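/- Let $\hbar,m_y>0$ and $g,E_0\in\mathbb{R}$. Let $\mathscr{H}=\mathscr{F}^+=\bigoplus_{n=0}^\infty S_+L^2(\mathbb{R}^3,\mathbb{C})^{\otimes n}$ be the bosonic Fock space, whose elements are the sequences $\psi=(\psi^{(n)})_{n\ge 0}$ of permutation-symmetric functions $\psi^{(n)}\in L^2((\mathbb{R}^3)^n,\mathbb{C})$ with $\sum_n\|\psi^{(n)}\|^2<\infty$. Write $y^n=(\boldsymbol y_1,\dots,\boldsymbol y_n)$ for a point of $(\mathbb{R}^3)^n$, $y^n\setminus\boldsymbol y_j$ for $y^n$ with $\boldsymbol y_j$ left out, $\mathbb{S}^2$ for the unit sphere of $\mathbb{R}^3$ and $\delta^3$ for the Dirac delta distribution on $\mathbb{R}^3$. There are a dense subspace $\mathscr{D}_{IBC}$ of $\mathscr{H}$ and a linear operator $H_{IBC}:\mathscr{D}_{IBC}\to\mathscr{H}$ with the following properties. (i) Every $\psi\in\mathscr{D}_{IBC}$ satisfies the interior--boundary condition: for suitable representatives of the $\psi^{(n)}$, for every $\boldsymbol\omega\in\mathbb{S}^2$, $n\in\{0,1,2,\dots\}$ and $y^n\in(\mathbb{R}^3\setminus\{\boldsymbol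 0\})^n$, $$\lim_{r\searrow 0}\Bigl(r\,\psi^{(n+1)}(y^n,r\boldsymbol\omega)\Bigr)=-\frac{g\,m_y}{2\pi\hbar^2\sqrt{n+1}}\,\psi^{(n)}(y^n).$$ (ii) On $\mathscr{D}_{IBC}$ the operator $H_{IBC}$ is well defined by $$(H_{IBC}\psi)^{(n)}(y^n)=-\frac{\hbar^2}{2m_y}\sum_{j=1}^n\nabla^2_{\boldsymbol y_j}\psi^{(n)}(y^n)+nE_0\,\psi^{(n)}(y^n)+\frac{g\sqrt{n+1}}{4\pi}\int_{\mathbb{S}^2}d^2\boldsymbol\omega\,\lim_{r\searrow 0}\frac{\partial}{\partial r}\Bigl(r\,\psi^{(n+1)}(y^n,r\boldsymbol\omega)\Bigr)+\frac{g}{\sqrt n}\sum_{j=1}^n\delta^3(\boldsymbol y_j)\,\psi^{(n-1)}(y^n\setminus\boldsymbol y_j)$$ (the last term being absent for $n=0$). That is, for every $\psi\in\mathscr{D}_{IBC}$, for suitable representatives as in (i), the limits in the third term exist for almost every $y^n$ and almost every $\boldsymbol\omega$ and their integrals over $\mathbb{S}^2$ exist and form a locally integrable function of $y^n$; the right-hand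 side is, in the sense of distributions on $(\mathbb{R}^3)^n$, a square-integrable function for every $n$; these functions form the element $H_{IBC}\psi$ of $\mathscr{H}$; and this element does not depend on the choice of the representatives. (iii) $H_{IBC}$ with domain $\mathscr{D}_{IBC}$ is self-adjoint. (iv) If $E_0>0$, then $H_{IBC}$ is positive, i.e. $\langle\psi,H_{IBC}\psi\rangle\ge 0$ for all $\psi\in\mathscr{D}_{IBC}$. -/

import Mathlib

noncomputable section

open MeasureTheory Filter Topology

namespace IBC

/-- Physical space `ℝ³` with its Euclidean norm. -/
abbrev Space : Type := EuclideanSpace ℝ (Fin 3)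

/-- Ordered configurations `yⁿ = (y₁, …, yₙ)` of `n` particles, with the `3n`-dimensional volume.
For `n = 0` this is one point of mass `1`. -/
abbrev Config (n : ℕ) : Type := Fin n → Space

theorem measurePreserving_perm {n : ℕ} (σ : Equiv.Perm (Fin n)) :
    MeasurePreserving (fun y : Config n => y ∘ σ) volume volume := by
  have h := volume_measurePreserving_piCongrLeft (fun _ : Fin n => Space) σ.symm
  convert h using 1
  funext y i
  rw [MeasurableEquiv.coe_piCongrLeft]
  have := Equiv.piCongrLeft_apply_apply (fun _ : Fin n => Space) σ.symm y (σ i)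
  simpa using this.symm

/-- The `n`-particle sector `S₊ L²(ℝ³)^{⊗ n}`: the permutation-symmetric functions in
`L²((ℝ³)ⁿ, ℂ)`. -/
def Sector (n : ℕ) : Submodule ℂ (Lp ℂ 2 (volume : Measure (Config n))) where
  carrier := {φ | ∀ σ : Equiv.Perm (Fin n),
    Lp.compMeasurePreserving (fun y : Config n => y ∘ σ) (measurePreserving_perm σ) φ = φ}
  add_mem' := by
    intro a b ha hb σ
    rw [map_add, ha σ, hb σ]
  zero_mem' := by
    intro σ
    rw [map_zero]
  smul_mem' := by
    intro c a ha σ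
    have h := (Lp.compMeasurePreservingₗ ℂ (fun y : Config n => y ∘ σ)
      (measurePreserving_perm σ)).map_smul c a
    exact h.trans (congrArg (c • ·) (ha σ))

instance (n : ℕ) : CompleteSpace (Sector n) := by
  have hc : IsClosed (Sector n : Set (Lp ℂ 2 (volume : Measure (Config n)))) := by
    have : (Sector n : Set (Lp ℂ 2 (volume : Measure (Config n)))) =
        ⋂ σ : Equiv.Perm (Fin n), {φ | Lp.compMeasurePreservingₗᵢ ℂ (fun y : Config n => y ∘ σ)
          (measurePreserving_perm σ) φ = φ} := by
      ext φ
      simp only [Set.mem_iInter]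
      rfl
    rw [this]
    exact isClosed_iInter fun σ => isClosed_eq (LinearIsometry.continuous _) continuous_id
  exact hc.completeSpace_coe

/-- The bosonic Fock space `⨁ₙ S₊ L²(ℝ³)^{⊗ n}` (Hilbert sum). -/
abbrev Fock : Type := lp (fun n : ℕ => Sector n) 2

/-- The sector `ψ⁽ⁿ⁾` of `ψ`, as an element of `L²((ℝ³)ⁿ, ℂ)`. -/
def sector (ψ : Fock) (n : ℕ) : Lp ℂ 2 (volume : Measure (Config n)) := (ψ n : Sector n)

/-- Functions on the disjoint union of the configuration spaces `(ℝ³)ⁿ`. -/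
abbrev WaveFunction : Type := ∀ n : ℕ, Config n → ℂ

/-- `u` is a particle-position representation of the Fock vector `ψ`: sector by sector, a
representative of the class `ψ⁽ⁿ⁾` of functions modulo null sets. -/
def Represents (u : WaveFunction) (ψ : Fock) : Prop :=
  ∀ n : ℕ, u n =ᵐ[volume] sector ψ n

/-- The configuration `(yⁿ, z)`, with the new particle in the last place. -/
abbrev addParticle {n : ℕ} (y : Config n) (z : Space) : Config (n + 1) :=
  Fin.snoc (α := fun _ => Space) y z

/-- The Dirichlet-type interior-boundary condition for a function on configuration space. -/
def DirichletIBC (ħ m g : ℝ) (u : WaveFunction) : Prop :=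
  ∀ ω ∈ Metric.sphere (0 : Space) 1, ∀ n : ℕ, ∀ y : Config n, (∀ j, y j ≠ 0) →
    Tendsto (fun r : ℝ => (r : ℂ) * u (n + 1) (addParticle y (r • ω))) (𝓝[>] 0)
      (𝓝 (-((g * m / (2 * Real.pi * ħ ^ 2 * √(n + 1 : ℝ)) : ℝ) : ℂ) * u n y))

/-- The function `r ↦ r u(yⁿ, rω)`. -/
def radial (u : WaveFunction) {n : ℕ} (y : Config n) (ω : Space) (r : ℝ) : ℂ :=
  (r : ℂ) * u (n + 1) (addParticle y (r • ω))

/-- `lim_{r ↘ 0} ∂/∂r (r u(yⁿ, rω))`; meaningful where `HasRadialLimit` holds. -/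
def radialLimit (u : WaveFunction) {n : ℕ} (y : Config n) (ω : Space) : ℂ :=
  limUnder (𝓝[>] (0 : ℝ)) (deriv (radial u y ω))

/-- `r ↦ r u(yⁿ, rω)` is differentiable for small `r > 0` and its derivative has a limit
as `r ↘ 0`. -/
def HasRadialLimit (u : WaveFunction) {n : ℕ} (y : Config n) (ω : Space) : Prop :=
  (∀ᶠ r in 𝓝[>] (0 : ℝ), DifferentiableAt ℝ (radial u y ω) r) ∧
    ∃ b : ℂ, Tendsto (deriv (radial u y ω)) (𝓝[>] 0) (𝓝 b)

/-- The surface integral `∫_{𝕊²} d²ω lim_{r ↘ 0} ∂/∂r (r u(yⁿ, rω))`. -/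
def sphereTerm (u : WaveFunction) {n : ℕ} (y : Config n) : ℂ :=
  ∫ ω : Metric.sphere (0 : Space) 1, radialLimit u y ω ∂(volume : Measure Space).toSphere

/-- The surface integrals make sense for almost all configurations, and they define a locally
integrable function on each `(ℝ³)ⁿ`. -/
structure BoundaryRegular (u : WaveFunction) : Prop where
  hasLimit : ∀ n : ℕ, ∀ᵐ y : Config n,
    ∀ᵐ ω : Metric.sphere (0 : Space) 1 ∂(volume : Measure Space).toSphere,
      HasRadialLimit u y (ω : Space)
  integrable : ∀ n : ℕ, ∀ᵐ y : Config n,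
    Integrable (fun ω : Metric.sphere (0 : Space) 1 => radialLimit u y (ω : Space))
      (volume : Measure Space).toSphere
  locallyIntegrable : ∀ n : ℕ, LocallyIntegrable (fun y : Config n => sphereTerm u y) volume

/-- The Laplacian `∇²_{y_j} η` with respect to the position of the `j`-th particle. -/
def particleLaplacian {n : ℕ} (j : Fin n) (η : Config n → ℂ) (y : Config n) : ℂ :=
  Laplacian.laplacian (fun z : Space => η (Function.update y j z)) (y j)

/-- The distribution `(g / √n) ∑_j δ³(y_j) u⁽ⁿ⁻¹⁾(yⁿ ∖ y_j)` on `(ℝ³)ⁿ`, applied to the test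
function `η`. It is zero for `n = 0`. -/
def deltaTerm (g : ℝ) (u : WaveFunction) : (n : ℕ) → (Config n → ℂ) → ℂ
  | 0, _ => 0
  | n + 1, η => ((g / √(n + 1 : ℝ) : ℝ) : ℂ) * ∑ j : Fin (n + 1),
      ∫ y : Config n, u n y * η (Fin.insertNth (α := fun _ => Space) j 0 y)

/-- The `n`-particle sector of the formal expression for the Hamiltonian on `u`,
`-ħ²/(2m) ∑_j ∇²_{y_j} u⁽ⁿ⁾ + n E₀ u⁽ⁿ⁾ + g √(n+1) / (4π) ∫_{𝕊²} d²ω lim ∂_r (r u⁽ⁿ⁺¹⁾(yⁿ, rω))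
+ (g / √n) ∑_j δ³(y_j) u⁽ⁿ⁻¹⁾(yⁿ ∖ y_j)`, as a distribution on `(ℝ³)ⁿ` applied to the test
function `η`. -/
def hamiltonianDistribution (ħ m g E₀ : ℝ) (u : WaveFunction) (n : ℕ) (η : Config n → ℂ) : ℂ :=
  -((ħ ^ 2 / (2 * m) : ℝ) : ℂ) * (∑ j : Fin n, ∫ y : Config n, u n y * particleLaplacian j η y)
    + ((n * E₀ : ℝ) : ℂ) * (∫ y : Config n, u n y * η y)
    + ((g * √(n + 1 : ℝ) / (4 * Real.pi) : ℝ) : ℂ) * (∫ y : Config n, sphereTerm u y * η y)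
    + deltaTerm g u n η

/-- The vector `ψ` satisfies the interior-boundary condition. -/
def SatisfiesIBC (ħ m g : ℝ) (ψ : Fock) : Prop :=
  ∃ u : WaveFunction, Represents u ψ ∧ DirichletIBC ħ m g u

/-- `ψ` satisfies the interior-boundary condition, all terms of the Hamiltonian make sense on it,
and their sum is, in every sector, the square-integrable function `Φ⁽ⁿ⁾`. -/
def IsHamiltonianValue (ħ m g E₀ : ℝ) (ψ Φ : Fock) : Prop :=
  ∃ u : WaveFunction, Represents u ψ ∧ DirichletIBC ħ m g u ∧ BoundaryRegular u ∧
    ∀ (n : ℕ) (η : Config n → ℂ), ContDiff ℝ (⊤ : ℕ∞) η → HasCompactSupport η →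
      ∫ y : Config n, sector Φ n y * η y = hamiltonianDistribution ħ m g E₀ u n η

end IBC

end

/-! Put c = ħ²/(2m) and work in momentum space with the one-particle energy h(p) = c(2π)²|p|² + l
for some l > 0. In three dimensions 1/h is square-integrable, so f = -g/h is the wave function of a
normalizable particle. Completing the square in the formal expression dΓ(h) + g(a(1) + a*(1)) turns
it into dΓ(h) minus an infinite constant. The Weyl operator W = e^{-γ²/2} e^{a*(f)} e^{-a(f)}, γ =
‖f‖, performs this shift. It is unitary although the formal expression makes no sense, and the
interior-boundary condition is exactly the renormalization that replaces the infinite constant by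
the finite one e = g²√(l/c)/(4πc).

The Hamiltonian is therefore defined as the conjugate, under W followed by the Fourier transform, of
a van Hove operator dΓ(h) + μ(N + a + a* + γ²) + e with l + μ = E₀. If E₀ > 0, the choice l = E₀, μ
= 0 leaves dΓ(h) + e, which is visibly nonnegative (`vanHove_nonneg`). If E₀ ≤ 0, a nonzero μ is
needed to keep l positive. The van Hove operator is given its maximal domain. It is symmetric
because the boundary term between neighbouring levels cannot stay away from 0 (`vanHove_symmetric`),
and it contains its adjoint because single-level vectors are enough test vectors
(`vanHove_adjoint_le`).

What remains is to recognize the conjugated operator. With Λ = 1 + dΓ(h), R = Λ⁻¹ and B the trace of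
R at coinciding positions, partial fractions give aR = R(a + gB) and aB = B(a + gB)
(`IsDispersion.ann_resolvent`, `IsDispersion.ann_traceOp`). Hence e^{-a} maps the range of R into
the range of R on sequences (`exists_isExp_vanHove`), and a domain vector is e^{a*} applied to some
Rθ. Pushing e^{a*} through dΓ(h) produces g a*(1), the sum of delta functions, because h f = -g
(`createExp_hamiltonian`).

Annihilating the last particle of e^{a*}Rθ splits it as f(p)/√(n+1) times the lower sector plus a
remainder F/h with F square-integrable (`IsDispersion.exists_remainder`). In position space 1/h is
the Yukawa kernel e^{-κ|x|}/(4πc|x|), κ = √(l/c). The singular part then gives the boundary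
condition and the constant e, and the remainder is an H² function of the last position, whose value
at the origin is the rest of the surface integral. For almost every direction the radial derivative
of such a function behaves as needed, although its gradient need not be bounded
(`ae_hasDerivAt_potential`). The pieces are assembled in
`IsSingularSplitting.integral_eq_hamiltonianDistribution`, and independence of the representative is
`IsHamiltonianValue.unique`. -/

noncomputable section

open MeasureTheory Filter Topology

namespace IBC

set_option linter.unusedSectionVars false

/-! ### Exponential series of operators on a topological vector space without a norm. -/

section Exponential

variable {V : Type*} [AddCommGroup V] [Module ℂ V] [TopologicalSpace V]

/-- `φ = e^T χ`, as a convergent series. -/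
def IsExp (T : V →L[ℂ] V) (χ φ : V) : Prop :=
  HasSum (fun j : ℕ => ((j.factorial : ℂ)⁻¹) • (T ^ j) χ) φ

variable [IsTopologicalAddGroup V] [ContinuousConstSMul ℂ V] {T S Q T' : V →L[ℂ] V} {χ φ χ' φ' : V}

theorem IsExp.intertwine (h : T * S = S * T') (hφ : IsExp T' χ φ) : IsExp T (S χ) (S φ) := by
  have hp : ∀ j : ℕ, T ^ j * S = S * T' ^ j := fun j =>
    (SemiconjBy.pow_right (show SemiconjBy S T' T from h.symm) j).symm
  have := ContinuousLinearMap.hasSum S hφ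
  refine this.congr_fun ?_
  intro j
  have := congrArg (fun U : V →L[ℂ] V => U χ) (hp j)
  simp only [mul_apply_eq_comp] at this
  simp [this]

/-- The commutator Q of T and S commutes with T, so the series for e^T S e^{-T} stops after S + Q.
On powers this reads T^{j+1} S = S T^{j+1} + (j+1) Q T^j. -/
theorem IsExp.conj (h : T * S = S * T + Q) (hQ : T * Q = Q * T) (hφ : IsExp T χ φ) :
    IsExp T (S χ) (S φ + Q φ) := by
  have hp : ∀ j : ℕ, T ^ (j + 1) * S = S * T ^ (j + 1) + ((j + 1 : ℕ) : ℂ) • (Q * T ^ j) := by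
    intro j
    induction j with
    | zero => simp [h]
    | succ j ih =>
      rw [pow_succ' T (j + 1), mul_assoc, ih, mul_add, ← mul_assoc, h, mul_smul_comm, ← mul_assoc T Q,
        hQ, mul_assoc Q T, ← pow_succ', add_mul, mul_assoc, ← pow_succ', add_assoc]
      congr 1
      push_cast
      module
  have h1 := ContinuousLinearMap.hasSum S hφ
  have h2 := ContinuousLinearMap.hasSum Q hφ
  have h3 : HasSum (fun j : ℕ => ((j.factorial : ℂ)⁻¹) • ((T ^ j) (S χ) - S ((T ^ j) χ))) (Q φ) := by
    -- The term j = 0 vanishes; after the shift (j+1)/(j+1)! becomes 1/j!.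
    rw [← hasSum_nat_add_iff' 1]
    simp only [Finset.range_one, Finset.sum_singleton, pow_zero, one_apply_eq_self,
      sub_self, smul_zero, sub_zero]
    refine h2.congr_fun ?_
    intro j
    have := congrArg (fun U : V →L[ℂ] V => U χ) (hp j)
    simp only [mul_apply_eq_comp, add_apply,
      smul_apply] at this
    rw [this, add_sub_cancel_left, smul_smul, Nat.factorial_succ, map_smul]
    congr 1
    have : ((j + 1 : ℕ) : ℂ) ≠ 0 := Nat.cast_ne_zero.mpr (Nat.succ_ne_zero j)
    have : (j.factorial : ℂ) ≠ 0 := Nat.cast_ne_zero.mpr (Nat.factorial_ne_zero j)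
    push_cast at *
    field_simp
  refine (h1.add h3).congr_fun ?_
  intro j
  simp only [map_smul, smul_sub]
  abel

theorem IsExp.add (h : IsExp T χ φ) (h' : IsExp T χ' φ') : IsExp T (χ + χ') (φ + φ') := by
  simpa [IsExp] using HasSum.add h h'

theorem IsExp.smul (c : ℂ) (h : IsExp T χ φ) : IsExp T (c • χ) (c • φ) := by
  simpa [IsExp, smul_comm c] using HasSum.const_smul c h

theorem IsExp.unique [T2Space V] (h : IsExp T χ φ) (h' : IsExp T χ φ') : φ = φ' :=
  HasSum.unique h h'

theorem isExp_of_pow_eq_zero {M : ℕ} (h : (T ^ M) χ = 0) :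
    IsExp T χ (∑ j ∈ Finset.range M, ((j.factorial : ℂ)⁻¹) • (T ^ j) χ) := by
  refine hasSum_sum_of_ne_finset_zero fun j hj => ?_
  have hj : M ≤ j := by simpa using hj
  obtain ⟨i, rfl⟩ := Nat.exists_eq_add_of_le' hj
  rw [pow_add, mul_apply_eq_comp, h]
  simp

theorem sum_antidiagonal_inv_factorial_neg_one_pow (l : ℕ) :
    ∑ p ∈ Finset.HasAntidiagonal.antidiagonal l, ((p.1.factorial : ℂ)⁻¹ * (-1) ^ p.1 * (p.2.factorial : ℂ)⁻¹)
      = if l = 0 then 1 else 0 := by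
  have h := congrArg (PowerSeries.coeff l) (PowerSeries.exp_mul_exp_neg_eq_one (A := ℂ))
  rw [mul_comm, PowerSeries.coeff_mul, PowerSeries.coeff_one] at h
  rw [← h]
  refine Finset.sum_congr rfl fun p _ => ?_
  simp [PowerSeries.evalNegHom, PowerSeries.coeff_rescale, PowerSeries.coeff_exp, mul_comm]

theorem hasSum_antidiagonal [T2Space V] {f : ℕ × ℕ → V} (hf : Summable f) :
    HasSum (fun l => ∑ p ∈ Finset.HasAntidiagonal.antidiagonal l, f p) (∑' p, f p) := by
  have h := (Finset.HasAntidiagonal.sigmaAntidiagonalEquivProd (A := ℕ)).hasSum_iff.mpr hf.hasSum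
  refine (h.sigma fun l => hasSum_fintype _).congr_fun fun l => ?_
  exact (Finset.sum_coe_sort (Finset.HasAntidiagonal.antidiagonal l) f).symm

theorem neg_pow_apply (i : ℕ) (φ : V) : ((-T) ^ i) φ = (-1 : ℂ) ^ i • (T ^ i) φ := by
  induction i with
  | zero => simp
  | succ i ih =>
    rw [pow_succ' (-T), pow_succ' T, pow_succ', mul_apply_eq_comp, mul_apply_eq_comp, ih,
      neg_apply, map_smul, mul_smul, neg_one_smul]

/-- This is e^{-T} e^T = 1. Without a norm the Cauchy product cannot be justified by absolute
convergence; nilpotency on χ makes the double series finite. -/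
theorem IsExp.of_neg_of_pow_eq_zero [T2Space V] {M : ℕ} (h : (T ^ M) χ = 0) (hφ : IsExp T χ φ) :
    IsExp (-T) φ χ := by
  set f : ℕ × ℕ → V := fun p =>
    ((p.1.factorial : ℂ)⁻¹ * (-1) ^ p.1 * (p.2.factorial : ℂ)⁻¹) • (T ^ (p.1 + p.2)) χ with hf
  have hz : ∀ l, M ≤ l → (T ^ l) χ = 0 := by
    intro l hl
    obtain ⟨i, rfl⟩ := Nat.exists_eq_add_of_le' hl
    rw [pow_add, mul_apply_eq_comp, h, map_zero]
  have hs : Summable f := by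
    refine summable_of_ne_finset_zero (s := Finset.range M ×ˢ Finset.range M) ?_
    rintro ⟨i, j⟩ hij
    have : M ≤ i + j := by
      by_contra hlt
      exact hij (by simp; omega)
    simp only [hf, hz _ this, smul_zero]
  have hrow : ∀ i, HasSum (fun j => f (i, j)) (((i.factorial : ℂ)⁻¹) • ((-T) ^ i) φ) := by
    intro i
    have := (ContinuousLinearMap.hasSum (T ^ i) hφ).const_smul ((i.factorial : ℂ)⁻¹ * (-1) ^ i)
    convert this using 1
    · funext j
      simp only [hf, map_smul, smul_smul]
      rw [pow_add, mul_apply_eq_comp]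
    · rw [mul_smul]
      congr 1
      exact neg_pow_apply i φ
  have h1 := hs.hasSum.prod_fiberwise hrow
  have h2 : HasSum f χ := by
    have h3 := hasSum_antidiagonal hs
    have h4 : HasSum (fun l => ∑ p ∈ Finset.HasAntidiagonal.antidiagonal l, f p) χ := by
      have : ∀ l, ∑ p ∈ Finset.HasAntidiagonal.antidiagonal l, f p = if l = 0 then χ else 0 := by
        intro l
        have : ∀ p ∈ Finset.HasAntidiagonal.antidiagonal l, f p =
            ((p.1.factorial : ℂ)⁻¹ * (-1) ^ p.1 * (p.2.factorial : ℂ)⁻¹) • (T ^ l) χ := by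
          intro p hp
          simp only [hf, Finset.HasAntidiagonal.mem_antidiagonal.mp hp]
        rw [Finset.sum_congr rfl this, ← Finset.sum_smul,
          sum_antidiagonal_inv_factorial_neg_one_pow]
        split_ifs with h <;> simp [h]
      simp_rw [this]
      exact hasSum_ite_eq 0 χ
    rw [← h3.unique h4]
    exact hs.hasSum
  rwa [hs.hasSum.unique h2] at h1

/-- Adding a scalar to the exponent multiplies the exponential by a scalar, here for a vector on
which the operator is nilpotent. -/
theorem IsExp.add_scalar_of_pow_eq_zero [T2Space V] [ContinuousSMul ℂ V] {M : ℕ}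
    (h : (T ^ M) χ = 0) (hφ : IsExp T χ φ) (c : ℂ) :
    IsExp (T + c • (1 : V →L[ℂ] V)) χ (Complex.exp c • φ) := by
  set f : ℕ × ℕ → V := fun p =>
    (c ^ p.1 / (p.1.factorial : ℂ)) • ((p.2.factorial : ℂ)⁻¹ • (T ^ p.2) χ) with hf
  have hz : ∀ l, M ≤ l → (T ^ l) χ = 0 := by
    intro l hl
    obtain ⟨i, rfl⟩ := Nat.exists_eq_add_of_le' hl
    rw [pow_add, mul_apply_eq_comp, h, map_zero]
  have hexp : HasSum (fun j : ℕ => c ^ j / (j.factorial : ℂ)) (Complex.exp c) := by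
    rw [Complex.exp_eq_exp_ℂ]
    exact NormedSpace.expSeries_div_hasSum_exp c
  have hs : HasSum f (Complex.exp c • φ) := by
    -- Each column is the scalar exponential series times a fixed vector, and only the columns j < M
    -- are nonzero, so the double series sums without absolute convergence.
    have hcol : ∀ j, HasSum (fun p : ℕ × ℕ => if p.2 = j then f p else 0)
        (Complex.exp c • ((j.factorial : ℂ)⁻¹ • (T ^ j) χ)) := by
      intro j
      have h1 := hexp.smul_const ((j.factorial : ℂ)⁻¹ • (T ^ j) χ)
      have hinj : Function.Injective (fun i : ℕ => (i, j)) := fun a b h => by simpa using h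
      rw [← hinj.hasSum_iff]
      · exact h1.congr_fun fun i => by simp [hf]
      · rintro ⟨a, b⟩ hab
        have : b ≠ j := fun hb => hab ⟨a, by simp [hb]⟩
        simp [this]
    have h2 := hasSum_sum (s := Finset.range M) fun j _ => hcol j
    rw [← Finset.smul_sum, (isExp_of_pow_eq_zero h).unique hφ] at h2
    refine h2.congr_fun ?_
    rintro ⟨i, j⟩
    by_cases hj : j < M
    · simp [hj]
    · simp only [hf, hz j (not_lt.mp hj), smul_zero, ite_self, Finset.sum_const_zero]
  have h3 := hasSum_antidiagonal hs.summable
  rw [hs.tsum_eq] at h3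
  refine h3.congr_fun fun l => ?_
  have hc : Commute (c • (1 : V →L[ℂ] V)) T := (Commute.one_left T).smul_left c
  rw [add_comm T, hc.add_pow', sum_apply, Finset.smul_sum]
  refine Finset.sum_congr rfl fun p hp => ?_
  have hl := Finset.HasAntidiagonal.mem_antidiagonal.mp hp
  simp only [hf, smul_pow, one_pow, smul_mul_assoc, one_mul, smul_apply,
    smul_smul]
  rw [← Nat.cast_smul_eq_nsmul ℂ, smul_smul, smul_smul]
  congr 1
  subst hl
  have := Nat.add_choose_mul_factorial_mul_factorial p.1 p.2
  rw [← Nat.choose_symm_add] at this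
  have h' : (((p.1 + p.2).choose p.1 : ℕ) : ℂ) * p.1.factorial * p.2.factorial
    = (p.1 + p.2).factorial := by exact_mod_cast this
  have e1 : (p.1.factorial : ℂ) ≠ 0 := Nat.cast_ne_zero.mpr (Nat.factorial_ne_zero _)
  have e2 : (p.2.factorial : ℂ) ≠ 0 := Nat.cast_ne_zero.mpr (Nat.factorial_ne_zero _)
  have e3 : ((p.1 + p.2).factorial : ℂ) ≠ 0 := Nat.cast_ne_zero.mpr (Nat.factorial_ne_zero _)
  field_simp
  rw [← h']
  ring

end Exponential

/-! ### Ladder operators on all sequences of levels, continuous in the product topology, and their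
commutation relations. -/

section Graded

variable {E : ℕ → Type*} [∀ n, NormedAddCommGroup (E n)] [∀ n, InnerProductSpace ℂ (E n)]

/-- The operator on sequences that moves the components down by one level. -/
def lowering (A : ∀ n, E (n + 1) →L[ℂ] E n) : (∀ n, E n) →L[ℂ] (∀ n, E n) :=
  ContinuousLinearMap.pi fun n => A n ∘L ContinuousLinearMap.proj (n + 1)

/-- The operator on sequences that moves the components up by one level. -/
def raising (C : ∀ n, E n →L[ℂ] E (n + 1)) : (∀ n, E n) →L[ℂ] (∀ n, E n) :=
  ContinuousLinearMap.pi fun n => match n with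
    | 0 => 0
    | n + 1 => C n ∘L ContinuousLinearMap.proj n

/-- The operator on sequences that acts in every level separately. -/
def diagonal (R : ∀ n, E n →L[ℂ] E n) : (∀ n, E n) →L[ℂ] (∀ n, E n) :=
  ContinuousLinearMap.pi fun n => R n ∘L ContinuousLinearMap.proj n

variable (A : ∀ n, E (n + 1) →L[ℂ] E n) (C : ∀ n, E n →L[ℂ] E (n + 1)) (R : ∀ n, E n →L[ℂ] E n)

@[simp] theorem lowering_apply (χ : ∀ n, E n) (n : ℕ) : lowering A χ n = A n (χ (n + 1)) := rfl

@[simp] theorem raising_apply_zero (χ : ∀ n, E n) : raising C χ 0 = 0 := rfl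

@[simp] theorem raising_apply_succ (χ : ∀ n, E n) (n : ℕ) :
    raising C χ (n + 1) = C n (χ n) := rfl

@[simp] theorem diagonal_apply (χ : ∀ n, E n) (n : ℕ) : diagonal R χ n = R n (χ n) := rfl

theorem raising_pow_apply_eq_zero {χ : ∀ n, E n} {p : ℕ} (h : ∀ m, m < p → χ m = 0) (j : ℕ) :
    ∀ n, n < p + j → (raising C ^ j) χ n = 0 := by
  induction j with
  | zero => simpa using h
  | succ j ih =>
    intro n hn
    rw [pow_succ', mul_apply_eq_comp]
    cases n with
    | zero => rfl
    | succ n => rw [raising_apply_succ, ih n (by omega), map_zero]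

theorem raising_pow_apply_eq_zero_of_gt {χ : ∀ n, E n} {p : ℕ} (h : ∀ m, p < m → χ m = 0) (j : ℕ) :
    ∀ n, p + j < n → (raising C ^ j) χ n = 0 := by
  induction j with
  | zero => simpa using h
  | succ j ih =>
    intro n hn
    rw [pow_succ', mul_apply_eq_comp]
    cases n with
    | zero => rfl
    | succ n => rw [raising_apply_succ, ih n (by omega), map_zero]

theorem lowering_pow_apply_eq_zero {χ : ∀ n, E n} {M : ℕ} (h : ∀ m, M ≤ m → χ m = 0) (j : ℕ) :
    ∀ n, M ≤ n + j → (lowering A ^ j) χ n = 0 := by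
  induction j with
  | zero => simpa using h
  | succ j ih =>
    intro n hn
    rw [pow_succ', mul_apply_eq_comp, lowering_apply, ih (n + 1) (by omega), map_zero]

/-- The exponential of a raising operator, a finite sum in every level. -/
def raisingExp : (∀ n, E n) →L[ℂ] (∀ n, E n) :=
  ContinuousLinearMap.pi fun n => ∑ j ∈ Finset.range (n + 1),
    ((j.factorial : ℂ)⁻¹) • (ContinuousLinearMap.proj n ∘L raising C ^ j)

theorem raisingExp_apply (χ : ∀ n, E n) (n : ℕ) : raisingExp C χ n =
    ∑ j ∈ Finset.range (n + 1), ((j.factorial : ℂ)⁻¹) • (raising C ^ j) χ n := by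
  simp only [raisingExp, ContinuousLinearMap.coe_pi', sum_apply]
  rfl

/-- On level n the powers above n contribute nothing, since j raisings leave the levels below j
empty. -/
theorem isExp_raisingExp (χ : ∀ n, E n) : IsExp (raising C) χ (raisingExp C χ) := by
  refine Pi.hasSum.mpr fun n => ?_
  rw [raisingExp_apply]
  refine hasSum_sum_of_ne_finset_zero fun j hj => ?_
  rw [Pi.smul_apply, raising_pow_apply_eq_zero C (p := 0) (by simp) j n (by simpa using hj),
    smul_zero]

theorem raisingExp_apply_eq_zero {χ : ∀ n, E n} {p : ℕ} (h : ∀ m, m < p → χ m = 0) :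
    ∀ n, n < p → raisingExp C χ n = 0 := by
  intro n hn
  rw [raisingExp_apply]
  exact Finset.sum_eq_zero fun j _ => by
    rw [raising_pow_apply_eq_zero C h j n (by omega), smul_zero]

theorem raisingExp_single_apply (p : ℕ) (x : E p) (k : ℕ) :
    raisingExp C (Pi.single p x) (p + k) =
      ((k.factorial : ℂ)⁻¹) • (raising C ^ k) (Pi.single p x) (p + k) := by
  rw [raisingExp_apply]
  refine Finset.sum_eq_single_of_mem k (by simp) fun j _ hjk => ?_
  rcases lt_or_gt_of_ne hjk with h | h
  · rw [raising_pow_apply_eq_zero_of_gt C (p := p) _ j (p + k) (by omega), smul_zero]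
    intro m hm
    exact Pi.single_eq_of_ne (by omega) x
  · rw [raising_pow_apply_eq_zero C (p := p) _ j (p + k) (by omega), smul_zero]
    intro m hm
    exact Pi.single_eq_of_ne (by omega) x

theorem eq_sum_single {χ : ∀ n, E n} {M : ℕ} (h : ∀ m, M ≤ m → χ m = 0) :
    χ = ∑ m ∈ Finset.range M, Pi.single m (χ m) := by
  funext n
  rw [Finset.sum_apply]
  by_cases hn : n < M
  · rw [Finset.sum_eq_single_of_mem n (by simpa using hn), Pi.single_eq_same]
    intro m _ hm
    exact Pi.single_eq_of_ne hm.symm _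
  · rw [h n (not_lt.mp hn)]
    refine (Finset.sum_eq_zero fun m hm => Pi.single_eq_of_ne ?_ _).symm
    have := Finset.mem_range.mp hm
    omega

variable [∀ n, CompleteSpace (E n)]

/-- The levelwise adjoint of a family of lowering maps. -/
abbrev adj (A : ∀ n, E (n + 1) →L[ℂ] E n) (n : ℕ) : E n →L[ℂ] E (n + 1) :=
  ContinuousLinearMap.adjoint (A n)

theorem inner_raising_pow_single (ζ : ∀ n, E n) (p : ℕ) (x : E p) (k : ℕ) :
    inner ℂ (ζ (p + k)) ((raising (adj A) ^ k) (Pi.single p x) (p + k)) =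
      inner ℂ ((lowering A ^ k) ζ p) x := by
  induction k generalizing ζ with
  | zero => simp
  | succ k ih =>
    have h1 : (raising (adj A) ^ (k + 1)) (Pi.single p x) (p + (k + 1)) =
        adj A (p + k) ((raising (adj A) ^ k) (Pi.single p x) (p + k)) := by
      rw [pow_succ', mul_apply_eq_comp]
      rfl
    rw [h1, ContinuousLinearMap.adjoint_inner_right, pow_succ, mul_apply_eq_comp, ← ih]
    rfl

/-- The exponential of the raising operator is adjoint to that of the lowering operator. -/
theorem hasSum_inner_raisingExp_single {ζ ζ' : ∀ n, E n} (h : IsExp (lowering A) ζ ζ') (p : ℕ)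
    (x : E p) :
    HasSum (fun n => inner ℂ (ζ n) (raisingExp (adj A) (Pi.single p x) n)) (inner ℂ (ζ' p) x) := by
  have hinj : Function.Injective (fun k : ℕ => p + k) := add_right_injective p
  rw [← hinj.hasSum_iff]
  · have h1 := Pi.hasSum.mp h p
    have h2 := ContinuousLinearMap.hasSum (innerSLFlip ℂ x) h1
    refine h2.congr_fun fun k => ?_
    simp only [Function.comp_apply, Pi.smul_apply, innerSLFlip_apply_apply]
    rw [raisingExp_single_apply, inner_smul_right, inner_raising_pow_single, inner_smul_left]
    simp
  · intro n hn
    rw [raisingExp_apply_eq_zero _ (p := p), inner_zero_right]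
    · intro m hm
      exact Pi.single_eq_of_ne (by omega) x
    · by_contra hlt
      exact hn ⟨n - p, by simp; omega⟩

theorem hasSum_inner_raisingExp {ζ ζ' ξ : ∀ n, E n} (h : IsExp (lowering A) ζ ζ') {M : ℕ}
    (hξ : ∀ m, M ≤ m → ξ m = 0) :
    HasSum (fun n => inner ℂ (ζ n) (raisingExp (adj A) ξ n))
      (∑ m ∈ Finset.range M, inner ℂ (ζ' m) (ξ m)) := by
  have h1 := hasSum_sum (s := Finset.range M) fun m _ =>
    hasSum_inner_raisingExp_single A h m (ξ m)
  refine h1.congr_fun fun n => ?_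
  conv_lhs => rw [eq_sum_single hξ]
  rw [map_sum, Finset.sum_apply, inner_sum]

theorem inner_self_ofReal {F : Type*} [NormedAddCommGroup F] [InnerProductSpace ℂ F] (x : F) :
    inner ℂ x x = ((‖x‖ ^ 2 : ℝ) : ℂ) := by
  rw [inner_self_eq_norm_sq_to_K]
  push_cast
  rfl

theorem adj_neg (n : ℕ) : adj (fun n => -A n) n = -adj A n := map_neg _ _

theorem lowering_neg : lowering (fun n => -A n) = -lowering A := rfl

theorem raising_neg : raising (fun n => -C n) = -raising C := by
  ext χ n
  cases n <;> simp

/-- Canonical commutation relations for one mode, with commutator `γ ^ 2`. -/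
structure IsCCR (γ : ℝ) : Prop where
  nonneg : 0 ≤ γ
  comm : lowering A * raising (adj A) =
    raising (adj A) * lowering A + ((γ ^ 2 : ℝ) : ℂ) • (1 : (∀ n, E n) →L[ℂ] (∀ n, E n))

variable {A} {γ : ℝ}

theorem IsCCR.apply (h : IsCCR A γ) (χ : ∀ n, E n) :
    lowering A (raising (adj A) χ) = raising (adj A) (lowering A χ) + ((γ ^ 2 : ℝ) : ℂ) • χ := by
  simpa using congrArg (fun U : (∀ n, E n) →L[ℂ] (∀ n, E n) => U χ) h.comm

theorem IsCCR.neg (h : IsCCR A γ) : IsCCR (fun n => -A n) γ := by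
  refine ⟨h.nonneg, ?_⟩
  have : adj (fun n => -A n) = fun n => -adj A n := funext (adj_neg A)
  rw [this, raising_neg, lowering_neg]
  ext1 χ
  have := h.apply χ
  simp only [mul_apply_eq_comp, neg_apply, map_neg, neg_neg, this, add_apply, smul_apply,
    one_apply_eq_self]

/-- The commutation relation gives ‖a* x‖² = ‖a x‖² + γ²‖x‖². The first summand is controlled one
level lower, so the bound accumulates γ² per level. -/
theorem IsCCR.norm_adj_apply_sq (h : IsCCR A γ) (n : ℕ) (x : E n) :
    ‖adj A n x‖ ^ 2 ≤ (n + 1) * γ ^ 2 * ‖x‖ ^ 2 := by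
  induction n with
  | zero =>
    have h1 := congrFun (h.apply (Pi.single 0 x)) 0
    simp only [lowering_apply, raising_apply_succ, Pi.single_eq_same, Pi.add_apply,
      raising_apply_zero, zero_add, Pi.smul_apply] at h1
    have h2 : inner ℂ (adj A 0 x) (adj A 0 x) = inner ℂ x (((γ ^ 2 : ℝ) : ℂ) • x) := by
      rw [← h1, ContinuousLinearMap.adjoint_inner_left]
    rw [inner_smul_right, inner_self_ofReal, inner_self_ofReal] at h2
    have h3 : ‖adj A 0 x‖ ^ 2 = γ ^ 2 * ‖x‖ ^ 2 := by
      exact_mod_cast h2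
    simp [h3]
  | succ n ih =>
    have h1 := congrFun (h.apply (Pi.single (n + 1) x)) (n + 1)
    simp only [lowering_apply, raising_apply_succ, Pi.single_eq_same, Pi.add_apply,
      Pi.smul_apply] at h1
    have h2 : inner ℂ (adj A (n + 1) x) (adj A (n + 1) x) =
        inner ℂ (A n x) (A n x) + inner ℂ x (((γ ^ 2 : ℝ) : ℂ) • x) := by
      rw [ContinuousLinearMap.adjoint_inner_left, h1, inner_add_right,
        ContinuousLinearMap.adjoint_inner_right]
    rw [inner_smul_right, inner_self_ofReal, inner_self_ofReal, inner_self_ofReal] at h2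
    have h3 : ‖adj A (n + 1) x‖ ^ 2 = ‖A n x‖ ^ 2 + γ ^ 2 * ‖x‖ ^ 2 := by
      exact_mod_cast h2
    have h4 : ‖adj A n‖ ≤ √(n + 1) * γ := by
      -- The induction hypothesis bounds the adjoint; an operator and its adjoint have the same
      -- norm, which gives the bound on `A n` itself.
      refine ContinuousLinearMap.opNorm_le_bound _ (by have := h.nonneg; positivity) fun y => ?_
      have := Real.le_sqrt_of_sq_le (ih y)
      rwa [Real.sqrt_mul (by positivity), Real.sqrt_mul (by positivity),
        Real.sqrt_sq h.nonneg, Real.sqrt_sq (norm_nonneg _)] at this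
    rw [LinearIsometryEquiv.norm_map] at h4
    have h5 : ‖A n x‖ ^ 2 ≤ (n + 1) * γ ^ 2 * ‖x‖ ^ 2 := by
      have := pow_le_pow_left₀ (norm_nonneg _) ((A n).le_of_opNorm_le h4 x) 2
      rwa [mul_pow, mul_pow, Real.sq_sqrt (by positivity)] at this
    rw [h3]
    push_cast
    nlinarith

theorem IsCCR.norm_le (h : IsCCR A γ) (n : ℕ) : ‖A n‖ ≤ γ * √(n + 1) := by
  rw [← LinearIsometryEquiv.norm_map ContinuousLinearMap.adjoint (A n)]
  refine ContinuousLinearMap.opNorm_le_bound _ (by have := h.nonneg; positivity) fun y => ?_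
  have := Real.le_sqrt_of_sq_le (h.norm_adj_apply_sq n y)
  rw [Real.sqrt_mul (by positivity), Real.sqrt_mul (by positivity),
    Real.sqrt_sq h.nonneg, Real.sqrt_sq (norm_nonneg _)] at this
  linarith [mul_comm γ √((n : ℝ) + 1)]

theorem norm_lowering_pow_apply_le (hA : ∀ n : ℕ, ‖A n‖ ≤ γ * √(n + 1)) (hγ : 0 ≤ γ)
    {χ : ∀ n, E n} {c ρ : ℝ} (hχ : ∀ n, ‖χ n‖ ≤ c * ρ ^ n) (j n : ℕ) :
    ‖(lowering A ^ j) χ n‖ ≤ c * γ ^ j * ρ ^ (n + j) * √((n + 1).ascFactorial j) := by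
  induction j generalizing n with
  | zero => simpa using hχ n
  | succ j ih =>
    rw [pow_succ', mul_apply_eq_comp, lowering_apply]
    refine ((A n).le_of_opNorm_le (hA n) _).trans ?_
    have h1 := mul_le_mul_of_nonneg_left (ih (n + 1))
      (by positivity : 0 ≤ γ * √((n : ℝ) + 1))
    refine h1.trans (le_of_eq ?_)
    have h2 : ((n + 1).ascFactorial (j + 1) : ℝ) = (n + 1) * ((n + 1 + 1).ascFactorial j : ℕ) := by
      have h3 : (n + 1).ascFactorial (j + 1) = (n + 1) * (n + 1 + 1).ascFactorial j := by
        rw [Nat.ascFactorial_succ, ← Nat.succ_ascFactorial]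
      rw [h3]
      push_cast
      ring
    rw [h2, Real.sqrt_mul (by positivity), show n + 1 + j = n + (j + 1) by ring]
    ring

/-- The rising factorial is j! times a binomial coefficient, which is at most 2^{n+j}. So j
lowerings cost only √(j!) up to geometric factors, and dividing by j! leaves a summable 1/√(j!). -/
theorem sqrt_ascFactorial_div_factorial_le (n j : ℕ) :
    √((n + 1).ascFactorial j) / j.factorial ≤ 2 ^ n * (2 ^ j / √(j.factorial)) := by
  have h1 : ((n + 1).ascFactorial j : ℝ) ≤ j.factorial * (2 ^ (n + j)) ^ 2 := by
    rw [Nat.ascFactorial_eq_factorial_mul_choose]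
    push_cast
    gcongr
    have h2 : (((n + j).choose j : ℕ) : ℝ) ≤ 2 ^ (n + j) := by
      exact_mod_cast Nat.choose_le_two_pow (n + j) j
    refine h2.trans ?_
    have : (1 : ℝ) ≤ 2 ^ (n + j) := one_le_pow₀ (by norm_num)
    nlinarith
  have h3 : (0 : ℝ) < j.factorial := by exact_mod_cast Nat.factorial_pos j
  have h4 := Real.sqrt_le_sqrt h1
  rw [Real.sqrt_mul h3.le, Real.sqrt_sq (by positivity)] at h4
  have h5 : √(j.factorial : ℝ) * √(j.factorial : ℝ) = j.factorial := Real.mul_self_sqrt h3.le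
  have h6 : 0 < √(j.factorial : ℝ) := Real.sqrt_pos.mpr h3
  rw [div_le_iff₀ h3]
  refine h4.trans (le_of_eq ?_)
  calc √(j.factorial : ℝ) * 2 ^ (n + j)
      = 2 ^ n * (2 ^ j / √(j.factorial)) * (√(j.factorial : ℝ) * √(j.factorial : ℝ)) := by
        field_simp
        ring
    _ = _ := by rw [h5]

/-- The term is the geometric mean of (2x²)^j/j! and 2^{-j}, both of which are summable. -/
theorem summable_pow_div_sqrt_factorial (x : ℝ) (hx : 0 ≤ x) :
    Summable fun j : ℕ => x ^ j / √(j.factorial) := by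
  have h1 : Summable fun j : ℕ => (2 * x ^ 2) ^ j / j.factorial := Real.summable_pow_div_factorial _
  have h2 : Summable fun j : ℕ => (1 / 2 : ℝ) ^ j := summable_geometric_two
  refine Summable.of_nonneg_of_le (fun j => by positivity) (fun j => ?_) (h1.add h2)
  have h3 : (0 : ℝ) < j.factorial := by exact_mod_cast Nat.factorial_pos j
  have h4 : x ^ j / √(j.factorial) = √((2 * x ^ 2) ^ j / j.factorial) * √((1 / 2 : ℝ) ^ j) := by
    rw [← Real.sqrt_mul (by positivity), eq_comm, Real.sqrt_eq_iff_mul_self_eq (by positivity)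
      (by positivity)]
    rw [div_mul_div_comm, Real.mul_self_sqrt h3.le, mul_pow, div_mul_eq_mul_div, mul_right_comm,
      ← mul_pow]
    norm_num
    ring
  have h5 := Real.sq_sqrt (by positivity : 0 ≤ (2 * x ^ 2) ^ j / (j.factorial : ℝ))
  have h6 := Real.sq_sqrt (by positivity : 0 ≤ (1 / 2 : ℝ) ^ j)
  rw [h4]
  nlinarith [sq_nonneg (√((2 * x ^ 2) ^ j / j.factorial) - √((1 / 2 : ℝ) ^ j)),
    sq_nonneg (√((2 * x ^ 2) ^ j / j.factorial)), sq_nonneg (√((1 / 2 : ℝ) ^ j))]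

/-- The components grow at most exponentially. -/
def Growth (χ : ∀ n, E n) : Prop := ∃ c ρ : ℝ, 0 ≤ ρ ∧ ∀ n, ‖χ n‖ ≤ c * ρ ^ n

theorem norm_inv_factorial_smul_lowering_pow_le (hA : ∀ n : ℕ, ‖A n‖ ≤ γ * √(n + 1)) (hγ : 0 ≤ γ)
    {χ : ∀ n, E n} {c ρ : ℝ} (hρ : 0 ≤ ρ) (hχ : ∀ n, ‖χ n‖ ≤ c * ρ ^ n) (j n : ℕ) :
    ‖((j.factorial : ℂ)⁻¹) • (lowering A ^ j) χ n‖ ≤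
      c * (ρ ^ n * 2 ^ n) * ((2 * γ * ρ) ^ j / √(j.factorial)) := by
  have hc : 0 ≤ c := by simpa using (norm_nonneg _).trans (hχ 0)
  rw [norm_smul, norm_inv, Complex.norm_natCast]
  have h1 := norm_lowering_pow_apply_le hA hγ hχ j n
  calc (j.factorial : ℝ)⁻¹ * ‖(lowering A ^ j) χ n‖
      ≤ (j.factorial : ℝ)⁻¹ * (c * γ ^ j * ρ ^ (n + j) * √((n + 1).ascFactorial j)) := by gcongr
    _ = c * γ ^ j * ρ ^ (n + j) * (√((n + 1).ascFactorial j) / j.factorial) := by ring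
    _ ≤ c * γ ^ j * ρ ^ (n + j) * (2 ^ n * (2 ^ j / √(j.factorial))) := by
        have := sqrt_ascFactorial_div_factorial_le n j
        gcongr
    _ = _ := by rw [mul_pow, mul_pow, pow_add]; ring

/-- The exponential of a lowering operator; meaningful on sequences of at most exponential growth. -/
def loweringExp (A : ∀ n, E (n + 1) →L[ℂ] E n) (χ : ∀ n, E n) (n : ℕ) : E n :=
  ∑' j : ℕ, ((j.factorial : ℂ)⁻¹) • (lowering A ^ j) χ n

theorem isExp_loweringExp (hA : ∀ n : ℕ, ‖A n‖ ≤ γ * √(n + 1)) (hγ : 0 ≤ γ) {χ : ∀ n, E n}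
    (hχ : Growth χ) : IsExp (lowering A) χ (loweringExp A χ) := by
  obtain ⟨c, ρ, hρ, hχ⟩ := hχ
  refine Pi.hasSum.mpr fun n => Summable.hasSum ?_
  refine Summable.of_norm_bounded
    ((summable_pow_div_sqrt_factorial (2 * γ * ρ) (by positivity)).mul_left
      (c * (ρ ^ n * 2 ^ n))) fun j => ?_
  exact norm_inv_factorial_smul_lowering_pow_le hA hγ hρ hχ j n

theorem isExp_lowering_finite {χ : ∀ n, E n} {M : ℕ} (h : ∀ m, M ≤ m → χ m = 0) :
    IsExp (lowering A) χ (loweringExp A χ) ∧ (lowering A ^ M) χ = 0 ∧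
      ∀ m, M ≤ m → loweringExp A χ m = 0 := by
  have h0 : (lowering A ^ M) χ = 0 := by
    funext n
    exact lowering_pow_apply_eq_zero A h M n (by omega)
  refine ⟨?_, h0, ?_⟩
  · have h1 := isExp_of_pow_eq_zero h0
    have h2 : loweringExp A χ = _ := funext fun n => (Pi.hasSum.mp h1 n).tsum_eq
    rwa [h2]
  · intro m hm
    refine (tsum_congr fun j => ?_).trans tsum_zero
    rw [lowering_pow_apply_eq_zero A h j m (by omega), smul_zero]

/-- The commutator of a* with a is a scalar, so `IsExp.conj` shifts a by γ² when it passes e^{a*}.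
-/
theorem IsCCR.lowering_mul_raisingExp (h : IsCCR A γ) :
    lowering A * raisingExp (adj A) = raisingExp (adj A) *
      (lowering A + ((γ ^ 2 : ℝ) : ℂ) • (1 : (∀ n, E n) →L[ℂ] (∀ n, E n))) := by
  ext1 χ
  have h1 : IsExp (raising (adj A)) (lowering A χ) _ := IsExp.conj (T := raising (adj A))
    (S := lowering A) (Q := -(((γ ^ 2 : ℝ) : ℂ) • (1 : (∀ n, E n) →L[ℂ] (∀ n, E n))))
    (by rw [h.comm]; abel) (by ext1; simp) (isExp_raisingExp (adj A) χ)
  have h2 := h1.unique (isExp_raisingExp (adj A) (lowering A χ))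
  simp only [mul_apply_eq_comp, add_apply, smul_apply, one_apply_eq_self, map_add, map_smul, ← h2,
    neg_apply]
  abel

/-- The norm identity behind the unitarity of the Weyl operator. -/
theorem IsCCR.hasSum_norm_sq (h : IsCCR A γ) {χ : ∀ n, E n} {M : ℕ} (hχ : ∀ m, M ≤ m → χ m = 0) :
    HasSum (fun n => ‖raisingExp (adj A) (loweringExp (fun n => -A n) χ) n‖ ^ 2)
      (Real.exp (γ ^ 2) * ∑ m ∈ Finset.range M, ‖χ m‖ ^ 2) := by
  obtain ⟨h1, h2, h3⟩ := isExp_lowering_finite (A := fun n => -A n) hχ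
  set ξ := loweringExp (fun n => -A n) χ
  -- With ξ = e^{-a}χ, applying e^a recovers χ.
  have h4 : IsExp (lowering A) ξ χ := by
    have := h1.of_neg_of_pow_eq_zero h2
    rwa [lowering_neg, neg_neg] at this
  have h5 : (lowering A ^ M) ξ = 0 := (isExp_lowering_finite (A := A) h3).2.1
  -- From a e^{a*} = e^{a*}(a + γ²): e^a e^{a*} ξ = e^{γ²} e^{a*} χ. The norm square of e^{a*}ξ is
  -- thus e^{γ²} times the pairing of e^{a*}χ with ξ.
  have h6 := (h4.add_scalar_of_pow_eq_zero h5 ((γ ^ 2 : ℝ) : ℂ)).intertwine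
    h.lowering_mul_raisingExp
  have h7 := hasSum_inner_raisingExp A h6 h3
  have h8 := hasSum_inner_raisingExp A h4 hχ
  -- By adjointness the pairing of ξ with e^{a*}χ is that of e^a ξ = χ with χ. It is a finite sum
  -- because ξ has no levels from M on.
  have h9 : ∑ m ∈ Finset.range M, inner ℂ (ξ m) (raisingExp (adj A) χ m) =
      ∑ m ∈ Finset.range M, inner ℂ (χ m) (χ m) := by
    refine HasSum.unique (hasSum_sum_of_ne_finset_zero fun n hn => ?_) h8
    rw [h3 n (by simpa using hn), inner_zero_left]
  have h10 : ∑ m ∈ Finset.range M, inner ℂ (raisingExp (adj A)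
      (Complex.exp ((γ ^ 2 : ℝ) : ℂ) • χ) m) (ξ m) =
      ((Real.exp (γ ^ 2) * ∑ m ∈ Finset.range M, ‖χ m‖ ^ 2 : ℝ) : ℂ) := by
    have := congrArg (starRingEnd ℂ) h9
    rw [map_sum, map_sum] at this
    simp_rw [inner_conj_symm] at this
    simp_rw [map_smul, Pi.smul_apply, inner_smul_left]
    rw [← Finset.mul_sum, this]
    simp_rw [inner_self_ofReal]
    rw [← Complex.ofReal_exp, Complex.conj_ofReal]
    push_cast
    rfl
  rw [h10] at h7
  rw [← Complex.hasSum_ofReal]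
  refine h7.congr_fun fun n => ?_
  rw [inner_self_ofReal]

end Graded

/-! ### The Weyl operator on the Hilbert sum and its unitarity. -/

section Weyl

variable {E : ℕ → Type*} [∀ n, NormedAddCommGroup (E n)] [∀ n, InnerProductSpace ℂ (E n)]

theorem memℓp_two_iff {f : ∀ n, E n} : Memℓp f 2 ↔ Summable fun n => ‖f n‖ ^ 2 := by
  rw [memℓp_gen_iff (by norm_num)]
  simp

theorem lp_two_hasSum_norm_sq (f : lp E 2) : HasSum (fun n => ‖f n‖ ^ 2) (‖f‖ ^ 2) := by
  simpa using lp.hasSum_norm (p := 2) (by norm_num) f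

theorem growth_lp (χ : lp E 2) (n : ℕ) : ‖χ n‖ ≤ ‖χ‖ * 1 ^ n := by
  simpa using lp.norm_apply_le_norm (by norm_num) χ n

/-- The components of level below `M`. -/
def truncate (χ : lp E 2) (M : ℕ) : lp E 2 := ∑ m ∈ Finset.range M, lp.single 2 m (χ m)

theorem truncate_apply (χ : lp E 2) (M n : ℕ) : truncate χ M n = if n < M then χ n else 0 := by
  rw [truncate, lp.coeFn_sum, Finset.sum_apply]
  split_ifs with h
  · rw [Finset.sum_eq_single_of_mem n (by simpa using h)]
    · simp
    · intro m _ hm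
      exact lp.single_apply_ne 2 m _ hm.symm
  · refine Finset.sum_eq_zero fun m hm => lp.single_apply_ne 2 m _ ?_
    have := Finset.mem_range.mp hm
    omega

theorem tendsto_truncate (χ : lp E 2) : Tendsto (truncate χ) atTop (𝓝 χ) :=
  (lp.hasSum_single (by norm_num) χ).tendsto_sum_nat

theorem norm_truncate_le (χ : lp E 2) (M : ℕ) : ‖truncate χ M‖ ≤ ‖χ‖ := by
  refine lp.norm_mono (by norm_num) fun n => ?_
  rw [truncate_apply]
  split_ifs <;> simp

variable [∀ n, CompleteSpace (E n)] {A : ∀ n, E (n + 1) →L[ℂ] E n} {γ : ℝ}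

theorem norm_loweringExp_le (hA : ∀ n : ℕ, ‖A n‖ ≤ γ * √(n + 1)) (hγ : 0 ≤ γ) (χ : lp E 2) (n : ℕ) :
    ‖loweringExp A χ n‖ ≤ (2 ^ n * ∑' j : ℕ, (2 * γ) ^ j / √(j.factorial)) * ‖χ‖ := by
  have h := (summable_pow_div_sqrt_factorial (2 * γ) (by positivity)).hasSum.mul_left
    (‖χ‖ * 2 ^ n)
  refine (tsum_of_norm_bounded h fun j => ?_).trans (le_of_eq (by ring))
  simpa using norm_inv_factorial_smul_lowering_pow_le hA hγ zero_le_one (growth_lp χ) j n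

/-- The exponential of a lowering operator as a continuous map from the Hilbert sum to
sequences. -/
def loweringExpCLM (hA : ∀ n : ℕ, ‖A n‖ ≤ γ * √(n + 1)) (hγ : 0 ≤ γ) :
    lp E 2 →L[ℂ] (∀ n, E n) :=
  have hexp (χ : lp E 2) : IsExp (lowering A) (χ : ∀ n, E n) (loweringExp A χ) :=
    isExp_loweringExp hA hγ ⟨_, 1, zero_le_one, growth_lp χ⟩
  ContinuousLinearMap.pi fun n => LinearMap.mkContinuous
    { toFun := fun χ => loweringExp A χ n
      map_add' := fun χ χ' => congrFun ((hexp (χ + χ')).unique ((hexp χ).add (hexp χ'))) n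
      map_smul' := fun c χ => congrFun ((hexp (c • χ)).unique ((hexp χ).smul c)) n }
    _ fun χ => norm_loweringExp_le hA hγ χ n

/-- The Weyl operator `e^{-γ²/2} e^{a*} e^{-a}`, with values in sequences. -/
def IsCCR.weylPi (h : IsCCR A γ) : lp E 2 →L[ℂ] (∀ n, E n) :=
  ((Real.exp (-γ ^ 2 / 2) : ℝ) : ℂ) • (raisingExp (adj A) ∘L loweringExpCLM h.neg.norm_le h.nonneg)

theorem IsCCR.weylPi_apply (h : IsCCR A γ) (χ : lp E 2) : h.weylPi χ =
    ((Real.exp (-γ ^ 2 / 2) : ℝ) : ℂ) • raisingExp (adj A) (loweringExp (fun n => -A n) χ) := rfl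

theorem IsCCR.hasSum_norm_sq_weylPi (h : IsCCR A γ) (χ : lp E 2) {M : ℕ}
    (hχ : ∀ m, M ≤ m → χ m = 0) : HasSum (fun n => ‖h.weylPi χ n‖ ^ 2) (‖χ‖ ^ 2) := by
  have h1 := (h.hasSum_norm_sq hχ).mul_left (Real.exp (-γ ^ 2 / 2) ^ 2)
  have h2 : ∑ m ∈ Finset.range M, ‖χ m‖ ^ 2 = ‖χ‖ ^ 2 := by
    refine HasSum.unique (hasSum_sum_of_ne_finset_zero fun n hn => ?_) (lp_two_hasSum_norm_sq χ)
    rw [hχ n (by simpa using hn)]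
    simp
  rw [h2, ← mul_assoc, ← Real.exp_nat_mul, ← Real.exp_add] at h1
  -- The square of the normalizing factor e^{-γ²/2} cancels the e^{γ²} of the norm identity.
  have h3 : ((2 : ℕ) : ℝ) * (-γ ^ 2 / 2) + γ ^ 2 = 0 := by push_cast; ring
  rw [h3, Real.exp_zero, one_mul] at h1
  refine h1.congr_fun fun n => ?_
  rw [h.weylPi_apply, Pi.smul_apply, norm_smul, Complex.norm_real, Real.norm_eq_abs, Real.abs_exp,
    mul_pow, Real.exp_nat_mul]

theorem IsCCR.exists_weyl_truncate (h : IsCCR A γ) (χ : lp E 2) (M : ℕ) :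
    ∃ w : lp E 2, (w : ∀ n, E n) = h.weylPi (truncate χ M) ∧ ‖w‖ = ‖truncate χ M‖ := by
  have h1 := h.hasSum_norm_sq_weylPi (truncate χ M) (M := M) fun m hm => by
    rw [truncate_apply, if_neg (by omega)]
  refine ⟨⟨h.weylPi (truncate χ M), memℓp_two_iff.mpr h1.summable⟩, rfl, ?_⟩
  rw [← sq_eq_sq₀ (norm_nonneg _) (norm_nonneg _)]
  exact (lp_two_hasSum_norm_sq _).unique h1

/-- The isometry is known on truncated vectors only. Their images stay bounded in norm and converge
level by level, so the limit is square-summable with the same bound. -/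
theorem IsCCR.exists_weyl (h : IsCCR A γ) (χ : lp E 2) :
    ∃ w : lp E 2, (w : ∀ n, E n) = h.weylPi χ ∧ ‖w‖ ≤ ‖χ‖ := by
  choose F hF hF' using h.exists_weyl_truncate χ
  have h1 : Tendsto (fun M => (F M : ∀ n, E n)) atTop (𝓝 (h.weylPi χ)) := by
    simp_rw [hF]
    exact (h.weylPi.continuous.tendsto χ).comp (tendsto_truncate χ)
  have hle : ∀ M, ‖F M‖ ≤ ‖χ‖ := fun M => (hF' M).le.trans (norm_truncate_le χ M)
  have h2 : Memℓp (h.weylPi χ) 2 := by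
    refine lp.memℓp_of_tendsto (F := F) (l := atTop) ?_ h1
    refine (isBounded_iff_forall_norm_le).mpr ⟨‖χ‖, ?_⟩
    rintro _ ⟨M, rfl⟩
    exact hle M
  exact ⟨⟨_, h2⟩, rfl, lp.norm_le_of_tendsto (F := F) (l := atTop) (.of_forall hle) h1⟩

/-- The Weyl operator `e^{-γ²/2} e^{a*} e^{-a}` on the Hilbert sum. -/
def IsCCR.weyl (h : IsCCR A γ) : lp E 2 →L[ℂ] lp E 2 :=
  LinearMap.mkContinuous
    { toFun := fun χ => ⟨h.weylPi χ, (h.exists_weyl χ).choose_spec.1 ▸ lp.memℓp _⟩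
      map_add' := fun χ χ' => lp.ext (map_add h.weylPi χ χ')
      map_smul' := fun c χ => lp.ext (map_smul h.weylPi c χ) }
    1 fun χ => by
      obtain ⟨w, hw, hw'⟩ := h.exists_weyl χ
      rw [one_mul]
      refine le_trans (le_of_eq ?_) hw'
      congr 1
      exact lp.ext hw.symm

theorem IsCCR.coe_weyl (h : IsCCR A γ) (χ : lp E 2) :
    (h.weyl χ : ∀ n, E n) = ((Real.exp (-γ ^ 2 / 2) : ℝ) : ℂ) •
      raisingExp (adj A) (loweringExp (fun n => -A n) χ) := rfl

theorem IsCCR.norm_weyl (h : IsCCR A γ) (χ : lp E 2) : ‖h.weyl χ‖ = ‖χ‖ := by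
  have h1 : Tendsto (fun M => ‖h.weyl (truncate χ M)‖) atTop (𝓝 ‖h.weyl χ‖) :=
    ((h.weyl.continuous.norm).tendsto χ).comp (tendsto_truncate χ)
  have h2 : Tendsto (fun M => ‖truncate χ M‖) atTop (𝓝 ‖χ‖) :=
    (continuous_norm.tendsto χ).comp (tendsto_truncate χ)
  refine tendsto_nhds_unique h1 (h2.congr fun M => ?_)
  obtain ⟨w, hw, hw'⟩ := h.exists_weyl_truncate χ M
  rw [← hw']
  congr 1
  exact lp.ext hw

/-- Level p of e^{a*}ζ depends only on the levels of ζ up to p, so ζ may be cut off and the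
adjointness relation for finite sequences applies. -/
theorem inner_raisingExp_neg_left (ζ : ∀ n, E n) (p : ℕ) (x : E p) :
    inner ℂ (raisingExp (adj fun n => -A n) ζ p) x =
      -- A vector of level p has lowered components on the levels 0, ..., p, hence p + 1 summands.
      ∑ m ∈ Finset.range (p + 1), inner ℂ (ζ m) (loweringExp (fun n => -A n) (Pi.single p x) m) := by
  set ξ : ∀ n, E n := fun n => if n < p + 1 then ζ n else 0 with hξ
  have hs : ∀ m, p + 1 ≤ m → (Pi.single p x : ∀ n, E n) m = 0 := fun m hm =>
    Pi.single_eq_of_ne (by omega) x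
  have h1 := hasSum_inner_raisingExp (fun n => -A n)
    (isExp_lowering_finite (A := fun n => -A n) hs).1 (ξ := ξ) (M := p + 1)
    fun m hm => if_neg (by omega)
  have h2 : HasSum (fun n => inner ℂ ((Pi.single p x : ∀ n, E n) n)
      (raisingExp (adj fun n => -A n) ξ n)) (inner ℂ x (raisingExp (adj fun n => -A n) ξ p)) := by
    have := hasSum_single (f := fun n => inner ℂ ((Pi.single p x : ∀ n, E n) n)
      (raisingExp (adj fun n => -A n) ξ n)) p fun n hn => by
        rw [Pi.single_eq_of_ne hn, inner_zero_left]
    simpa using this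
  have h3 := congrArg (starRingEnd ℂ) (h2.unique h1)
  rw [map_sum, inner_conj_symm] at h3
  simp_rw [inner_conj_symm] at h3
  have h4 : raisingExp (adj fun n => -A n) ζ p = raisingExp (adj fun n => -A n) ξ p := by
    rw [← sub_eq_zero, ← Pi.sub_apply, ← map_sub]
    refine raisingExp_apply_eq_zero _ (p := p + 1) (fun m hm => ?_) p (by omega)
    simp only [hξ, Pi.sub_apply, hm, if_true, sub_self]
  rw [h4, h3]
  refine Finset.sum_congr rfl fun m hm => ?_
  rw [hξ]
  simp only [Finset.mem_range.mp hm, if_true]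

/-- The adjoint of e^{a*} e^{-a} is e^{-a*} e^{a}, which is the Weyl operator of -a. By continuity
it is enough to test on vectors of one level. -/
theorem IsCCR.inner_weyl (h : IsCCR A γ) (ζ χ : lp E 2) :
    inner ℂ ζ (h.weyl χ) = inner ℂ (h.neg.weyl ζ) χ := by
  have key : (innerSL ℂ ζ) ∘L h.weyl = innerSL ℂ (h.neg.weyl ζ) := by
    refine lp.ext_continuousLinearMap (by norm_num) fun p => ?_
    ext x
    change inner ℂ ζ (h.weyl (lp.single 2 p x)) = inner ℂ (h.neg.weyl ζ) (lp.single 2 p x)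
    rw [lp.inner_single_right]
    refine (lp.hasSum_inner ζ (h.weyl (lp.single 2 p x))).unique ?_
    have hs : ∀ m, p + 1 ≤ m → (Pi.single p x : ∀ n, E n) m = 0 := fun m hm =>
      Pi.single_eq_of_ne (by omega) x
    have hζ : IsExp (lowering A) (ζ : ∀ n, E n) (loweringExp A ζ) :=
      isExp_loweringExp h.norm_le h.nonneg ⟨_, 1, zero_le_one, growth_lp ζ⟩
    have h1 := (hasSum_inner_raisingExp A hζ
      (isExp_lowering_finite (A := fun n => -A n) hs).2.2).mul_left
        ((Real.exp (-γ ^ 2 / 2) : ℝ) : ℂ)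
    rw [← inner_raisingExp_neg_left] at h1
    have h2 : inner ℂ (h.neg.weyl ζ p) x = ((Real.exp (-γ ^ 2 / 2) : ℝ) : ℂ) *
        inner ℂ (raisingExp (adj fun n => -A n) (loweringExp A ζ) p) x := by
      rw [h.neg.coe_weyl]
      simp only [neg_neg, Pi.smul_apply, inner_smul_left, Complex.conj_ofReal]
    rw [h2]
    refine h1.congr_fun fun n => ?_
    rw [h.coe_weyl, lp.coeFn_single, Pi.smul_apply, inner_smul_right]
  exact congrArg (fun f : lp E 2 →L[ℂ] ℂ => f χ) key

/-- An isometry composed with its adjoint is the identity. Exchanging a and -a gives the other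
composition, and with it surjectivity. -/
theorem IsCCR.weyl_neg_weyl (h : IsCCR A γ) (χ : lp E 2) : h.neg.weyl (h.weyl χ) = χ := by
  refine ext_inner_right ℂ fun ζ => ?_
  rw [← h.inner_weyl]
  exact (LinearMap.norm_map_iff_inner_map_map h.weyl).mp h.norm_weyl χ ζ

theorem IsCCR.weyl_weyl_neg (h : IsCCR A γ) (χ : lp E 2) : h.weyl (h.neg.weyl χ) = χ := by
  have h1 : h.neg.neg.weyl (h.neg.weyl χ) = h.weyl (h.neg.weyl χ) := by
    apply lp.ext
    rw [h.neg.neg.coe_weyl, h.coe_weyl]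
    simp only [neg_neg]
  rw [← h1, h.neg.weyl_neg_weyl]

/-- The Weyl operator is unitary. -/
def IsCCR.weylEquiv (h : IsCCR A γ) : lp E 2 ≃ₗᵢ[ℂ] lp E 2 where
  toLinearEquiv := LinearEquiv.ofLinearMap h.weyl.toLinearMap h.neg.weyl.toLinearMap
    (LinearMap.ext h.weyl_weyl_neg) (LinearMap.ext h.weyl_neg_weyl)
  norm_map' := h.norm_weyl

theorem IsCCR.coe_weylEquiv (h : IsCCR A γ) (χ : lp E 2) :
    (h.weylEquiv χ : ∀ n, E n) = ((Real.exp (-γ ^ 2 / 2) : ℝ) : ℂ) •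
      raisingExp (adj A) (loweringExp (fun n => -A n) χ) := rfl

end Weyl

/-! ### The exponential of T + Q when Q intertwines T + Q with T. -/

section Perturbation

variable {V : Type*} [AddCommGroup V] [Module ℂ V] [TopologicalSpace V] [IsTopologicalAddGroup V]
  [ContinuousConstSMul ℂ V] {T Q P : V →L[ℂ] V} {χ φ φ' : V}

/-- The relation QP = TQ gives P^{j+1} = T^{j+1} + (j+1) T^j Q, hence e^P = e^T + e^T Q. It is used
with T = -a and Q = -gB. -/
theorem IsExp.add_of_semiconj (hP : P = T + Q) (hQ : Q * P = T * Q) (h : IsExp T χ φ)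
    (h' : IsExp T (Q χ) φ') : IsExp P χ (φ + φ') := by
  have hQP : ∀ j : ℕ, Q * P ^ j = T ^ j * Q := fun j =>
    (SemiconjBy.pow_right (show SemiconjBy Q P T from hQ) j)
  have hp : ∀ j : ℕ, P ^ (j + 1) = T ^ (j + 1) + ((j + 1 : ℕ) : ℂ) • (T ^ j * Q) := by
    intro j
    induction j with
    | zero => simp [hP]
    | succ j ih =>
      have h1 : P ^ (j + 1 + 1) = T * P ^ (j + 1) + Q * P ^ (j + 1) := by
        rw [pow_succ' P (j + 1), ← add_mul, ← hP]
      rw [h1, hQP, ih, mul_add, ← pow_succ', mul_smul_comm, ← mul_assoc, ← pow_succ', add_assoc]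
      congr 1
      push_cast
      module
  have h3 : HasSum (fun j : ℕ => ((j.factorial : ℂ)⁻¹) • ((P ^ j) χ - (T ^ j) χ)) φ' := by
    rw [← hasSum_nat_add_iff' 1]
    simp only [Finset.range_one, Finset.sum_singleton, pow_zero, one_apply_eq_self,
      sub_self, smul_zero, sub_zero]
    refine h'.congr_fun fun j => ?_
    rw [hp j, add_apply, smul_apply, mul_apply_eq_comp, add_sub_cancel_left, smul_smul,
      Nat.factorial_succ]
    congr 1
    have : ((j + 1 : ℕ) : ℂ) ≠ 0 := Nat.cast_ne_zero.mpr (Nat.succ_ne_zero j)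
    have : (j.factorial : ℂ) ≠ 0 := Nat.cast_ne_zero.mpr (Nat.factorial_ne_zero j)
    push_cast at *
    field_simp
  refine (HasSum.add h h3).congr_fun fun j => ?_
  simp only [smul_sub]
  abel

end Perturbation

/-! ### Van Hove operators with maximal domain: symmetry, adjoint, density, conjugation by e^{-a}.
-/

section VanHove

variable {E : ℕ → Type*} [∀ n, NormedAddCommGroup (E n)] [∀ n, InnerProductSpace ℂ (E n)]
  [∀ n, CompleteSpace (E n)]

theorem Growth.add {χ χ' : ∀ n, E n} (h : Growth χ) (h' : Growth χ') : Growth (χ + χ') := by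
  obtain ⟨c, ρ, hρ, h⟩ := h
  obtain ⟨c', ρ', hρ', h'⟩ := h'
  have hc : 0 ≤ c := by simpa using (norm_nonneg _).trans (h 0)
  have hc' : 0 ≤ c' := by simpa using (norm_nonneg _).trans (h' 0)
  refine ⟨c + c', max ρ ρ', le_max_of_le_left hρ, fun n => ?_⟩
  calc ‖χ n + χ' n‖ ≤ c * ρ ^ n + c' * ρ' ^ n := (norm_add_le _ _).trans (add_le_add (h n) (h' n))
    _ ≤ c * (max ρ ρ') ^ n + c' * (max ρ ρ') ^ n := by
      gcongr
      · exact le_max_left _ _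
      · exact le_max_right _ _
    _ = _ := by ring

theorem Growth.smul {χ : ∀ n, E n} (h : Growth χ) (a : ℂ) : Growth (a • χ) := by
  obtain ⟨c, ρ, hρ, h⟩ := h
  refine ⟨‖a‖ * c, ρ, hρ, fun n => ?_⟩
  rw [Pi.smul_apply, norm_smul, mul_assoc]
  gcongr
  exact h n

theorem Growth.neg {χ : ∀ n, E n} (h : Growth χ) : Growth (-χ) := by
  simpa using h.smul (-1)

theorem Growth.lp (χ : lp E 2) : Growth (χ : ∀ n, E n) := ⟨_, 1, zero_le_one, growth_lp χ⟩

theorem natCast_succ_le_two_pow (n : ℕ) : (n : ℝ) + 1 ≤ 2 ^ n := by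
  exact_mod_cast Nat.lt_two_pow_self

theorem sqrt_natCast_succ_le_two_pow (n : ℕ) : √((n : ℝ) + 1) ≤ 2 ^ n := by
  refine le_trans ?_ (natCast_succ_le_two_pow n)
  rw [Real.sqrt_le_left (by positivity)]
  nlinarith [(n.cast_nonneg : (0 : ℝ) ≤ n)]

/-- The factor √(n+1) is absorbed by doubling the exponential rate. This class of sequences is
stable under the ladder operators and still small enough for e^{-a} to converge. -/
theorem Growth.lowering {χ : ∀ n, E n} (h : Growth χ) {B : ∀ n, E (n + 1) →L[ℂ] E n} {β : ℝ}
    (hB : ∀ n : ℕ, ‖B n‖ ≤ β * √(n + 1)) : Growth (lowering B χ) := by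
  obtain ⟨c, ρ, hρ, h⟩ := h
  have hc : 0 ≤ c := by simpa using (norm_nonneg _).trans (h 0)
  have hβ : 0 ≤ β := by simpa using (norm_nonneg _).trans (hB 0)
  refine ⟨β * c * ρ, 2 * ρ, by positivity, fun n => ?_⟩
  rw [lowering_apply]
  refine ((B n).le_of_opNorm_le (hB n) _).trans ?_
  calc β * √(n + 1) * ‖χ (n + 1)‖ ≤ β * 2 ^ n * (c * ρ ^ (n + 1)) := by
        gcongr
        · exact sqrt_natCast_succ_le_two_pow n
        · exact h (n + 1)
    _ = _ := by rw [mul_pow, pow_succ]; ring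

theorem Growth.raising {χ : ∀ n, E n} (h : Growth χ) {C : ∀ n, E n →L[ℂ] E (n + 1)} {β : ℝ}
    (hB : ∀ n : ℕ, ‖C n‖ ≤ β * √(n + 1)) : Growth (raising C χ) := by
  obtain ⟨c, ρ, hρ, h⟩ := h
  have hc : 0 ≤ c := by simpa using (norm_nonneg _).trans (h 0)
  have hβ : 0 ≤ β := by simpa using (norm_nonneg _).trans (hB 0)
  refine ⟨β * c, max 1 (2 * ρ), by positivity, fun n => ?_⟩
  cases n with
  | zero => simp; positivity
  | succ n =>
    rw [raising_apply_succ]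
    refine ((C n).le_of_opNorm_le (hB n) _).trans ?_
    calc β * √(n + 1) * ‖χ n‖ ≤ β * 2 ^ n * (c * ρ ^ n) := by
          gcongr
          · exact sqrt_natCast_succ_le_two_pow n
          · exact h n
      _ = β * c * (2 * ρ) ^ n := by rw [mul_pow]; ring
      _ ≤ β * c * (max 1 (2 * ρ)) ^ n := by
          gcongr
          exact le_max_right _ _
      _ ≤ β * c * (max 1 (2 * ρ)) ^ (n + 1) := by
          gcongr
          · exact le_max_left _ _
          · omega

/-- The number operator. -/
def number : (∀ n, E n) →L[ℂ] (∀ n, E n) := diagonal fun n => (n : ℂ) • (1 : E n →L[ℂ] E n)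

@[simp] theorem number_apply (χ : ∀ n, E n) (n : ℕ) : number χ n = (n : ℂ) • χ n := rfl

theorem Growth.number {χ : ∀ n, E n} (h : Growth χ) : Growth (number χ) := by
  obtain ⟨c, ρ, hρ, h⟩ := h
  refine ⟨c, 2 * ρ, by positivity, fun n => ?_⟩
  rw [number_apply, norm_smul, Complex.norm_natCast]
  calc (n : ℝ) * ‖χ n‖ ≤ 2 ^ n * (c * ρ ^ n) := by
        gcongr
        · linarith [natCast_succ_le_two_pow n]
        · exact h n
    _ = _ := by rw [mul_pow]; ring

variable (A : ∀ n, E (n + 1) →L[ℂ] E n) (R : ∀ n, E n →L[ℂ] E n) (μ c : ℝ)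

/-- The part `μ N + μ (a + a*) + c` of a van Hove Hamiltonian. -/
def coupling : (∀ n, E n) →L[ℂ] (∀ n, E n) :=
  (μ : ℂ) • (number + lowering A + raising (adj A)) + (c : ℂ) • 1

theorem coupling_apply (χ : ∀ n, E n) (n : ℕ) : coupling A μ c χ n =
    (μ : ℂ) • ((n : ℂ) • χ n + A n (χ (n + 1)) + raising (adj A) χ n) + (c : ℂ) • χ n := rfl

/-- The graph of the van Hove Hamiltonian `R⁻¹ + μ N + μ (a + a*) + c` with its maximal domain. -/
def vanHove : Submodule ℂ (lp E 2 × lp E 2) where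
  carrier := {p | ∃ ξ : ∀ n, E n, (p.1 : ∀ n, E n) = diagonal R ξ ∧
    (p.2 : ∀ n, E n) = ξ + coupling A μ c p.1}
  add_mem' := by
    rintro p q ⟨ξ, h1, h2⟩ ⟨ξ', h1', h2'⟩
    refine ⟨ξ + ξ', ?_, ?_⟩
    · rw [Prod.fst_add, lp.coeFn_add, h1, h1', map_add]
    · rw [Prod.snd_add, Prod.fst_add, lp.coeFn_add, lp.coeFn_add, h2, h2', map_add]
      abel
  zero_mem' := ⟨0, by rw [map_zero]; rfl, by
    have : ((0 : lp E 2 × lp E 2).1 : ∀ n, E n) = 0 := rfl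
    rw [this, map_zero, add_zero]; rfl⟩
  smul_mem' := by
    rintro a p ⟨ξ, h1, h2⟩
    refine ⟨a • ξ, ?_, ?_⟩
    · rw [Prod.smul_fst, lp.coeFn_smul, h1, map_smul]
    · rw [Prod.smul_snd, Prod.smul_fst, lp.coeFn_smul, lp.coeFn_smul, h2, map_smul, smul_add]

variable {A R μ c}

theorem mem_vanHove {χ Θ : lp E 2} : (χ, Θ) ∈ vanHove A R μ c ↔ ∃ ξ : ∀ n, E n,
    (χ : ∀ n, E n) = diagonal R ξ ∧ (Θ : ∀ n, E n) = ξ + coupling A μ c χ := Iff.rfl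

theorem vanHove_unique (hR : ∀ n, Function.Injective (R n)) {χ Θ Θ' : lp E 2}
    (h : (χ, Θ) ∈ vanHove A R μ c) (h' : (χ, Θ') ∈ vanHove A R μ c) : Θ = Θ' := by
  obtain ⟨ξ, h1, h2⟩ := mem_vanHove.mp h
  obtain ⟨ξ', h1', h2'⟩ := mem_vanHove.mp h'
  have : ξ = ξ' := by
    funext n
    exact hR n (congrFun (h1.symm.trans h1') n)
  subst this
  exact lp.ext (h2.trans h2'.symm)

/-- A nonzero limit would force 1/(n+1) below a multiple of s n eventually, contradicting the
divergence of the harmonic series. -/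
theorem eq_zero_of_tendsto_of_summable {s : ℕ → ℝ} (hs : Summable s) {t : ℕ → ℂ} {S : ℂ}
    (ht : Tendsto t atTop (𝓝 S)) {C : ℝ} (hts : ∀ n, ‖t n‖ ≤ C * (n + 1) * s n) :
    S = 0 := by
  by_contra hS
  have hS' : 0 < ‖S‖ / 2 := by positivity
  have h1 : ∀ᶠ n in atTop, ‖S‖ / 2 < ‖t n‖ :=
    ht.norm.eventually_const_lt (by linarith [norm_pos_iff.mpr hS])
  have h2 : Summable fun n : ℕ => (‖S‖ / 2) * (1 / ((n : ℝ) + 1)) := by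
    refine Summable.of_norm_bounded_eventually_nat (hs.mul_left C) ?_
    filter_upwards [h1] with n hn
    have h3 := hn.le.trans (hts n)
    have h4 : (0 : ℝ) < n + 1 := by positivity
    rw [Real.norm_of_nonneg (by positivity), mul_one_div, div_le_iff₀ h4]
    linarith
  have h3 : Summable fun n : ℕ => 1 / ((n : ℝ) + 1) := by
    simpa [summable_mul_left_iff hS'.ne'] using h2
  refine Real.not_summable_one_div_natCast ?_
  rw [← summable_nat_add_iff 1]
  simpa using h3

theorem summable_norm_mul_norm_succ (χ χ' : lp E 2) :
    Summable fun n => ‖χ (n + 1)‖ * ‖χ' n‖ := by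
  have h1 := (summable_nat_add_iff 1).mpr (lp_two_hasSum_norm_sq χ).summable
  have h2 := (lp_two_hasSum_norm_sq χ').summable
  refine Summable.of_nonneg_of_le (fun n => by positivity) (fun n => ?_) (h1.add h2)
  nlinarith [sq_nonneg (‖χ (n + 1)‖ - ‖χ' n‖), sq_nonneg ‖χ (n + 1)‖, sq_nonneg ‖χ' n‖]

/-- Summed over the levels up to M, the difference of the two pairings telescopes to a single flux
from level M+1 to level M. It is at most √(M+1) times a summable sequence and it converges, so its
limit is 0. No cutoff of the domain is needed. -/
theorem vanHove_symmetric {γ : ℝ} (hA : ∀ n : ℕ, ‖A n‖ ≤ γ * √(n + 1))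
    (hR : ∀ n x y, inner ℂ (R n x) y = inner ℂ x (R n y)) {χ Θ χ' Θ' : lp E 2}
    (h : (χ, Θ) ∈ vanHove A R μ c) (h' : (χ', Θ') ∈ vanHove A R μ c) :
    inner ℂ Θ χ' = inner ℂ χ Θ' := by
  have hγ : 0 ≤ γ := by simpa using (norm_nonneg _).trans (hA 0)
  obtain ⟨ξ, h1, h2⟩ := mem_vanHove.mp h
  obtain ⟨ξ', h1', h2'⟩ := mem_vanHove.mp h'
  clear h h'
  -- The flux through the bond between n+1 and n, seen from below as `b n` and from above as `d (n +
  -- 1) = -b n`.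
  obtain ⟨b, hb⟩ : ∃ b : ℕ → ℂ, b = fun n =>
    inner ℂ (A n (χ (n + 1))) (χ' n) - inner ℂ (χ n) (A n (χ' (n + 1))) := ⟨_, rfl⟩
  obtain ⟨d, hd⟩ : ∃ d : ℕ → ℂ, d = fun n => inner ℂ (raising (adj A) χ n) (χ' n) -
    inner ℂ (χ n) (raising (adj A) χ' n) := ⟨_, rfl⟩
  have hd0 : d 0 = 0 := by simp [hd]
  have hds : ∀ n, d (n + 1) = -b n := by
    intro n
    simp only [hd, hb, raising_apply_succ, ContinuousLinearMap.adjoint_inner_left,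
      ContinuousLinearMap.adjoint_inner_right]
    ring
  have hterm : ∀ n, inner ℂ (Θ n) (χ' n) - inner ℂ (χ n) (Θ' n) = (μ : ℂ) * (b n + d n) := by
    intro n
    have e0 : inner ℂ (ξ n) (χ' n) = inner ℂ (χ n) (ξ' n) := by
      rw [h1, h1', diagonal_apply, diagonal_apply, hR]
    rw [h2, h2']
    simp only [Pi.add_apply, coupling_apply, inner_add_left, inner_add_right, inner_smul_left,
      inner_smul_right, Complex.conj_ofReal, map_natCast, e0]
    simp only [hb, hd]
    ring
  have hsum : ∀ M, ∑ n ∈ Finset.range (M + 1), (inner ℂ (Θ n) (χ' n) - inner ℂ (χ n) (Θ' n)) =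
      (μ : ℂ) * b M := by
    intro M
    induction M with
    | zero => simp [hterm, hd0]
    | succ M ih =>
      rw [Finset.sum_range_succ, ih, hterm, hds]
      ring
  have hs1 : HasSum (fun n => inner ℂ (Θ n) (χ' n)) (inner ℂ Θ χ') := lp.hasSum_inner Θ χ'
  have hs2 : HasSum (fun n => inner ℂ (χ n) (Θ' n)) (inner ℂ χ Θ') := lp.hasSum_inner χ Θ'
  have hlim : Tendsto (fun M => (μ : ℂ) * b M) atTop (𝓝 (inner ℂ Θ χ' - inner ℂ χ Θ')) := by
    have := (tendsto_add_atTop_iff_nat 1).mpr (hs1.sub hs2).tendsto_sum_nat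
    exact this.congr hsum
  have hz := eq_zero_of_tendsto_of_summable (C := |μ| * γ)
    ((summable_norm_mul_norm_succ χ χ').add (summable_norm_mul_norm_succ χ' χ)) hlim
    fun M => ?_
  · exact sub_eq_zero.mp hz
  · rw [norm_mul, Complex.norm_real, Real.norm_eq_abs]
    have h3 : ‖b M‖ ≤ γ * √(M + 1) * (‖χ (M + 1)‖ * ‖χ' M‖ + ‖χ' (M + 1)‖ * ‖χ M‖) := by
      have e1 := (norm_inner_le_norm (𝕜 := ℂ) (A M (χ (M + 1))) (χ' M)).trans
        (mul_le_mul_of_nonneg_right ((A M).le_of_opNorm_le (hA M) _) (norm_nonneg _))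
      have e2 := (norm_inner_le_norm (𝕜 := ℂ) (χ M) (A M (χ' (M + 1)))).trans
        (mul_le_mul_of_nonneg_left ((A M).le_of_opNorm_le (hA M) _) (norm_nonneg _))
      rw [hb]
      refine (norm_sub_le _ _).trans ((add_le_add e1 e2).trans (le_of_eq (by ring)))
    have h4 : √((M : ℝ) + 1) ≤ M + 1 := by
      rw [Real.sqrt_le_left (by positivity)]
      nlinarith [(M.cast_nonneg : (0 : ℝ) ≤ M)]
    calc |μ| * ‖b M‖ ≤ |μ| * (γ * √(M + 1) * (‖χ (M + 1)‖ * ‖χ' M‖ + ‖χ' (M + 1)‖ * ‖χ M‖)) := by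
          gcongr
      _ ≤ |μ| * (γ * (M + 1) * (‖χ (M + 1)‖ * ‖χ' M‖ + ‖χ' (M + 1)‖ * ‖χ M‖)) := by gcongr
      _ = _ := by ring

theorem lowering_single_succ (n : ℕ) (x : E (n + 1)) :
    lowering A (Pi.single (n + 1) x) = Pi.single n (A n x) := by
  funext m
  rw [lowering_apply]
  by_cases h : m = n
  · subst h; simp
  · rw [Pi.single_eq_of_ne h, Pi.single_eq_of_ne (by omega), map_zero]

theorem lowering_single_zero (x : E 0) : lowering A (Pi.single 0 x) = 0 := by
  funext m
  rw [lowering_apply, Pi.single_eq_of_ne (by omega), map_zero, Pi.zero_apply]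

theorem raising_single (C : ∀ n, E n →L[ℂ] E (n + 1)) (n : ℕ) (x : E n) :
    raising C (Pi.single n x) = Pi.single (n + 1) (C n x) := by
  funext m
  cases m with
  | zero => rw [raising_apply_zero, Pi.single_eq_of_ne (by omega)]
  | succ m =>
    rw [raising_apply_succ]
    by_cases h : m = n
    · subst h; simp
    · rw [Pi.single_eq_of_ne h, Pi.single_eq_of_ne (by omega), map_zero]

theorem number_single (n : ℕ) (x : E n) :
    number (Pi.single n x) = Pi.single n ((n : ℂ) • x) := by
  funext m
  rw [number_apply]
  by_cases h : m = n
  · subst h; simp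
  · rw [Pi.single_eq_of_ne h, Pi.single_eq_of_ne h, smul_zero]

theorem diagonal_single (n : ℕ) (x : E n) :
    diagonal R (Pi.single n x) = Pi.single n (R n x) := by
  funext m
  rw [diagonal_apply]
  by_cases h : m = n
  · subst h; simp
  · rw [Pi.single_eq_of_ne h, Pi.single_eq_of_ne h, map_zero]

/-- Single-level vectors in the range of R lie in the domain, and the image pairs with any ζ through
the formal expression. These are the test vectors for the adjoint and for density. -/
theorem exists_vanHove_single (n : ℕ) (x : E n) : ∃ Θ : lp E 2,
    (lp.single 2 n (R n x), Θ) ∈ vanHove A R μ c ∧ ∀ ζ : lp E 2,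
      inner ℂ Θ ζ = inner ℂ x (ζ n) + inner ℂ (R n x) (coupling A μ c ζ n) := by
  cases n with
  | zero =>
    refine ⟨lp.single 2 0 x + ((μ : ℂ) • lp.single 2 1 (adj A 0 (R 0 x)) +
      (c : ℂ) • lp.single 2 0 (R 0 x)), ⟨Pi.single 0 x, ?_, ?_⟩, fun ζ => ?_⟩
    · rw [diagonal_single, lp.coeFn_single]
    · simp only [lp.coeFn_add, lp.coeFn_smul, lp.coeFn_single, coupling, add_apply, smul_apply,
        number_single, lowering_single_zero, raising_single, one_apply_eq_self]
      simp
    · simp only [inner_add_left, inner_smul_left, lp.inner_single_left, coupling_apply,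
        inner_add_right, inner_smul_right, ContinuousLinearMap.adjoint_inner_left,
        Complex.conj_ofReal, raising_apply_zero, inner_zero_right]
      simp
  | succ n =>
    refine ⟨lp.single 2 (n + 1) x + ((μ : ℂ) • (lp.single 2 (n + 1) (((n + 1 : ℕ) : ℂ) • R (n + 1) x)
      + lp.single 2 n (A n (R (n + 1) x)) + lp.single 2 (n + 2) (adj A (n + 1) (R (n + 1) x))) +
      (c : ℂ) • lp.single 2 (n + 1) (R (n + 1) x)), ⟨Pi.single (n + 1) x, ?_, ?_⟩, fun ζ => ?_⟩
    · rw [diagonal_single, lp.coeFn_single]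
    · simp only [lp.coeFn_add, lp.coeFn_smul, lp.coeFn_single, coupling, add_apply, smul_apply,
        number_single, lowering_single_succ, raising_single, one_apply_eq_self]
    · simp only [inner_add_left, inner_smul_left, lp.inner_single_left, coupling_apply,
        inner_add_right, inner_smul_right, ContinuousLinearMap.adjoint_inner_left,
        Complex.conj_ofReal, raising_apply_succ, ContinuousLinearMap.adjoint_inner_right,
        map_natCast]
      ring

/-- Testing on single levels reads off ζ = R(θ - coupling ζ) on every level, which is membership in
the maximal graph. -/
theorem vanHove_adjoint_le (hR : ∀ n x y, inner ℂ (R n x) y = inner ℂ x (R n y)) {ζ θ : lp E 2}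
    (h : ∀ χ Θ : lp E 2, (χ, Θ) ∈ vanHove A R μ c → inner ℂ Θ ζ = inner ℂ χ θ) :
    (ζ, θ) ∈ vanHove A R μ c := by
  refine ⟨θ - coupling A μ c ζ, ?_, by simp⟩
  funext n
  refine ext_inner_left ℂ fun x => ?_
  obtain ⟨Θ, h1, h2⟩ := exists_vanHove_single (A := A) (R := R) (μ := μ) (c := c) n x
  have h3 := h _ _ h1
  rw [h2, lp.inner_single_left] at h3
  rw [diagonal_apply, ← hR, Pi.sub_apply, inner_sub_right, ← h3]
  ring

theorem vanHove_dense (hR : ∀ n x y, inner ℂ (R n x) y = inner ℂ x (R n y))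
    (hinj : ∀ n, Function.Injective (R n)) {z : lp E 2}
    (h : ∀ χ Θ : lp E 2, (χ, Θ) ∈ vanHove A R μ c → inner ℂ χ z = 0) : z = 0 := by
  apply lp.ext
  funext n
  apply hinj n
  rw [lp.coeFn_zero, Pi.zero_apply, map_zero]
  refine ext_inner_left ℂ fun x => ?_
  obtain ⟨Θ, h1, -⟩ := exists_vanHove_single (A := A) (R := R) (μ := μ) (c := c) n x
  have h3 := h _ _ h1
  rw [lp.inner_single_left] at h3
  rw [← hR, h3, inner_zero_right]

/-- Conjugation of the van Hove Hamiltonian by `e^{-a}`. -/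
theorem exists_isExp_vanHove {γ β g : ℝ} {B : ∀ n, E (n + 1) →L[ℂ] E n} (hA : IsCCR A γ)
    (hB : ∀ n : ℕ, ‖B n‖ ≤ β * √(n + 1))
    (hAR : lowering A * diagonal R = diagonal R * (lowering A + (g : ℂ) • lowering B))
    (hAB : lowering A * lowering B = lowering B * (lowering A + (g : ℂ) • lowering B))
    {χ Θ : lp E 2} (h : (χ, Θ) ∈ vanHove A R μ c) :
    ∃ θ : ∀ n, E n, loweringExp (fun n => -A n) χ = diagonal R θ ∧
      loweringExp (fun n => -A n) Θ = θ + (g : ℂ) • lowering B θ +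
        (μ : ℂ) • (number (diagonal R θ) + raising (adj A) (diagonal R θ)) +
        ((c - μ * γ ^ 2 : ℝ) : ℂ) • diagonal R θ := by
  obtain ⟨ξ, h1, h2⟩ := mem_vanHove.mp h
  clear h
  have hexp : ∀ {η : ∀ n, E n}, Growth η →
      IsExp (-lowering A) η (loweringExp (fun n => -A n) η) := fun hη =>
    isExp_loweringExp hA.neg.norm_le hA.nonneg hη
  have hχ := Growth.lp χ
  have hadj : ∀ n : ℕ, ‖adj A n‖ ≤ γ * √(n + 1) := fun n => by
    rw [LinearIsometryEquiv.norm_map]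
    exact hA.norm_le n
  -- ξ is Θ minus the coupling and need not be square-summable; exponential growth is all that
  -- e^{-a} requires.
  have hξ : Growth ξ := by
    have e1 : ξ = Θ + -(coupling A μ c χ) := by rw [h2]; abel
    rw [e1]
    exact (Growth.lp Θ).add ((((hχ.number.add (hχ.lowering hA.norm_le)).add
      (hχ.raising hadj)).smul _).add (hχ.smul _)).neg
  have hQ : Growth ((-((g : ℂ) • lowering B)) ξ) := ((hξ.lowering hB).smul (g : ℂ)).neg
  obtain ⟨P, hP⟩ : ∃ P, P = -(lowering A + (g : ℂ) • lowering B) := ⟨_, rfl⟩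
  obtain ⟨T, hT⟩ : ∃ T, T = -lowering A := ⟨_, rfl⟩
  rw [← hT] at hexp
  -- θ is e^P ξ with P = -(a + gB), written as e^T ξ + e^T Q ξ.
  obtain ⟨θ, hθ⟩ : ∃ θ, θ = loweringExp (fun n => -A n) ξ +
    loweringExp (fun n => -A n) ((-((g : ℂ) • lowering B)) ξ) := ⟨_, rfl⟩
  have h3 : IsExp P ξ θ := by
    rw [hθ]
    refine IsExp.add_of_semiconj (T := T) (Q := -((g : ℂ) • lowering B)) (by rw [hP, hT]; abel) ?_
      (hexp hξ) (hexp hQ)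
    ext1 η
    have := congrArg (fun U : (∀ n, E n) →L[ℂ] (∀ n, E n) => U η) hAB
    simp only [mul_apply_eq_comp, add_apply, smul_apply] at this
    simp only [hP, hT, mul_apply_eq_comp, add_apply, smul_apply, neg_apply, map_neg, map_smul,
      neg_neg, this, smul_neg]
  -- Since aR = R(a + gB), moving e^{-a} through R turns it into e^P.
  have h4 : IsExp T (diagonal R ξ) (diagonal R θ) := by
    refine IsExp.intertwine ?_ h3
    ext1 η
    have := congrArg (fun U : (∀ n, E n) →L[ℂ] (∀ n, E n) => U η) hAR
    simp only [mul_apply_eq_comp] at this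
    simp only [hP, hT, mul_apply_eq_comp, neg_apply, map_neg, this]
  have h5 : IsExp T (lowering B ξ) (lowering B θ) := by
    refine IsExp.intertwine ?_ h3
    ext1 η
    have := congrArg (fun U : (∀ n, E n) →L[ℂ] (∀ n, E n) => U η) hAB
    simp only [mul_apply_eq_comp] at this
    simp only [hP, hT, mul_apply_eq_comp, neg_apply, map_neg, this]
  have h6 : IsExp T (χ : ∀ n, E n) (diagonal R θ) := by rwa [h1]
  -- Because e^{-a}B = B e^P, the correction e^T Q ξ in θ equals -gBθ, so e^{-a}ξ is θ + gBθ.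
  have h7 : IsExp T ξ (θ + (g : ℂ) • lowering B θ) := by
    have e1 := (h5.smul (-(g : ℂ))).unique (by simpa using hexp hQ)
    have e2 : θ + (g : ℂ) • lowering B θ = loweringExp (fun n => -A n) ξ := by
      rw [eq_comm]
      have : loweringExp (fun n => -A n) ((-((g : ℂ) • lowering B)) ξ) =
        -(g : ℂ) • lowering B θ := by
          rw [e1]
          simp
      calc _ = θ - loweringExp (fun n => -A n) ((-((g : ℂ) • lowering B)) ξ) := by
            rw [hθ]; abel
        _ = _ := by rw [this]; module
    rw [e2]
    exact hexp hξ
  refine ⟨θ, (hexp hχ).unique h6, (hexp (Growth.lp Θ)).unique ?_⟩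
  clear hexp
  generalize hx : (χ : ∀ n, E n) = x at *
  generalize hφ : diagonal R θ = φ at *
  have e8 : T * number = number * T + T := by
    ext1 η
    funext n
    simp only [hT, mul_apply_eq_comp, neg_apply, add_apply, Pi.neg_apply, lowering_apply,
      number_apply, map_smul, Pi.add_apply]
    push_cast
    module
  have h8 : IsExp T (number x) (number φ + T φ) := h6.conj e8 rfl
  have e9 : T * raising (adj A) = raising (adj A) * T +
      -(((γ ^ 2 : ℝ) : ℂ) • (1 : (∀ n, E n) →L[ℂ] (∀ n, E n))) := by
    ext1 η
    have := hA.apply η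
    simp only [hT, mul_apply_eq_comp, neg_apply, add_apply, this, smul_apply, one_apply_eq_self,
      map_neg]
    abel
  have h9 := h6.conj e9 (by ext1 η; simp)
  have h10 : IsExp T (lowering A x) (lowering A φ) :=
    h6.intertwine (by ext1 η; simp [hT])
  have h11 := h7.add ((((h8.add h10).add h9).smul (μ : ℂ)).add (h6.smul (c : ℂ)))
  rw [h2]
  -- Conjugating the number operator produces -a, which cancels the +a of the coupling; conjugating
  -- a* produces the scalar -γ².
  have e12 : θ + (g : ℂ) • lowering B θ + (μ : ℂ) • (number φ + raising (adj A) φ) +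
      ((c - μ * γ ^ 2 : ℝ) : ℂ) • φ = θ + (g : ℂ) • lowering B θ +
      ((μ : ℂ) • (number φ + T φ + lowering A φ + (raising (adj A) φ +
        (-(((γ ^ 2 : ℝ) : ℂ) • (1 : (∀ n, E n) →L[ℂ] (∀ n, E n)))) φ)) + (c : ℂ) • φ) := by
    simp only [hT, neg_apply, smul_apply, one_apply_eq_self]
    push_cast
    module
  rw [e12]
  exact h11

end VanHove

/-! ### Square-integrable functions: norms, Cauchy-Schwarz, bounded multiplication operators. -/

section L2

variable {α : Type*} [MeasurableSpace α] {μ : Measure α}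

theorem memLp_two_iff_integrable {f : α → ℂ} (hf : AEStronglyMeasurable f μ) :
    MemLp f 2 μ ↔ Integrable (fun x => ‖f x‖ ^ 2) μ := memLp_two_iff_integrable_sq_norm hf

theorem norm_sq_Lp_eq_integral (F : Lp ℂ 2 μ) : ‖F‖ ^ 2 = ∫ x, ‖F x‖ ^ 2 ∂μ := by
  have h : inner ℂ F F = ∫ x, inner ℂ (F x) (F x) ∂μ := L2.inner_def F F
  simp_rw [inner_self_ofReal] at h
  rw [integral_complex_ofReal] at h
  exact_mod_cast h

theorem norm_sq_toLp_eq_integral {f : α → ℂ} (hf : MemLp f 2 μ) :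
    ‖hf.toLp f‖ ^ 2 = ∫ x, ‖f x‖ ^ 2 ∂μ := by
  rw [norm_sq_Lp_eq_integral]
  refine integral_congr_ae ?_
  filter_upwards [hf.coeFn_toLp] with x hx
  rw [hx]

theorem norm_integral_mul_sq_le {f g : α → ℂ} (hf : MemLp f 2 μ) (hg : MemLp g 2 μ) :
    ‖∫ x, f x * g x ∂μ‖ ^ 2 ≤ (∫ x, ‖f x‖ ^ 2 ∂μ) * ∫ x, ‖g x‖ ^ 2 ∂μ := by
  have h1 := integral_mul_norm_le_Lp_mul_Lq (μ := μ) (f := f) (g := g) Real.HolderConjugate.two_two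
    (by simpa using hf) (by simpa using hg)
  have h2 : ‖∫ x, f x * g x ∂μ‖ ≤ ∫ x, ‖f x‖ * ‖g x‖ ∂μ := by
    refine (norm_integral_le_integral_norm _).trans (le_of_eq ?_)
    simp_rw [norm_mul]
  have h3 := pow_le_pow_left₀ (norm_nonneg _) (h2.trans h1) 2
  refine h3.trans (le_of_eq ?_)
  rw [mul_pow]
  have h0 : ∀ u : α → ℂ, 0 ≤ ∫ x, ‖u x‖ ^ (2 : ℝ) ∂μ := fun u => integral_nonneg fun x => by positivity
  rw [← Real.sqrt_eq_rpow, ← Real.sqrt_eq_rpow, Real.sq_sqrt (h0 f), Real.sq_sqrt (h0 g)]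
  simp

theorem integrable_mul_of_memLp_two {f g : α → ℂ} (hf : MemLp f 2 μ) (hg : MemLp g 2 μ) :
    Integrable (fun x => f x * g x) μ := hf.integrable_mul hg

theorem memLp_bounded_mul {r : α → ℝ} (hr : Measurable r) (hb : ∀ x, |r x| ≤ 1) {f : α → ℂ}
    (hf : MemLp f 2 μ) : MemLp (fun x => (r x : ℂ) * f x) 2 μ :=
  hf.of_le ((Complex.measurable_ofReal.comp hr).aestronglyMeasurable.mul hf.1)
    (.of_forall fun x => by
      rw [norm_mul, Complex.norm_real]
      exact mul_le_of_le_one_left (norm_nonneg _) (hb x))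

/-- Multiplication by a bounded measurable real function on `L²`. -/
def mulOp (r : α → ℝ) (hr : Measurable r) (hb : ∀ x, |r x| ≤ 1) : Lp ℂ 2 μ →L[ℂ] Lp ℂ 2 μ :=
  have hm (F : Lp ℂ 2 μ) := memLp_bounded_mul hr hb (Lp.memLp F)
  LinearMap.mkContinuous
    { toFun := fun F => (hm F).toLp
      map_add' := fun F G => by
        ext1
        filter_upwards [(hm (F + G)).coeFn_toLp, Lp.coeFn_add ((hm F).toLp) ((hm G).toLp),
          (hm F).coeFn_toLp, (hm G).coeFn_toLp, Lp.coeFn_add F G] with x h1 h2 h3 h4 h5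
        rw [h1, h2, Pi.add_apply, h3, h4, h5, Pi.add_apply, mul_add]
      map_smul' := fun c F => by
        ext1
        filter_upwards [(hm (c • F)).coeFn_toLp, Lp.coeFn_smul c ((hm F).toLp),
          (hm F).coeFn_toLp, Lp.coeFn_smul c F] with x h1 h2 h3 h4
        simp only [RingHom.id_apply]
        rw [h1, h2, Pi.smul_apply, h3, h4, Pi.smul_apply, smul_eq_mul, smul_eq_mul]
        ring }
    1 fun F => by
      rw [one_mul, ← sq_le_sq₀ (norm_nonneg _) (norm_nonneg _)]
      change ‖(hm F).toLp‖ ^ 2 ≤ _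
      rw [norm_sq_toLp_eq_integral, norm_sq_Lp_eq_integral]
      refine integral_mono_of_nonneg (.of_forall fun x => by positivity)
        ((memLp_two_iff_integrable (Lp.aestronglyMeasurable F)).mp (Lp.memLp F))
        (.of_forall fun x => ?_)
      simp only [norm_mul, Complex.norm_real]
      gcongr
      exact mul_le_of_le_one_left (norm_nonneg _) (hb x)

theorem coeFn_mulOp (r : α → ℝ) (hr : Measurable r) (hb : ∀ x, |r x| ≤ 1) (F : Lp ℂ 2 μ) :
    mulOp r hr hb F =ᵐ[μ] fun x => (r x : ℂ) * F x :=
  (memLp_bounded_mul hr hb (Lp.memLp F)).coeFn_toLp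

end L2

/-! ### Inserting and deleting a particle, Fubini, and kernels integrated over one particle. -/

section Slices

variable {n : ℕ}

/-- The configuration `k` with a further particle at `p`, in the place `j`. -/
abbrev ins (j : Fin (n + 1)) (p : Space) (k : Config n) : Config (n + 1) :=
  Fin.insertNth (α := fun _ => Space) j p k

/-- The configuration `k` without its `j`-th particle. -/
abbrev del (j : Fin (n + 1)) (k : Config (n + 1)) : Config n := fun i => k (j.succAbove i)

theorem ins_last (p : Space) (k : Config n) : ins (Fin.last n) p k = addParticle k p :=
  Fin.insertNth_last' p k

theorem ins_del (j : Fin (n + 1)) (k : Config (n + 1)) : ins j (k j) (del j k) = k :=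
  Fin.insertNth_self_removeNth j k

theorem del_ins (j : Fin (n + 1)) (p : Space) (k : Config n) : del j (ins j p k) = k := by
  funext i
  simp [del, ins]

theorem measurePreserving_ins (j : Fin (n + 1)) :
    MeasurePreserving (fun q : Space × Config n => ins j q.1 q.2) volume volume :=
  (volume_preserving_piFinSuccAbove (fun _ : Fin (n + 1) => Space) j).symm

theorem measurableEmbedding_ins (j : Fin (n + 1)) :
    MeasurableEmbedding (fun q : Space × Config n => ins j q.1 q.2) :=
  (MeasurableEquiv.piFinSuccAbove (fun _ : Fin (n + 1) => Space) j).symm.measurableEmbedding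

theorem measurePreserving_split (j : Fin (n + 1)) :
    MeasurePreserving (fun k : Config (n + 1) => (k j, del j k)) volume volume :=
  volume_preserving_piFinSuccAbove (fun _ : Fin (n + 1) => Space) j

theorem quasiMeasurePreserving_del (j : Fin (n + 1)) :
    Measure.QuasiMeasurePreserving (del j : Config (n + 1) → Config n) volume volume :=
  Measure.quasiMeasurePreserving_snd.comp (measurePreserving_split j).quasiMeasurePreserving

theorem integral_ins (j : Fin (n + 1)) {f : Config (n + 1) → ℂ} (hf : Integrable f) :
    ∫ k, f k = ∫ k : Config n, ∫ p : Space, f (ins j p k) := by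
  rw [← (measurePreserving_ins j).integral_comp (measurableEmbedding_ins j)]
  have h1 := ((measurePreserving_ins j).integrable_comp_emb (measurableEmbedding_ins j)).mpr hf
  exact integral_prod_symm _ h1

theorem integrable_ins_iff (j : Fin (n + 1)) {F : Type*} [NormedAddCommGroup F]
    {f : Config (n + 1) → F} :
    Integrable (fun q : Space × Config n => f (ins j q.1 q.2)) ↔ Integrable f :=
  (measurePreserving_ins j).integrable_comp_emb (measurableEmbedding_ins j)

theorem ae_ins_iff (j : Fin (n + 1)) {P : Config (n + 1) → Prop} :
    (∀ᵐ q : Space × Config n, P (ins j q.1 q.2)) ↔ ∀ᵐ k, P k := by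
  refine ⟨fun h => ?_, fun h => (measurePreserving_ins j).quasiMeasurePreserving.ae h⟩
  have := (measurePreserving_split j).quasiMeasurePreserving.ae h
  filter_upwards [this] with k hk
  simpa [ins_del] using hk

theorem ae_ae_swap {P : Space × Config n → Prop} (h : ∀ᵐ q : Space × Config n, P q) :
    ∀ᵐ k : Config n, ∀ᵐ p : Space, P (p, k) := by
  have h1 : ∀ᵐ q : Config n × Space, P q.swap :=
    (Measure.measurePreserving_swap (μ := (volume : Measure (Config n)))
      (ν := (volume : Measure Space))).quasiMeasurePreserving.ae h
  exact Measure.ae_ae_of_ae_prod h1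

theorem ae_ae_ins (j : Fin (n + 1)) {P : Config (n + 1) → Prop} (h : ∀ᵐ k, P k) :
    ∀ᵐ k : Config n, ∀ᵐ p : Space, P (ins j p k) :=
  ae_ae_swap (P := fun q => P (ins j q.1 q.2)) ((ae_ins_iff j).mpr h)

theorem memLp_ins (j : Fin (n + 1)) {χ : Config (n + 1) → ℂ} (hχ : MemLp χ 2) :
    MemLp (fun q : Space × Config n => χ (ins j q.1 q.2)) 2 :=
  hχ.comp_measurePreserving (measurePreserving_ins j)

theorem ae_memLp_slice (j : Fin (n + 1)) {χ : Config (n + 1) → ℂ} (hχ : MemLp χ 2) :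
    ∀ᵐ k : Config n, MemLp (fun p => χ (ins j p k)) 2 := by
  have h1 := memLp_ins j hχ
  have h2 := (memLp_two_iff_integrable h1.1).mp h1
  filter_upwards [h2.prod_left_ae, h1.1.prodMk_right] with k hk hk'
  exact (memLp_two_iff_integrable hk').mpr hk

theorem integrable_slice_norm_sq (j : Fin (n + 1)) {χ : Config (n + 1) → ℂ} (hχ : MemLp χ 2) :
    Integrable (fun k : Config n => ∫ p, ‖χ (ins j p k)‖ ^ 2) ∧
      ∫ k : Config n, ∫ p, ‖χ (ins j p k)‖ ^ 2 = ∫ k, ‖χ k‖ ^ 2 := by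
  have h1 := memLp_ins j hχ
  have h2 := (memLp_two_iff_integrable h1.1).mp h1
  refine ⟨h2.integral_prod_right, ?_⟩
  rw [← (measurePreserving_ins j).integral_comp (measurableEmbedding_ins j)]
  exact (integral_prod_symm _ h2).symm

/-- A tensor product of square-integrable functions. -/
theorem memLp_tensor (j : Fin (n + 1)) {f : Space → ℂ} (hf : MemLp f 2) {ξ : Config n → ℂ}
    (hξ : MemLp ξ 2) : MemLp (fun k : Config (n + 1) => f (k j) * ξ (del j k)) 2 := by
  have h1 : MemLp (fun q : Space × Config n => f q.1 * ξ q.2) 2 := by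
    have hm : AEStronglyMeasurable (fun q : Space × Config n => f q.1 * ξ q.2) :=
      hf.1.comp_fst.mul hξ.1.comp_snd
    rw [memLp_two_iff_integrable hm]
    have := ((memLp_two_iff_integrable hf.1).mp hf).mul_prod
      ((memLp_two_iff_integrable hξ.1).mp hξ)
    refine this.congr (.of_forall fun q => ?_)
    simp only [norm_mul]
    ring
  exact h1.comp_measurePreserving (measurePreserving_split j)

/-- Integration of a square-integrable function over one particle against a kernel. -/
def sliceInt (w : Config (n + 1) → ℝ) (χ : Config (n + 1) → ℂ) (k : Config n) : ℂ :=
  ∫ p, (w (ins (Fin.last n) p k) : ℂ) * χ (ins (Fin.last n) p k)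

variable {ϑ : Space → ℝ} {w : Config (n + 1) → ℝ}

theorem ae_memLp_kernel (hϑ : MemLp (fun p => (ϑ p : ℂ)) 2) (hw : Measurable w)
    (hwϑ : ∀ k, |w k| ≤ ϑ (k (Fin.last n))) (k : Config n) :
    MemLp (fun p => (w (ins (Fin.last n) p k) : ℂ)) 2 := by
  refine hϑ.of_le ?_ (.of_forall fun p => ?_)
  · refine (Complex.measurable_ofReal.comp (hw.comp ?_)).aestronglyMeasurable
    exact (measurePreserving_ins (Fin.last n)).measurable.comp measurable_prodMk_right
  · have := hwϑ (ins (Fin.last n) p k)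
    simp only [ins, Fin.insertNth_apply_same] at this
    rw [Complex.norm_real, Complex.norm_real]
    exact this.trans (le_abs_self _)

theorem sliceInt_congr {χ χ' : Config (n + 1) → ℂ} (h : χ =ᵐ[volume] χ') :
    sliceInt w χ =ᵐ[volume] sliceInt w χ' := by
  filter_upwards [ae_ae_ins (Fin.last n) h] with k hk
  exact integral_congr_ae (hk.mono fun p hp => by simp only [hp])

theorem norm_sliceInt_sq_le (hϑ : MemLp (fun p => (ϑ p : ℂ)) 2) (hw : Measurable w)
    (hwϑ : ∀ k, |w k| ≤ ϑ (k (Fin.last n))) {χ : Config (n + 1) → ℂ} (hχ : MemLp χ 2) :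
    ∀ᵐ k : Config n, ‖sliceInt w χ k‖ ^ 2 ≤
      (∫ p, ϑ p ^ 2) * ∫ p, ‖χ (ins (Fin.last n) p k)‖ ^ 2 := by
  filter_upwards [ae_memLp_slice (Fin.last n) hχ] with k hk
  refine (norm_integral_mul_sq_le (ae_memLp_kernel hϑ hw hwϑ k) hk).trans ?_
  refine mul_le_mul_of_nonneg_right ?_ (integral_nonneg fun p => by positivity)
  refine integral_mono ((memLp_two_iff_integrable (ae_memLp_kernel hϑ hw hwϑ k).1).mp
    (ae_memLp_kernel hϑ hw hwϑ k)) ?_ fun p => ?_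
  · simpa using (memLp_two_iff_integrable hϑ.1).mp hϑ
  · have := hwϑ (ins (Fin.last n) p k)
    simp only [ins, Fin.insertNth_apply_same] at this
    simp only [Complex.norm_real, Real.norm_eq_abs]
    exact pow_le_pow_left₀ (abs_nonneg _) this 2

/-- Cauchy-Schwarz in the last particle, with the kernel dominated by ϑ uniformly in the other
particles, integrated over those. -/
theorem memLp_sliceInt (hϑ : MemLp (fun p => (ϑ p : ℂ)) 2) (hw : Measurable w)
    (hwϑ : ∀ k, |w k| ≤ ϑ (k (Fin.last n))) {χ : Config (n + 1) → ℂ} (hχ : MemLp χ 2) :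
    MemLp (sliceInt w χ) 2 ∧
      ∫ k, ‖sliceInt w χ k‖ ^ 2 ≤ (∫ p, ϑ p ^ 2) * ∫ k, ‖χ k‖ ^ 2 := by
  have h1 := integrable_slice_norm_sq (Fin.last n) hχ
  have hm : AEStronglyMeasurable (sliceInt w χ) := by
    have h2 : AEStronglyMeasurable (fun q : Space × Config n =>
        (w (ins (Fin.last n) q.1 q.2) : ℂ) * χ (ins (Fin.last n) q.1 q.2)) :=
      (Complex.measurable_ofReal.comp
        (hw.comp (measurePreserving_ins (Fin.last n)).measurable)).aestronglyMeasurable.mul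
        (memLp_ins (Fin.last n) hχ).1
    exact h2.prod_swap.integral_prod_right'
  have h3 := norm_sliceInt_sq_le hϑ hw hwϑ hχ
  have h4 : Integrable (fun k => ‖sliceInt w χ k‖ ^ 2) :=
    (h1.1.const_mul (∫ p, ϑ p ^ 2)).mono' (hm.norm.pow 2) (h3.mono fun k hk => by
      rwa [Real.norm_of_nonneg (by positivity)])
  refine ⟨(memLp_two_iff_integrable hm).mpr h4, ?_⟩
  rw [← h1.2, ← integral_const_mul]
  exact integral_mono_ae h4 (h1.1.const_mul _) h3

end Slices

/-! ### Symmetric sectors and operators between neighbouring sectors. -/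

section SectorOps

variable {n : ℕ}

theorem mem_sector_iff {φ : Lp ℂ 2 (volume : Measure (Config n))} :
    φ ∈ Sector n ↔ ∀ σ : Equiv.Perm (Fin n), (fun k => φ (k ∘ σ)) =ᵐ[volume] φ := by
  constructor
  · intro h σ
    have h1 := Lp.coeFn_compMeasurePreserving φ (measurePreserving_perm σ)
    rw [h σ] at h1
    exact h1.symm
  · intro h σ
    ext1
    exact (Lp.coeFn_compMeasurePreserving φ (measurePreserving_perm σ)).trans (h σ)

theorem sector_comp_perm (φ : Sector n) (σ : Equiv.Perm (Fin n)) :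
    ∀ᵐ k, φ.1 (k ∘ σ) = φ.1 k := mem_sector_iff.mp φ.2 σ

/-- Build an element of a sector from a symmetric function. -/
def mkSector (f : Config n → ℂ) (hf : MemLp f 2)
    (h : ∀ σ : Equiv.Perm (Fin n), (fun k => f (k ∘ σ)) =ᵐ[volume] f) : Sector n :=
  ⟨hf.toLp f, mem_sector_iff.mpr fun σ => by
    have h1 := (measurePreserving_perm σ).quasiMeasurePreserving.ae_eq_comp hf.coeFn_toLp
    exact h1.trans ((h σ).trans hf.coeFn_toLp.symm)⟩

theorem coeFn_mkSector {f : Config n → ℂ} (hf : MemLp f 2)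
    (h : ∀ σ : Equiv.Perm (Fin n), (fun k => f (k ∘ σ)) =ᵐ[volume] f) :
    (mkSector f hf h).1 =ᵐ[volume] f := hf.coeFn_toLp

theorem Sector.ext_ae {φ φ' : Sector n}
    (h : φ.1 =ᵐ[volume] φ'.1) : φ = φ' :=
  Subtype.ext (Lp.ext h)

theorem coeFn_sector_add (φ φ' : Sector n) : (φ + φ').1 =ᵐ[volume]
    fun k => φ.1 k + φ'.1 k :=
  Lp.coeFn_add φ.1 φ'.1

theorem coeFn_sector_smul (c : ℂ) (φ : Sector n) : (c • φ).1 =ᵐ[volume]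
    fun k => c * φ.1 k :=
  Lp.coeFn_smul c φ.1

theorem coeFn_sector_zero : (0 : Sector n).1 =ᵐ[volume] fun _ => 0 :=
  Lp.coeFn_zero _ _ _

theorem norm_sector_sq (φ : Sector n) :
    ‖φ‖ ^ 2 = ∫ k, ‖φ.1 k‖ ^ 2 :=
  norm_sq_Lp_eq_integral φ.1

theorem inner_sector (φ φ' : Sector n) : inner ℂ φ φ' =
    ∫ k, (starRingEnd ℂ) (φ.1 k) * φ'.1 k := by
  have h : inner ℂ φ φ' = inner ℂ φ.1 φ'.1 := rfl
  rw [h, L2.inner_def]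
  refine integral_congr_ae (.of_forall fun k => ?_)
  simp [mul_comm]

/-- The permutation that moves the last place to the place `j`. -/
def insPerm (j : Fin (n + 1)) : Equiv.Perm (Fin (n + 1)) :=
  (finSuccEquiv' j).trans (finSuccEquiv' (Fin.last n)).symm

theorem ins_last_comp_insPerm (j : Fin (n + 1)) (p : Space) (k : Config n) :
    ins (Fin.last n) p k ∘ insPerm j = ins j p k := by
  funext i
  rcases Fin.eq_self_or_eq_succAbove j i with rfl | ⟨i, rfl⟩
  · simp only [Function.comp_apply, insPerm, Equiv.trans_apply, finSuccEquiv'_at,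
      finSuccEquiv'_symm_none, ins, Fin.insertNth_apply_same]
  · simp only [Function.comp_apply, insPerm, Equiv.trans_apply, finSuccEquiv'_succAbove,
      finSuccEquiv'_symm_some, ins, Fin.insertNth_apply_succAbove]

/-- The extension of a permutation to one more place, which is fixed. -/
def extendPerm (σ : Equiv.Perm (Fin n)) : Equiv.Perm (Fin (n + 1)) :=
  (finSuccEquiv' (Fin.last n)).trans (σ.optionCongr.trans (finSuccEquiv' (Fin.last n)).symm)

theorem ins_last_comp_extendPerm (σ : Equiv.Perm (Fin n)) (p : Space) (k : Config n) :
    ins (Fin.last n) p k ∘ extendPerm σ = ins (Fin.last n) p (k ∘ σ) := by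
  funext i
  rcases Fin.eq_self_or_eq_succAbove (Fin.last n) i with rfl | ⟨i, rfl⟩
  · simp only [Function.comp_apply, extendPerm, Equiv.trans_apply, finSuccEquiv'_at,
      Equiv.optionCongr_apply, Option.map_none, finSuccEquiv'_symm_none, ins,
      Fin.insertNth_apply_same]
  · simp only [Function.comp_apply, extendPerm, Equiv.trans_apply, finSuccEquiv'_succAbove,
      Equiv.optionCongr_apply, Option.map_some, finSuccEquiv'_symm_some, ins,
      Fin.insertNth_apply_succAbove]

/-- The permutation of the remaining places when a permutation is applied before deleting `j`. -/
def delPerm (σ : Equiv.Perm (Fin (n + 1))) (j : Fin (n + 1)) : Equiv.Perm (Fin n) :=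
  ((finSuccAboveEquiv j).trans ((σ.subtypeEquiv fun a => by simp).trans
    (finSuccAboveEquiv (σ j)).symm))

theorem del_comp_perm (σ : Equiv.Perm (Fin (n + 1))) (j : Fin (n + 1)) (k : Config (n + 1)) :
    del j (k ∘ σ) = del (σ j) k ∘ delPerm σ j := by
  funext i
  simp only [del, Function.comp_apply, delPerm, Equiv.trans_apply]
  congr 1
  have h := (finSuccAboveEquiv (σ j)).apply_symm_apply
    ((σ.subtypeEquiv (fun a => by simp) : {x // x ≠ j} ≃ {x // x ≠ σ j}) (finSuccAboveEquiv j i))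
  have h2 := congrArg Subtype.val h
  exact h2.symm

/-- Kernels that are dominated by a square-integrable function of the last particle and symmetric
in the others. -/
structure SliceKernel (ϑ : Space → ℝ) (w : Config (n + 1) → ℝ) : Prop where
  memLp : MemLp (fun p => (ϑ p : ℂ)) 2
  measurable : Measurable w
  le : ∀ k, |w k| ≤ ϑ (k (Fin.last n))
  symm : ∀ (σ : Equiv.Perm (Fin n)) p k, w (ins (Fin.last n) p (k ∘ σ)) = w (ins (Fin.last n) p k)

variable {ϑ : Space → ℝ} {w : Config (n + 1) → ℝ}

theorem SliceKernel.symm_sliceInt (hw : SliceKernel ϑ w) (χ : Sector (n + 1))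
    (σ : Equiv.Perm (Fin n)) : (fun k => sliceInt w χ.1 (k ∘ σ)) =ᵐ[volume]
      sliceInt w χ.1 := by
  filter_upwards [ae_ae_ins (Fin.last n) (sector_comp_perm χ (extendPerm σ))] with k hk
  refine integral_congr_ae (hk.mono fun p hp => ?_)
  simp only at hp ⊢
  rw [hw.symm, ← hp, ins_last_comp_extendPerm]

theorem SliceKernel.memLp_smul (hw : SliceKernel ϑ w) (χ : Sector (n + 1)) (c : ℂ) :
    MemLp (fun k => c * sliceInt w χ.1 k) 2 :=
  (memLp_sliceInt hw.memLp hw.measurable hw.le (Lp.memLp _)).1.const_mul c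

theorem SliceKernel.integrable (hw : SliceKernel ϑ w) {χ : Config (n + 1) → ℂ} (hχ : MemLp χ 2) :
    ∀ᵐ k : Config n, Integrable fun p =>
      (w (ins (Fin.last n) p k) : ℂ) * χ (ins (Fin.last n) p k) := by
  filter_upwards [ae_memLp_slice (Fin.last n) hχ] with k hk
  exact integrable_mul_of_memLp_two (ae_memLp_kernel hw.memLp hw.measurable hw.le k) hk

/-- The operator `√(n+1) ∫ w(k, p) χ(k, p) dp` between sectors. -/
def SliceKernel.op (hw : SliceKernel ϑ w) : Sector (n + 1) →L[ℂ] Sector n :=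
  have hs (χ : Sector (n + 1)) (σ : Equiv.Perm (Fin n)) :
      (fun k => (√(n + 1 : ℝ) : ℂ) * sliceInt w χ.1 (k ∘ σ)) =ᵐ[volume]
        fun k => (√(n + 1 : ℝ) : ℂ) * sliceInt w χ.1 k :=
    (hw.symm_sliceInt χ σ).mono fun k hk => by simp only at hk ⊢; rw [hk]
  LinearMap.mkContinuous
    { toFun := fun χ => mkSector _ (hw.memLp_smul χ (√(n + 1 : ℝ) : ℂ)) (hs χ)
      map_add' := fun χ χ' => by
        apply Sector.ext_ae
        filter_upwards [coeFn_mkSector (hw.memLp_smul (χ + χ') (√(n + 1 : ℝ) : ℂ)) (hs (χ + χ')),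
          coeFn_sector_add (mkSector _ (hw.memLp_smul χ (√(n + 1 : ℝ) : ℂ)) (hs χ))
            (mkSector _ (hw.memLp_smul χ' (√(n + 1 : ℝ) : ℂ)) (hs χ')),
          coeFn_mkSector (hw.memLp_smul χ (√(n + 1 : ℝ) : ℂ)) (hs χ),
          coeFn_mkSector (hw.memLp_smul χ' (√(n + 1 : ℝ) : ℂ)) (hs χ'),
          sliceInt_congr (w := w) (coeFn_sector_add χ χ'), hw.integrable (Lp.memLp χ.1),
          hw.integrable (Lp.memLp χ'.1)] with k h1 h2 h3 h4 h5 h6 h7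
        rw [h1, h2, h3, h4, h5, ← mul_add]
        congr 1
        simp only [sliceInt, mul_add]
        exact integral_add h6 h7
      map_smul' := fun c χ => by
        apply Sector.ext_ae
        filter_upwards [coeFn_mkSector (hw.memLp_smul (c • χ) (√(n + 1 : ℝ) : ℂ)) (hs (c • χ)),
          coeFn_sector_smul c (mkSector _ (hw.memLp_smul χ (√(n + 1 : ℝ) : ℂ)) (hs χ)),
          coeFn_mkSector (hw.memLp_smul χ (√(n + 1 : ℝ) : ℂ)) (hs χ),
          sliceInt_congr (w := w) (coeFn_sector_smul c χ)] with k h1 h2 h3 h4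
        simp only [RingHom.id_apply]
        rw [h1, h2, h3, h4, mul_left_comm]
        congr 1
        simp only [sliceInt, ← integral_const_mul]
        exact integral_congr_ae (.of_forall fun p => by ring) }
    (√(∫ p, ϑ p ^ 2) * √(n + 1 : ℝ)) fun χ => by
      have h0 : 0 ≤ ∫ p, ϑ p ^ 2 := integral_nonneg fun p => by positivity
      rw [← sq_le_sq₀ (norm_nonneg _) (by positivity)]
      change ‖mkSector _ (hw.memLp_smul χ (√(n + 1 : ℝ) : ℂ)) (hs χ)‖ ^ 2 ≤ _
      have h1 : ‖mkSector _ (hw.memLp_smul χ (√(n + 1 : ℝ) : ℂ)) (hs χ)‖ ^ 2 =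
          ((n : ℝ) + 1) * ∫ k, ‖sliceInt w χ.1 k‖ ^ 2 := by
        refine (norm_sq_toLp_eq_integral (hw.memLp_smul χ (√(n + 1 : ℝ) : ℂ))).trans ?_
        rw [← integral_const_mul]
        refine integral_congr_ae (.of_forall fun k => ?_)
        simp only [norm_mul, mul_pow, Complex.norm_real, Real.norm_eq_abs, sq_abs]
        rw [Real.sq_sqrt (by positivity)]
      rw [h1, mul_pow, mul_pow, Real.sq_sqrt h0, Real.sq_sqrt (by positivity), norm_sector_sq]
      have := (memLp_sliceInt hw.memLp hw.measurable hw.le (Lp.memLp χ.1)).2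
      nlinarith [mul_le_mul_of_nonneg_left this (by positivity : (0 : ℝ) ≤ (n : ℝ) + 1)]

theorem SliceKernel.coeFn_op (hw : SliceKernel ϑ w) (χ : Sector (n + 1)) :
    (hw.op χ).1 =ᵐ[volume]
      fun k => (√(n + 1 : ℝ) : ℂ) * sliceInt w χ.1 k :=
  (hw.memLp_smul χ (√(n + 1 : ℝ) : ℂ)).coeFn_toLp

theorem SliceKernel.norm_op_le (hw : SliceKernel ϑ w) :
    ‖hw.op‖ ≤ √(∫ p, ϑ p ^ 2) * √(n + 1 : ℝ) := by
  unfold SliceKernel.op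
  exact LinearMap.mkContinuous_norm_le _ (by positivity) _

end SectorOps

/-! ### The resolvent, the annihilation operator of -g/h, the trace operator and creation. -/

section Momentum

variable {n : ℕ}

/-- A measurable positive one-particle energy whose inverse is square-integrable. -/
structure IsDispersion (h : Space → ℝ) : Prop where
  pos : ∀ p, 0 < h p
  measurable : Measurable h
  memLp : MemLp (fun p => (((h p)⁻¹ : ℝ) : ℂ)) 2

/-- One plus the total energy. -/
def energy (h : Space → ℝ) (k : Config n) : ℝ := 1 + ∑ j, h (k j)

variable {h : Space → ℝ}

theorem energy_ins (j : Fin (n + 1)) (p : Space) (k : Config n) :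
    energy h (ins j p k) = h p + energy h k := by
  simp only [energy, ins]
  rw [Fin.sum_univ_succAbove _ j]
  simp
  ring

theorem energy_comp_perm (σ : Equiv.Perm (Fin n)) (k : Config n) :
    energy h (k ∘ σ) = energy h k := by
  simp only [energy, Function.comp_apply]
  rw [Equiv.sum_comp σ fun j => h (k j)]

namespace IsDispersion

theorem one_le_energy (hh : IsDispersion h) (k : Config n) : 1 ≤ energy h k := by
  have : 0 ≤ ∑ j, h (k j) := Finset.sum_nonneg fun j _ => (hh.pos _).le
  simp only [energy]
  linarith

theorem energy_pos (hh : IsDispersion h) (k : Config n) : 0 < energy h k := one_pos.trans_le (hh.one_le_energy k)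

theorem le_energy (hh : IsDispersion h) (j : Fin n) (k : Config n) : h (k j) ≤ energy h k := by
  have := Finset.single_le_sum (f := fun j => h (k j)) (fun j _ => (hh.pos (k j)).le)
    (Finset.mem_univ j)
  simp only [energy]
  linarith

theorem measurable_energy (hh : IsDispersion h) : Measurable (energy h : Config n → ℝ) := by
  have := hh.measurable
  unfold energy
  fun_prop

theorem abs_inv_energy_le (hh : IsDispersion h) (k : Config n) : |(energy h k)⁻¹| ≤ 1 := by
  rw [abs_of_pos (inv_pos.mpr (hh.energy_pos k))]
  exact inv_le_one_of_one_le₀ (hh.one_le_energy k)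

/-- Multiplication by the inverse energy. -/
def resolvent (hh : IsDispersion h) : Sector n →L[ℂ] Sector n :=
  ((mulOp (fun k : Config n => (energy h k)⁻¹) hh.measurable_energy.inv hh.abs_inv_energy_le).comp
    (Sector n).subtypeL).codRestrict (Sector n) fun φ => mem_sector_iff.mpr fun σ => by
    have h1 := coeFn_mulOp (fun k : Config n => (energy h k)⁻¹) hh.measurable_energy.inv
      hh.abs_inv_energy_le φ.1
    have h2 := (measurePreserving_perm σ).quasiMeasurePreserving.ae_eq_comp h1
    refine h2.trans (EventuallyEq.trans ?_ h1.symm)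
    filter_upwards [sector_comp_perm φ σ] with k hk
    simp only [Function.comp_apply] at hk ⊢
    have h3 := energy_comp_perm (h := h) σ k
    simp only [Function.comp_def] at h3 hk ⊢
    rw [h3, hk]

theorem coeFn_resolvent (hh : IsDispersion h) (φ : Sector n) :
    (hh.resolvent φ).1 =ᵐ[volume] fun k => (((energy h k)⁻¹ : ℝ) : ℂ) * φ.1 k :=
  coeFn_mulOp (fun k : Config n => (energy h k)⁻¹) hh.measurable_energy.inv
    hh.abs_inv_energy_le φ.1

theorem resolvent_injective (hh : IsDispersion h) : Function.Injective (hh.resolvent : Sector n →L[ℂ] Sector n) := by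
  intro φ φ' hφ
  apply Sector.ext_ae
  filter_upwards [hh.coeFn_resolvent φ, hh.coeFn_resolvent φ'] with k h1 h2
  rw [hφ] at h1
  rw [h1] at h2
  have h3 : (((energy h k)⁻¹ : ℝ) : ℂ) ≠ 0 := by
    exact_mod_cast (inv_pos.mpr (hh.energy_pos k)).ne'
  exact mul_left_cancel₀ h3 h2

theorem resolvent_symmetric (hh : IsDispersion h) (φ φ' : Sector n) :
    inner ℂ (hh.resolvent φ) φ' = inner ℂ φ (hh.resolvent φ') := by
  rw [inner_sector, inner_sector]
  refine integral_congr_ae ?_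
  filter_upwards [hh.coeFn_resolvent φ, hh.coeFn_resolvent φ'] with k h1 h2
  rw [h1, h2, map_mul, Complex.conj_ofReal]
  ring

theorem sliceKernel_inv (hh : IsDispersion h) :
    SliceKernel (fun p => (h p)⁻¹) (fun k : Config (n + 1) => (h (k (Fin.last n)))⁻¹) where
  memLp := hh.memLp
  measurable := (hh.measurable.comp (measurable_pi_apply (Fin.last n))).inv
  le := fun k => by rw [abs_of_pos (inv_pos.mpr (hh.pos _))]
  symm := fun σ p k => by simp [ins]

/-- The total energy dominates that of the last particle, so 1/Λ ≤ 1/h(p), and 1/h is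
square-integrable. -/
theorem sliceKernel_inv_energy (hh : IsDispersion h) :
    SliceKernel (fun p => (h p)⁻¹) (fun k : Config (n + 1) => (energy h k)⁻¹) where
  memLp := hh.memLp
  measurable := hh.measurable_energy.inv
  le := fun k => by
    rw [abs_of_pos (inv_pos.mpr (hh.energy_pos _))]
    exact inv_anti₀ (hh.pos _) (hh.le_energy _ k)
  symm := fun σ p k => by rw [energy_ins, energy_ins, energy_comp_perm]

/-- Annihilation of a particle with the wave function `-g / h`. -/
def ann (hh : IsDispersion h) (g : ℝ) (n : ℕ) : Sector (n + 1) →L[ℂ] Sector n :=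
  (-(g : ℂ)) • (hh.sliceKernel_inv (n := n)).op

/-- The restriction of `R χ` to coinciding positions, `√(n+1) ∫ χ(k, p) / Λ(k, p) dp`. -/
def traceOp (hh : IsDispersion h) (n : ℕ) : Sector (n + 1) →L[ℂ] Sector n := (hh.sliceKernel_inv_energy (n := n)).op

theorem coeFn_traceOp (hh : IsDispersion h) (χ : Sector (n + 1)) : (hh.traceOp n χ).1 =ᵐ[volume] fun k =>
    (√(n + 1 : ℝ) : ℂ) * ∫ p, (((energy h (ins (Fin.last n) p k))⁻¹ : ℝ) : ℂ) *
      χ.1 (ins (Fin.last n) p k) := (hh.sliceKernel_inv_energy).coeFn_op χ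

theorem coeFn_ann (hh : IsDispersion h) (g : ℝ) (χ : Sector (n + 1)) : (hh.ann g n χ).1 =ᵐ[volume] fun k =>
    (-(g : ℂ)) * ((√(n + 1 : ℝ) : ℂ) * ∫ p, (((h p)⁻¹ : ℝ) : ℂ) * χ.1 (ins (Fin.last n) p k)) := by
  filter_upwards [coeFn_sector_smul (-(g : ℂ)) ((hh.sliceKernel_inv (n := n)).op χ),
    hh.sliceKernel_inv.coeFn_op χ] with k h1 h2
  rw [ann, smul_apply, h1, h2]
  simp only [sliceInt, ins, Fin.insertNth_apply_same]

end IsDispersion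

/-- Creation of a particle with the wave function `f`, on functions. -/
def createFun (f : Space → ℂ) (ξ : Config n → ℂ) (k : Config (n + 1)) : ℂ :=
  (√(n + 1 : ℝ) : ℂ)⁻¹ * ∑ j, f (k j) * ξ (del j k)

theorem memLp_createFun {f : Space → ℂ} (hf : MemLp f 2) {ξ : Config n → ℂ} (hξ : MemLp ξ 2) :
    MemLp (createFun f ξ) 2 :=
  (memLp_finsetSum _ fun j _ => memLp_tensor j hf hξ).const_mul _

theorem createFun_congr (f : Space → ℂ) {ξ ξ' : Config n → ℂ} (hξ : ξ =ᵐ[volume] ξ') :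
    createFun f ξ =ᵐ[volume] createFun f ξ' := by
  have : ∀ᵐ k : Config (n + 1), ∀ j, ξ (del j k) = ξ' (del j k) :=
    ae_all_iff.mpr fun j => (quasiMeasurePreserving_del j).ae hξ
  filter_upwards [this] with k hk
  simp only [createFun, hk]

/-- A permutation permutes the summands; what it does to the remaining particles is a permutation
again, which the symmetric ξ does not notice. -/
theorem createFun_comp_perm (f : Space → ℂ) (ξ : Sector n) (σ : Equiv.Perm (Fin (n + 1))) :
    (fun k => createFun f ξ.1 (k ∘ σ)) =ᵐ[volume] createFun f ξ.1 := by
  have : ∀ᵐ k : Config (n + 1), ∀ j, ξ.1 (del j k ∘ delPerm σ (σ.symm j)) = ξ.1 (del j k) :=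
    ae_all_iff.mpr fun j =>
      (quasiMeasurePreserving_del j).ae (sector_comp_perm ξ (delPerm σ (σ.symm j)))
  filter_upwards [this] with k hk
  simp only [createFun]
  congr 1
  rw [← Equiv.sum_comp σ fun j => f (k j) * ξ.1 (del j k)]
  refine Finset.sum_congr rfl fun j _ => ?_
  rw [del_comp_perm, Function.comp_apply]
  have := hk (σ j)
  rw [Equiv.symm_apply_apply] at this
  rw [this]

namespace IsDispersion

theorem memLp_form (hh : IsDispersion h) (g : ℝ) : MemLp (fun p => (((-g * (h p)⁻¹ : ℝ)) : ℂ)) 2 := by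
  refine (hh.memLp.const_mul (-(g : ℂ))).ae_eq (.of_forall fun p => ?_)
  push_cast
  rfl

theorem ae_ins_eq_ins_last (χ : Sector (n + 1)) (j : Fin (n + 1)) :
    ∀ᵐ k : Config n, ∀ᵐ p : Space, χ.1 (ins j p k) = χ.1 (ins (Fin.last n) p k) := by
  filter_upwards [ae_ae_ins (Fin.last n) (sector_comp_perm χ (insPerm j))] with k hk
  filter_upwards [hk] with p hp
  rw [← hp, ins_last_comp_insPerm]

-- By symmetry of χ the n+1 summands of the creation operator contribute equally, and (n+1)/√(n+1) =
-- √(n+1) is the factor of the annihilation operator.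
set_option maxHeartbeats 1000000 in
theorem inner_createFun (hh : IsDispersion h) (g : ℝ) (ξ : Sector n) (ζ : Sector (n + 1))
    (hζ' : ζ.1 =ᵐ[volume] createFun (fun p => (((-g * (h p)⁻¹ : ℝ)) : ℂ)) ξ.1)
    (χ : Sector (n + 1)) : inner ℂ ξ (hh.ann g n χ) = inner ℂ ζ χ := by
  rw [inner_sector, inner_sector]
  have hji : ∀ j, Integrable (fun k : Config (n + 1) => (starRingEnd ℂ)
      ((((-g * (h (k j))⁻¹ : ℝ)) : ℂ) * ξ.1 (del j k)) * χ.1 k) := fun j =>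
    integrable_mul_of_memLp_two (memLp_tensor j (hh.memLp_form g) (Lp.memLp ξ.1)).star
      (Lp.memLp χ.1)
  have h1 : ∫ k, (starRingEnd ℂ) (ζ.1 k) * χ.1 k = (√(n + 1 : ℝ) : ℂ)⁻¹ *
      ∑ j, ∫ k : Config (n + 1), (starRingEnd ℂ)
      ((((-g * (h (k j))⁻¹ : ℝ)) : ℂ) * ξ.1 (del j k)) * χ.1 k := by
    rw [← integral_finsetSum _ fun j _ => hji j, ← integral_const_mul]
    refine integral_congr_ae (hζ'.mono fun k hk => ?_)
    simp only
    rw [hk, createFun, map_mul, map_sum, map_inv₀, Complex.conj_ofReal, mul_assoc, Finset.sum_mul]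
  have h2 : ∀ j, ∫ k : Config (n + 1), (starRingEnd ℂ)
      ((((-g * (h (k j))⁻¹ : ℝ)) : ℂ) * ξ.1 (del j k)) * χ.1 k = ∫ k : Config n,
      (starRingEnd ℂ) (ξ.1 k) * ((-(g : ℂ)) * ∫ p, (((h p)⁻¹ : ℝ) : ℂ) *
        χ.1 (ins (Fin.last n) p k)) := by
    intro j
    rw [integral_ins j (hji j)]
    refine integral_congr_ae ((ae_ins_eq_ins_last χ j).mono fun k hk => ?_)
    simp only
    rw [← integral_const_mul, ← integral_const_mul]
    refine integral_congr_ae (hk.mono fun p hp => ?_)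
    simp only [hp, map_mul, Complex.conj_ofReal, del_ins]
    simp only [ins, Fin.insertNth_apply_same]
    push_cast
    ring
  rw [h1]
  simp only [h2]
  rw [Finset.sum_const, Finset.card_univ, Fintype.card_fin, nsmul_eq_mul, ← mul_assoc,
    ← integral_const_mul]
  refine integral_congr_ae ((hh.coeFn_ann g χ).mono fun k hk => ?_)
  simp only
  rw [hk]
  have h3 : (√(n + 1 : ℝ) : ℂ)⁻¹ * ((n + 1 : ℕ) : ℂ) = (√(n + 1 : ℝ) : ℂ) := by
    have h4 : (√(n + 1 : ℝ) : ℂ) * (√(n + 1 : ℝ) : ℂ) = ((n + 1 : ℕ) : ℂ) := by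
      rw [← Complex.ofReal_mul, Real.mul_self_sqrt (by positivity)]
      push_cast
      rfl
    have h5 : (√(n + 1 : ℝ) : ℂ) ≠ 0 := by
      exact_mod_cast (Real.sqrt_pos.mpr (by positivity)).ne'
    rw [← h4]
    field_simp
  rw [h3]
  ring

theorem coeFn_adj_ann (hh : IsDispersion h) (g : ℝ) (ξ : Sector n) : (ContinuousLinearMap.adjoint (hh.ann g n) ξ).1
    =ᵐ[volume] createFun (fun p => (((-g * (h p)⁻¹ : ℝ)) : ℂ)) ξ.1 := by
  have hm := memLp_createFun (hh.memLp_form g) (Lp.memLp ξ.1)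
  have hζ := coeFn_mkSector hm (createFun_comp_perm _ ξ)
  have hs : ContinuousLinearMap.adjoint (hh.ann g n) ξ = mkSector _ hm (createFun_comp_perm _ ξ) :=
    ext_inner_right ℂ fun χ => (ContinuousLinearMap.adjoint_inner_left _ _ _).trans
      (hh.inner_createFun g ξ _ hζ χ)
  exact (Filter.EventuallyEq.of_eq
    (congrArg (fun z : Sector (n + 1) => (z.1 : Config (n + 1) → ℂ)) hs)).trans hζ

end IsDispersion

end Momentum

/-! ### Commutation relations among annihilation, resolvent and trace operator. -/

section Relations

variable {n : ℕ}

theorem del_castSucc_ins_last (i : Fin (n + 1)) (p : Space) (k : Config (n + 1)) :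
    del i.castSucc (ins (Fin.last (n + 1)) p k) = ins (Fin.last n) p (del i k) := by
  rw [ins_last, ins_last]
  funext j
  simp only [del]
  refine Fin.lastCases ?_ (fun j => ?_) j
  · rw [Fin.succAbove_castSucc_of_le, Fin.succ_last]
    · simp [addParticle]
    · exact Fin.le_last i
  · rw [Fin.castSucc_succAbove_castSucc]
    simp [addParticle]

theorem createFun_ins_last (f : Space → ℂ) (ξ : Config (n + 1) → ℂ) (p : Space)
    (k : Config (n + 1)) : createFun f ξ (ins (Fin.last (n + 1)) p k) =
      (√((n + 1 : ℕ) + 1 : ℝ) : ℂ)⁻¹ *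
        (∑ i, f (k i) * ξ (ins (Fin.last n) p (del i k)) + f p * ξ k) := by
  rw [createFun, Fin.sum_univ_castSucc]
  simp only [del_castSucc_ins_last, del_ins]
  congr 2
  · refine Finset.sum_congr rfl fun i _ => ?_
    simp [ins]
  · simp [ins]

theorem createFun_ins_last_zero (f : Space → ℂ) (ξ : Config 0 → ℂ) (p : Space)
    (k : Config 0) : createFun f ξ (ins (Fin.last 0) p k) = f p * ξ k := by
  rw [createFun, Fin.sum_univ_castSucc]
  simp only [del_ins]
  simp [ins]

theorem sqrt_ne_zero_complex (n : ℕ) : (√(n + 1 : ℝ) : ℂ) ≠ 0 := by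
  exact_mod_cast (Real.sqrt_pos.mpr (by positivity)).ne'

variable {h : Space → ℝ}

theorem measurePreserving_ins_ins : MeasurePreserving
    (fun z : (Space × Space) × Config n =>
      ins (Fin.last (n + 1)) z.1.2 (ins (Fin.last n) z.1.1 z.2)) volume volume := by
  have h1 : MeasurePreserving (fun z : (Space × Space) × Config n =>
      ((z.1.2, z.1.1), z.2)) volume volume :=
    (Measure.measurePreserving_swap (μ := (volume : Measure Space))
      (ν := (volume : Measure Space))).prod (MeasurePreserving.id (volume : Measure (Config n)))
  have h2 : MeasurePreserving (fun z : (Space × Space) × Config n => (z.1.1, z.1.2, z.2))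
      volume volume := measurePreserving_prodAssoc volume volume volume
  have h3 : MeasurePreserving (fun z : Space × Space × Config n =>
      (z.1, ins (Fin.last n) z.2.1 z.2.2)) volume volume :=
    (MeasurePreserving.id (volume : Measure Space)).prod (measurePreserving_ins (Fin.last n))
  exact (measurePreserving_ins (Fin.last (n + 1))).comp (h3.comp (h2.comp h1))

theorem ins_last_swap (p q : Space) (k : Config n) :
    ins (Fin.last (n + 1)) q (ins (Fin.last n) p k) ∘
      Equiv.swap (Fin.last (n + 1)) (Fin.last n).castSucc =
    ins (Fin.last (n + 1)) p (ins (Fin.last n) q k) := by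
  simp only [ins_last]
  funext j
  rw [Function.comp_apply]
  refine Fin.lastCases ?_ (fun j => ?_) j
  · rw [Equiv.swap_apply_left]; simp [addParticle]
  · refine Fin.lastCases ?_ (fun j => ?_) j
    · rw [Equiv.swap_apply_right]; simp [addParticle]
    · rw [Equiv.swap_apply_of_ne_of_ne]
      · simp [addParticle]
      · exact (Fin.castSucc_lt_last _).ne
      · intro hj
        exact (Fin.castSucc_lt_last j).ne (Fin.castSucc_injective _ hj)

theorem ae_ae_ins_ins {P : Config (n + 2) → Prop} (hP : ∀ᵐ k, P k) :
    ∀ᵐ k : Config n, ∀ᵐ z : Space × Space,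
      P (ins (Fin.last (n + 1)) z.2 (ins (Fin.last n) z.1 k)) := by
  have h1 := measurePreserving_ins_ins.quasiMeasurePreserving.ae hP
  have h2 : ∀ᵐ z : Config n × (Space × Space),
      P (ins (Fin.last (n + 1)) z.2.2 (ins (Fin.last n) z.2.1 z.1)) :=
    (Measure.measurePreserving_swap (μ := (volume : Measure (Config n)))
      (ν := (volume : Measure (Space × Space)))).quasiMeasurePreserving.ae h1
  exact Measure.ae_ae_of_ae_prod h2

theorem ae_memLp_double_slice {χ : Config (n + 2) → ℂ} (hχ : MemLp χ 2) :
    ∀ᵐ k : Config n, MemLp (fun z : Space × Space =>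
      χ (ins (Fin.last (n + 1)) z.2 (ins (Fin.last n) z.1 k))) 2 := by
  have h1 := hχ.comp_measurePreserving measurePreserving_ins_ins
  have h2 := (memLp_two_iff_integrable h1.1).mp h1
  filter_upwards [h2.prod_left_ae, h1.1.prodMk_right] with k hk hk'
  exact (memLp_two_iff_integrable hk').mpr hk

/-- A double integral of a symmetric function may be computed with the two particles exchanged. -/
theorem integral_double_slice_swap {ϑ : Space → ℝ} (hϑ : MemLp (fun p => (ϑ p : ℂ)) 2)
    {w : Config (n + 2) → ℝ} (hw : Measurable w)
    (hwϑ : ∀ p q k, |w (ins (Fin.last (n + 1)) q (ins (Fin.last n) p k))| ≤ ϑ p * ϑ q)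
    (χ : Sector (n + 2)) : ∀ᵐ k : Config n,
      ∫ p, ∫ q, (w (ins (Fin.last (n + 1)) q (ins (Fin.last n) p k)) : ℂ) *
          χ.1 (ins (Fin.last (n + 1)) q (ins (Fin.last n) p k)) =
      ∫ p, ∫ q, (w (ins (Fin.last (n + 1)) p (ins (Fin.last n) q k)) : ℂ) *
          χ.1 (ins (Fin.last (n + 1)) q (ins (Fin.last n) p k)) := by
  filter_upwards [ae_memLp_double_slice (Lp.memLp χ.1), ae_ae_ins_ins (sector_comp_perm χ
    (Equiv.swap (Fin.last (n + 1)) (Fin.last n).castSucc))] with k h1 h2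
  have hmeas : Measurable (fun z : Space × Space =>
      w (ins (Fin.last (n + 1)) z.2 (ins (Fin.last n) z.1 k))) :=
    hw.comp (measurePreserving_ins_ins.measurable.comp measurable_prodMk_right)
  have h3 : MemLp (fun z : Space × Space =>
      (w (ins (Fin.last (n + 1)) z.2 (ins (Fin.last n) z.1 k)) : ℂ)) 2 := by
    have h4 : MemLp (fun z : Space × Space => (ϑ z.1 : ℂ) * (ϑ z.2 : ℂ)) 2 := by
      refine (memLp_two_iff_integrable (hϑ.1.comp_fst.mul hϑ.1.comp_snd)).mpr ?_
      have := ((memLp_two_iff_integrable hϑ.1).mp hϑ).mul_prod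
        ((memLp_two_iff_integrable hϑ.1).mp hϑ)
      refine this.congr (.of_forall fun q => ?_)
      simp only [Pi.mul_apply, norm_mul]
      ring
    refine h4.of_le (Complex.measurable_ofReal.comp hmeas).aestronglyMeasurable
      (.of_forall fun z => ?_)
    rw [← Complex.ofReal_mul, Complex.norm_real, Complex.norm_real]
    exact (hwϑ z.1 z.2 k).trans (le_abs_self _)
  have h5 := integrable_mul_of_memLp_two h3 h1
  rw [integral_integral_swap h5]
  have h6 : ∀ᵐ p : Space, ∀ᵐ q : Space,
      χ.1 (ins (Fin.last (n + 1)) p (ins (Fin.last n) q k)) =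
        χ.1 (ins (Fin.last (n + 1)) q (ins (Fin.last n) p k)) := by
    refine Measure.ae_ae_of_ae_prod (p := fun z : Space × Space =>
      χ.1 (ins (Fin.last (n + 1)) z.1 (ins (Fin.last n) z.2 k)) =
        χ.1 (ins (Fin.last (n + 1)) z.2 (ins (Fin.last n) z.1 k))) (h2.mono fun z hz => ?_)
    rw [← hz, ins_last_swap]
  refine integral_congr_ae (h6.mono fun p hp => integral_congr_ae (hp.mono fun q hq => ?_))
  simp only
  rw [hq]

namespace IsDispersion

/-- The norm of the form factor `-g / h`. -/
def formNorm (_ : IsDispersion h) (g : ℝ) : ℝ := |g| * √(∫ p, (h p)⁻¹ ^ 2)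

theorem formNorm_sq (hh : IsDispersion h) (g : ℝ) : ((hh.formNorm g ^ 2 : ℝ) : ℂ) =
    (g : ℂ) ^ 2 * ∫ p, ((((h p)⁻¹ : ℝ) : ℂ)) ^ 2 := by
  have h0 : 0 ≤ ∫ p, (h p)⁻¹ ^ 2 := integral_nonneg fun p => by positivity
  rw [formNorm, mul_pow, sq_abs, Real.sq_sqrt h0]
  push_cast
  congr 1
  rw [← integral_complex_ofReal]
  push_cast
  rfl

theorem integrable_inv_sq (hh : IsDispersion h) : Integrable fun p => ((((h p)⁻¹ : ℝ) : ℂ)) ^ 2 := by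
  simp_rw [pow_two]
  exact integrable_mul_of_memLp_two hh.memLp hh.memLp

theorem integrable_slice (hh : IsDispersion h) (ξ : Sector (n + 1)) : ∀ᵐ k : Config n, Integrable fun p =>
    (((h p)⁻¹ : ℝ) : ℂ) * ξ.1 (ins (Fin.last n) p k) := by
  filter_upwards [hh.sliceKernel_inv.integrable (Lp.memLp ξ.1)] with k hk
  simpa only [ins, Fin.insertNth_apply_same] using hk

theorem ann_createFun_zero (hh : IsDispersion h) (g : ℝ) {c : ℂ} (hc : c = (g : ℂ) ^ 2 * ∫ p, ((((h p)⁻¹ : ℝ) : ℂ)) ^ 2)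
    (ξ : Sector 0) (χ : Sector 1)
    (hχ : χ.1 =ᵐ[volume] createFun (fun p => (((-g * (h p)⁻¹ : ℝ)) : ℂ)) ξ.1) :
    hh.ann g 0 χ = c • ξ := by
  apply Sector.ext_ae
  filter_upwards [hh.coeFn_ann g χ, ae_ae_ins (Fin.last 0) hχ, coeFn_sector_smul c ξ]
    with k h1 h2 h3
  rw [h1, h3]
  have h4 : ∫ p, (((h p)⁻¹ : ℝ) : ℂ) * χ.1 (ins (Fin.last 0) p k) =
      ∫ p, (-(g : ℂ) * ξ.1 k) * ((((h p)⁻¹ : ℝ) : ℂ)) ^ 2 := by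
    refine integral_congr_ae (h2.mono fun p hp => ?_)
    simp only
    rw [hp, createFun_ins_last_zero]
    push_cast
    ring
  rw [h4, integral_const_mul, hc]
  simp
  ring

/-- Either the created particle is the one annihilated, which gives ‖f‖² ξ, or another one is, which
gives the creation operator applied to the annihilated vector. -/
theorem ann_createFun_succ (hh : IsDispersion h) (g : ℝ) {c : ℂ} (hc : c = (g : ℂ) ^ 2 * ∫ p, ((((h p)⁻¹ : ℝ) : ℂ)) ^ 2)
    (ξ ζ : Sector (n + 1)) (χ : Sector (n + 2))
    (hχ : χ.1 =ᵐ[volume] createFun (fun p => (((-g * (h p)⁻¹ : ℝ)) : ℂ)) ξ.1)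
    (hζ : ζ.1 =ᵐ[volume] createFun (fun p => (((-g * (h p)⁻¹ : ℝ)) : ℂ)) (hh.ann g n ξ).1) :
    hh.ann g (n + 1) χ = ζ + c • ξ := by
  apply Sector.ext_ae
  have hdel : ∀ᵐ k : Config (n + 1), ∀ i, Integrable fun p =>
      (((h p)⁻¹ : ℝ) : ℂ) * ξ.1 (ins (Fin.last n) p (del i k)) :=
    ae_all_iff.mpr fun i => (quasiMeasurePreserving_del i).ae (hh.integrable_slice ξ)
  have hζ' := hζ.trans
    (createFun_congr (fun p => (((-g * (h p)⁻¹ : ℝ)) : ℂ)) (hh.coeFn_ann g ξ))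
  filter_upwards [hh.coeFn_ann g χ, ae_ae_ins (Fin.last (n + 1)) hχ, coeFn_sector_smul c ξ,
    coeFn_sector_add ζ (c • ξ), hζ', hdel] with k h1 h2 h3 h4 h5 h7
  have h8 : ∫ p, (((h p)⁻¹ : ℝ) : ℂ) * χ.1 (ins (Fin.last (n + 1)) p k) =
      (√((n + 1 : ℕ) + 1 : ℝ) : ℂ)⁻¹ *
        ((∑ i, (((-g * (h (k i))⁻¹ : ℝ)) : ℂ) * ∫ p, (((h p)⁻¹ : ℝ) : ℂ) *
          ξ.1 (ins (Fin.last n) p (del i k))) +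
        (-(g : ℂ) * ξ.1 k) * ∫ p, ((((h p)⁻¹ : ℝ) : ℂ)) ^ 2) := by
    simp_rw [← integral_const_mul]
    rw [← integral_finsetSum _ fun i _ => (h7 i).const_mul _,
      ← integral_add (integrable_finsetSum _ fun i _ => (h7 i).const_mul _)
        (hh.integrable_inv_sq.const_mul _), ← integral_const_mul]
    refine integral_congr_ae (h2.mono fun p hp => ?_)
    simp only
    rw [hp, createFun_ins_last, mul_left_comm, mul_add, Finset.mul_sum]
    congr 2
    · refine Finset.sum_congr rfl fun i _ => ?_
      ring
    · push_cast
      ring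
  refine h1.trans (Eq.trans ?_ (h4.trans (congrArg₂ (· + ·) h5 h3)).symm)
  rw [h8, createFun, mul_inv_cancel_left₀ (sqrt_ne_zero_complex (n + 1)), mul_add, Finset.mul_sum,
    Finset.mul_sum, hc]
  congr 1
  · refine Finset.sum_congr rfl fun i _ => ?_
    have := sqrt_ne_zero_complex n
    field_simp
  · ring

theorem isCCR (hh : IsDispersion h) (g : ℝ) : IsCCR (E := fun n => Sector n) (hh.ann g) (hh.formNorm g) := by
  refine ⟨by unfold formNorm; positivity, ?_⟩
  ext1 χ
  funext n
  cases n with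
  | zero =>
    refine (hh.ann_createFun_zero g (hh.formNorm_sq g) (χ 0) _ (hh.coeFn_adj_ann g (χ 0))).trans ?_
    exact (zero_add (((hh.formNorm g ^ 2 : ℝ) : ℂ) • χ 0)).symm
  | succ n =>
    exact hh.ann_createFun_succ g (hh.formNorm_sq g) (χ (n + 1)) _ _
      (hh.coeFn_adj_ann g (χ (n + 1))) (hh.coeFn_adj_ann g (hh.ann g n (χ (n + 1))))

-- Partial fractions in the energy of the annihilated particle: with Λ the energy of the others,
-- 1/(h(h + Λ)) = Λ⁻¹(1/h - 1/(h + Λ)). The second term is the trace operator.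
set_option maxHeartbeats 1000000 in
theorem ann_resolvent (hh : IsDispersion h) (g : ℝ) (ξ : Sector (n + 1)) : hh.ann g n (hh.resolvent ξ) =
    hh.resolvent (hh.ann g n ξ + (g : ℂ) • hh.traceOp n ξ) := by
  apply Sector.ext_ae
  have hB := hh.sliceKernel_inv_energy.integrable (Lp.memLp ξ.1)
  filter_upwards [hh.coeFn_ann g (hh.resolvent ξ), ae_ae_ins (Fin.last n) (hh.coeFn_resolvent ξ),
    hh.coeFn_resolvent (hh.ann g n ξ + (g : ℂ) • hh.traceOp n ξ),
    coeFn_sector_add (hh.ann g n ξ) ((g : ℂ) • hh.traceOp n ξ), coeFn_sector_smul (g : ℂ)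
    (hh.traceOp n ξ), hh.coeFn_ann g ξ, hh.coeFn_traceOp ξ, hh.integrable_slice ξ, hB]
    with k h1 h2 h3 h4 h5 h6 h7 h8 h9
  rw [h1, h3, h4, h5, h6, h7]
  have h10 : ∫ p, (((h p)⁻¹ : ℝ) : ℂ) * (hh.resolvent ξ).1 (ins (Fin.last n) p k) =
      (((energy h k)⁻¹ : ℝ) : ℂ) * ((∫ p, (((h p)⁻¹ : ℝ) : ℂ) * ξ.1 (ins (Fin.last n) p k)) -
        ∫ p, (((energy h (ins (Fin.last n) p k))⁻¹ : ℝ) : ℂ) * ξ.1 (ins (Fin.last n) p k)) := by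
    rw [← integral_sub h8 h9, ← integral_const_mul]
    refine integral_congr_ae (h2.mono fun p hp => ?_)
    simp only
    rw [hp, ← mul_assoc, ← sub_mul, ← mul_assoc]
    congr 1
    norm_cast
    rw [energy_ins]
    have e1 := hh.pos p
    have e2 := hh.energy_pos k
    have e3 : h p + energy h k ≠ 0 := by positivity
    field_simp
    ring
  rw [h10]
  ring

-- The same partial fractions with two integrated particles p and q. One side carries the weight
-- 1/h(p) and the other 1/h(q); symmetry of ξ allows the exchange, the double integral being
-- dominated by the product of 1/h(p) and 1/h(q).
set_option maxHeartbeats 1000000 in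
theorem ann_traceOp (hh : IsDispersion h) (g : ℝ) (ξ : Sector (n + 2)) : hh.ann g n (hh.traceOp (n + 1) ξ) =
    hh.traceOp n (hh.ann g (n + 1) ξ + (g : ℂ) • hh.traceOp (n + 1) ξ) := by
  apply Sector.ext_ae
  have hB := ae_ae_ins (Fin.last n) (hh.sliceKernel_inv_energy.integrable (Lp.memLp ξ.1))
  have hw : Measurable fun k : Config (n + 2) =>
      (h (k (Fin.last n).castSucc))⁻¹ * (energy h k)⁻¹ :=
    (hh.measurable.comp (measurable_pi_apply (Fin.last n).castSucc)).inv.mul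
      hh.measurable_energy.inv
  have hv : ∀ p q (k : Config n),
      ins (Fin.last (n + 1)) q (ins (Fin.last n) p k) (Fin.last n).castSucc = p := by
    intro p q k
    simp
  have hsw := integral_double_slice_swap hh.memLp hw (fun p q k => by
    rw [hv, abs_of_pos (mul_pos (inv_pos.mpr (hh.pos _)) (inv_pos.mpr (hh.energy_pos _)))]
    refine mul_le_mul_of_nonneg_left (inv_anti₀ (hh.pos _) ?_) (inv_pos.mpr (hh.pos _)).le
    rw [energy_ins]
    linarith [hh.energy_pos (ins (Fin.last n) p k)]) ξ
  filter_upwards [hh.coeFn_ann g (hh.traceOp (n + 1) ξ),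
    ae_ae_ins (Fin.last n) (hh.coeFn_traceOp ξ), ae_ae_ins (Fin.last n) (hh.coeFn_ann g ξ),
    hh.coeFn_traceOp (hh.ann g (n + 1) ξ + (g : ℂ) • hh.traceOp (n + 1) ξ),
    ae_ae_ins (Fin.last n) (coeFn_sector_add (hh.ann g (n + 1) ξ)
      ((g : ℂ) • hh.traceOp (n + 1) ξ)), ae_ae_ins (Fin.last n) (coeFn_sector_smul (g : ℂ)
    (hh.traceOp (n + 1) ξ)), ae_ae_ins (Fin.last n) (hh.integrable_slice ξ), hB, hsw]
    with k h1 h2 h3 h4 h5 h6 h7 h8 h9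
  rw [h1, h4]
  have hv' : ∀ p q : Space, ins (Fin.last (n + 1)) q (ins (Fin.last n) p k)
      (Fin.last n).castSucc = p := fun p q => hv p q k
  simp_rw [hv'] at h9
  have e1 : ∫ p, (((h p)⁻¹ : ℝ) : ℂ) * (hh.traceOp (n + 1) ξ).1 (ins (Fin.last n) p k) =
      (√((n + 1 : ℕ) + 1 : ℝ) : ℂ) * ∫ p, ∫ q, (((h p)⁻¹ *
        (energy h (ins (Fin.last (n + 1)) q (ins (Fin.last n) p k)))⁻¹ : ℝ) : ℂ) *
          ξ.1 (ins (Fin.last (n + 1)) q (ins (Fin.last n) p k)) := by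
    rw [← integral_const_mul]
    refine integral_congr_ae (h2.mono fun p hp => ?_)
    simp only
    rw [hp, mul_left_comm, ← integral_const_mul]
    congr 2
    funext q
    push_cast
    ring
  have e2 : ∫ p, (((energy h (ins (Fin.last n) p k))⁻¹ : ℝ) : ℂ) *
      (hh.ann g (n + 1) ξ + (g : ℂ) • hh.traceOp (n + 1) ξ).1 (ins (Fin.last n) p k) =
      (-(g : ℂ)) * (√((n + 1 : ℕ) + 1 : ℝ) : ℂ) * ∫ p, ∫ q, (((h q)⁻¹ *
        (energy h (ins (Fin.last (n + 1)) p (ins (Fin.last n) q k)))⁻¹ : ℝ) : ℂ) *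
          ξ.1 (ins (Fin.last (n + 1)) q (ins (Fin.last n) p k)) := by
    rw [← integral_const_mul]
    refine integral_congr_ae ?_
    filter_upwards [h2, h3, h5, h6, h7, h8] with p h2 h3 h5 h6 h7 h8
    rw [h5, h6, h3, h2]
    have e3 : ∫ q, (((h q)⁻¹ *
        (energy h (ins (Fin.last (n + 1)) p (ins (Fin.last n) q k)))⁻¹ : ℝ) : ℂ) *
          ξ.1 (ins (Fin.last (n + 1)) q (ins (Fin.last n) p k)) =
        (((energy h (ins (Fin.last n) p k))⁻¹ : ℝ) : ℂ) *
          ((∫ q, (((h q)⁻¹ : ℝ) : ℂ) * ξ.1 (ins (Fin.last (n + 1)) q (ins (Fin.last n) p k))) -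
          ∫ q, (((energy h (ins (Fin.last (n + 1)) q (ins (Fin.last n) p k)))⁻¹ : ℝ) : ℂ) *
            ξ.1 (ins (Fin.last (n + 1)) q (ins (Fin.last n) p k))) := by
      rw [← integral_sub h7 h8, ← integral_const_mul]
      congr 1
      funext q
      rw [← sub_mul, ← mul_assoc]
      congr 1
      norm_cast
      simp only [energy_ins]
      have e1 := hh.pos p
      have e4 := hh.pos q
      have e2 := hh.energy_pos k
      have e3 : h p + energy h k ≠ 0 := by positivity
      have e3 : h p + (h q + energy h k) ≠ 0 := by positivity
      have e3 : h q + (h p + energy h k) ≠ 0 := by positivity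
      field_simp
      ring
    rw [e3]
    ring
  rw [e1, e2, h9]
  ring

theorem lowering_ann_diagonal (hh : IsDispersion h) (g : ℝ) :
    lowering (E := fun n => Sector n) (hh.ann g) * diagonal (fun _ => hh.resolvent) =
      diagonal (fun _ => hh.resolvent) *
        (lowering (E := fun n => Sector n) (hh.ann g) + (g : ℂ) • lowering hh.traceOp) := by
  ext1 χ
  funext n
  exact hh.ann_resolvent g (χ (n + 1))

theorem lowering_ann_traceOp (hh : IsDispersion h) (g : ℝ) :
    lowering (E := fun n => Sector n) (hh.ann g) * lowering hh.traceOp =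
      lowering hh.traceOp *
        (lowering (E := fun n => Sector n) (hh.ann g) + (g : ℂ) • lowering hh.traceOp) := by
  ext1 χ
  funext n
  exact hh.ann_traceOp g (χ (n + 2))

theorem norm_traceOp_le (hh : IsDispersion h) (n : ℕ) :
    ‖hh.traceOp n‖ ≤ √(∫ p, (h p)⁻¹ ^ 2) * √(n + 1 : ℝ) := hh.sliceKernel_inv_energy.norm_op_le

end IsDispersion

end Relations

/-! ### Bilinear pairings and the Fourier transform on L² of a Euclidean space. -/

section Pairing

variable {α : Type*} [MeasurableSpace α] {μ : Measure α}

/-- The bilinear pairing `F ↦ ∫ F f` on `L²`. -/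
def pairing {f : α → ℂ} (hf : MemLp f 2 μ) : Lp ℂ 2 μ →L[ℂ] ℂ := innerSL ℂ hf.star.toLp

theorem pairing_apply {f : α → ℂ} (hf : MemLp f 2 μ) (F : Lp ℂ 2 μ) :
    pairing hf F = ∫ x, F x * f x ∂μ := by
  rw [pairing, innerSL_apply_apply, L2.inner_def]
  refine integral_congr_ae (hf.star.coeFn_toLp.mono fun x hx => ?_)
  simp only [hx, RCLike.inner_apply, Pi.star_apply]
  simp

end Pairing

section FourierL2

open FourierTransform SchwartzMap

variable {V : Type*} [NormedAddCommGroup V] [InnerProductSpace ℝ V] [FiniteDimensional ℝ V]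
  [MeasurableSpace V] [BorelSpace V]

theorem integral_fourier_mul_schwartz (F : Lp ℂ 2 (volume : Measure V)) (η : 𝓢(V, ℂ)) :
    ∫ x, (𝓕 F : Lp ℂ 2 (volume : Measure V)) x * η x = ∫ x, F x * (𝓕 (η : V → ℂ)) x := by
  have h := congrArg (fun T : 𝓢'(V, ℂ) => T η) (Lp.fourier_toTemperedDistribution_eq F)
  simp only [TemperedDistribution.fourier_apply, Lp.toTemperedDistribution_apply, smul_eq_mul] at h
  rw [SchwartzMap.fourier_coe] at h
  rw [integral_congr_ae (.of_forall fun x => mul_comm _ _), ← h]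
  exact integral_congr_ae (.of_forall fun x => mul_comm _ _)

theorem integral_fourier_mul_eq_of_integrable {f g : V → ℂ} (hf : Integrable f)
    (hg : Integrable g) : ∫ x, 𝓕 f x * g x = ∫ x, f x * 𝓕 g x := by
  have := VectorFourier.integral_fourierIntegral_smul_eq_flip (μ := (volume : Measure V))
    (ν := (volume : Measure V)) (L := innerₗ V) Real.continuous_fourierChar continuous_inner hf hg
  simp only [smul_eq_mul, flip_innerₗ] at this
  exact this

/-- Both transforms are moved onto the same smooth test function, the first by tempered
distributions and the second by Fubini, and therefore agree almost everywhere. -/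
theorem coeFn_fourier_toLp {ζ : V → ℂ} (h1 : Integrable ζ) (h2 : MemLp ζ 2) :
    (𝓕 (h2.toLp ζ) : Lp ℂ 2 (volume : Measure V)) =ᵐ[volume] 𝓕 ζ := by
  have hc : Continuous (𝓕 ζ) :=
    VectorFourier.fourierIntegral_continuous Real.continuous_fourierChar continuous_inner h1
  refine ae_eq_of_integral_contDiff_smul_eq
    ((Lp.memLp _).locallyIntegrable (by norm_num)) hc.locallyIntegrable fun g hg hgc => ?_
  have hg₁ : HasCompactSupport (Complex.ofRealCLM ∘ g) := hgc.comp_left rfl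
  have hg₂ : ContDiff ℝ (⊤ : ℕ∞) (Complex.ofRealCLM ∘ g) := by fun_prop
  obtain ⟨η, hη⟩ : ∃ η : 𝓢(V, ℂ), ∀ x, η x = (g x : ℂ) := ⟨hg₁.toSchwartzMap hg₂, fun x => rfl⟩
  have e1 : ∀ f : V → ℂ, ∫ x, g x • f x = ∫ x, f x * η x := by
    intro f
    congr 1
    funext x
    rw [hη, mul_comm, Complex.real_smul]
  rw [e1, e1, integral_fourier_mul_schwartz, integral_fourier_mul_eq_of_integrable h1 η.integrable]
  refine integral_congr_ae (h2.coeFn_toLp.mono fun x hx => ?_)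
  simp only [hx]

theorem memLp_fourier {ζ : V → ℂ} (h1 : Integrable ζ) (h2 : MemLp ζ 2) : MemLp (𝓕 ζ) 2 :=
  (Lp.memLp (𝓕 (h2.toLp ζ) : Lp ℂ 2 (volume : Measure V))).ae_eq (coeFn_fourier_toLp h1 h2)

theorem integral_fourier_mul (F : Lp ℂ 2 (volume : Measure V)) {ζ : V → ℂ} (h1 : Integrable ζ)
    (h2 : MemLp ζ 2) :
    ∫ x, (𝓕 F : Lp ℂ 2 (volume : Measure V)) x * ζ x = ∫ x, F x * 𝓕 ζ x := by
  have h3 := memLp_fourier h1 h2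
  rw [← pairing_apply h2, ← pairing_apply h3]
  refine DenseRange.induction_on (p := fun F : Lp ℂ 2 (volume : Measure V) =>
    pairing h2 (𝓕 F) = pairing h3 F)
    (SchwartzMap.denseRange_toLpCLM (F := ℂ) (p := 2) ENNReal.ofNat_ne_top) F ?_ fun φ => ?_
  · exact isClosed_eq ((pairing h2).continuous.comp
      (Lp.fourierTransformₗᵢ V ℂ).continuous) (pairing h3).continuous
  · rw [SchwartzMap.toLpCLM_apply, SchwartzMap.toLp_fourier_eq, pairing_apply, pairing_apply]
    have e1 : ∫ x, ((𝓕 φ).toLp 2 : Lp ℂ 2 (volume : Measure V)) x * ζ x = ∫ x, (𝓕 φ) x * ζ x :=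
      integral_congr_ae (((𝓕 φ).coeFn_toLp 2 volume).mono fun x hx => by simp only [hx])
    have e2 : ∫ x, (φ.toLp 2 : Lp ℂ 2 (volume : Measure V)) x * 𝓕 ζ x = ∫ x, φ x * 𝓕 ζ x :=
      integral_congr_ae ((φ.coeFn_toLp 2 volume).mono fun x hx => by simp only [hx])
    rw [e1, e2, SchwartzMap.fourier_coe]
    exact integral_fourier_mul_eq_of_integrable φ.integrable h1

end FourierL2

/-! ### The Fourier transform on configuration space, transported from Euclidean coordinates since
configurations carry the supremum norm. -/

section ConfigFourier

open FourierTransform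

variable {n : ℕ}

theorem measurePreserving_uncurry : MeasurePreserving
    (fun (f : Fin n → Fin 3 → ℝ) (q : Fin n × Fin 3) => f q.1 q.2) volume volume := by
  refine ⟨by fun_prop, ?_⟩
  refine (Measure.pi_eq fun s hs => ?_).symm
  rw [Measure.map_apply (by fun_prop) (MeasurableSet.univ_pi hs)]
  have : (fun (f : Fin n → Fin 3 → ℝ) (q : Fin n × Fin 3) => f q.1 q.2) ⁻¹' Set.univ.pi s =
      Set.univ.pi fun i => Set.univ.pi fun a => s (i, a) := by
    ext f
    simp
  rw [this, volume_pi_pi]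
  simp_rw [volume_pi_pi]
  rw [Fintype.prod_prod_type]

/-- The Euclidean space of all coordinates of a configuration. -/
abbrev Coords (n : ℕ) : Type := EuclideanSpace ℝ (Fin n × Fin 3)

/-- Configurations as vectors of coordinates. -/
def coords : Config n ≃L[ℝ] Coords n :=
  LinearEquiv.toContinuousLinearEquiv
    { toFun := fun y => WithLp.toLp 2 fun q => y q.1 q.2
      invFun := fun v j => WithLp.toLp 2 fun a => v (j, a)
      map_add' := fun y y' => by ext; simp
      map_smul' := fun c y => by ext; simp
      left_inv := fun y => by ext; simp
      right_inv := fun v => by ext; simp }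

theorem measurePreserving_coords : MeasurePreserving (coords : Config n → Coords n) := by
  have h1 : MeasurePreserving (fun (y : Config n) (j : Fin n) => WithLp.ofLp (y j))
      volume volume := volume_preserving_pi fun _ => PiLp.volume_preserving_ofLp (Fin 3)
  exact (PiLp.volume_preserving_toLp (Fin n × Fin 3)).comp (measurePreserving_uncurry.comp h1)

theorem measurableEmbedding_coords : MeasurableEmbedding (coords : Config n → Coords n) :=
  coords.toHomeomorph.measurableEmbedding

theorem measurePreserving_coords_symm :
    MeasurePreserving (coords.symm : Coords n → Config n) :=
  MeasurePreserving.symm (coords.toHomeomorph.toMeasurableEquiv) measurePreserving_coords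

theorem inner_coords (y k : Config n) :
    inner ℝ (coords y) (coords k) = ∑ j, inner ℝ (y j) (k j) := by
  rw [PiLp.inner_apply, Fintype.sum_prod_type]
  refine Finset.sum_congr rfl fun j _ => ?_
  rw [PiLp.inner_apply]
  rfl

/-- The phase `e^{2πix}`. -/
def phase (x : ℝ) : ℂ := ((Real.fourierChar x : Circle) : ℂ)

@[simp] theorem norm_phase (x : ℝ) : ‖phase x‖ = 1 := Circle.norm_coe _

@[simp] theorem phase_zero : phase 0 = 1 := by
  rw [phase, AddChar.map_zero_eq_one, Circle.coe_one]

theorem phase_add (a b : ℝ) : phase (a + b) = phase a * phase b := by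
  rw [phase, AddChar.map_add_eq_mul, Circle.coe_mul, phase, phase]

theorem phase_neg_add (a b : ℝ) : phase (-(a + b)) = phase (-a) * phase (-b) := by
  rw [neg_add, phase_add]

theorem continuous_phase : Continuous phase :=
  continuous_induced_dom.comp Real.continuous_fourierChar

/-- The Fourier integral of a function of several particles. -/
def fourierC (ζ : Config n → ℂ) (k : Config n) : ℂ :=
  ∫ y : Config n, phase (-∑ j, inner ℝ (y j) (k j)) * ζ y

theorem fourierC_eq (ζ : Config n → ℂ) (k : Config n) :
    fourierC ζ k = 𝓕 (ζ ∘ coords.symm) (coords k) := by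
  rw [fourierC, Real.fourier_eq,
    ← measurePreserving_coords.integral_comp measurableEmbedding_coords]
  refine integral_congr_ae (.of_forall fun y => ?_)
  simp only [inner_coords, Function.comp_apply, ContinuousLinearEquiv.symm_apply_apply]
  rfl

/-- The unitary Fourier transform on the space of square-integrable functions of `n` particles. -/
def fourierL2 : Lp ℂ 2 (volume : Measure (Config n)) ≃ₗᵢ[ℂ] Lp ℂ 2 (volume : Measure (Config n)) :=
  let T : Lp ℂ 2 (volume : Measure (Coords n)) ≃ₗᵢ[ℂ] Lp ℂ 2 (volume : Measure (Config n)) :=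
    { Lp.compMeasurePreservingₗᵢ ℂ coords measurePreserving_coords with
      invFun := Lp.compMeasurePreservingₗᵢ ℂ coords.symm measurePreserving_coords_symm
      left_inv := fun F => by
        ext1
        have h1 := Lp.coeFn_compMeasurePreserving F (measurePreserving_coords (n := n))
        have h2 := Lp.coeFn_compMeasurePreserving (Lp.compMeasurePreserving coords
          measurePreserving_coords F) (measurePreserving_coords_symm (n := n))
        have h3 := measurePreserving_coords_symm.quasiMeasurePreserving.ae_eq_comp h1
        refine h2.trans (h3.trans (.of_forall fun x => ?_))
        simp
      right_inv := fun F => by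
        ext1
        have h1 := Lp.coeFn_compMeasurePreserving F (measurePreserving_coords_symm (n := n))
        have h2 := Lp.coeFn_compMeasurePreserving (Lp.compMeasurePreserving coords.symm
          measurePreserving_coords_symm F) (measurePreserving_coords (n := n))
        have h3 := measurePreserving_coords.quasiMeasurePreserving.ae_eq_comp h1
        refine h2.trans (h3.trans (.of_forall fun x => ?_))
        simp }
  (T.symm.trans (Lp.fourierTransformₗᵢ (Coords n) ℂ)).trans T

theorem coeFn_fourierL2 (F : Lp ℂ 2 (volume : Measure (Config n))) :
    fourierL2 F =ᵐ[volume] fun y =>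
      (𝓕 (Lp.compMeasurePreserving coords.symm measurePreserving_coords_symm F) :
        Lp ℂ 2 (volume : Measure (Coords n))) (coords y) :=
  Lp.coeFn_compMeasurePreserving (𝓕 (Lp.compMeasurePreserving coords.symm
    measurePreserving_coords_symm F) : Lp ℂ 2 (volume : Measure (Coords n)))
    measurePreserving_coords

theorem memLp_fourierC {ζ : Config n → ℂ} (h1 : Integrable ζ) (h2 : MemLp ζ 2) :
    MemLp (fourierC ζ) 2 := by
  have := memLp_fourier (measurePreserving_coords_symm.integrable_comp_of_integrable h1)
    (h2.comp_measurePreserving measurePreserving_coords_symm)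
  refine (this.comp_measurePreserving measurePreserving_coords).ae_eq (.of_forall fun k => ?_)
  rw [fourierC_eq]
  rfl

/-- The Fourier transform is symmetric for the bilinear pairing. -/
theorem integral_fourierL2_mul (F : Lp ℂ 2 (volume : Measure (Config n))) {ζ : Config n → ℂ}
    (h1 : Integrable ζ) (h2 : MemLp ζ 2) :
    ∫ y, fourierL2 F y * ζ y = ∫ k, F k * fourierC ζ k := by
  have h3 := measurePreserving_coords_symm.integrable_comp_of_integrable h1
  have h4 := h2.comp_measurePreserving (measurePreserving_coords_symm (n := n))
  have h5 := integral_fourier_mul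
    (Lp.compMeasurePreserving coords.symm measurePreserving_coords_symm F) h3 h4
  rw [← measurePreserving_coords.integral_comp measurableEmbedding_coords,
    ← measurePreserving_coords.integral_comp measurableEmbedding_coords] at h5
  refine Eq.trans ?_ (h5.trans ?_)
  · refine integral_congr_ae ((coeFn_fourierL2 F).mono fun y hy => ?_)
    simp only [Function.comp_apply, ContinuousLinearEquiv.symm_apply_apply]
    rw [hy]
  · have h6 := measurePreserving_coords.quasiMeasurePreserving.ae_eq_comp
      (Lp.coeFn_compMeasurePreserving F (measurePreserving_coords_symm (n := n)))
    refine integral_congr_ae (h6.mono fun k hk => ?_)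
    simp only [Function.comp_apply, ContinuousLinearEquiv.symm_apply_apply] at hk
    simp only
    rw [hk, fourierC_eq]

end ConfigFourier

/-! ### Levelwise unitaries, permutation invariance, and the Fourier transform on Fock space. -/

section LpMap

variable {E : ℕ → Type*} [∀ n, NormedAddCommGroup (E n)] [∀ n, InnerProductSpace ℂ (E n)]

theorem memℓp_map (U : ∀ n, E n ≃ₗᵢ[ℂ] E n) (χ : lp E 2) :
    Memℓp (fun n => U n (χ n)) 2 := by
  have := lp.memℓp χ
  rw [memℓp_two_iff] at this ⊢
  simpa using this

/-- The unitary map on a Hilbert sum given by unitary maps of the summands. -/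
def lpMap (U : ∀ n, E n ≃ₗᵢ[ℂ] E n) : lp E 2 ≃ₗᵢ[ℂ] lp E 2 where
  toFun χ := ⟨fun n => U n (χ n), memℓp_map U χ⟩
  invFun χ := ⟨fun n => (U n).symm (χ n), memℓp_map (fun n => (U n).symm) χ⟩
  map_add' χ χ' := by
    apply lp.ext
    funext n
    exact map_add (U n) (χ n) (χ' n)
  map_smul' c χ := by
    apply lp.ext
    funext n
    exact map_smul (U n) c (χ n)
  left_inv χ := by
    apply lp.ext
    funext n
    exact (U n).symm_apply_apply (χ n)
  right_inv χ := by
    apply lp.ext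
    funext n
    exact (U n).apply_symm_apply (χ n)
  norm_map' χ := by
    have h1 := lp_two_hasSum_norm_sq χ
    have h2 := lp_two_hasSum_norm_sq (⟨fun n => U n (χ n), memℓp_map U χ⟩ : lp E 2)
    have h3 : (fun n => ‖(⟨fun n => U n (χ n), memℓp_map U χ⟩ : lp E 2) n‖ ^ 2) =
        fun n => ‖χ n‖ ^ 2 := by
      funext n
      rw [← (U n).norm_map (χ n)]
    rw [h3] at h2
    exact (sq_eq_sq₀ (norm_nonneg _) (norm_nonneg _)).mp (h2.unique h1)

end LpMap

section Permutations

variable {n : ℕ}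

theorem measurableEmbedding_perm (σ : Equiv.Perm (Fin n)) :
    MeasurableEmbedding (fun y : Config n => y ∘ σ) :=
  (MeasurableEquiv.arrowCongr' σ.symm (MeasurableEquiv.refl Space)).measurableEmbedding

theorem fourierC_comp_perm (σ : Equiv.Perm (Fin n)) (ζ : Config n → ℂ) (k : Config n) :
    fourierC (fun y => ζ (y ∘ σ)) k = fourierC ζ (k ∘ σ) := by
  rw [fourierC, fourierC]
  refine Eq.trans ?_ ((measurePreserving_perm σ).integral_comp (measurableEmbedding_perm σ) _)
  refine integral_congr_ae (.of_forall fun y => ?_)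
  simp only [Function.comp_apply]
  rw [Equiv.sum_comp σ fun j => inner ℝ (y j) (k j)]

theorem ext_of_forall_test {F F' : Config n → ℂ} (hF : LocallyIntegrable F)
    (hF' : LocallyIntegrable F') (h : ∀ η : Config n → ℂ, ContDiff ℝ (⊤ : ℕ∞) η →
      HasCompactSupport η → ∫ y, F y * η y = ∫ y, F' y * η y) : F =ᵐ[volume] F' := by
  refine ae_eq_of_integral_contDiff_smul_eq hF hF' fun g hg hgc => ?_
  have hg₁ : HasCompactSupport (Complex.ofRealCLM ∘ g) := hgc.comp_left rfl
  have hg₂ : ContDiff ℝ (⊤ : ℕ∞) (Complex.ofRealCLM ∘ g) := by fun_prop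
  have e1 : ∀ f : Config n → ℂ, ∫ x, g x • f x = ∫ x, f x * (Complex.ofRealCLM ∘ g) x := by
    intro f
    congr 1
    funext x
    rw [mul_comm, Complex.real_smul]
    rfl
  rw [e1, e1]
  exact h _ hg₂ hg₁

theorem memLp_test {η : Config n → ℂ} (hη : ContDiff ℝ (⊤ : ℕ∞) η) (hc : HasCompactSupport η)
    (p : ENNReal) : MemLp η p := hη.continuous.memLp_of_hasCompactSupport hc

theorem integrable_test {η : Config n → ℂ} (hη : ContDiff ℝ (⊤ : ℕ∞) η)
    (hc : HasCompactSupport η) : Integrable η := hη.continuous.integrable_of_hasCompactSupport hc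

/-- Shown by duality: on test functions the transform is an explicit integral, where a change of
variables moves the permutation. -/
theorem fourierL2_comp_perm (σ : Equiv.Perm (Fin n)) (F : Lp ℂ 2 (volume : Measure (Config n))) :
    fourierL2 (Lp.compMeasurePreserving (fun y : Config n => y ∘ σ) (measurePreserving_perm σ) F) =
      Lp.compMeasurePreserving (fun y : Config n => y ∘ σ) (measurePreserving_perm σ)
        (fourierL2 F) := by
  ext1
  refine ext_of_forall_test ((Lp.memLp _).locallyIntegrable (by norm_num))
    ((Lp.memLp _).locallyIntegrable (by norm_num)) fun η hη hc => ?_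
  have hp := measurePreserving_perm σ
  have hp' := measurePreserving_perm σ.symm
  have h1 := integrable_test hη hc
  have h2 := memLp_test hη hc 2
  have e : ∀ y : Config n, (y ∘ σ) ∘ σ.symm = y := fun y => by
    funext j; simp
  rw [integral_fourierL2_mul _ h1 h2]
  have a1 : ∫ k, (Lp.compMeasurePreserving (fun y : Config n => y ∘ σ) hp F) k * fourierC η k =
      ∫ k, F k * fourierC (fun y => η (y ∘ σ.symm)) k := by
    refine Eq.trans ?_ (hp.integral_comp (measurableEmbedding_perm σ)
      fun k => F k * fourierC (fun y => η (y ∘ σ.symm)) k)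
    refine integral_congr_ae ((Lp.coeFn_compMeasurePreserving F hp).mono fun k hk => ?_)
    simp only [Function.comp_apply] at hk ⊢
    rw [hk, fourierC_comp_perm, e]
  have a2 := integral_fourierL2_mul F (hp'.integrable_comp_of_integrable h1)
    (h2.comp_measurePreserving hp')
  rw [a1]
  refine a2.symm.trans ?_
  rw [← hp.integral_comp (measurableEmbedding_perm σ)]
  refine integral_congr_ae
    ((Lp.coeFn_compMeasurePreserving (fourierL2 F) hp).mono fun k hk => ?_)
  simp only [Function.comp_apply] at hk ⊢
  rw [hk, e]

/-- The Fourier transform on a sector. -/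
def fourierSector : Sector n ≃ₗᵢ[ℂ] Sector n where
  toFun F := ⟨fourierL2 F.1, fun σ => by rw [← fourierL2_comp_perm, F.2 σ]⟩
  invFun F := ⟨fourierL2.symm F.1, fun σ => fourierL2.injective (by
    rw [fourierL2_comp_perm, LinearIsometryEquiv.apply_symm_apply, F.2 σ])⟩
  map_add' F G := Subtype.ext (map_add fourierL2 F.1 G.1)
  map_smul' c F := Subtype.ext (map_smul fourierL2 c F.1)
  left_inv F := Subtype.ext (fourierL2.symm_apply_apply F.1)
  right_inv F := Subtype.ext (fourierL2.apply_symm_apply F.1)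
  norm_map' F := fourierL2.norm_map F.1

/-- The Fourier transform on Fock space. -/
def fourierFock : Fock ≃ₗᵢ[ℂ] Fock := lpMap fun _ => fourierSector

end Permutations

/-! ### Fourier transform in one particle at a time. -/

section Partial

open FourierTransform

variable {n : ℕ}

theorem sum_inner_ins (j : Fin (n + 1)) (z p : Space) (y k : Config n) :
    ∑ i, inner ℝ (ins j z y i) (ins j p k i) = inner ℝ z p + ∑ i, inner ℝ (y i) (k i) := by
  rw [Fin.sum_univ_succAbove _ j]
  simp

theorem fourier_eq_integral_mul (f : Space → ℂ) (p : Space) :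
    𝓕 f p = ∫ z, phase (-inner ℝ z p) * f z := rfl

theorem integrable_phase_mul {α : Type*} [MeasurableSpace α] {μ : Measure α} {ζ : α → ℂ}
    (hζ : Integrable ζ μ) {θ : α → ℝ} (hθ : Measurable θ) :
    Integrable (fun y => phase (θ y) * ζ y) μ := by
  refine (integrable_norm_iff ?_).mp ?_
  · exact (continuous_phase.measurable.comp hθ).aestronglyMeasurable.mul hζ.1
  · simpa using hζ.norm

theorem integrable_fourierC_integrand {ζ : Config n → ℂ} (hζ : Integrable ζ) (k : Config n) :
    Integrable fun y : Config n => phase (-∑ j, inner ℝ (y j) (k j)) * ζ y :=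
  integrable_phase_mul hζ (by fun_prop)

/-- Here the particle j is transformed inside the integral over the others; `fourierC_ins'` is the
opposite order of Fubini. -/
theorem fourierC_ins {ζ : Config (n + 1) → ℂ} (hζ : Integrable ζ) (j : Fin (n + 1)) (p : Space)
    (k : Config n) : fourierC ζ (ins j p k) =
      ∫ y : Config n, phase (-∑ i, inner ℝ (y i) (k i)) *
        𝓕 (fun z => ζ (ins j z y)) p := by
  rw [fourierC, integral_ins j (integrable_fourierC_integrand hζ _)]
  refine integral_congr_ae (.of_forall fun y => ?_)
  simp only [fourier_eq_integral_mul]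
  rw [← integral_const_mul]
  refine integral_congr_ae (.of_forall fun z => ?_)
  simp only [sum_inner_ins, phase_neg_add]
  ring

theorem fourierC_ins' {ζ : Config (n + 1) → ℂ} (hζ : Integrable ζ) (j : Fin (n + 1)) (p : Space)
    (k : Config n) : fourierC ζ (ins j p k) =
      𝓕 (fun z => fourierC (fun y => ζ (ins j z y)) k) p := by
  rw [fourierC, ← (measurePreserving_ins j).integral_comp (measurableEmbedding_ins j),
    fourier_eq_integral_mul]
  refine (integral_prod _ ((integrable_ins_iff j).mpr (integrable_fourierC_integrand hζ
    (ins j p k)))).trans ?_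
  refine integral_congr_ae (.of_forall fun z => ?_)
  simp only [fourierC]
  rw [← integral_const_mul]
  refine integral_congr_ae (.of_forall fun y => ?_)
  simp only [sum_inner_ins, phase_neg_add]
  ring

theorem integrable_tensor (j : Fin (n + 1)) {f : Space → ℂ} (hf : Integrable f)
    {ξ : Config n → ℂ} (hξ : Integrable ξ) :
    Integrable (fun k : Config (n + 1) => f (k j) * ξ (del j k)) :=
  (measurePreserving_split j).integrable_comp_of_integrable (hf.mul_prod hξ)

theorem fourierC_tensor (j : Fin (n + 1)) {f : Space → ℂ} (hf : Integrable f)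
    {ξ : Config n → ℂ} (hξ : Integrable ξ) (p : Space) (k : Config n) :
    fourierC (fun k => f (k j) * ξ (del j k)) (ins j p k) = 𝓕 f p * fourierC ξ k := by
  rw [fourierC_ins (integrable_tensor j hf hξ), fourierC, ← integral_const_mul]
  refine integral_congr_ae (.of_forall fun y => ?_)
  simp only [fourier_eq_integral_mul, del_ins]
  simp only [ins, Fin.insertNth_apply_same]
  rw [mul_left_comm, ← integral_mul_const]
  simp only [mul_assoc]

theorem continuous_ins (j : Fin (n + 1)) : Continuous fun q : Space × Config n => ins j q.1 q.2 :=
  Continuous.finInsertNth (A := fun _ : Fin (n + 1) => Space) j continuous_fst continuous_snd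

theorem isClosedEmbedding_ins (j : Fin (n + 1)) (y : Config n) :
    Topology.IsClosedEmbedding fun z : Space => ins j z y := by
  have h : Function.LeftInverse (fun k : Config (n + 1) => k j) (fun z : Space => ins j z y) :=
    fun z => by simp [ins]
  exact h.isClosedEmbedding (continuous_apply j)
    ((continuous_ins j).comp (Continuous.prodMk_left y))

theorem contDiff_ins (j : Fin (n + 1)) (y : Config n) :
    ContDiff ℝ (⊤ : ℕ∞) fun z : Space => ins j z y := by
  rw [contDiff_pi]
  intro i
  rcases Fin.eq_self_or_eq_succAbove j i with rfl | ⟨i, rfl⟩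
  · simpa [ins] using contDiff_fun_id
  · simpa [ins] using contDiff_const

/-- A slice of a test function is a Schwartz function. -/
theorem exists_schwartz_slice {η : Config (n + 1) → ℂ} (hη : ContDiff ℝ (⊤ : ℕ∞) η)
    (hc : HasCompactSupport η) (j : Fin (n + 1)) (y : Config n) :
    ∃ φ : SchwartzMap Space ℂ, (φ : Space → ℂ) = fun z => η (ins j z y) :=
  ⟨(hc.comp_isClosedEmbedding (isClosedEmbedding_ins j y)).toSchwartzMap
    (hη.comp (contDiff_ins j y)), rfl⟩

theorem fourier_laplacian_schwartz (φ : SchwartzMap Space ℂ) (p : Space) :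
    𝓕 (Laplacian.laplacian (φ : Space → ℂ)) p =
      (((-((2 * Real.pi) ^ 2 * ‖p‖ ^ 2) : ℝ)) : ℂ) * 𝓕 (φ : Space → ℂ) p := by
  have h1 : (Laplacian.laplacian (φ : Space → ℂ)) =
      ((Laplacian.laplacian φ : SchwartzMap Space ℂ) : Space → ℂ) := by
    funext x
    exact (SchwartzMap.laplacian_apply φ x).symm
  rw [h1, ← SchwartzMap.fourier_coe, SchwartzMap.laplacian_eq_fourierMultiplierCLM,
    FourierTransform.fourier_smul, SchwartzMap.fourierMultiplierCLM_apply,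
    FourierTransform.fourier_fourierInv_eq]
  rw [smul_apply, SchwartzMap.smulLeftCLM_apply_apply (by fun_prop),
    SchwartzMap.fourier_coe]
  simp
  ring

end Partial

/-! ### Laplacians, decay and restriction of transformed test functions. -/

section TestFunctions

open FourierTransform

variable {n : ℕ}

/-- Writing the one-particle Laplacian through the joint second derivative lets it inherit
continuity and compact support in all variables. -/
theorem particleLaplacian_eq_sum {η : Config n → ℂ} (hη : ContDiff ℝ (⊤ : ℕ∞) η) (j : Fin n)
    (y : Config n) : particleLaplacian j η y = ∑ a, iteratedFDeriv ℝ 2 η y fun _ =>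
      ContinuousLinearMap.single ℝ (fun _ : Fin n => Space) j
        (EuclideanSpace.basisFun (Fin 3) ℝ a) := by
  have h1 : (fun z : Space => η (Function.update y j z)) =
      (fun w => η (Function.update y j 0 + w)) ∘
        ContinuousLinearMap.single ℝ (fun _ : Fin n => Space) j := by
    funext z
    simp only [Function.comp_apply]
    congr 1
    funext i
    by_cases hi : i = j
    · subst hi; simp
    · simp [hi]
  rw [particleLaplacian, h1, InnerProductSpace.laplacian_eq_iteratedFDeriv_orthonormalBasis _
    (EuclideanSpace.basisFun (Fin 3) ℝ)]
  refine Finset.sum_congr rfl fun a _ => ?_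
  have h3 : ContDiff ℝ (⊤ : ℕ∞) fun w => η (Function.update y j 0 + w) := by fun_prop
  rw [ContinuousLinearMap.iteratedFDeriv_comp_right _ h3 _ (i := 2)
    (WithTop.coe_le_coe.mpr le_top), iteratedFDeriv_comp_add_left]
  have h2 : Function.update y j 0 + ContinuousLinearMap.single ℝ (fun _ : Fin n => Space) j (y j)
      = y := by
    funext i
    by_cases hi : i = j
    · subst hi; simp
    · simp [hi]
  rw [h2, ContinuousMultilinearMap.compContinuousLinearMap_apply]
  congr 1
  funext i
  fin_cases i <;> rfl

theorem continuous_particleLaplacian {η : Config n → ℂ} (hη : ContDiff ℝ (⊤ : ℕ∞) η)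
    (j : Fin n) : Continuous (particleLaplacian j η) := by
  have h1 : Continuous (iteratedFDeriv ℝ 2 η) :=
    hη.continuous_iteratedFDeriv (WithTop.coe_le_coe.mpr le_top)
  simp_rw [funext fun y => particleLaplacian_eq_sum hη j y]
  refine continuous_finsetSum _ fun a _ => ?_
  exact (ContinuousMultilinearMap.apply ℝ (fun _ : Fin 2 => Config n) ℂ fun _ =>
    ContinuousLinearMap.single ℝ (fun _ : Fin n => Space) j
      (EuclideanSpace.basisFun (Fin 3) ℝ a)).continuous.comp h1

theorem hasCompactSupport_particleLaplacian {η : Config n → ℂ} (hη : ContDiff ℝ (⊤ : ℕ∞) η)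
    (hc : HasCompactSupport η) (j : Fin n) : HasCompactSupport (particleLaplacian j η) := by
  refine (hc.iteratedFDeriv (𝕜 := ℝ) 2).mono fun y hy => ?_
  rw [Function.mem_support] at hy ⊢
  intro h
  rw [particleLaplacian_eq_sum hη j y, h] at hy
  simp at hy

theorem integrable_particleLaplacian {η : Config n → ℂ} (hη : ContDiff ℝ (⊤ : ℕ∞) η)
    (hc : HasCompactSupport η) (j : Fin n) : Integrable (particleLaplacian j η) :=
  (continuous_particleLaplacian hη j).integrable_of_hasCompactSupport
    (hasCompactSupport_particleLaplacian hη hc j)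

theorem memLp_particleLaplacian {η : Config n → ℂ} (hη : ContDiff ℝ (⊤ : ℕ∞) η)
    (hc : HasCompactSupport η) (j : Fin n) : MemLp (particleLaplacian j η) 2 :=
  (continuous_particleLaplacian hη j).memLp_of_hasCompactSupport
    (hasCompactSupport_particleLaplacian hη hc j)

theorem update_ins (j : Fin (n + 1)) (w z : Space) (y : Config n) :
    Function.update (ins j w y) j z = ins j z y := by
  funext i
  rcases Fin.eq_self_or_eq_succAbove j i with rfl | ⟨i, rfl⟩
  · simp
  · simp [Fin.succAbove_ne]

theorem fourierC_particleLaplacian {η : Config n → ℂ} (hη : ContDiff ℝ (⊤ : ℕ∞) η)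
    (hc : HasCompactSupport η) (j : Fin n) (k : Config n) :
    fourierC (particleLaplacian j η) k =
      (((-((2 * Real.pi) ^ 2 * ‖k j‖ ^ 2) : ℝ)) : ℂ) * fourierC η k := by
  cases n with
  | zero => exact j.elim0
  | succ n =>
    obtain ⟨p, k, rfl⟩ : ∃ p k', k = ins j p k' := ⟨k j, del j k, (ins_del j k).symm⟩
    rw [fourierC_ins (integrable_particleLaplacian hη hc j),
      fourierC_ins (integrable_test hη hc), ← integral_const_mul]
    refine integral_congr_ae (.of_forall fun y => ?_)
    obtain ⟨φ, hφ⟩ := exists_schwartz_slice hη hc j y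
    have h1 : (fun z => particleLaplacian j η (ins j z y)) =
        Laplacian.laplacian (φ : Space → ℂ) := by
      funext z
      simp only [particleLaplacian, update_ins, hφ]
      simp [ins]
    simp only
    rw [h1, fourier_laplacian_schwartz, hφ]
    simp only [ins, Fin.insertNth_apply_same]
    ring

/-- The weighted function is the transform of (l - c∇²) applied to η in the particle j. This
supplies the only decay of the transform that is needed. -/
theorem memLp_mul_fourierC {η : Config n → ℂ} (hη : ContDiff ℝ (⊤ : ℕ∞) η)
    (hc : HasCompactSupport η) (j : Fin n) (c l : ℝ) :
    MemLp (fun k => ((c * ((2 * Real.pi) ^ 2 * ‖k j‖ ^ 2) + l : ℝ) : ℂ) * fourierC η k) 2 := by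
  have h1 := (memLp_fourierC (integrable_particleLaplacian hη hc j)
    (memLp_particleLaplacian hη hc j)).const_mul (-(c : ℂ))
  have h2 := (memLp_fourierC (integrable_test hη hc) (memLp_test hη hc 2)).const_mul (l : ℂ)
  refine (h1.add h2).ae_eq (.of_forall fun k => ?_)
  simp only [Pi.add_apply, fourierC_particleLaplacian hη hc]
  push_cast
  ring

theorem continuous_fourierC_slice {η : Config (n + 1) → ℂ} (hη : Continuous η)
    (hc : HasCompactSupport η) (j : Fin (n + 1)) (k : Config n) :
    Continuous fun z => fourierC (fun y => η (ins j z y)) k := by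
  have hK : IsCompact (del j '' tsupport η) := IsCompact.image hc (by unfold del; fun_prop)
  obtain ⟨M, hM⟩ := hη.bounded_above_of_compact_support hc
  refine continuous_of_dominated (bound := (del j '' tsupport η).indicator fun _ => M)
    (fun z => ?_) (fun z => .of_forall fun y => ?_) ?_ (.of_forall fun y => ?_)
  · have : Continuous fun y : Config n => η (ins j z y) :=
      hη.comp ((continuous_ins j).comp (Continuous.prodMk_right z))
    exact ((continuous_phase.comp (by fun_prop)).mul this).aestronglyMeasurable
  · rw [norm_mul, norm_phase, one_mul]
    by_cases hy : y ∈ del j '' tsupport η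
    · rw [Set.indicator_of_mem hy]; exact hM _
    · rw [Set.indicator_of_notMem hy]
      have : ins j z y ∉ tsupport η := fun h => hy ⟨_, h, del_ins j z y⟩
      simp only [image_eq_zero_of_notMem_tsupport this, norm_zero, le_refl]
  · exact (integrable_indicator_iff hK.measurableSet).mpr
      (integrableOn_const hK.measure_lt_top.ne)
  · exact continuous_const.mul (hη.comp ((continuous_ins j).comp (Continuous.prodMk_left y)))

theorem integrable_fourierC_slice {η : Config (n + 1) → ℂ} (hη : Continuous η)
    (hc : HasCompactSupport η) (j : Fin (n + 1)) (k : Config n) :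
    Integrable fun z => fourierC (fun y => η (ins j z y)) k := by
  have h1 := (integrable_ins_iff j).mpr (hη.integrable_of_hasCompactSupport hc)
  refine h1.norm.integral_prod_left.mono'
    (continuous_fourierC_slice hη hc j k).aestronglyMeasurable (.of_forall fun z => ?_)
  refine (norm_integral_le_integral_norm _).trans (le_of_eq ?_)
  simp

/-- The Fourier transform of the restriction to `y_j = 0` is the integral over `k_j`. -/
theorem fourierC_restrict {η : Config (n + 1) → ℂ} (hη : Continuous η)
    (hc : HasCompactSupport η) (j : Fin (n + 1)) {k : Config n}
    (hk : Integrable fun p => fourierC η (ins j p k)) :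
    fourierC (fun y => η (ins j 0 y)) k = ∫ p, fourierC η (ins j p k) := by
  have h1 := fun p => fourierC_ins' (hη.integrable_of_hasCompactSupport hc) j p k
  simp only [h1] at hk ⊢
  have h2 := congrFun ((continuous_fourierC_slice hη hc j k).fourierInv_fourier_eq
    (integrable_fourierC_slice hη hc j k) hk) 0
  rw [← h2, Real.fourierInv_eq]
  refine integral_congr_ae (.of_forall fun p => ?_)
  simp

end TestFunctions

/-! ### The subordination integral. -/

section Subordination

/-- A primitive of `e^{-s²}`. -/
def gaussPrim (x : ℝ) : ℝ := ∫ s in (0 : ℝ)..x, Real.exp (-s ^ 2)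

theorem hasDerivAt_gaussPrim (x : ℝ) : HasDerivAt gaussPrim (Real.exp (-x ^ 2)) x :=
  (by fun_prop : Continuous fun s : ℝ => Real.exp (-s ^ 2)).integral_hasStrictDerivAt 0 x
    |>.hasDerivAt

theorem tendsto_gaussPrim_atTop : Tendsto gaussPrim atTop (𝓝 (√Real.pi / 2)) := by
  have h1 : Integrable fun s : ℝ => Real.exp (-s ^ 2) := by
    simpa using integrable_exp_neg_mul_sq one_pos
  have h2 := intervalIntegral_tendsto_integral_Ioi (0 : ℝ) h1.integrableOn tendsto_id
  have h3 := integral_gaussian_Ioi 1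
  simp only [neg_mul, one_mul, div_one] at h3
  rw [h3] at h2
  exact h2

theorem gaussPrim_neg (x : ℝ) : gaussPrim (-x) = -gaussPrim x := by
  have := intervalIntegral.integral_comp_neg (a := 0) (b := x) fun s : ℝ => Real.exp (-s ^ 2)
  simp only [neg_zero, even_two, Even.neg_pow] at this
  rw [gaussPrim, gaussPrim, this, intervalIntegral.integral_symm]

theorem tendsto_gaussPrim_atBot : Tendsto gaussPrim atBot (𝓝 (-(√Real.pi / 2))) := by
  have h := (tendsto_gaussPrim_atTop.comp tendsto_neg_atBot_atTop).neg
  refine h.congr fun x => ?_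
  simp only [Function.comp_apply, gaussPrim_neg, neg_neg]

/-- A primitive of `t^{-3/2} e^{-a²/t - b²t}`. -/
def subPrim (a b t : ℝ) : ℝ :=
  -(1 / a) * (Real.exp (-2 * a * b) * gaussPrim (a / √t - b * √t) +
    Real.exp (2 * a * b) * gaussPrim (a / √t + b * √t))

/-- Completing the square, (a/√t ∓ b√t)² = a²/t + b²t ∓ 2ab, so the prefactors turn both Gaussians
into the same exponential. In the sum of inner derivatives the b-terms cancel and the a-terms add.
-/
theorem hasDerivAt_subPrim {a b t : ℝ} (ha : 0 < a) (ht : 0 < t) :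
    HasDerivAt (subPrim a b) ((t * √t)⁻¹ * Real.exp (-a ^ 2 / t - b ^ 2 * t)) t := by
  have hs : 0 < √t := Real.sqrt_pos.mpr ht
  have hst : √t ^ 2 = t := Real.sq_sqrt ht.le
  have h0 := Real.hasDerivAt_sqrt ht.ne'
  have h1 : HasDerivAt (fun t => a / √t) (-(a / (2 * (t * √t)))) t := by
    refine ((hasDerivAt_const t a).div h0 hs.ne').congr_deriv ?_
    field_simp
    rw [hst]
    ring
  have h2 := (hasDerivAt_gaussPrim _).comp t (h1.sub (h0.const_mul b))
  have h3 := (hasDerivAt_gaussPrim _).comp t (h1.add (h0.const_mul b))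
  refine (((h2.const_mul (Real.exp (-2 * a * b))).add
    (h3.const_mul (Real.exp (2 * a * b)))).const_mul (-(1 / a))).congr_deriv ?_
  have e1 : Real.exp (-2 * a * b) * (Real.exp (-(a / √t - b * √t) ^ 2)) =
      Real.exp (-a ^ 2 / t - b ^ 2 * t) := by
    rw [← Real.exp_add]
    congr 1
    rw [sub_sq, div_pow, mul_pow, hst]
    field_simp
    ring
  have e2 : Real.exp (2 * a * b) * (Real.exp (-(a / √t + b * √t) ^ 2)) =
      Real.exp (-a ^ 2 / t - b ^ 2 * t) := by
    rw [← Real.exp_add]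
    congr 1
    rw [add_sq, div_pow, mul_pow, hst]
    field_simp
    ring
  have e3 : -(1 / a) * ((-(a / (2 * (t * √t))) - b * (1 / (2 * √t))) +
      (-(a / (2 * (t * √t))) + b * (1 / (2 * √t)))) = (t * √t)⁻¹ := by
    field_simp
    ring
  simp only [Pi.add_apply, Pi.sub_apply]
  linear_combination (-(1 / a) * (-(a / (2 * (t * √t))) - b * (1 / (2 * √t)))) * e1 +
    (-(1 / a) * (-(a / (2 * (t * √t))) + b * (1 / (2 * √t)))) * e2 +
    Real.exp (-a ^ 2 / t - b ^ 2 * t) * e3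

theorem tendsto_subPrim_atTop {a b : ℝ} (hb : 0 < b) : Tendsto (subPrim a b) atTop
    (𝓝 (-(1 / a) * (Real.exp (-2 * a * b) * (-(√Real.pi / 2)) +
      Real.exp (2 * a * b) * (√Real.pi / 2)))) := by
  have hs : Tendsto Real.sqrt atTop atTop := Real.tendsto_sqrt_atTop
  have h1 : Tendsto (fun t => a / √t) atTop (𝓝 0) := hs.const_div_atTop a
  have h2 : Tendsto (fun t => b * √t) atTop atTop := hs.const_mul_atTop hb
  have h3 : Tendsto (fun t => a / √t - b * √t) atTop atBot := by
    simpa [sub_eq_add_neg] using h1.add_atBot (tendsto_neg_atTop_atBot.comp h2)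
  have h4 : Tendsto (fun t => a / √t + b * √t) atTop atTop := h1.add_atTop h2
  exact (((tendsto_gaussPrim_atBot.comp h3).const_mul _).add
    ((tendsto_gaussPrim_atTop.comp h4).const_mul _)).const_mul _

theorem tendsto_subPrim_zero {a b : ℝ} (ha : 0 < a) : Tendsto (subPrim a b) (𝓝[>] 0)
    (𝓝 (-(1 / a) * (Real.exp (-2 * a * b) * (√Real.pi / 2) +
      Real.exp (2 * a * b) * (√Real.pi / 2)))) := by
  have h0 : Tendsto Real.sqrt (𝓝[>] 0) (𝓝 0) := by
    simpa using (Real.continuous_sqrt.tendsto 0).mono_left nhdsWithin_le_nhds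
  have hs : Tendsto Real.sqrt (𝓝[>] 0) (𝓝[>] 0) :=
    tendsto_nhdsWithin_iff.mpr ⟨h0, eventually_mem_nhdsWithin.mono fun t ht => Real.sqrt_pos.mpr ht⟩
  have h1 : Tendsto (fun t => a / √t) (𝓝[>] 0) atTop := by
    simpa [div_eq_mul_inv] using (tendsto_inv_nhdsGT_zero.comp hs).const_mul_atTop ha
  have h2 : Tendsto (fun t => b * √t) (𝓝[>] 0) (𝓝 (b * 0)) := h0.const_mul b
  have h3 : Tendsto (fun t => a / √t - b * √t) (𝓝[>] 0) atTop := by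
    simpa [sub_eq_add_neg] using h1.atTop_add h2.neg
  have h4 : Tendsto (fun t => a / √t + b * √t) (𝓝[>] 0) atTop := h1.atTop_add h2
  exact (((tendsto_gaussPrim_atTop.comp h3).const_mul _).add
    ((tendsto_gaussPrim_atTop.comp h4).const_mul _)).const_mul _

theorem integral_subordination {a b : ℝ} (ha : 0 < a) (hb : 0 < b) :
    IntegrableOn (fun t : ℝ => (t * √t)⁻¹ * Real.exp (-a ^ 2 / t - b ^ 2 * t)) (Set.Ioi 0) ∧
      ∫ t in Set.Ioi (0 : ℝ), (t * √t)⁻¹ * Real.exp (-a ^ 2 / t - b ^ 2 * t) =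
        √Real.pi / a * Real.exp (-2 * a * b) := by
  -- m is the limit of the primitive at 0 from the right. Division by √0 = 0 gives the primitive
  -- another value there, so it is redefined at 0.
  obtain ⟨m, hm⟩ : ∃ m, m = -(1 / a) * (Real.exp (-2 * a * b) * (√Real.pi / 2) +
      Real.exp (2 * a * b) * (√Real.pi / 2)) := ⟨_, rfl⟩
  have h1 : ContinuousWithinAt (Function.update (subPrim a b) 0 m) (Set.Ici 0) 0 := by
    rw [continuousWithinAt_update_same]
    have : (Set.Ici (0 : ℝ) \ {0}) = Set.Ioi 0 := Set.Ici_sdiff_left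
    rw [this, hm]
    exact tendsto_subPrim_zero ha
  have h2 : ∀ t ∈ Set.Ioi (0 : ℝ), HasDerivAt (Function.update (subPrim a b) 0 m)
      ((t * √t)⁻¹ * Real.exp (-a ^ 2 / t - b ^ 2 * t)) t := by
    intro t ht
    refine (hasDerivAt_subPrim ha ht).congr_of_eventuallyEq ?_
    filter_upwards [eventually_ne_nhds (ne_of_gt ht)] with s hs
    exact Function.update_of_ne hs _ _
  have h3 : ∀ t ∈ Set.Ioi (0 : ℝ), 0 ≤ (t * √t)⁻¹ * Real.exp (-a ^ 2 / t - b ^ 2 * t) := by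
    intro t ht
    have : 0 < t := ht
    positivity
  have h4 : Tendsto (Function.update (subPrim a b) 0 m) atTop
    (𝓝 (-(1 / a) * (Real.exp (-2 * a * b) * (-(√Real.pi / 2)) +
      Real.exp (2 * a * b) * (√Real.pi / 2)))) := by
    refine (tendsto_subPrim_atTop hb).congr' ?_
    filter_upwards [eventually_gt_atTop 0] with s hs
    exact (Function.update_of_ne hs.ne' _ _).symm
  refine ⟨integrableOn_Ioi_deriv_of_nonneg h1 h2 h3 h4, ?_⟩
  -- The argument a/√t + b√t tends to +∞ at both ends, so the e^{2ab} terms cancel; the other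
  -- argument changes sign and contributes √π e^{-2ab}/a.
  rw [integral_Ioi_of_hasDerivAt_of_nonneg h1 h2 h3 h4, Function.update_self, hm]
  ring

end Subordination

/-! ### The Yukawa potential as a time integral of heat kernels, and its Fourier transform. -/

section Yukawa

open FourierTransform

variable {c l : ℝ}

/-- The Yukawa potential, the fundamental solution of `l - c ∇²`. -/
def yukawa (c l : ℝ) (x : Space) : ℝ := Real.exp (-√(l / c) * ‖x‖) / (4 * Real.pi * c * ‖x‖)

/-- The symbol `c (2π)² |p|² + l` of `l - c ∇²`. -/
def symbol (c l : ℝ) (p : Space) : ℝ := c * ((2 * Real.pi) ^ 2 * ‖p‖ ^ 2) + l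

theorem symbol_pos (hc : 0 < c) (hl : 0 < l) (p : Space) : 0 < symbol c l p := by
  unfold symbol; positivity

theorem yukawa_neg (x : Space) : yukawa c l (-x) = yukawa c l x := by simp [yukawa]

theorem yukawa_nonneg (hc : 0 < c) (x : Space) : 0 ≤ yukawa c l x := by
  unfold yukawa; positivity

theorem measurable_yukawa : Measurable (yukawa c l) := by
  unfold yukawa; fun_prop

/-- The kernel of `e^{-t (l - c ∇²)}`. -/
def heat (c l t : ℝ) (x : Space) : ℝ :=
  Real.exp (-l * t) * ((√(4 * Real.pi * c * t)) ^ 3)⁻¹ * Real.exp (-(1 / (4 * c * t)) * ‖x‖ ^ 2)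

theorem heat_nonneg (t : ℝ) (x : Space) : 0 ≤ heat c l t x := by
  unfold heat; positivity

theorem heat_eq (hc : 0 < c) (hl : 0 < l) {t : ℝ} (ht : 0 < t) (x : Space) :
    heat c l t x = ((√(4 * Real.pi * c)) ^ 3)⁻¹ * ((t * √t)⁻¹ *
      Real.exp (-(‖x‖ / (2 * √c)) ^ 2 / t - √l ^ 2 * t)) := by
  rw [heat, Real.sqrt_mul (by positivity), mul_pow, Real.sq_sqrt hl.le, div_pow, mul_pow,
    Real.sq_sqrt hc.le, show -(‖x‖ ^ 2 / (2 ^ 2 * c)) / t - l * t =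
      -l * t + -(1 / (4 * c * t)) * ‖x‖ ^ 2 by field_simp; ring, Real.exp_add]
  have : √t ^ 3 = t * √t := by
    rw [pow_succ, Real.sq_sqrt ht.le]
  rw [this, mul_inv]
  ring

/-- Subordination with a = |x|/(2√c) and b = √l; then 2ab = √(l/c)|x|. -/
theorem integral_heat (hc : 0 < c) (hl : 0 < l) {x : Space} (hx : x ≠ 0) :
    IntegrableOn (fun t => heat c l t x) (Set.Ioi 0) ∧
      ∫ t in Set.Ioi (0 : ℝ), heat c l t x = yukawa c l x := by
  have hx' : 0 < ‖x‖ := norm_pos_iff.mpr hx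
  have h := integral_subordination (a := ‖x‖ / (2 * √c)) (b := √l) (by positivity) (by positivity)
  have e : ∀ t ∈ Set.Ioi (0 : ℝ), heat c l t x = ((√(4 * Real.pi * c)) ^ 3)⁻¹ * ((t * √t)⁻¹ *
      Real.exp (-(‖x‖ / (2 * √c)) ^ 2 / t - √l ^ 2 * t)) := fun t ht => heat_eq hc hl ht x
  refine ⟨(integrableOn_congr_fun e measurableSet_Ioi).mpr (h.1.const_mul _), ?_⟩
  rw [setIntegral_congr_fun measurableSet_Ioi e, integral_const_mul, h.2, yukawa]
  have e2 : -2 * (‖x‖ / (2 * √c)) * √l = -√(l / c) * ‖x‖ := by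
    rw [Real.sqrt_div hl.le]
    field_simp
  have e3 : √(4 * Real.pi * c) ^ 3 = (4 * Real.pi * c) * (2 * √Real.pi * √c) := by
    rw [pow_succ, Real.sq_sqrt (by positivity), Real.sqrt_mul (by positivity),
      Real.sqrt_mul (by positivity), show (4 : ℝ) = 2 ^ 2 by norm_num,
      Real.sqrt_sq (by norm_num)]
  rw [e2, e3]
  have : √Real.pi ≠ 0 := by positivity
  field_simp

theorem fourier_heat (hc : 0 < c) {t : ℝ} (ht : 0 < t) (p : Space) :
    𝓕 (fun x => (heat c l t x : ℂ)) p = ((Real.exp (-symbol c l p * t) : ℝ) : ℂ) := by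
  have hb : (0 : ℝ) < 1 / (4 * c * t) := by positivity
  have h := fourier_gaussian_innerProductSpace (V := Space) (b := ((1 / (4 * c * t) : ℝ) : ℂ))
    (by rw [Complex.ofReal_re]; exact hb) p
  have e1 : (fun x : Space => (heat c l t x : ℂ)) =
      ((Real.exp (-l * t) * ((√(4 * Real.pi * c * t)) ^ 3)⁻¹ : ℝ) : ℂ) • fun x : Space =>
        Complex.exp (-((1 / (4 * c * t) : ℝ) : ℂ) * (‖x‖ : ℂ) ^ 2) := by
    funext x
    simp only [heat, Pi.smul_apply, smul_eq_mul]
    push_cast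
    ring_nf
  have e2 : ((Real.pi : ℂ) / ((1 / (4 * c * t) : ℝ) : ℂ)) ^ ((Module.finrank ℝ Space : ℂ) / 2) =
      (((√(4 * Real.pi * c * t)) ^ 3 : ℝ) : ℂ) := by
    have h1 : ((Real.pi : ℂ) / ((1 / (4 * c * t) : ℝ) : ℂ)) = ((4 * Real.pi * c * t : ℝ) : ℂ) := by
      push_cast
      field_simp
    have h2 : ((Module.finrank ℝ Space : ℂ) / 2) = (((3 : ℝ) / 2 : ℝ) : ℂ) := by simp
    rw [h1, h2, ← Complex.ofReal_cpow (by positivity), Real.sqrt_eq_rpow, ← Real.rpow_natCast,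
      ← Real.rpow_mul (by positivity)]
    norm_num
  have e3 : 𝓕 (((Real.exp (-l * t) * ((√(4 * Real.pi * c * t)) ^ 3)⁻¹ : ℝ) : ℂ) •
      fun x : Space => Complex.exp (-((1 / (4 * c * t) : ℝ) : ℂ) * (‖x‖ : ℂ) ^ 2)) p =
      ((Real.exp (-l * t) * ((√(4 * Real.pi * c * t)) ^ 3)⁻¹ : ℝ) : ℂ) *
        𝓕 (fun x : Space => Complex.exp (-((1 / (4 * c * t) : ℝ) : ℂ) * (‖x‖ : ℂ) ^ 2)) p := by
    simp only [fourier_eq_integral_mul, Pi.smul_apply, smul_eq_mul]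
    rw [← integral_const_mul]
    congr 1
    funext x
    ring
  rw [e1, e3, h, e2, symbol]
  have h5 : ((√(4 * Real.pi * c * t)) ^ 3 : ℝ) ≠ 0 := by positivity
  have e4 : Complex.exp (-(Real.pi : ℂ) ^ 2 * (‖p‖ : ℂ) ^ 2 / ((1 / (4 * c * t) : ℝ) : ℂ)) =
      ((Real.exp (-(c * ((2 * Real.pi) ^ 2 * ‖p‖ ^ 2)) * t) : ℝ) : ℂ) := by
    rw [Complex.ofReal_exp]
    congr 1
    push_cast
    field_simp
    ring
  rw [e4, ← Complex.ofReal_mul, ← Complex.ofReal_mul]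
  congr 1
  rw [show -(c * ((2 * Real.pi) ^ 2 * ‖p‖ ^ 2) + l) * t =
    -l * t + -(c * ((2 * Real.pi) ^ 2 * ‖p‖ ^ 2)) * t by ring, Real.exp_add]
  field_simp

end Yukawa

section Yukawa

open FourierTransform

variable {c l : ℝ}

theorem integrable_heat (hc : 0 < c) {t : ℝ} (ht : 0 < t) : Integrable (heat c l t) := by
  have hb : (0 : ℝ) < 1 / (4 * c * t) := by positivity
  have h := (GaussianFourier.integrable_cexp_neg_mul_sq_norm_add (V := Space)
    (b := ((1 / (4 * c * t) : ℝ) : ℂ)) (by rw [Complex.ofReal_re]; exact hb) 0 0).re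
  refine (h.const_mul (Real.exp (-l * t) * ((√(4 * Real.pi * c * t)) ^ 3)⁻¹)).congr
    (.of_forall fun x => ?_)
  simp only [heat]
  congr 1
  rw [zero_mul, add_zero, ← Complex.ofReal_pow, ← Complex.ofReal_neg, ← Complex.ofReal_mul,
    ← Complex.ofReal_exp]
  exact Complex.ofReal_re _

theorem integral_heat_space (hc : 0 < c) {t : ℝ} (ht : 0 < t) :
    ∫ x, heat c l t x = Real.exp (-l * t) := by
  have h := fourier_heat (l := l) hc ht 0
  simp only [fourier_eq_integral_mul, inner_zero_right, neg_zero, phase_zero, one_mul] at h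
  rw [integral_complex_ofReal] at h
  have h2 : ∫ x, heat c l t x = Real.exp (-symbol c l 0 * t) := by exact_mod_cast h
  rw [h2]
  simp [symbol]

theorem integrable_heat_prod (hc : 0 < c) (hl : 0 < l) :
    Integrable (fun q : ℝ × Space => heat c l q.1 q.2)
      ((volume.restrict (Set.Ioi 0)).prod volume) := by
  have hm : Measurable fun q : ℝ × Space => heat c l q.1 q.2 := by
    unfold heat; fun_prop
  refine (integrable_prod_iff hm.aestronglyMeasurable).mpr ⟨?_, ?_⟩
  · filter_upwards [ae_restrict_mem measurableSet_Ioi] with t ht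
    exact integrable_heat hc ht
  · have h1 : IntegrableOn (fun t : ℝ => Real.exp (-l * t)) (Set.Ioi 0) :=
      integrableOn_exp_mul_Ioi (by linarith) 0
    refine h1.congr ?_
    filter_upwards [ae_restrict_mem measurableSet_Ioi] with t ht
    rw [← integral_heat_space hc ht]
    refine integral_congr_ae (.of_forall fun x => ?_)
    simp only
    rw [Real.norm_of_nonneg (heat_nonneg t x)]

theorem ae_integral_heat (hc : 0 < c) (hl : 0 < l) :
    (fun x : Space => ∫ t in Set.Ioi (0 : ℝ), heat c l t x) =ᵐ[volume] yukawa c l := by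
  have : ∀ᵐ x : Space, x ≠ 0 := Measure.ae_ne volume 0
  filter_upwards [this] with x hx
  exact (integral_heat hc hl hx).2

theorem integrable_yukawa (hc : 0 < c) (hl : 0 < l) : Integrable (yukawa c l) :=
  (integrable_heat_prod hc hl).integral_prod_right.congr (ae_integral_heat hc hl)

/-- Each heat kernel transforms into e^{-t·symbol}; exchanging the integrals leaves the time
integral of this exponential. -/
theorem fourier_yukawa (hc : 0 < c) (hl : 0 < l) (p : Space) :
    𝓕 (fun x => (yukawa c l x : ℂ)) p = (((symbol c l p)⁻¹ : ℝ) : ℂ) := by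
  have h1 : Integrable (fun q : ℝ × Space => phase (-inner ℝ q.2 p) * (heat c l q.1 q.2 : ℂ))
      ((volume.restrict (Set.Ioi 0)).prod volume) :=
    integrable_phase_mul (integrable_heat_prod hc hl).ofReal (by fun_prop)
  rw [fourier_eq_integral_mul]
  have h2 : ∫ x : Space, phase (-inner ℝ x p) * (yukawa c l x : ℂ) =
      ∫ x : Space, ∫ t in Set.Ioi (0 : ℝ), phase (-inner ℝ x p) * (heat c l t x : ℂ) := by
    refine integral_congr_ae ((ae_integral_heat hc hl).mono fun x hx => ?_)
    simp only at hx ⊢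
    rw [integral_const_mul, integral_complex_ofReal, hx]
  rw [h2, ← integral_integral_swap (f := fun t x => phase (-inner ℝ x p) * (heat c l t x : ℂ)) h1]
  have h3 : ∫ t in Set.Ioi (0 : ℝ), ∫ x : Space, phase (-inner ℝ x p) * (heat c l t x : ℂ) =
      ∫ t in Set.Ioi (0 : ℝ), ((Real.exp (-symbol c l p * t) : ℝ) : ℂ) := by
    refine setIntegral_congr_fun measurableSet_Ioi fun t ht => ?_
    rw [← fourier_heat hc ht, fourier_eq_integral_mul]
  rw [h3, integral_complex_ofReal,
    integral_exp_mul_Ioi (by linarith [symbol_pos hc hl p])]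
  have := (symbol_pos hc hl p).ne'
  simp

/-- In three dimensions the Jacobian r² cancels the singularity 1/r² of the square, leaving an
exponential. -/
theorem memLp_yukawa (hc : 0 < c) (hl : 0 < l) : MemLp (fun x => (yukawa c l x : ℂ)) 2 := by
  refine (memLp_two_iff_integrable
    (Complex.measurable_ofReal.comp measurable_yukawa).aestronglyMeasurable).mpr ?_
  change Integrable (fun x : Space => ‖(yukawa c l x : ℂ)‖ ^ 2) volume
  have h1 : (fun x : Space => ‖(yukawa c l x : ℂ)‖ ^ 2) = fun x =>
      (fun r : ℝ => (Real.exp (-√(l / c) * r) / (4 * Real.pi * c * r)) ^ 2) ‖x‖ := by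
    funext x
    rw [Complex.norm_real, Real.norm_of_nonneg (yukawa_nonneg hc x), yukawa]
  rw [h1]
  refine (integrable_fun_norm_addHaar (E := Space) volume (f := fun r : ℝ =>
    (Real.exp (-√(l / c) * r) / (4 * Real.pi * c * r)) ^ 2)).mpr ?_
  have h2 : IntegrableOn (fun r : ℝ => ((4 * Real.pi * c) ^ 2)⁻¹ * Real.exp (-(2 * √(l / c)) * r))
      (Set.Ioi 0) := by
    have : 0 < √(l / c) := Real.sqrt_pos.mpr (by positivity)
    exact (integrableOn_exp_mul_Ioi (by linarith) 0).const_mul _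
  refine (integrableOn_congr_fun (fun r hr => ?_) measurableSet_Ioi).mpr h2
  have hr' : 0 < r := hr
  have h3 : Module.finrank ℝ Space - 1 = 2 := by simp
  rw [h3, smul_eq_mul, div_pow, ← Real.exp_nat_mul]
  push_cast
  field_simp

/-- The inverse symbol is square-integrable because it is the Fourier transform of the
square-integrable Yukawa potential. -/
theorem isDispersion_symbol (hc : 0 < c) (hl : 0 < l) : IsDispersion (symbol c l) where
  pos := symbol_pos hc hl
  measurable := by unfold symbol; fun_prop
  memLp := by
    have h := memLp_fourier (integrable_yukawa hc hl).ofReal (memLp_yukawa hc hl)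
    exact h.ae_eq (.of_forall fun p => fourier_yukawa hc hl p)

end Yukawa

/-! ### Polar coordinates: a null set meets almost every ray in a null set. -/

section Polar

theorem lintegral_polar {f : Space → ENNReal} (hf : Measurable f) :
    ∫⁻ x, f x = ∫⁻ ω : Metric.sphere (0 : Space) 1, (∫⁻ s in Set.Ioi (0 : ℝ),
      ENNReal.ofReal (s ^ 2) * f (s • (ω : Space))) ∂(volume : Measure Space).toSphere := by
  have hd : Module.finrank ℝ Space - 1 = 2 := by simp
  have hmp := (volume : Measure Space).measurePreserving_homeomorphUnitSphereProd
  rw [hd] at hmp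
  have hg : Measurable fun q : Metric.sphere (0 : Space) 1 × Set.Ioi (0 : ℝ) =>
      f ((q.2 : ℝ) • (q.1 : Space)) := hf.comp (by fun_prop)
  have h1 : ∫⁻ x, f x = ∫⁻ x : ({0}ᶜ : Set Space), f x ∂((volume : Measure Space).comap (↑)) := by
    rw [lintegral_subtype_comap (measurableSet_singleton _).compl, restrict_compl_singleton]
  rw [h1]
  have h2 := hmp.lintegral_comp hg
  have h3 : ∀ x : ({0}ᶜ : Set Space), ((homeomorphUnitSphereProd Space x).2 : ℝ) •
      ((homeomorphUnitSphereProd Space x).1 : Space) = x := fun x => by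
    have := norm_ne_zero_iff.mpr x.2
    simp [smul_smul, this]
  simp only [h3] at h2
  rw [h2, lintegral_prod _ hg.aemeasurable]
  refine lintegral_congr fun ω => ?_
  have hm : Measurable fun s : Set.Ioi (0 : ℝ) => f ((s : ℝ) • (ω : Space)) :=
    hf.comp (by fun_prop)
  rw [Measure.volumeIoiPow, lintegral_withDensity_eq_lintegral_mul _ (by fun_prop) hm,
    ← lintegral_subtype_comap measurableSet_Ioi
      (fun s => ENNReal.ofReal (s ^ 2) * f (s • (ω : Space)))]
  rfl

theorem ae_ae_polar {P : Space → Prop} (h : ∀ᵐ x, P x) :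
    ∀ᵐ ω : Metric.sphere (0 : Space) 1 ∂(volume : Measure Space).toSphere,
      ∀ᵐ s : ℝ, 0 < s → P (s • (ω : Space)) := by
  obtain ⟨N, hN, hmeas, h0⟩ := exists_measurable_superset_of_null h
  have h1 := lintegral_polar ((measurable_const (a := (1 : ENNReal))).indicator hmeas)
  rw [lintegral_indicator_const hmeas, h0, mul_zero, eq_comm, lintegral_eq_zero_iff] at h1
  · filter_upwards [h1] with ω hω
    simp only [Pi.zero_apply] at hω
    rw [lintegral_eq_zero_iff, EventuallyEq, ae_restrict_iff' measurableSet_Ioi] at hω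
    · filter_upwards [hω] with s hs hpos
      have h2 := hs hpos
      simp only [Pi.zero_apply, mul_eq_zero, ENNReal.ofReal_eq_zero, not_le.mpr (pow_pos hpos 2),
        false_or, Set.indicator_apply_eq_zero, one_ne_zero, imp_false] at h2
      by_contra hP
      exact h2 (hN hP)
    · exact Measurable.mul (by fun_prop)
        (((measurable_const (a := (1 : ENNReal))).indicator hmeas).comp (by fun_prop))
  · refine Measurable.lintegral_prod_right' (ν := volume.restrict (Set.Ioi (0 : ℝ))) (f := fun q : Metric.sphere (0 : Space) 1 × ℝ =>
      ENNReal.ofReal (q.2 ^ 2) * N.indicator 1 (q.2 • (q.1 : Space))) ?_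
    exact Measurable.mul (by fun_prop)
      (((measurable_const (a := (1 : ENNReal))).indicator hmeas).comp (by fun_prop))

end Polar

/-! ### A bound for radial derivatives. -/

section Ray

/-- The derivative of sU' - U is sU'', so rU'(r) is bounded by values of U and an integral of sU''.
Only the weight s²|U''|² enters, which is what polar coordinates make of a square-integrable
Hessian. The free ε is chosen later to make a series converge. -/
theorem norm_radial_deriv_le {U U₁ U₂ : ℝ → ℂ} (h1 : ∀ s, HasDerivAt U (U₁ s) s)
    (h2 : ∀ s, HasDerivAt U₁ (U₂ s) s) (hc : Continuous U₂) {M : ℝ} (hM : ∀ s, ‖U s‖ ≤ M)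
    {ε : ℝ} (hε : 0 < ε) {r : ℝ} (hr : r ∈ Set.Ioo (0 : ℝ) 1) :
    ‖U r + r * U₁ r‖ ≤ 3 * M + ε + ε⁻¹ * ∫ s in (0 : ℝ)..1, s ^ 2 * ‖U₂ s‖ ^ 2 := by
  have h3 : ∀ s : ℝ, HasDerivAt (fun s : ℝ => (s : ℂ) * U₁ s - U s) ((s : ℂ) * U₂ s) s := by
    intro s
    refine (((Complex.ofRealCLM.hasDerivAt (x := s)).fun_mul (h2 s)).fun_sub (h1 s)).congr_deriv ?_
    simp
  have hcont : Continuous fun s : ℝ => (s : ℂ) * U₂ s := by fun_prop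
  have h4 := intervalIntegral.integral_eq_sub_of_hasDerivAt (fun s _ => h3 s)
    (hcont.intervalIntegrable 0 r)
  have h5 : (r : ℂ) * U₁ r = U r - U 0 + ∫ s in (0 : ℝ)..r, (s : ℂ) * U₂ s := by
    rw [h4]; push_cast; ring
  have hc2 : Continuous fun s : ℝ => ε + ε⁻¹ * (s ^ 2 * ‖U₂ s‖ ^ 2) := by fun_prop
  have h6 : ‖∫ s in (0 : ℝ)..r, (s : ℂ) * U₂ s‖ ≤
      ∫ s in (0 : ℝ)..1, (ε + ε⁻¹ * (s ^ 2 * ‖U₂ s‖ ^ 2)) := by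
    refine (intervalIntegral.norm_integral_le_of_norm_le hr.1.le
      (g := fun s => ε + ε⁻¹ * (s ^ 2 * ‖U₂ s‖ ^ 2)) (.of_forall fun s _ => ?_)
      (hc2.intervalIntegrable _ _)).trans ?_
    · have : 0 ≤ (‖(s : ℂ) * U₂ s‖ - ε) ^ 2 := sq_nonneg _
      have h7 : ‖(s : ℂ) * U₂ s‖ ^ 2 = s ^ 2 * ‖U₂ s‖ ^ 2 := by
        rw [norm_mul, mul_pow, Complex.norm_real, Real.norm_eq_abs, sq_abs]
      have h8 : 0 ≤ ‖(s : ℂ) * U₂ s‖ := norm_nonneg _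
      rw [← h7, ← sub_nonneg]
      have h9 : ε + ε⁻¹ * ‖(s : ℂ) * U₂ s‖ ^ 2 - ‖(s : ℂ) * U₂ s‖ =
        ε⁻¹ * ((‖(s : ℂ) * U₂ s‖ - ε) ^ 2 + ε * ‖(s : ℂ) * U₂ s‖) := by field_simp; ring
      rw [h9]; positivity
    · refine intervalIntegral.integral_mono_interval le_rfl hr.1.le hr.2.le
        (.of_forall fun s => by simp only [Pi.zero_apply]; positivity) (hc2.intervalIntegrable _ _)
  rw [intervalIntegral.integral_add (continuous_const.intervalIntegrable _ _)
    ((by fun_prop : Continuous fun s : ℝ => ε⁻¹ * (s ^ 2 * ‖U₂ s‖ ^ 2)).intervalIntegrable _ _),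
    intervalIntegral.integral_const, intervalIntegral.integral_const_mul, sub_zero, one_smul] at h6
  rw [h5]
  calc ‖U r + (U r - U 0 + ∫ s in (0 : ℝ)..r, (s : ℂ) * U₂ s)‖
      ≤ ‖U r‖ + (‖U r‖ + ‖U 0‖ + ‖∫ s in (0 : ℝ)..r, (s : ℂ) * U₂ s‖) :=
        (norm_add_le _ _).trans (add_le_add le_rfl ((norm_add_le _ _).trans
          (add_le_add (norm_sub_le _ _) le_rfl)))
    _ ≤ _ := by linarith [hM r, hM 0]

end Ray

/-! ### Rays through Schwartz functions and Hessian bounds from the symbol. -/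

section Schwartz

open FourierTransform SchwartzMap LineDeriv

/-- The `a`-th partial derivative. -/
def partialD (a : Fin 3) (u : 𝓢(Space, ℂ)) : 𝓢(Space, ℂ) := ∂_{EuclideanSpace.single a (1 : ℝ)} u

theorem hasDerivAt_ray (u : 𝓢(Space, ℂ)) (ω : Space) (s : ℝ) :
    HasDerivAt (fun s : ℝ => u (s • ω)) (∑ a, (ω a : ℂ) * partialD a u (s • ω)) s := by
  have h1 : HasFDerivAt u (fderiv ℝ u (s • ω)) (s • ω) :=
    (u.differentiable (s • ω)).hasFDerivAt
  have h2 : HasDerivAt (fun s : ℝ => s • ω) ω s := by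
    simpa using (hasDerivAt_id s).smul_const ω
  refine (h1.comp_hasDerivAt s h2).congr_deriv ?_
  have h3 : ω = ∑ a, ω a • EuclideanSpace.single a (1 : ℝ) := by
    ext b
    simp [Fin.sum_univ_three]
    fin_cases b <;> simp
  conv_lhs => rw [h3]
  rw [map_sum]
  refine Finset.sum_congr rfl fun a _ => ?_
  rw [map_smul, partialD, lineDerivOp_apply_eq_fderiv, Complex.real_smul]
  rw [← h3]

/-- The sum of the absolute values of the second partial derivatives. -/
def hessSum (u : 𝓢(Space, ℂ)) (x : Space) : ℝ := ∑ a, ∑ b, ‖partialD b (partialD a u) x‖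

theorem continuous_hessSum (u : 𝓢(Space, ℂ)) : Continuous (hessSum u) := by
  unfold hessSum
  exact continuous_finsetSum _ fun a _ => continuous_finsetSum _ fun b _ =>
    (SchwartzMap.continuous _).norm

/-- The derivative of `r ↦ r u(r ω)`. -/
def rayDeriv (u : 𝓢(Space, ℂ)) (ω : Space) (r : ℝ) : ℂ :=
  u (r • ω) + r * ∑ a, (ω a : ℂ) * partialD a u (r • ω)

theorem hasDerivAt_mul_ray (u : 𝓢(Space, ℂ)) (ω : Space) (r : ℝ) :
    HasDerivAt (fun r : ℝ => (r : ℂ) * u (r • ω)) (rayDeriv u ω r) r := by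
  refine ((Complex.ofRealCLM.hasDerivAt (x := r)).fun_mul (hasDerivAt_ray u ω r)).congr_deriv ?_
  simp [rayDeriv]

theorem continuous_rayDeriv (u : 𝓢(Space, ℂ)) (ω : Space) : Continuous (rayDeriv u ω) := by
  unfold rayDeriv
  have : ∀ v : 𝓢(Space, ℂ), Continuous fun r : ℝ => v (r • ω) := fun v =>
    v.continuous.comp (by fun_prop)
  exact (this u).add (Complex.continuous_ofReal.mul
    (continuous_finsetSum _ fun a _ => continuous_const.mul (this _)))

theorem norm_rayDeriv_le (u : 𝓢(Space, ℂ)) {ω : Space} (hω : ‖ω‖ = 1) {M : ℝ}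
    (hM : ∀ x, ‖u x‖ ≤ M) {ε : ℝ} (hε : 0 < ε) {r : ℝ} (hr : r ∈ Set.Ioo (0 : ℝ) 1) :
    ‖rayDeriv u ω r‖ ≤ 3 * M + ε +
      ε⁻¹ * ∫ s in Set.Ioc (0 : ℝ) 1, s ^ 2 * hessSum u (s • ω) ^ 2 := by
  have hcu : ∀ v : 𝓢(Space, ℂ), Continuous fun r : ℝ => v (r • ω) := fun v =>
    v.continuous.comp (by fun_prop)
  have hω1 : ∀ a, ‖(ω a : ℂ)‖ ≤ 1 := fun a => by
    rw [Complex.norm_real, ← hω]; exact PiLp.norm_apply_le ω a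
  have hc2 : Continuous fun s : ℝ =>
      ∑ a, (ω a : ℂ) * ∑ b, (ω b : ℂ) * partialD b (partialD a u) (s • ω) :=
    continuous_finsetSum _ fun a _ => continuous_const.mul
      (continuous_finsetSum _ fun b _ => continuous_const.mul (hcu _))
  refine (norm_radial_deriv_le (hasDerivAt_ray u ω)
    (fun s => HasDerivAt.fun_sum fun a _ => (hasDerivAt_ray (partialD a u) ω s).const_mul _)
    hc2 (fun s => hM _) hε hr).trans ?_
  gcongr
  rw [intervalIntegral.integral_of_le zero_le_one]
  have hch : Continuous fun s : ℝ => hessSum u (s • ω) :=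
    (continuous_hessSum u).comp (by fun_prop)
  refine integral_mono_of_nonneg (.of_forall fun s => by simp only [Pi.zero_apply]; positivity)
    ((by fun_prop : Continuous fun s : ℝ => s ^ 2 * hessSum u (s • ω) ^ 2).integrableOn_Ioc)
    (.of_forall fun s => ?_)
  simp only
  gcongr
  refine (norm_sum_le _ _).trans (Finset.sum_le_sum fun a _ => ?_)
  rw [norm_mul]
  refine (mul_le_of_le_one_left (norm_nonneg _) (hω1 a)).trans ?_
  refine (norm_sum_le _ _).trans (Finset.sum_le_sum fun b _ => ?_)
  rw [norm_mul]
  exact mul_le_of_le_one_left (norm_nonneg _) (hω1 b)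

theorem integrable_norm_sq_schwartz (u : 𝓢(Space, ℂ)) : Integrable fun x => ‖u x‖ ^ 2 :=
  (memLp_two_iff_integrable u.continuous.aestronglyMeasurable).mp (u.memLp 2)

theorem partialD_fourier (a : Fin 3) (φ : 𝓢(Space, ℂ)) :
    ∃ φ' : 𝓢(Space, ℂ), partialD a (𝓕 φ) = 𝓕 φ' ∧
      ∀ p, ‖φ' p‖ = 2 * Real.pi * |p a| * ‖φ p‖ := by
  refine ⟨_, lineDerivOp_fourier_eq φ _, fun p => ?_⟩
  have hg : (fun p : Space => inner ℝ p (EuclideanSpace.single a (1 : ℝ))).HasTemperateGrowth :=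
    by fun_prop
  rw [smul_apply, smulLeftCLM_apply_apply hg]
  simp [EuclideanSpace.inner_single_right, abs_of_pos Real.pi_pos, mul_assoc]

/-- By Plancherel two derivatives are multiplication by at most (2π)²|p|², which is at most
symbol/c. -/
theorem integral_partialD_sq_le {c l : ℝ} (hc : 0 < c) (hl : 0 < l) (φ : 𝓢(Space, ℂ))
    (hφ : Integrable fun p => ‖(symbol c l p : ℂ) * φ p‖ ^ 2) (a b : Fin 3) :
    ∫ x, ‖partialD b (partialD a (𝓕 φ)) x‖ ^ 2 ≤
      (c⁻¹) ^ 2 * ∫ p, ‖(symbol c l p : ℂ) * φ p‖ ^ 2 := by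
  obtain ⟨φ₁, h1, h1'⟩ := partialD_fourier a φ
  obtain ⟨φ₂, h2, h2'⟩ := partialD_fourier b φ₁
  rw [h1, h2, integral_norm_sq_fourier, ← integral_const_mul]
  refine integral_mono (integrable_norm_sq_schwartz φ₂) (hφ.const_mul _) fun p => ?_
  simp only
  rw [← mul_pow, h2', h1', norm_mul, Complex.norm_real, Real.norm_of_nonneg (symbol_pos hc hl p).le]
  have ha : |p a| ≤ ‖p‖ := PiLp.norm_apply_le p a
  have hb : |p b| ≤ ‖p‖ := PiLp.norm_apply_le p b
  gcongr ?_ ^ 2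
  have h3 : |p b| * |p a| ≤ ‖p‖ * ‖p‖ := by gcongr
  have h4 : (2 * Real.pi) ^ 2 * (‖p‖ * ‖p‖) ≤ c⁻¹ * symbol c l p := by
    unfold symbol
    rw [mul_add, ← mul_assoc c⁻¹, inv_mul_cancel₀ hc.ne', one_mul, ← pow_two]
    have : 0 < c⁻¹ * l := by positivity
    linarith
  calc 2 * Real.pi * |p b| * (2 * Real.pi * |p a| * ‖φ p‖)
      = (2 * Real.pi) ^ 2 * (|p b| * |p a|) * ‖φ p‖ := by ring
    _ ≤ (2 * Real.pi) ^ 2 * (‖p‖ * ‖p‖) * ‖φ p‖ := by gcongr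
    _ ≤ c⁻¹ * symbol c l p * ‖φ p‖ := by gcongr
    _ = _ := by ring

/-- The constant 81 is 9 from Cauchy-Schwarz on nine summands times the nine second derivatives. -/
theorem lintegral_hessSum_le {c l : ℝ} (hc : 0 < c) (hl : 0 < l) (φ : 𝓢(Space, ℂ))
    (hφ : Integrable fun p => ‖(symbol c l p : ℂ) * φ p‖ ^ 2) :
    ∫⁻ x, ENNReal.ofReal (hessSum (𝓕 φ) x ^ 2) ≤
      ENNReal.ofReal (81 * (c⁻¹) ^ 2 * ∫ p, ‖(symbol c l p : ℂ) * φ p‖ ^ 2) := by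
  set u := 𝓕 φ
  have h1 : ∀ x, hessSum u x ^ 2 ≤ 9 * ∑ a, ∑ b, ‖partialD b (partialD a u) x‖ ^ 2 := by
    intro x
    unfold hessSum
    refine (sq_sum_le_card_mul_sum_sq (s := Finset.univ)).trans ?_
    rw [Finset.mul_sum, Finset.mul_sum]
    refine Finset.sum_le_sum fun a _ => ?_
    have := sq_sum_le_card_mul_sum_sq (s := Finset.univ)
      (f := fun b => ‖partialD b (partialD a u) x‖)
    simp only [Finset.card_univ, Fintype.card_fin] at this ⊢
    push_cast at this ⊢
    linarith
  have hi : Integrable fun x => 9 * ∑ a, ∑ b, ‖partialD b (partialD a u) x‖ ^ 2 :=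
    (integrable_finsetSum _ fun a _ => integrable_finsetSum _ fun b _ =>
      integrable_norm_sq_schwartz _).const_mul _
  refine (lintegral_mono fun x => ENNReal.ofReal_le_ofReal (h1 x)).trans ?_
  rw [← ofReal_integral_eq_lintegral_ofReal hi (.of_forall fun x => by
    simp only [Pi.zero_apply]; positivity)]
  refine ENNReal.ofReal_le_ofReal ?_
  rw [integral_const_mul, integral_finsetSum _ fun a _ => integrable_finsetSum _ fun b _ =>
    integrable_norm_sq_schwartz _]
  have h2 : ∑ a : Fin 3, ∫ x, ∑ b : Fin 3, ‖partialD b (partialD a u) x‖ ^ 2 ≤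
      ∑ a : Fin 3, ∑ b : Fin 3, (c⁻¹) ^ 2 * ∫ p, ‖(symbol c l p : ℂ) * φ p‖ ^ 2 := by
    refine Finset.sum_le_sum fun a _ => ?_
    rw [integral_finsetSum _ fun b _ => integrable_norm_sq_schwartz _]
    exact Finset.sum_le_sum fun b _ => integral_partialD_sq_le hc hl φ hφ a b
  simp only [Finset.sum_const, Finset.card_univ, Fintype.card_fin, nsmul_eq_mul] at h2
  push_cast at h2
  linarith

end Schwartz

/-! ### Radial regularity of H² functions at the origin. -/

section RadialRegularity

open FourierTransform SchwartzMap

variable {c l : ℝ}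

/-- The solution `𝓕 (symbol⁻¹ G)` of `(l - c ∇²) v = 𝓕 G`. -/
def potential (c l : ℝ) (G : Space → ℂ) (x : Space) : ℂ :=
  𝓕 (fun p => (((symbol c l p)⁻¹ : ℝ) : ℂ) * G p) x

theorem memLp_phase_mul {α : Type*} [MeasurableSpace α] {μ : Measure α} {f : α → ℂ}
    (hf : MemLp f 2 μ) {θ : α → ℝ} (hθ : Measurable θ) :
    MemLp (fun x => phase (θ x) * f x) 2 μ :=
  hf.of_le ((continuous_phase.measurable.comp hθ).aestronglyMeasurable.mul hf.1)
    (.of_forall fun x => by rw [norm_mul, norm_phase, one_mul])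

theorem memLp_plane (hc : 0 < c) (hl : 0 < l) (x : Space) :
    MemLp (fun p => phase (-inner ℝ p x) * (((symbol c l p)⁻¹ : ℝ) : ℂ)) 2 :=
  memLp_phase_mul (isDispersion_symbol hc hl).memLp (by fun_prop)

theorem potential_eq_pairing (hc : 0 < c) (hl : 0 < l) (F : Lp ℂ 2 (volume : Measure Space))
    (x : Space) : potential c l F x = pairing (memLp_plane hc hl x) F := by
  rw [pairing_apply, potential, fourier_eq_integral_mul]
  exact integral_congr_ae (.of_forall fun p => by ring)

theorem potential_congr {G G' : Space → ℂ} (h : G =ᵐ[volume] G') :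
    potential c l G = potential c l G' := by
  funext x
  rw [potential, potential, fourier_eq_integral_mul, fourier_eq_integral_mul]
  exact integral_congr_ae (h.mono fun p hp => by simp only [hp])

/-- Point values are bounded functionals of F because 1/symbol is square-integrable. -/
theorem norm_potential_le (hc : 0 < c) (hl : 0 < l) (F : Lp ℂ 2 (volume : Measure Space))
    (x : Space) :
    ‖potential c l F x‖ ≤ √(∫ p, ((symbol c l p)⁻¹) ^ 2) * ‖F‖ := by
  refine abs_le_of_sq_le_sq' ?_ (by positivity) |>.2
  rw [potential_eq_pairing hc hl, pairing_apply, mul_pow, Real.sq_sqrt (integral_nonneg fun p => by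
    positivity), norm_sq_Lp_eq_integral, mul_comm]
  refine (norm_integral_mul_sq_le (Lp.memLp F) (memLp_plane hc hl x)).trans (le_of_eq ?_)
  congr 1
  refine integral_congr_ae (.of_forall fun p => ?_)
  simp only
  rw [norm_mul, norm_phase, one_mul, Complex.norm_real, Real.norm_eq_abs, sq_abs]

/-- The square-integrable functions of the form `symbol · φ` with a Schwartz function `φ`. -/
def symbolRange (c l : ℝ) : AddSubgroup (Lp ℂ 2 (volume : Measure Space)) where
  carrier := {F | ∃ φ : 𝓢(Space, ℂ), F =ᵐ[volume] fun p => (symbol c l p : ℂ) * φ p}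
  zero_mem' := ⟨0, (Lp.coeFn_zero _ _ _).trans (.of_forall fun p => by simp)⟩
  add_mem' := by
    rintro F F' ⟨φ, hφ⟩ ⟨φ', hφ'⟩
    refine ⟨φ + φ', ?_⟩
    filter_upwards [Lp.coeFn_add F F', hφ, hφ'] with p h1 h2 h3
    rw [h1, Pi.add_apply, h2, h3, add_apply, mul_add]
  neg_mem' := by
    rintro F ⟨φ, hφ⟩
    refine ⟨-φ, ?_⟩
    filter_upwards [Lp.coeFn_neg F, hφ] with p h1 h2
    rw [h1, Pi.neg_apply, h2, neg_apply, mul_neg]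

/-- A test function g is symbol · (g/symbol), and g/symbol is again a test function. -/
theorem dense_symbolRange (hc : 0 < c) (hl : 0 < l) :
    Dense (symbolRange c l : Set (Lp ℂ 2 (volume : Measure Space))) := by
  refine (Lp.dense_hasCompactSupport_contDiff (p := 2) (by simp)).mono ?_
  rintro F ⟨g, hFg, hgc, hg⟩
  have hs : ContDiff ℝ (⊤ : ℕ∞) fun p => (((symbol c l p)⁻¹ : ℝ) : ℂ) := by
    refine Complex.ofRealCLM.contDiff.comp (ContDiff.inv ?_ fun p => (symbol_pos hc hl p).ne')
    exact (contDiff_const.mul (contDiff_const.mul (contDiff_norm_sq ℝ))).add contDiff_const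
  have hsupp : HasCompactSupport fun p => (((symbol c l p)⁻¹ : ℝ) : ℂ) * g p := hgc.mul_left
  refine ⟨hsupp.toSchwartzMap (hs.mul hg), hFg.trans (.of_forall fun p => ?_)⟩
  change g p = (symbol c l p : ℂ) * ((((symbol c l p)⁻¹ : ℝ) : ℂ) * g p)
  have := (symbol_pos hc hl p).ne'
  rw [← mul_assoc, ← Complex.ofReal_mul, mul_inv_cancel₀ this, Complex.ofReal_one, one_mul]

theorem potential_eq_fourier (hc : 0 < c) (hl : 0 < l) {F : Space → ℂ}
    {φ : 𝓢(Space, ℂ)} (hF : F =ᵐ[volume] fun p => (symbol c l p : ℂ) * φ p) (x : Space) :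
    potential c l F x = (𝓕 φ : 𝓢(Space, ℂ)) x := by
  rw [potential_congr hF, potential, fourier_coe, fourier_eq_integral_mul, fourier_eq_integral_mul]
  refine integral_congr_ae (.of_forall fun p => ?_)
  simp only
  rw [← mul_assoc (((symbol c l p)⁻¹ : ℝ) : ℂ), ← Complex.ofReal_mul,
    inv_mul_cancel₀ (symbol_pos hc hl p).ne',
    Complex.ofReal_one, one_mul]

/-- The square-integral of the Hessian along a ray. -/
def rayEnergy (u : 𝓢(Space, ℂ)) (ω : Space) : ENNReal :=
  ∫⁻ s in Set.Ioi (0 : ℝ), ENNReal.ofReal (s ^ 2) * ENNReal.ofReal (hessSum u (s • ω) ^ 2)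

theorem measurable_rayEnergy (u : 𝓢(Space, ℂ)) :
    Measurable fun ω : Metric.sphere (0 : Space) 1 => rayEnergy u ω := by
  refine Measurable.lintegral_prod_right' (ν := volume.restrict (Set.Ioi (0 : ℝ)))
    (f := fun q : Metric.sphere (0 : Space) 1 × ℝ =>
      ENNReal.ofReal (q.2 ^ 2) * ENNReal.ofReal (hessSum u (q.2 • (q.1 : Space)) ^ 2)) ?_
  have := (continuous_hessSum u).measurable.comp
    (by fun_prop : Measurable fun q : Metric.sphere (0 : Space) 1 × ℝ => q.2 • (q.1 : Space))
  exact Measurable.mul (by fun_prop) (ENNReal.measurable_ofReal.comp (this.pow_const 2))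

theorem lintegral_rayEnergy (u : 𝓢(Space, ℂ)) :
    ∫⁻ ω : Metric.sphere (0 : Space) 1, rayEnergy u ω ∂(volume : Measure Space).toSphere =
      ∫⁻ x, ENNReal.ofReal (hessSum u x ^ 2) :=
  (lintegral_polar (ENNReal.measurable_ofReal.comp
    ((continuous_hessSum u).measurable.pow_const 2))).symm

theorem integral_le_rayEnergy (u : 𝓢(Space, ℂ)) (ω : Space) (h : rayEnergy u ω ≠ ⊤) :
    ∫ s in Set.Ioc (0 : ℝ) 1, s ^ 2 * hessSum u (s • ω) ^ 2 ≤ (rayEnergy u ω).toReal := by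
  rw [integral_eq_lintegral_of_nonneg_ae (.of_forall fun s => by
    simp only [Pi.zero_apply]; positivity)]
  · refine ENNReal.toReal_mono h ?_
    simp_rw [ENNReal.ofReal_mul (sq_nonneg _)]
    exact lintegral_mono_set Set.Ioc_subset_Ioi_self
  · have : Continuous fun s : ℝ => hessSum u (s • ω) := (continuous_hessSum u).comp (by fun_prop)
    exact (by fun_prop : Continuous fun s : ℝ => s ^ 2 * hessSum u (s • ω) ^ 2).aestronglyMeasurable

/-- A square-integrable function is a rapidly converging series of functions `symbol · φ`. -/
theorem exists_symbol_series (hc : 0 < c) (hl : 0 < l) (F : Lp ℂ 2 (volume : Measure Space)) :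
    ∃ (D : ℕ → Lp ℂ 2 (volume : Measure Space)) (φ : ℕ → 𝓢(Space, ℂ)) (B : ℝ), HasSum D F ∧
      (∀ k, D k =ᵐ[volume] fun p => (symbol c l p : ℂ) * φ k p) ∧
      ∀ k, ‖D k‖ ≤ B * (1 / 2) ^ k := by
  obtain ⟨D, h1, h2, -, h4⟩ := controlled_sum_of_mem_closure (s := symbolRange c l) (a := F)
    (dense_symbolRange hc hl F) (b := fun k => (1 / 2 : ℝ) ^ k) (fun k => by positivity)
  choose φ hφ using h2
  have h5 : ∀ k, ‖D k‖ ≤ (1 + ‖D 0‖) * (1 / 2) ^ k := by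
    intro k
    rcases Nat.eq_zero_or_pos k with rfl | hk
    · simp
    · refine (h4 k hk).le.trans ?_
      exact le_mul_of_one_le_left (by positivity) (by linarith [norm_nonneg (D 0)])
  refine ⟨D, φ, 1 + ‖D 0‖, ?_, hφ, h5⟩
  have h6 : Summable D := .of_norm_bounded
    ((summable_geometric_of_lt_one (by norm_num) (by norm_num)).mul_left _) h5
  have h7 := h6.hasSum.tendsto_sum_nat
  rw [← tendsto_nhds_unique ((tendsto_add_atTop_iff_nat 1).mpr h7) h1]
  exact h6.hasSum

/-- The potential is a geometrically convergent series of Schwartz functions. On almost every ray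
the radial derivatives of the terms are dominated by a summable sequence, so the series may be
differentiated, and passed to the limit r ↘ 0, term by term. -/
theorem ae_hasDerivAt_potential (hc : 0 < c) (hl : 0 < l) {G : Space → ℂ} (hG : MemLp G 2) :
    ∀ᵐ ω : Metric.sphere (0 : Space) 1 ∂(volume : Measure Space).toSphere,
      ∃ f' : ℝ → ℂ, (∀ r ∈ Set.Ioo (0 : ℝ) 1,
        HasDerivAt (fun r : ℝ => (r : ℂ) * potential c l G (r • (ω : Space))) (f' r) r) ∧
      Tendsto f' (𝓝[>] 0) (𝓝 (potential c l G 0)) := by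
  rw [← potential_congr hG.coeFn_toLp]
  generalize hG.toLp = F
  obtain ⟨D, φ, B, hD, hφ, hB⟩ := exists_symbol_series hc hl F
  set u : ℕ → 𝓢(Space, ℂ) := fun k => 𝓕 (φ k) with hu
  set K : ℝ := √(∫ p, ((symbol c l p)⁻¹) ^ 2) with hK
  have hK0 : 0 ≤ K := Real.sqrt_nonneg _
  have hsum : ∀ x, HasSum (fun k => u k x) (potential c l F x) := fun x => by
    rw [potential_eq_pairing hc hl]
    refine ((pairing (memLp_plane hc hl x)).hasSum hD).congr_fun fun k => ?_
    rw [← potential_eq_pairing hc hl, potential_eq_fourier hc hl (hφ k)]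
  have hM : ∀ k x, ‖u k x‖ ≤ K * (B * (1 / 2) ^ k) := fun k x => by
    rw [hu, ← potential_eq_fourier hc hl (hφ k)]
    exact (norm_potential_le hc hl _ _).trans (by gcongr; exact hB k)
  have hgeom : Summable fun k : ℕ => (1 / 2 : ℝ) ^ k :=
    summable_geometric_of_lt_one (by norm_num) (by norm_num)
  have hI : ∀ k, Integrable fun p => ‖(symbol c l p : ℂ) * φ k p‖ ^ 2 := fun k =>
    ((memLp_two_iff_integrable (Lp.memLp (D k)).1).mp (Lp.memLp (D k))).congr
      ((hφ k).mono fun p hp => by simp only [hp])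
  have hI2 : ∀ k, ∫ p, ‖(symbol c l p : ℂ) * φ k p‖ ^ 2 ≤ (B * (1 / 2) ^ k) ^ 2 := fun k => by
    have h1 : ∫ p, ‖(symbol c l p : ℂ) * φ k p‖ ^ 2 = ‖D k‖ ^ 2 := by
      rw [norm_sq_Lp_eq_integral]
      exact integral_congr_ae ((hφ k).mono fun p hp => by simp only [hp])
    rw [h1]
    exact pow_le_pow_left₀ (norm_nonneg _) (hB k) 2
  -- The energies integrate to O(4^{-k}), so even with the weight 2^k, the inverse of ε = 2^{-k},
  -- their sum is integrable over the sphere and hence finite for almost every direction.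
  have hfin : ∫⁻ ω : Metric.sphere (0 : Space) 1,
      (∑' k, ENNReal.ofReal (2 ^ k) * rayEnergy (u k) ω) ∂(volume : Measure Space).toSphere ≠ ⊤ := by
    rw [lintegral_tsum fun k => ((measurable_rayEnergy (u k)).const_mul _).aemeasurable]
    have h2 : ∀ k, ∫⁻ ω : Metric.sphere (0 : Space) 1, ENNReal.ofReal (2 ^ k) * rayEnergy (u k) ω
        ∂(volume : Measure Space).toSphere ≤
        ENNReal.ofReal (81 * (c⁻¹) ^ 2 * B ^ 2 * (1 / 2) ^ k) := fun k => by
      rw [lintegral_const_mul _ (measurable_rayEnergy _), lintegral_rayEnergy]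
      refine (mul_le_mul_right (lintegral_hessSum_le hc hl (φ k) (hI k)) _).trans ?_
      rw [← ENNReal.ofReal_mul (by positivity)]
      refine ENNReal.ofReal_le_ofReal ?_
      calc (2 : ℝ) ^ k * (81 * (c⁻¹) ^ 2 * ∫ p, ‖(symbol c l p : ℂ) * φ k p‖ ^ 2)
          ≤ 2 ^ k * (81 * (c⁻¹) ^ 2 * (B * (1 / 2) ^ k) ^ 2) := by gcongr; exact hI2 k
        _ = 81 * (c⁻¹) ^ 2 * B ^ 2 * (1 / 2) ^ k * (2 ^ k * (1 / 2) ^ k) := by ring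
        _ = _ := by rw [← mul_pow]; norm_num
    refine ne_top_of_le_ne_top ?_ (ENNReal.tsum_le_tsum h2)
    rw [← ENNReal.ofReal_tsum_of_nonneg (fun k => by positivity) (hgeom.mul_left _)]
    exact ENNReal.ofReal_ne_top
  filter_upwards [ae_lt_top (Measurable.tsum fun k =>
    (measurable_rayEnergy (u k)).const_mul _) hfin] with ω hω
  have hω1 : ‖(ω : Space)‖ = 1 := by simp
  have hS := ENNReal.summable_toReal hω.ne
  set b : ℕ → ℝ := fun k => 3 * (K * (B * (1 / 2) ^ k)) + (1 / 2) ^ k +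
    (ENNReal.ofReal (2 ^ k) * rayEnergy (u k) ω).toReal with hb
  have hbs : Summable b := ((((hgeom.mul_left B).mul_left K).mul_left 3).add hgeom).add hS
  have hbound : ∀ k, ∀ r ∈ Set.Ioo (0 : ℝ) 1, ‖rayDeriv (u k) ω r‖ ≤ b k := fun k r hr => by
    refine (norm_rayDeriv_le (u k) hω1 (hM k) (ε := (1 / 2) ^ k) (by positivity) hr).trans ?_
    rw [hb]
    simp only
    gcongr
    rw [ENNReal.toReal_mul, ENNReal.toReal_ofReal (by positivity)]
    have h3 : ((1 / 2 : ℝ) ^ k)⁻¹ = 2 ^ k := by simp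
    rw [h3]
    gcongr
    refine integral_le_rayEnergy _ _ fun htop => ?_
    have := ENNReal.ne_top_of_tsum_ne_top hω.ne k
    rw [htop, ENNReal.mul_top (by simp)] at this
    exact this rfl
  refine ⟨fun r => ∑' k, rayDeriv (u k) ω r, fun r hr => ?_, ?_⟩
  · have h4 : (fun r : ℝ => (r : ℂ) * potential c l F (r • (ω : Space))) =
        fun r : ℝ => ∑' k, (r : ℂ) * u k (r • (ω : Space)) := by
      funext r
      exact ((hsum _).mul_left _).tsum_eq.symm
    rw [h4]
    exact hasDerivAt_tsum_of_isPreconnected hbs isOpen_Ioo isPreconnected_Ioo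
      (fun k r _ => hasDerivAt_mul_ray (u k) ω r) hbound hr ((hsum _).summable.mul_left _) hr
  · rw [← (hsum 0).tsum_eq]
    refine tendsto_tsum_of_dominated_convergence hbs (fun k => ?_) ?_
    · have := ((continuous_rayDeriv (u k) ω).tendsto 0).mono_left
        (nhdsWithin_le_nhds (s := Set.Ioi (0 : ℝ)))
      have h5 : rayDeriv (u k) ω 0 = u k 0 := by simp [rayDeriv]
      rwa [h5] at this
    · filter_upwards [Ioo_mem_nhdsGT (zero_lt_one' ℝ)] with r hr k
      exact hbound k r hr

end RadialRegularity

/-! ### Convolution with the Yukawa potential in the last particle, and its trace at the origin. -/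

section Convolution

open FourierTransform

variable {c l : ℝ} {n : ℕ}

/-- The convolution of `F` with the Yukawa potential in the position of the last particle. -/
def lastConv (c l : ℝ) (F : Config (n + 1) → ℂ) (x : Config (n + 1)) : ℂ :=
  ∫ w, (yukawa c l w : ℂ) * F (x - ins (Fin.last n) w 0)

theorem ins_sub_ins_zero (z w : Space) (y : Config n) :
    ins (Fin.last n) z y - ins (Fin.last n) w 0 = ins (Fin.last n) (z - w) y := by
  rw [ins_last, ins_last, ins_last]
  funext i
  refine Fin.lastCases ?_ (fun i => ?_) i <;> simp

theorem lastConv_ins (F : Config (n + 1) → ℂ) (z : Space) (y : Config n) :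
    lastConv c l F (ins (Fin.last n) z y) =
      ∫ w, (yukawa c l w : ℂ) * F (ins (Fin.last n) (z - w) y) := by
  simp only [lastConv, ins_sub_ins_zero]

theorem measurable_ins_zero : Measurable fun w : Space => ins (Fin.last n) w (0 : Config n) :=
  (measurePreserving_ins (Fin.last n)).measurable.comp (measurable_id.prodMk measurable_const)

theorem sum_inner_ins_zero (w : Space) (k : Config (n + 1)) :
    ∑ j, inner ℝ (ins (Fin.last n) w 0 j) (k j) = inner ℝ w (k (Fin.last n)) := by
  rw [Fin.sum_univ_castSucc, ins_last]
  simp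

theorem integral_yukawa_phase (hc : 0 < c) (hl : 0 < l) (p : Space) :
    ∫ w, (yukawa c l w : ℂ) * phase (inner ℝ w p) = (((symbol c l p)⁻¹ : ℝ) : ℂ) := by
  have h := fourier_yukawa hc hl (-p)
  rw [fourier_eq_integral_mul] at h
  simp only [inner_neg_right, neg_neg] at h
  have h2 : symbol c l (-p) = symbol c l p := by simp [symbol]
  rw [← h2, ← h]
  exact integral_congr_ae (.of_forall fun w => mul_comm _ _)

theorem fourierC_translate (ζ : Config n → ℂ) (a k : Config n) :
    fourierC (fun x => ζ (x + a)) k = phase (∑ j, inner ℝ (a j) (k j)) * fourierC ζ k := by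
  rw [fourierC, fourierC, ← integral_const_mul,
    ← integral_add_right_eq_self (fun y => phase (∑ j, inner ℝ (a j) (k j)) *
      (phase (-∑ j, inner ℝ (y j) (k j)) * ζ y)) a]
  refine integral_congr_ae (.of_forall fun y => ?_)
  simp only [Pi.add_apply]
  rw [← mul_assoc, ← phase_add]
  congr 2
  simp only [inner_add_left, Finset.sum_add_distrib]
  ring

theorem norm_integral_mul_le {α : Type*} [MeasurableSpace α] {μ : Measure α} {f g : α → ℂ}
    (hf : MemLp f 2 μ) (hg : MemLp g 2 μ) :
    ∫ x, ‖f x * g x‖ ∂μ ≤ (∫ x, ‖f x‖ ^ 2 ∂μ) + ∫ x, ‖g x‖ ^ 2 ∂μ := by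
  have h1 := (memLp_two_iff_integrable hf.1).mp hf
  have h2 := (memLp_two_iff_integrable hg.1).mp hg
  rw [← integral_add h1 h2]
  refine integral_mono (integrable_mul_of_memLp_two hf hg).norm (h1.add h2) fun x => ?_
  simp only [norm_mul]
  nlinarith [sq_nonneg (‖f x‖ - ‖g x‖), norm_nonneg (f x), norm_nonneg (g x)]

theorem integrable_lastConv_prod (hc : 0 < c) (hl : 0 < l)
    (F : Lp ℂ 2 (volume : Measure (Config (n + 1)))) {ζ : Config (n + 1) → ℂ} (hζ : MemLp ζ 2) :
    Integrable (fun q : Space × Config (n + 1) =>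
      (yukawa c l q.1 : ℂ) * (F (q.2 - ins (Fin.last n) q.1 0) * ζ q.2))
      ((volume : Measure Space).prod (volume : Measure (Config (n + 1)))) := by
  have hm : AEStronglyMeasurable (fun q : Space × Config (n + 1) =>
      (yukawa c l q.1 : ℂ) * (F (q.2 - ins (Fin.last n) q.1 0) * ζ q.2))
      ((volume : Measure Space).prod (volume : Measure (Config (n + 1)))) := by
    refine (Complex.measurable_ofReal.comp
      (measurable_yukawa.comp measurable_fst)).aestronglyMeasurable.mul
      (AEStronglyMeasurable.mul ?_ hζ.1.comp_snd)
    refine ((Lp.stronglyMeasurable F).measurable.comp ?_).aestronglyMeasurable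
    exact measurable_snd.sub (measurable_ins_zero.comp measurable_fst)
  have hsh : ∀ w : Space, MemLp (fun x => F (x - ins (Fin.last n) w 0)) 2 := fun w =>
    (Lp.memLp F).comp_measurePreserving (measurePreserving_sub_right volume _)
  refine (integrable_prod_iff hm).mpr ⟨.of_forall fun w => ?_, ?_⟩
  · exact (integrable_mul_of_memLp_two (hsh w) hζ).const_mul (yukawa c l w : ℂ)
  · refine ((integrable_yukawa hc hl).mul_const ((∫ x, ‖F x‖ ^ 2) + ∫ x, ‖ζ x‖ ^ 2)).mono'
      hm.norm.integral_prod_right' (.of_forall fun w => ?_)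
    rw [Real.norm_of_nonneg (integral_nonneg fun x => norm_nonneg _)]
    simp_rw [norm_mul (yukawa c l w : ℂ), Complex.norm_real,
      Real.norm_of_nonneg (yukawa_nonneg hc w)]
    rw [integral_const_mul]
    refine mul_le_mul_of_nonneg_left ?_ (yukawa_nonneg hc w)
    refine (norm_integral_mul_le (hsh w) hζ).trans (le_of_eq ?_)
    congr 1
    exact integral_sub_right_eq_self (fun x => ‖F x‖ ^ 2) (ins (Fin.last n) w 0)

theorem integrable_lastConv_mul (hc : 0 < c) (hl : 0 < l)
    (F : Lp ℂ 2 (volume : Measure (Config (n + 1)))) {ζ : Config (n + 1) → ℂ} (hζ : MemLp ζ 2) :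
    Integrable fun x => lastConv c l F x * ζ x := by
  refine (integrable_lastConv_prod hc hl F hζ).integral_prod_right.congr (.of_forall fun x => ?_)
  simp only [lastConv, ← mul_assoc]
  rw [integral_mul_const]

theorem locallyIntegrable_lastConv (hc : 0 < c) (hl : 0 < l)
    (F : Lp ℂ 2 (volume : Measure (Config (n + 1)))) : LocallyIntegrable (lastConv c l F) := by
  rw [locallyIntegrable_iff]
  intro K hK
  have h1 : MemLp (K.indicator fun _ : Config (n + 1) => (1 : ℂ)) 2 :=
    memLp_indicator_const 2 hK.measurableSet 1 (Or.inr hK.measure_ne_top)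
  have h2 := integrable_lastConv_mul hc hl F h1
  rw [← integrable_indicator_iff hK.measurableSet]
  refine h2.congr (.of_forall fun x => ?_)
  by_cases hx : x ∈ K <;> simp [hx]

/-- Under the Fourier transform a translation by w is a phase; integrating the phase against the
Yukawa potential gives 1/symbol. -/
theorem integral_lastConv_mul (hc : 0 < c) (hl : 0 < l)
    (F : Lp ℂ 2 (volume : Measure (Config (n + 1)))) {ζ : Config (n + 1) → ℂ}
    (h1 : Integrable ζ) (h2 : MemLp ζ 2) :
    ∫ x, lastConv c l (fourierL2 F) x * ζ x =
      ∫ k, (((symbol c l (k (Fin.last n)))⁻¹ : ℝ) : ℂ) * F k * fourierC ζ k := by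
  have e1 : ∫ x, lastConv c l (fourierL2 F) x * ζ x = ∫ x : Config (n + 1), ∫ w : Space,
      (yukawa c l w : ℂ) * (fourierL2 F (x - ins (Fin.last n) w 0) * ζ x) := by
    refine integral_congr_ae (.of_forall fun x => ?_)
    simp only [lastConv, ← mul_assoc]
    rw [integral_mul_const]
  rw [e1, ← integral_integral_swap (f := fun (w : Space) (x : Config (n + 1)) =>
      (yukawa c l w : ℂ) * (fourierL2 F (x - ins (Fin.last n) w 0) * ζ x))
      (integrable_lastConv_prod hc hl (fourierL2 F) h2)]
  have e2 : ∀ w : Space, ∫ x, (yukawa c l w : ℂ) * (fourierL2 F (x - ins (Fin.last n) w 0) * ζ x) =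
      ∫ k, (yukawa c l w : ℂ) * (phase (inner ℝ w (k (Fin.last n))) * (F k * fourierC ζ k)) := by
    intro w
    rw [integral_const_mul, integral_const_mul]
    congr 1
    have hs := integral_sub_right_eq_self (μ := (volume : Measure (Config (n + 1))))
      (fun x => fourierL2 F x * ζ (x + ins (Fin.last n) w 0)) (ins (Fin.last n) w 0)
    simp only [sub_add_cancel] at hs
    rw [hs, integral_fourierL2_mul F (h1.comp_add_right _)
      (h2.comp_measurePreserving (measurePreserving_add_right volume _))]
    refine integral_congr_ae (.of_forall fun k => ?_)
    simp only
    rw [fourierC_translate, sum_inner_ins_zero]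
    ring
  simp only [e2]
  have hI : Integrable fun k => F k * fourierC ζ k :=
    integrable_mul_of_memLp_two (Lp.memLp F) (memLp_fourierC h1 h2)
  rw [integral_integral_swap]
  · refine integral_congr_ae (.of_forall fun k => ?_)
    simp only [← mul_assoc]
    rw [integral_mul_const, integral_mul_const, integral_yukawa_phase hc hl]
  · have hY : Integrable fun w => (yukawa c l w : ℂ) := (integrable_yukawa hc hl).ofReal
    have h3 := integrable_phase_mul (hY.mul_prod hI)
      (θ := fun q : Space × Config (n + 1) => inner ℝ q.1 (q.2 (Fin.last n))) (by fun_prop)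
    refine h3.congr (.of_forall fun q => ?_)
    simp only [Function.uncurry]
    ring

/-- Convolution with the Yukawa potential is division by the symbol on the Fourier side. -/
theorem lastConv_fourierL2 (hc : 0 < c) (hl : 0 < l)
    (F R : Lp ℂ 2 (volume : Measure (Config (n + 1))))
    (h : R =ᵐ[volume] fun k => (((symbol c l (k (Fin.last n)))⁻¹ : ℝ) : ℂ) * F k) :
    lastConv c l (fourierL2 F) =ᵐ[volume] fourierL2 R := by
  refine ext_of_forall_test (locallyIntegrable_lastConv hc hl _)
    ((Lp.memLp _).locallyIntegrable (by norm_num)) fun η hη hηc => ?_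
  rw [integral_lastConv_mul hc hl F (integrable_test hη hηc) (memLp_test hη hηc 2),
    integral_fourierL2_mul R (integrable_test hη hηc) (memLp_test hη hηc 2)]
  exact integral_congr_ae (h.mono fun k hk => by simp only [hk])

/-- The trace at `0` of the convolution of `F` with the Yukawa potential. -/
def lastTrace (c l : ℝ) (F : Config (n + 1) → ℂ) (y : Config n) : ℂ :=
  sliceInt (fun k => yukawa c l (k (Fin.last n))) F y

theorem lastTrace_eq (F : Config (n + 1) → ℂ) (y : Config n) :
    lastTrace c l F y = ∫ w, (yukawa c l w : ℂ) * F (ins (Fin.last n) (0 - w) y) := by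
  rw [lastTrace, sliceInt, ← integral_neg_eq_self]
  refine integral_congr_ae (.of_forall fun w => ?_)
  simp [yukawa_neg]

theorem memLp_lastTrace (hc : 0 < c) (hl : 0 < l) {F : Config (n + 1) → ℂ} (hF : MemLp F 2) :
    MemLp (lastTrace c l F) 2 :=
  (memLp_sliceInt (ϑ := yukawa c l) (memLp_yukawa hc hl)
    (measurable_yukawa.comp (measurable_pi_apply _))
    (fun _ => (abs_of_nonneg (yukawa_nonneg hc _)).le) hF).1

/-- The trace against ζ is the pairing with the tensor product of the Yukawa potential and ζ, whose
transform factorizes. -/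
theorem integral_lastTrace_mul (hc : 0 < c) (hl : 0 < l)
    (F : Lp ℂ 2 (volume : Measure (Config (n + 1)))) {ζ : Config n → ℂ}
    (h1 : Integrable ζ) (h2 : MemLp ζ 2) :
    ∫ y, lastTrace c l (fourierL2 F) y * ζ y =
      ∫ k : Config n, (∫ p, (((symbol c l p)⁻¹ : ℝ) : ℂ) * F (ins (Fin.last n) p k)) *
        fourierC ζ k := by
  have hY1 : Integrable fun w => (yukawa c l w : ℂ) := (integrable_yukawa hc hl).ofReal
  have hY2 := memLp_yukawa hc hl
  have ht1 := integrable_tensor (Fin.last n) hY1 h1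
  have ht2 := memLp_tensor (Fin.last n) hY2 h2
  have key := integral_fourierL2_mul F ht1 ht2
  rw [integral_ins (Fin.last n) (integrable_mul_of_memLp_two (Lp.memLp _) ht2),
    integral_ins (Fin.last n) (integrable_mul_of_memLp_two (Lp.memLp F)
      (memLp_fourierC ht1 ht2))] at key
  refine Eq.trans ?_ (key.trans ?_)
  · refine integral_congr_ae (.of_forall fun y => ?_)
    simp only [lastTrace, sliceInt]
    rw [← integral_mul_const]
    refine integral_congr_ae (.of_forall fun w => ?_)
    simp only [del_ins, Fin.insertNth_apply_same]
    ring
  · refine integral_congr_ae (.of_forall fun k => ?_)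
    simp only
    rw [← integral_mul_const]
    refine integral_congr_ae (.of_forall fun p => ?_)
    simp only
    rw [fourierC_tensor (Fin.last n) hY1 h1, fourier_yukawa hc hl]
    ring

/-- The convolution of a square-integrable function with the Yukawa potential is a `potential`. -/
theorem integral_yukawa_mul_eq_potential (hc : 0 < c) (hl : 0 < l) {f : Space → ℂ}
    (hf : MemLp f 2) (z : Space) :
    ∫ w, (yukawa c l w : ℂ) * f (z - w) =
      potential c l (𝓕⁻ hf.toLp : Lp ℂ 2 (volume : Measure Space)) z := by
  set F : Lp ℂ 2 (volume : Measure Space) := 𝓕⁻ hf.toLp with hF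
  have hfF : 𝓕 F = hf.toLp := FourierTransform.fourier_fourierInv_eq _
  have hY : Integrable fun w => (yukawa c l w : ℂ) := (integrable_yukawa hc hl).ofReal
  have hY1 : Integrable fun w => (yukawa c l (z - w) : ℂ) := hY.comp_sub_left z
  have hY2 : MemLp (fun w => (yukawa c l (z - w) : ℂ)) 2 :=
    (memLp_yukawa hc hl).comp_measurePreserving (Measure.measurePreserving_sub_left volume z)
  have key := integral_fourier_mul F hY1 hY2
  have e1 : ∫ w, (yukawa c l w : ℂ) * f (z - w) =
      ∫ w, (𝓕 F : Lp ℂ 2 (volume : Measure Space)) w * (yukawa c l (z - w) : ℂ) := by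
    rw [hfF, ← integral_sub_left_eq_self _ volume z]
    refine integral_congr_ae (hf.coeFn_toLp.mono fun w hw => ?_)
    simp only [sub_sub_cancel]
    rw [hw, mul_comm]
  rw [e1, key, potential, fourier_eq_integral_mul]
  refine integral_congr_ae (.of_forall fun p => ?_)
  simp only
  have e2 : 𝓕 (fun w => (yukawa c l (z - w) : ℂ)) p =
      phase (-inner ℝ p z) * (((symbol c l p)⁻¹ : ℝ) : ℂ) := by
    rw [fourier_eq_integral_mul, ← integral_sub_left_eq_self _ volume z,
      ← integral_yukawa_phase hc hl, ← integral_const_mul]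
    refine integral_congr_ae (.of_forall fun w => ?_)
    simp only [sub_sub_cancel, inner_sub_left]
    rw [show -(inner ℝ z p - inner ℝ w p) = -inner ℝ p z + inner ℝ w p by
      rw [real_inner_comm]; ring, phase_add]
    ring
  rw [e2]
  ring

end Convolution

/-! ### Creation and annihilation on genuine functions, at every configuration. -/

section Pointwise

/-- Creation of a particle with wave function `f`. -/
def createOp (f : Space → ℂ) : WaveFunction →L[ℂ] WaveFunction where
  toFun u n := match n with
    | 0 => 0
    | n + 1 => createFun f (u n)
  map_add' u v := by
    funext n k
    cases n with
    | zero => simp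
    | succ n => simp [createFun, mul_add, Finset.sum_add_distrib]
  map_smul' a u := by
    funext n k
    cases n with
    | zero => simp
    | succ n =>
      simp only [createFun, Pi.smul_apply, smul_eq_mul, RingHom.id_apply, Finset.mul_sum]
      exact Finset.sum_congr rfl fun j _ => by ring
  cont := by
    refine continuous_pi fun n => continuous_pi fun k => ?_
    cases n with
    | zero => exact continuous_const
    | succ n =>
      refine continuous_const.mul (continuous_finsetSum _ fun j _ => continuous_const.mul ?_)
      exact (continuous_apply (del j k)).comp (continuous_apply n)

theorem createOp_zero (f : Space → ℂ) (u : WaveFunction) : createOp f u 0 = 0 := rfl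

theorem createOp_succ (f : Space → ℂ) (u : WaveFunction) (n : ℕ) :
    createOp f u (n + 1) = createFun f (u n) := rfl

/-- Annihilation of a particle at `p`. -/
def sliceOp (p : Space) : WaveFunction →L[ℂ] WaveFunction where
  toFun u n k := (√(n + 1 : ℝ) : ℂ) * u (n + 1) (ins (Fin.last n) p k)
  map_add' u v := by funext n k; simp [mul_add]
  map_smul' a u := by
    funext n k
    simp only [Pi.smul_apply, smul_eq_mul, RingHom.id_apply]
    ring
  cont := by
    refine continuous_pi fun n => continuous_pi fun k => continuous_const.mul ?_
    exact (continuous_apply _).comp (continuous_apply (n + 1))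

theorem sliceOp_apply (p : Space) (u : WaveFunction) (n : ℕ) (k : Config n) :
    sliceOp p u n k = (√(n + 1 : ℝ) : ℂ) * u (n + 1) (ins (Fin.last n) p k) := rfl

/-- The second quantization of the multiplication by `e`. -/
def sumOp (e : Space → ℂ) : WaveFunction →L[ℂ] WaveFunction where
  toFun u n k := (∑ j, e (k j)) * u n k
  map_add' u v := by funext n k; simp [mul_add]
  map_smul' a u := by
    funext n k
    simp only [Pi.smul_apply, smul_eq_mul, RingHom.id_apply]
    ring
  cont := by
    refine continuous_pi fun n => continuous_pi fun k => continuous_const.mul ?_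
    exact (continuous_apply _).comp (continuous_apply n)

theorem sumOp_apply (e : Space → ℂ) (u : WaveFunction) (n : ℕ) (k : Config n) :
    sumOp e u n k = (∑ j, e (k j)) * u n k := rfl

/-- The canonical commutation relation. -/
theorem sliceOp_createOp (f : Space → ℂ) (p : Space) (u : WaveFunction) :
    sliceOp p (createOp f u) = createOp f (sliceOp p u) + f p • u := by
  funext n k
  simp only [sliceOp_apply, createOp_succ, Pi.add_apply, Pi.smul_apply, smul_eq_mul]
  cases n with
  | zero =>
    rw [createFun_ins_last_zero, createOp_zero]
    simp
  | succ n =>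
    rw [createFun_ins_last, createOp_succ, createFun, mul_inv_cancel_left₀]
    · simp only [sliceOp_apply, Finset.mul_sum]
      congr 1
      refine Finset.sum_congr rfl fun j _ => ?_
      have := sqrt_ne_zero_complex n
      field_simp
    · exact_mod_cast sqrt_ne_zero_complex (n + 1)

theorem ext_sliceOp {u v : WaveFunction} (n : ℕ) (h : ∀ p, sliceOp p u n = sliceOp p v n) :
    u (n + 1) = v (n + 1) := by
  funext k
  have h1 := congrFun (h (k (Fin.last n))) (del (Fin.last n) k)
  simp only [sliceOp_apply, ins_del] at h1
  exact mul_left_cancel₀ (sqrt_ne_zero_complex n) h1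

/-- Functions of n+1 particles agree if all their annihilations at points agree, and the commutation
relation reduces these to one particle fewer. -/
theorem createOp_comm (f e : Space → ℂ) : createOp f * createOp e = createOp e * createOp f := by
  have key : ∀ n (u : WaveFunction), createOp f (createOp e u) n = createOp e (createOp f u) n := by
    intro n
    induction n with
    | zero => intro u; rfl
    | succ n ih =>
      intro u
      refine ext_sliceOp n fun p => ?_
      simp only [sliceOp_createOp, map_add, map_smul, Pi.add_apply, ih, Pi.smul_apply]
      abel
  ext1 u
  funext n
  exact key n u

theorem sumOp_createOp (e f : Space → ℂ) :
    createOp f * sumOp e = sumOp e * createOp f + -createOp (fun p => e p * f p) := by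
  ext1 u
  funext n k
  simp only [mul_apply_eq_comp, add_apply, neg_apply, Pi.add_apply, Pi.neg_apply, sumOp_apply]
  cases n with
  | zero => simp [createOp_zero]
  | succ n =>
    simp only [createOp_succ, createFun, sumOp_apply]
    have h1 : ∀ j, ∑ i, e (k i) = e (k j) + ∑ i, e (del j k i) := fun j =>
      Fin.sum_univ_succAbove _ j
    rw [mul_left_comm, ← mul_neg, ← mul_add, Finset.mul_sum _ _ (∑ i, e (k i)),
      ← Finset.sum_neg_distrib, ← Finset.sum_add_distrib]
    congr 1
    refine Finset.sum_congr rfl fun j _ => ?_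
    rw [h1 j]
    ring

/-- The exponential of the creation operator. -/
def createExp (f : Space → ℂ) (u : WaveFunction) : WaveFunction := fun n =>
  ∑ j ∈ Finset.range (n + 1), ((j.factorial : ℂ)⁻¹) • (createOp f ^ j) u n

theorem createOp_pow_apply_eq_zero (f : Space → ℂ) (u : WaveFunction) (j : ℕ) :
    ∀ n, n < j → (createOp f ^ j) u n = 0 := by
  induction j with
  | zero => simp
  | succ j ih =>
    intro n hn
    rw [pow_succ', mul_apply_eq_comp]
    cases n with
    | zero => rfl
    | succ n =>
      rw [createOp_succ, ih n (by omega)]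
      funext k
      simp [createFun]

theorem isExp_createExp (f : Space → ℂ) (u : WaveFunction) :
    IsExp (createOp f) u (createExp f u) := by
  refine Pi.hasSum.mpr fun n => hasSum_sum_of_ne_finset_zero fun j hj => ?_
  rw [Pi.smul_apply, createOp_pow_apply_eq_zero f u j n (by simpa using hj), smul_zero]

theorem createExp_add (f : Space → ℂ) (u v : WaveFunction) :
    createExp f (u + v) = createExp f u + createExp f v :=
  (isExp_createExp f _).unique ((isExp_createExp f u).add (isExp_createExp f v))

theorem createExp_smul (f : Space → ℂ) (a : ℂ) (u : WaveFunction) :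
    createExp f (a • u) = a • createExp f u :=
  (isExp_createExp f _).unique ((isExp_createExp f u).smul a)

theorem createExp_createOp (f : Space → ℂ) (u : WaveFunction) :
    createExp f (createOp f u) = createOp f (createExp f u) :=
  (isExp_createExp f _).unique (IsExp.intertwine rfl (isExp_createExp f u))

/-- Annihilation of a particle in an exponential vector. -/
theorem sliceOp_createExp (f : Space → ℂ) (p : Space) (u : WaveFunction) :
    sliceOp p (createExp f u) = createExp f (sliceOp p u) + f p • createExp f u := by
  have h := IsExp.conj (T := createOp f) (S := sliceOp p) (Q := -(f p • (1 : _ →L[ℂ] WaveFunction)))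
    (by
      ext1 v
      simp only [mul_apply_eq_comp, sliceOp_createOp, add_apply, neg_apply, smul_apply,
        one_apply_eq_self]
      abel)
    (by ext1 v; simp) (isExp_createExp f u)
  rw [(isExp_createExp f _).unique h]
  simp

/-- The commutator of a*(f) with dΓ(e) is -a*(ef), which commutes with a*(f), so `IsExp.conj`
applies. -/
theorem sumOp_createExp (e f : Space → ℂ) (u : WaveFunction) :
    createExp f (sumOp e u) = sumOp e (createExp f u) -
      createOp (fun p => e p * f p) (createExp f u) := by
  have h := IsExp.conj (sumOp_createOp e f) (by
    ext1 v
    have := congrArg (fun U : WaveFunction →L[ℂ] WaveFunction => U v)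
      (createOp_comm f fun p => e p * f p)
    simp only [mul_apply_eq_comp] at this
    simp only [mul_apply_eq_comp, neg_apply, map_neg, this]) (isExp_createExp f u)
  rw [(isExp_createExp f _).unique h, neg_apply, sub_eq_add_neg]

end Pointwise

/-! ### Agreement of pointwise and Hilbert space exponentials almost everywhere. -/

section AlmostEverywhere

variable {f : Space → ℂ}

theorem createOp_congr {u v : WaveFunction} (h : ∀ n, u n =ᵐ[volume] v n) (n : ℕ) :
    createOp f u n =ᵐ[volume] createOp f v n := by
  cases n with
  | zero => exact EventuallyEq.rfl
  | succ n => exact createFun_congr f (h n)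

theorem pow_succ_apply {V : Type*} [AddCommGroup V] [Module ℂ V] [TopologicalSpace V]
    (T : V →L[ℂ] V) (j : ℕ) (v : V) : (T ^ (j + 1)) v = T ((T ^ j) v) := by
  rw [pow_succ', mul_apply_eq_comp]

theorem createOp_pow_succ (u : WaveFunction) (j : ℕ) :
    (createOp f ^ (j + 1)) u = createOp f ((createOp f ^ j) u) := pow_succ_apply _ j u

theorem createOp_pow_succ' (u : WaveFunction) (j : ℕ) :
    (createOp f ^ (j + 1)) u = (createOp f ^ j) (createOp f u) := by
  rw [pow_succ, mul_apply_eq_comp]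

theorem createOp_pow_congr {u v : WaveFunction} (h : ∀ n, u n =ᵐ[volume] v n) (j : ℕ) :
    ∀ n, (createOp f ^ j) u n =ᵐ[volume] (createOp f ^ j) v n := by
  induction j with
  | zero => exact h
  | succ j ih =>
    intro n
    rw [createOp_pow_succ, createOp_pow_succ]
    exact createOp_congr ih n

theorem createExp_apply (u : WaveFunction) (n : ℕ) (k : Config n) : createExp f u n k =
    ∑ j ∈ Finset.range (n + 1), (j.factorial : ℂ)⁻¹ * (createOp f ^ j) u n k := by
  simp [createExp, Finset.sum_apply]

theorem createExp_congr {u v : WaveFunction} (h : ∀ n, u n =ᵐ[volume] v n) (n : ℕ) :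
    createExp f u n =ᵐ[volume] createExp f v n := by
  have h1 : ∀ᵐ k, ∀ j, (createOp f ^ j) u n k = (createOp f ^ j) v n k :=
    ae_all_iff.mpr fun j => createOp_pow_congr h j n
  filter_upwards [h1] with k hk
  simp only [createExp_apply, hk]

/-- The representatives of a sequence of vectors. -/
def repr (ξ : ∀ n, Sector n) : WaveFunction := fun n k => (ξ n).1 k

variable {C : ∀ n, Sector n →L[ℂ] Sector (n + 1)}

theorem repr_raising_pow (hC : ∀ n ξ, (C n ξ).1 =ᵐ[volume] createFun f ξ.1) (ξ : ∀ n, Sector n)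
    (j : ℕ) : ∀ n, repr ((raising (E := fun n => Sector n) C ^ j) ξ) n =ᵐ[volume]
      (createOp f ^ j) (repr ξ) n := by
  induction j with
  | zero => exact fun n => EventuallyEq.rfl
  | succ j ih =>
    intro n
    have h1 : (raising (E := fun n => Sector n) C ^ (j + 1)) ξ =
        raising (E := fun n => Sector n) C ((raising (E := fun n => Sector n) C ^ j) ξ) :=
      pow_succ_apply _ j ξ
    refine (EventuallyEq.of_eq (congrArg (fun ζ => repr ζ n) h1)).trans (EventuallyEq.trans ?_
      (EventuallyEq.of_eq (congrFun (createOp_pow_succ (f := f) (repr ξ) j) n).symm))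
    generalize (raising (E := fun n => Sector n) C ^ j) ξ = ζ at ih
    cases n with
    | zero => exact coeFn_sector_zero
    | succ n => exact (hC n (ζ n)).trans (createFun_congr f (ih n))

theorem coeFn_sector_sum {n : ℕ} {ι : Type*} (s : Finset ι) (a : ι → ℂ) (φ : ι → Sector n)
    {v : ι → Config n → ℂ} (h : ∀ i, (φ i).1 =ᵐ[volume] v i) :
    (∑ i ∈ s, a i • φ i).1 =ᵐ[volume] fun k => ∑ i ∈ s, a i * v i k := by
  classical
  induction s using Finset.induction_on with
  | empty => simpa using coeFn_sector_zero
  | insert i s hi ih =>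
    rw [Finset.sum_insert hi]
    filter_upwards [coeFn_sector_add (a i • φ i) (∑ i ∈ s, a i • φ i), coeFn_sector_smul (a i) (φ i),
      h i, ih] with k h1 h2 h3 h4
    rw [h1, h2, h3, h4, Finset.sum_insert hi]

theorem repr_raisingExp (hC : ∀ n ξ, (C n ξ).1 =ᵐ[volume] createFun f ξ.1) (ξ : ∀ n, Sector n)
    (n : ℕ) : repr (raisingExp (E := fun n => Sector n) C ξ) n =ᵐ[volume]
      createExp f (repr ξ) n := by
  have h1 : raisingExp (E := fun n => Sector n) C ξ n = _ := raisingExp_apply C ξ n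
  have h2 := coeFn_sector_sum (Finset.range (n + 1)) (fun j => ((j.factorial : ℂ)⁻¹))
    (fun j => (raising (E := fun n => Sector n) C ^ j) ξ n)
    (fun j => repr_raising_pow hC ξ j n)
  unfold repr at h2 ⊢
  rw [h1]
  refine h2.trans (.of_forall fun k => ?_)
  rw [createExp_apply]

end AlmostEverywhere

/-! ### Exponentials in the presence of a spectator in the last place. -/

section Spectator

variable {f : Space → ℂ}

/-- The wave functions `U (·, p)` with the last particle at `p`. -/
def freeze (U : ∀ m, Config (m + 1) → ℂ) (p : Space) : WaveFunction :=
  fun m k => U m (ins (Fin.last m) p k)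

/-- Creation of a particle in the presence of a spectator in the last place. -/
def spectatorCreate (f : Space → ℂ) (U : ∀ m, Config (m + 1) → ℂ) : ∀ m, Config (m + 1) → ℂ
  | 0 => 0
  | m + 1 => fun x => (√(m + 1 : ℝ) : ℂ)⁻¹ *
      ∑ i : Fin (m + 1), f (x i.castSucc) * U m (del i.castSucc x)

theorem freeze_spectatorCreate (U : ∀ m, Config (m + 1) → ℂ) (p : Space) :
    freeze (spectatorCreate f U) p = createOp f (freeze U p) := by
  funext m k
  cases m with
  | zero => rfl
  | succ m =>
    simp only [freeze, spectatorCreate, createOp_succ, createFun, del_castSucc_ins_last]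
    congr 1
    refine Finset.sum_congr rfl fun i _ => ?_
    rw [ins_last]
    simp

theorem memLp_spectatorCreate (hf : MemLp f 2) {U : ∀ m, Config (m + 1) → ℂ}
    (hU : ∀ m, MemLp (U m) 2) (m : ℕ) : MemLp (spectatorCreate f U m) 2 := by
  cases m with
  | zero => exact MemLp.zero
  | succ m => exact (memLp_finsetSum _ fun i _ => memLp_tensor _ hf (hU m)).const_mul _

/-- One creation operator is absorbed into U by `freeze_spectatorCreate`, so the induction on j must
leave U arbitrary. This gives joint measurability in the spectator. -/
theorem memLp_createOp_pow_freeze (hf : MemLp f 2) (j : ℕ) : ∀ {U : ∀ m, Config (m + 1) → ℂ},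
    (∀ m, MemLp (U m) 2) → ∀ n, MemLp (fun x : Config (n + 1) =>
      (createOp f ^ j) (freeze U (x (Fin.last n))) n (del (Fin.last n) x)) 2 := by
  induction j with
  | zero =>
    intro U hU n
    refine (hU n).ae_eq (.of_forall fun x => ?_)
    simp [freeze, ins_del]
  | succ j ih =>
    intro U hU n
    refine (ih (memLp_spectatorCreate hf hU) n).ae_eq (.of_forall fun x => ?_)
    simp only [createOp_pow_succ', freeze_spectatorCreate]

theorem memLp_createExp_freeze (hf : MemLp f 2) {U : ∀ m, Config (m + 1) → ℂ}
    (hU : ∀ m, MemLp (U m) 2) (n : ℕ) : MemLp (fun x : Config (n + 1) =>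
      createExp f (freeze U (x (Fin.last n))) n (del (Fin.last n) x)) 2 := by
  simp only [createExp_apply]
  exact memLp_finsetSum _ fun j _ => (memLp_createOp_pow_freeze hf j hU n).const_mul _

/-- Integration over the position of the last particle. -/
def marginal (U : ∀ m, Config (m + 1) → ℂ) : WaveFunction :=
  fun m k => ∫ p, U m (ins (Fin.last m) p k)

theorem marginal_spectatorCreate {U : ∀ m, Config (m + 1) → ℂ}
    (hU : ∀ m, ∀ᵐ k : Config m, Integrable fun p => U m (ins (Fin.last m) p k)) (m : ℕ) :
    (∀ᵐ k : Config m, Integrable fun p => spectatorCreate f U m (ins (Fin.last m) p k)) ∧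
    marginal (spectatorCreate f U) m =ᵐ[volume] createOp f (marginal U) m := by
  have hfr : ∀ p (k : Config m), spectatorCreate f U m (ins (Fin.last m) p k) =
      createOp f (freeze U p) m k := fun p k =>
    congrFun (congrFun (freeze_spectatorCreate U p) m) k
  have hma : marginal (spectatorCreate f U) m = fun k => ∫ p, createOp f (freeze U p) m k := by
    funext k
    simp only [marginal, hfr]
  rw [hma]
  simp only [hfr]
  cases m with
  | zero => exact ⟨.of_forall fun k => integrable_zero _ _ _, .of_forall fun k => by
      simp [createOp_zero]⟩
  | succ m =>
    have h1 : ∀ᵐ k : Config (m + 1), ∀ j,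
        Integrable fun p => U m (ins (Fin.last m) p (del j k)) :=
      ae_all_iff.mpr fun j => (quasiMeasurePreserving_del j).ae (hU m)
    have h2 : ∀ᵐ k : Config (m + 1), ∀ j : Fin (m + 1), Integrable fun p =>
        f (k j) * freeze U p m (del j k) := by
      filter_upwards [h1] with k hk j
      exact (hk j).const_mul _
    refine ⟨h2.mono fun k hk => ?_, h2.mono fun k hk => ?_⟩
    · exact (integrable_finsetSum _ fun j _ => hk j).const_mul _
    · simp only [createOp_succ, createFun]
      rw [integral_const_mul, integral_finsetSum _ fun j _ => hk j]
      simp only [integral_const_mul]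
      rfl

/-- Creation does not touch the spectator and therefore commutes with integrating it out. -/
theorem integral_createOp_pow_freeze (j : ℕ) : ∀ {U : ∀ m, Config (m + 1) → ℂ},
    (∀ m, ∀ᵐ k : Config m, Integrable fun p => U m (ins (Fin.last m) p k)) → ∀ n,
    ∀ᵐ k : Config n, Integrable (fun p => (createOp f ^ j) (freeze U p) n k) ∧
      ∫ p, (createOp f ^ j) (freeze U p) n k = (createOp f ^ j) (marginal U) n k := by
  induction j with
  | zero =>
    intro U hU n
    filter_upwards [hU n] with k hk
    exact ⟨hk, rfl⟩
  | succ j ih =>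
    intro U hU n
    have h1 := ih (fun m => (marginal_spectatorCreate (f := f) hU m).1) n
    have h2 := createOp_pow_congr (f := f) (fun m => (marginal_spectatorCreate (f := f) hU m).2) j n
    filter_upwards [h1, h2] with k hk hk'
    simp only [freeze_spectatorCreate] at hk
    simp only [createOp_pow_succ']
    exact ⟨hk.1, hk.2.trans hk'⟩

theorem integral_createExp_freeze {U : ∀ m, Config (m + 1) → ℂ}
    (hU : ∀ m, ∀ᵐ k : Config m, Integrable fun p => U m (ins (Fin.last m) p k)) (n : ℕ) :
    ∀ᵐ k : Config n, ∫ p, createExp f (freeze U p) n k = createExp f (marginal U) n k := by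
  have h := ae_all_iff.mpr fun j => integral_createOp_pow_freeze (f := f) j hU n
  filter_upwards [h] with k hk
  simp only [createExp_apply]
  rw [integral_finsetSum _ fun j _ => (hk j).1.const_mul _]
  simp only [integral_const_mul, (hk _).2]

end Spectator

/-! ### Singular part and remainder in momentum space; the dressed Hamiltonian. -/

section MomentumStructure

variable {h : Space → ℝ} (θ : ∀ n, Sector n)

/-- The pointwise product of `θ` with the inverse energy. -/
def resolved (h : Space → ℝ) (θ : ∀ n, Sector n) : WaveFunction :=
  fun n k => (((energy h k)⁻¹ : ℝ) : ℂ) * (θ n).1 k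

/-- The `(m + 1)`-particle sectors of `resolved`, scaled by `√(m + 1)`. -/
def resolvedSlices (h : Space → ℝ) (θ : ∀ n, Sector n) (m : ℕ) (x : Config (m + 1)) : ℂ :=
  (√(m + 1 : ℝ) : ℂ) * ((((energy h x)⁻¹ : ℝ) : ℂ) * (θ (m + 1)).1 x)

theorem freeze_resolvedSlices (p : Space) :
    freeze (resolvedSlices h θ) p = sliceOp p (resolved h θ) := rfl

theorem IsDispersion.integrable_resolvedSlices (hh : IsDispersion h) (m : ℕ) :
    ∀ᵐ k : Config m, Integrable fun p => resolvedSlices h θ m (ins (Fin.last m) p k) := by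
  filter_upwards [hh.sliceKernel_inv_energy.integrable (Lp.memLp (θ (m + 1)).1)] with k hk
  exact hk.const_mul _

/-- The resolvent pays for one factor h of the last particle, because h(p) ≤ Λ. -/
theorem IsDispersion.memLp_resolvedSlices (hh : IsDispersion h) (m : ℕ) :
    MemLp (fun x => (h (x (Fin.last m)) : ℂ) * resolvedSlices h θ m x) 2 := by
  have h1 := memLp_bounded_mul (r := fun x : Config (m + 1) => h (x (Fin.last m)) * (energy h x)⁻¹)
    ((hh.measurable.comp (measurable_pi_apply (Fin.last m))).mul hh.measurable_energy.inv) (fun x => by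
      rw [abs_of_pos (mul_pos (hh.pos _) (inv_pos.mpr (hh.energy_pos x))), ← div_eq_mul_inv,
        div_le_one (hh.energy_pos x)]
      exact hh.le_energy _ x) (Lp.memLp (θ (m + 1)).1)
  refine (h1.const_mul (√(m + 1 : ℝ) : ℂ)).ae_eq (.of_forall fun x => ?_)
  simp only [resolvedSlices]
  push_cast
  ring

/-- The singular part of an exponential vector in the position of its last particle: the remainder
is divided by the dispersion relation. -/
theorem IsDispersion.exists_remainder (hh : IsDispersion h) {f : Space → ℂ} (hf : MemLp f 2) (n : ℕ) :
    ∃ F : Lp ℂ 2 (volume : Measure (Config (n + 1))),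
      (∀ᵐ x, createExp f (resolved h θ) (n + 1) x =
        (√(n + 1 : ℝ) : ℂ)⁻¹ * (f (x (Fin.last n)) *
          createExp f (resolved h θ) n (del (Fin.last n) x)) +
        (((h (x (Fin.last n)))⁻¹ : ℝ) : ℂ) * F x) ∧
      ∀ᵐ k : Config n, ∫ p, (((h p)⁻¹ : ℝ) : ℂ) * F (ins (Fin.last n) p k) =
        (√(n + 1 : ℝ) : ℂ)⁻¹ * createExp f (marginal (resolvedSlices h θ)) n k := by
  set w := createExp f (resolved h θ) with hw
  -- The remainder is e^{a*} applied to the annihilation of Rθ at p. Multiplied by h(p) it is still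
  -- square-integrable, which is what makes F exist.
  set U : ∀ m, Config (m + 1) → ℂ := fun m x =>
    (h (x (Fin.last m)) : ℂ) * resolvedSlices h θ m x with hU
  have hfr : ∀ p, freeze U p = (h p : ℂ) • sliceOp p (resolved h θ) := by
    intro p
    rw [← freeze_resolvedSlices]
    funext m k
    simp [hU, freeze]
  have h1 := (memLp_createExp_freeze hf (fun m => hh.memLp_resolvedSlices θ m) n).const_mul
    (√(n + 1 : ℝ) : ℂ)⁻¹
  set F : Lp ℂ 2 (volume : Measure (Config (n + 1))) := h1.toLp _ with hF
  have h2 : ∀ᵐ x : Config (n + 1), F x = (√(n + 1 : ℝ) : ℂ)⁻¹ *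
      ((h (x (Fin.last n)) : ℂ) *
        createExp f (sliceOp (x (Fin.last n)) (resolved h θ)) n (del (Fin.last n) x)) := by
    filter_upwards [h1.coeFn_toLp] with x hx
    rw [hF, hx]
    congr 1
    change createExp f (freeze U _) n _ = _
    rw [hfr, createExp_smul]
    rfl
  have hinv : ∀ p, (((h p)⁻¹ : ℝ) : ℂ) * (h p : ℂ) = 1 := fun p => by
    rw [← Complex.ofReal_mul, inv_mul_cancel₀ (hh.pos p).ne', Complex.ofReal_one]
  refine ⟨F, ?_, ?_⟩
  · filter_upwards [h2] with x hx
    rw [hx]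
    -- Annihilation of the last particle in an exponential vector: the commutator term f(p) e^{a*}Rθ
    -- is the singular part.
    have h3 := congrFun (congrFun (sliceOp_createExp f (x (Fin.last n)) (resolved h θ)) n)
      (del (Fin.last n) x)
    rw [sliceOp_apply, ins_del, ← hw] at h3
    rw [mul_left_comm _ (√(n + 1 : ℝ) : ℂ)⁻¹, ← mul_assoc (((h _)⁻¹ : ℝ) : ℂ), hinv, one_mul,
      ← mul_add, eq_inv_mul_iff_mul_eq₀ (sqrt_ne_zero_complex n), h3]
    simp only [Pi.add_apply, Pi.smul_apply, smul_eq_mul]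
    ring
  · filter_upwards [integral_createExp_freeze (f := f) (hh.integrable_resolvedSlices θ) n,
      ae_ae_ins (Fin.last n) h2] with k hk hk2
    rw [← hk, ← integral_const_mul]
    refine integral_congr_ae (hk2.mono fun p hp => ?_)
    simp only
    have hpl : ins (Fin.last n) p k (Fin.last n) = p := Fin.insertNth_apply_same _ _ _
    rw [hp, del_ins, hpl, freeze_resolvedSlices,
      mul_left_comm, ← mul_assoc (((h _)⁻¹ : ℝ) : ℂ), hinv, one_mul]

variable {R : ∀ n, Sector n →L[ℂ] Sector n} {B : ∀ n, Sector (n + 1) →L[ℂ] Sector n}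
  {C : ∀ n, Sector n →L[ℂ] Sector (n + 1)} {f : Space → ℂ}

theorem createExp_resolved (hC : ∀ n ξ, (C n ξ).1 =ᵐ[volume] createFun f ξ.1)
    (hR : ∀ n ξ, (R n ξ).1 =ᵐ[volume] fun k => (((energy h k)⁻¹ : ℝ) : ℂ) * ξ.1 k) (n : ℕ) :
    (raisingExp (E := fun n => Sector n) C (diagonal (E := fun n => Sector n) R θ) n).1 =ᵐ[volume]
      createExp f (resolved h θ) n :=
  (repr_raisingExp hC _ n).trans (createExp_congr (fun m => hR m (θ m)) n)

theorem coeFn_raising_resolved (hC : ∀ n ξ, (C n ξ).1 =ᵐ[volume] createFun f ξ.1)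
    (hR : ∀ n ξ, (R n ξ).1 =ᵐ[volume] fun k => (((energy h k)⁻¹ : ℝ) : ℂ) * ξ.1 k) (m : ℕ) :
    (raising (E := fun n => Sector n) C (diagonal (E := fun n => Sector n) R θ) m).1 =ᵐ[volume]
      createOp f (resolved h θ) m := by
  cases m with
  | zero => exact coeFn_sector_zero
  | succ m => exact (hC m _).trans (createFun_congr f (hR m (θ m)))

theorem coeFn_sector_combination {m : ℕ} (a₁ a₂ a₃ a₄ : Sector m) (g μ d b : ℂ) :
    (a₁ + g • a₂ + μ • (d • a₃ + a₄) + b • a₃).1 =ᵐ[volume] fun k =>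
      a₁.1 k + g * a₂.1 k + μ * (d * a₃.1 k + a₄.1 k) + b * a₃.1 k := by
  filter_upwards [coeFn_sector_add (a₁ + g • a₂ + μ • (d • a₃ + a₄)) (b • a₃),
    coeFn_sector_add (a₁ + g • a₂) (μ • (d • a₃ + a₄)), coeFn_sector_add a₁ (g • a₂),
    coeFn_sector_smul g a₂, coeFn_sector_smul b a₃, coeFn_sector_smul μ (d • a₃ + a₄),
    coeFn_sector_add (d • a₃) a₄, coeFn_sector_smul d a₃] with k e1 e2 e3 e4 e5 e6 e7 e8
  rw [e1, e2, e3, e4, e5, e6, e7, e8]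

/-- With u = Rθ one has θ = (1 + Σh)u, so θ supplies the one-particle energies of u, and Bθ is the
marginal of the slices of u. -/
theorem IsDispersion.repr_hamiltonian (hh : IsDispersion h)
    (hR : ∀ n ξ, (R n ξ).1 =ᵐ[volume] fun k => (((energy h k)⁻¹ : ℝ) : ℂ) * ξ.1 k)
    (hB : ∀ n χ, (B n χ).1 =ᵐ[volume] fun k =>
      (√(n + 1 : ℝ) : ℂ) * ∫ p, (((energy h (ins (Fin.last n) p k))⁻¹ : ℝ) : ℂ) *
        χ.1 (ins (Fin.last n) p k))
    {D : ∀ n, Sector n} (hD : ∀ m, (D m).1 =ᵐ[volume] createOp f (resolved h θ) m)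
    (g μ b : ℂ) {Ξ : ∀ n, Sector n} (hΞ : ∀ n, Ξ n = θ n + g • B n (θ (n + 1)) +
      μ • ((n : ℂ) • R n (θ n) + D n) + b • R n (θ n)) (m : ℕ) :
    repr Ξ m =ᵐ[volume] (sumOp (fun p => (h p : ℂ) + μ) (resolved h θ) +
      μ • createOp f (resolved h θ) +
      ((1 + b) • resolved h θ + g • marginal (resolvedSlices h θ))) m := by
  change (Ξ m).1 =ᵐ[volume] _
  rw [hΞ m]
  filter_upwards [hD m, hR m (θ m), hB m (θ (m + 1)),
    coeFn_sector_combination (θ m) (B m (θ (m + 1))) (R m (θ m)) (D m) g μ m b] with k e1 e2 e3 e4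
  rw [e4, e1, e2, e3]
  have hM : marginal (resolvedSlices h θ) m k = (√(m + 1 : ℝ) : ℂ) *
      ∫ p, (((energy h (ins (Fin.last m) p k))⁻¹ : ℝ) : ℂ) *
        (θ (m + 1)).1 (ins (Fin.last m) p k) := by
    simp only [marginal, resolvedSlices]
    rw [integral_const_mul]
  have hθ : (θ m).1 k = (1 + ∑ j, (h (k j) : ℂ)) * resolved h θ m k := by
    have h3 : (1 + ∑ j, (h (k j) : ℂ)) = (energy h k : ℂ) := by
      simp [energy]
    rw [h3, resolved, ← mul_assoc, ← Complex.ofReal_mul,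
      mul_inv_cancel₀ (hh.energy_pos k).ne', Complex.ofReal_one, one_mul]
  have hr : (((energy h k)⁻¹ : ℝ) : ℂ) * (θ m).1 k = resolved h θ m k := rfl
  rw [← hM, hr, hθ]
  simp only [Pi.add_apply, Pi.smul_apply, smul_eq_mul, sumOp_apply, Finset.sum_add_distrib,
    Finset.sum_const, Finset.card_univ, Fintype.card_fin, nsmul_eq_mul]
  ring

/-- The exponential of the conjugated Hamiltonian as a pointwise expression. -/
theorem createExp_hamiltonian (g μ b : ℂ) (hfg : ∀ p, (h p : ℂ) * f p = -g)
    (u M : WaveFunction) (n : ℕ) (k : Config n) :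
    createExp f (sumOp (fun p => (h p : ℂ) + μ) u + μ • createOp f u + ((1 + b) • u + g • M)) n k =
      (∑ j, ((h (k j) : ℂ) + μ)) * createExp f u n k +
      g * createOp (fun _ => 1) (createExp f u) n k + (1 + b) * createExp f u n k +
      g * createExp f M n k := by
  rw [createExp_add, createExp_add, createExp_add, createExp_smul, createExp_smul, createExp_smul,
    createExp_createOp, sumOp_createExp]
  -- Since h f = -g, the commutator of the one-particle energies yields g a*(1), the delta
  -- functions, and a term that cancels μ a*(f).
  have h2 : createOp (fun p => ((h p : ℂ) + μ) * f p) (createExp f u) =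
      μ • createOp f (createExp f u) - g • createOp (fun _ => 1) (createExp f u) := by
    funext m k
    cases m with
    | zero => simp [createOp_zero]
    | succ m =>
      simp only [createOp_succ, createFun, Pi.sub_apply, Pi.smul_apply, smul_eq_mul,
        Finset.mul_sum, ← Finset.sum_sub_distrib]
      refine Finset.sum_congr rfl fun j _ => ?_
      rw [add_mul, hfg]
      ring
  rw [h2]
  simp only [Pi.add_apply, Pi.sub_apply, Pi.smul_apply, smul_eq_mul, sumOp_apply]
  ring

end MomentumStructure

/-! ### Delta functions and Yukawa tensor factors under the Fourier transform. -/

section DeltaTerm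

open FourierTransform

variable {n : ℕ} {c l : ℝ}

theorem memLp_symbol_mul_fourierC {η : Config n → ℂ} (hη : ContDiff ℝ (⊤ : ℕ∞) η)
    (hηc : HasCompactSupport η) (j : Fin n) :
    MemLp (fun k => (symbol c l (k j) : ℂ) * fourierC η k) 2 :=
  memLp_mul_fourierC hη hηc j c l

theorem inv_symbol_mul_symbol (hc : 0 < c) (hl : 0 < l) (p : Space) (a : ℂ) :
    (((symbol c l p)⁻¹ : ℝ) : ℂ) * ((symbol c l p : ℂ) * a) = a := by
  rw [← mul_assoc, ← Complex.ofReal_mul, inv_mul_cancel₀ (symbol_pos hc hl p).ne',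
    Complex.ofReal_one, one_mul]

/-- The slice is the product of 1/symbol and of symbol times the slice, both square-integrable; any
positive parameters would do. -/
theorem ae_integrable_fourierC_slice {η : Config (n + 1) → ℂ} (hη : ContDiff ℝ (⊤ : ℕ∞) η)
    (hηc : HasCompactSupport η) (j : Fin (n + 1)) :
    ∀ᵐ k : Config n, Integrable fun p => fourierC η (ins j p k) := by
  filter_upwards [ae_memLp_slice j (memLp_symbol_mul_fourierC (c := 1) (l := 1) hη hηc j)]
    with k hk
  refine (integrable_mul_of_memLp_two (isDispersion_symbol one_pos one_pos).memLp hk).congr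
    (.of_forall fun p => ?_)
  simp only [ins, Fin.insertNth_apply_same]
  exact inv_symbol_mul_symbol one_pos one_pos p _

theorem integrable_del_mul_fourierC {W : Config n → ℂ} (hW : MemLp W 2) {η : Config (n + 1) → ℂ}
    (hη : ContDiff ℝ (⊤ : ℕ∞) η) (hηc : HasCompactSupport η) (j : Fin (n + 1)) :
    Integrable fun x => W (del j x) * fourierC η x := by
  refine (integrable_mul_of_memLp_two
    (memLp_tensor j (isDispersion_symbol one_pos one_pos).memLp hW)
    (memLp_symbol_mul_fourierC (c := 1) (l := 1) hη hηc j)).congr (.of_forall fun x => ?_)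
  simp only
  rw [mul_right_comm, inv_symbol_mul_symbol one_pos one_pos, mul_comm]

theorem hasCompactSupport_ins {η : Config (n + 1) → ℂ} (hηc : HasCompactSupport η)
    (j : Fin (n + 1)) (z : Space) : HasCompactSupport fun y => η (ins j z y) := by
  refine HasCompactSupport.intro (K := del j '' tsupport η)
    (IsCompact.image hηc (by unfold del; fun_prop)) fun y hy => ?_
  exact image_eq_zero_of_notMem_tsupport fun h => hy ⟨_, h, del_ins j z y⟩

theorem continuous_ins_right {η : Config (n + 1) → ℂ} (hη : Continuous η) (j : Fin (n + 1))
    (z : Space) : Continuous fun y => η (ins j z y) :=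
  hη.comp ((continuous_ins j).comp (Continuous.prodMk_right z))

/-- The Fourier transform of a Dirac distribution in the position of one particle. -/
theorem integral_del_mul_fourierC (W : Lp ℂ 2 (volume : Measure (Config n)))
    {η : Config (n + 1) → ℂ} (hη : ContDiff ℝ (⊤ : ℕ∞) η) (hηc : HasCompactSupport η)
    (j : Fin (n + 1)) :
    ∫ x, W (del j x) * fourierC η x = ∫ y, fourierL2 W y * η (ins j 0 y) := by
  have hc := continuous_ins_right hη.continuous j 0
  have hs := hasCompactSupport_ins hηc j 0
  rw [integral_fourierL2_mul W (hc.integrable_of_hasCompactSupport hs)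
    (hc.memLp_of_hasCompactSupport hs),
    integral_ins j (integrable_del_mul_fourierC (Lp.memLp W) hη hηc j)]
  refine integral_congr_ae ((ae_integrable_fourierC_slice hη hηc j).mono fun k hk => ?_)
  simp only [del_ins]
  rw [integral_const_mul, fourierC_restrict hη.continuous hηc j hk]

theorem integral_inv_symbol_mul_fourierC (hc : 0 < c) (hl : 0 < l) {η : Config (n + 1) → ℂ}
    (hη : Continuous η) (hηc : HasCompactSupport η) (j : Fin (n + 1)) {k : Config n}
    (hk : Integrable fun p => fourierC η (ins j p k)) :
    ∫ p, (((symbol c l p)⁻¹ : ℝ) : ℂ) * fourierC η (ins j p k) =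
      ∫ z, (yukawa c l z : ℂ) * fourierC (fun y => η (ins j z y)) k := by
  have h1 := fun p => fourierC_ins' (hη.integrable_of_hasCompactSupport hηc) j p k
  simp only [h1] at hk ⊢
  set S : Space → ℂ := fun z => fourierC (fun y => η (ins j z y)) k with hS
  have hY : Integrable fun z => (yukawa c l z : ℂ) := (integrable_yukawa hc hl).ofReal
  have h2 := integral_fourier_mul_eq_of_integrable hY hk
  simp only [fourier_yukawa hc hl] at h2
  refine h2.trans ?_
  rw [← integral_neg_eq_self]
  refine integral_congr_ae (.of_forall fun z => ?_)
  simp only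
  rw [yukawa_neg]
  congr 1
  have h3 := congrFun ((continuous_fourierC_slice hη hηc j k).fourierInv_fourier_eq
    (integrable_fourierC_slice hη hηc j k) hk) z
  rw [← Real.fourierInv_eq_fourier_neg]
  exact h3

theorem integrable_yukawa_mul_test (hc : 0 < c) (hl : 0 < l) {η : Config (n + 1) → ℂ}
    (hη : Continuous η) (hηc : HasCompactSupport η) (j : Fin (n + 1)) :
    Integrable (fun q : Space × Config n => (yukawa c l q.1 : ℂ) * η (ins j q.1 q.2))
      ((volume : Measure Space).prod (volume : Measure (Config n))) := by
  obtain ⟨M, hM⟩ := hη.bounded_above_of_compact_support hηc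
  have hK : IsCompact (del j '' tsupport η) := IsCompact.image hηc (by unfold del; fun_prop)
  have hI : Integrable ((del j '' tsupport η).indicator fun _ => M) :=
    (integrable_indicator_iff hK.measurableSet).mpr (integrableOn_const hK.measure_lt_top.ne)
  refine ((integrable_yukawa hc hl).mul_prod hI).mono' ?_ (.of_forall fun q => ?_)
  · exact (Complex.measurable_ofReal.comp
      (measurable_yukawa.comp measurable_fst)).aestronglyMeasurable.mul
      (hη.comp (continuous_ins j)).aestronglyMeasurable
  · rw [norm_mul, Complex.norm_real, Real.norm_of_nonneg (yukawa_nonneg hc _)]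
    refine mul_le_mul_of_nonneg_left ?_ (yukawa_nonneg hc _)
    by_cases hy : q.2 ∈ del j '' tsupport η
    · rw [Set.indicator_of_mem hy]; exact hM _
    · rw [Set.indicator_of_notMem hy]
      have : ins j q.1 q.2 ∉ tsupport η := fun h => hy ⟨_, h, del_ins j q.1 q.2⟩
      simp only [image_eq_zero_of_notMem_tsupport this, norm_zero, le_refl]

/-- The Fourier transform of the tensor product with the inverse symbol. -/
theorem fourierL2_tensor_inv_symbol (hc : 0 < c) (hl : 0 < l)
    (W : Lp ℂ 2 (volume : Measure (Config n))) (G : Lp ℂ 2 (volume : Measure (Config (n + 1))))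
    (hG : G =ᵐ[volume] fun x =>
      (((symbol c l (x (Fin.last n)))⁻¹ : ℝ) : ℂ) * W (del (Fin.last n) x)) :
    fourierL2 G =ᵐ[volume] fun x =>
      (yukawa c l (x (Fin.last n)) : ℂ) * fourierL2 W (del (Fin.last n) x) := by
  have hten := memLp_tensor (Fin.last n) (memLp_yukawa hc hl) (Lp.memLp (fourierL2 W))
  refine ext_of_forall_test ((Lp.memLp _).locallyIntegrable (by norm_num))
    (hten.locallyIntegrable (by norm_num)) fun η hη hηc => ?_
  have h1 := integrable_test hη hηc
  have h2 := memLp_test hη hηc 2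
  -- Integrating out the last particle reduces both sides to the duality of the n-particle transform
  -- with this function.
  set ζ : Config n → ℂ := fun y => ∫ z, (yukawa c l z : ℂ) * η (ins (Fin.last n) z y) with hζ
  have hYη := integrable_yukawa_mul_test hc hl hη.continuous hηc (Fin.last n)
  have hζ1 : Integrable ζ := hYη.integral_prod_right
  have hζ2 : MemLp ζ 2 := by
    have := (memLp_sliceInt (w := fun k : Config (n + 1) => yukawa c l (k (Fin.last n)))
      (ϑ := yukawa c l) (memLp_yukawa hc hl)
      (measurable_yukawa.comp (measurable_pi_apply (Fin.last n)))
      (fun _ => (abs_of_nonneg (yukawa_nonneg hc _)).le) h2).1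
    refine this.ae_eq (.of_forall fun y => ?_)
    simp [hζ, sliceInt]
  have e1 : ∫ x, (yukawa c l (x (Fin.last n)) : ℂ) * fourierL2 W (del (Fin.last n) x) * η x =
      ∫ y, fourierL2 W y * ζ y := by
    rw [integral_ins (Fin.last n) (integrable_mul_of_memLp_two hten h2)]
    refine integral_congr_ae (.of_forall fun y => ?_)
    simp only [del_ins, ins, Fin.insertNth_apply_same, hζ]
    rw [← integral_const_mul]
    refine integral_congr_ae (.of_forall fun z => ?_)
    simp only
    ring
  rw [e1, integral_fourierL2_mul W hζ1 hζ2, integral_fourierL2_mul G h1 h2]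
  have e2 : ∫ x, G x * fourierC η x = ∫ x, (((symbol c l (x (Fin.last n)))⁻¹ : ℝ) : ℂ) *
      W (del (Fin.last n) x) * fourierC η x :=
    integral_congr_ae (hG.mono fun x hx => by simp only [hx])
  rw [e2, integral_ins (Fin.last n) (integrable_mul_of_memLp_two (memLp_tensor (Fin.last n)
    (isDispersion_symbol hc hl).memLp (Lp.memLp W)) (memLp_fourierC h1 h2))]
  refine integral_congr_ae ((ae_integrable_fourierC_slice hη hηc (Fin.last n)).mono fun k hk => ?_)
  simp only [del_ins]
  have hlast : ∀ p, ins (Fin.last n) p k (Fin.last n) = p := fun p =>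
    Fin.insertNth_apply_same _ _ _
  simp only [hlast]
  have e3 : fourierC ζ k = ∫ z, (yukawa c l z : ℂ) *
      fourierC (fun y => η (ins (Fin.last n) z y)) k := by
    have hI : Integrable (fun q : Space × Config n => phase (-∑ j, inner ℝ (q.2 j) (k j)) *
        ((yukawa c l q.1 : ℂ) * η (ins (Fin.last n) q.1 q.2)))
        ((volume : Measure Space).prod (volume : Measure (Config n))) :=
      integrable_phase_mul hYη (by fun_prop)
    have h3 := integral_integral_swap (f := fun (z : Space) (y : Config n) =>
      phase (-∑ j, inner ℝ (y j) (k j)) * ((yukawa c l z : ℂ) * η (ins (Fin.last n) z y))) hI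
    simp only [fourierC, hζ, ← integral_const_mul] at h3 ⊢
    rw [← h3]
    refine integral_congr_ae (.of_forall fun z => integral_congr_ae (.of_forall fun y => ?_))
    simp only
    ring
  rw [e3, ← integral_inv_symbol_mul_fourierC hc hl hη.continuous hηc (Fin.last n) hk,
    ← integral_const_mul]
  refine integral_congr_ae (.of_forall fun p => ?_)
  simp only
  ring

end DeltaTerm

/-! ### A representative with explicit singularity; the boundary condition and the radial limits. -/

section Representative

open FourierTransform

variable {n : ℕ} {c l g : ℝ}

open Classical in
/-- The convolution with the Yukawa potential in the last variable, where it is defined. -/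
def regConv (c l : ℝ) (F : Config (n + 1) → ℂ) (y : Config n) (z : Space) : ℂ :=
  if MemLp (fun w => F (ins (Fin.last n) w y)) 2 then
    ∫ w, (yukawa c l w : ℂ) * F (ins (Fin.last n) (z - w) y) else 0

/-- The default 0 is the potential of 0, so boundedness and radial regularity hold for every y. The
boundary condition is required at every y without a particle at the origin, and almost every y would
not suffice. -/
theorem exists_regConv_eq_potential (hc : 0 < c) (hl : 0 < l) (F : Config (n + 1) → ℂ)
    (y : Config n) : ∃ G : Lp ℂ 2 (volume : Measure Space), ∀ z,
      regConv c l F y z = potential c l G z := by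
  by_cases h : MemLp (fun w => F (ins (Fin.last n) w y)) 2
  · refine ⟨(𝓕⁻ h.toLp : Lp ℂ 2 (volume : Measure Space)), fun z => ?_⟩
    rw [regConv, if_pos h]
    exact integral_yukawa_mul_eq_potential hc hl h z
  · refine ⟨0, fun z => ?_⟩
    rw [regConv, if_neg h, potential_eq_pairing hc hl, map_zero]

theorem norm_regConv_le (hc : 0 < c) (hl : 0 < l) (F : Config (n + 1) → ℂ) (y : Config n) :
    ∃ M : ℝ, ∀ z, ‖regConv c l F y z‖ ≤ M := by
  obtain ⟨G, hG⟩ := exists_regConv_eq_potential hc hl F y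
  refine ⟨√(∫ p, ((symbol c l p)⁻¹) ^ 2) * ‖G‖, fun z => ?_⟩
  rw [hG]
  exact norm_potential_le hc hl G z

theorem ae_hasDerivAt_regConv (hc : 0 < c) (hl : 0 < l) (F : Config (n + 1) → ℂ) (y : Config n) :
    ∀ᵐ ω : Metric.sphere (0 : Space) 1 ∂(volume : Measure Space).toSphere,
      ∃ f' : ℝ → ℂ, (∀ r ∈ Set.Ioo (0 : ℝ) 1,
        HasDerivAt (fun r : ℝ => (r : ℂ) * regConv c l F y (r • (ω : Space))) (f' r) r) ∧
      Tendsto f' (𝓝[>] 0) (𝓝 (regConv c l F y 0)) := by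
  obtain ⟨G, hG⟩ := exists_regConv_eq_potential hc hl F y
  simp only [hG]
  exact ae_hasDerivAt_potential hc hl (Lp.memLp G)

theorem regConv_ae_eq_lastConv (F : Lp ℂ 2 (volume : Measure (Config (n + 1)))) :
    ∀ᵐ x : Config (n + 1), regConv c l F (del (Fin.last n) x) (x (Fin.last n)) =
      lastConv c l F x := by
  filter_upwards [(quasiMeasurePreserving_del (Fin.last n)).ae
    (ae_memLp_slice (Fin.last n) (Lp.memLp F))] with x hx
  rw [regConv, if_pos hx, ← lastConv_ins, ins_del]

theorem regConv_zero_ae_eq (F : Lp ℂ 2 (volume : Measure (Config (n + 1)))) :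
    ∀ᵐ y : Config n, regConv c l F y 0 = lastTrace c l F y := by
  filter_upwards [ae_memLp_slice (Fin.last n) (Lp.memLp F)] with y hy
  rw [regConv, if_pos hy, lastTrace_eq]

/-- The wave function with vacuum component `u₀` and regular parts `V`. -/
def singularRep (c l g : ℝ) (u₀ : Config 0 → ℂ) (V : ∀ n, Config n → Space → ℂ) : WaveFunction
  | 0 => u₀
  | n + 1 => fun x => (√(n + 1 : ℝ) : ℂ)⁻¹ * (((-g * yukawa c l (x (Fin.last n)) : ℝ) : ℂ) *
      singularRep c l g u₀ V n (del (Fin.last n) x)) +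
      V n (del (Fin.last n) x) (x (Fin.last n))

variable {u₀ : Config 0 → ℂ} {V : ∀ n, Config n → Space → ℂ}

theorem singularRep_addParticle (y : Config n) (z : Space) :
    singularRep c l g u₀ V (n + 1) (addParticle y z) =
      (√(n + 1 : ℝ) : ℂ)⁻¹ * (((-g * yukawa c l z : ℝ) : ℂ) * singularRep c l g u₀ V n y) +
      V n y z := by
  rw [← ins_last, singularRep]
  simp only [del_ins]
  simp only [ins, Fin.insertNth_apply_same]

theorem mul_yukawa_ray {ω : Space} (hω : ‖ω‖ = 1) {r : ℝ} (hr : 0 < r) :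
    r * yukawa c l (r • ω) = (4 * Real.pi * c)⁻¹ * Real.exp (-√(l / c) * r) := by
  rw [yukawa, norm_smul, hω, mul_one, Real.norm_of_nonneg hr.le]
  field_simp

theorem radial_singularRep (y : Config n) {ω : Space} (hω : ‖ω‖ = 1) {r : ℝ} (hr : 0 < r) :
    radial (singularRep c l g u₀ V) y ω r =
      ((Real.exp (-√(l / c) * r) : ℝ) : ℂ) * (((-g * (4 * Real.pi * c)⁻¹ : ℝ) : ℂ) *
        ((√(n + 1 : ℝ) : ℂ)⁻¹ * singularRep c l g u₀ V n y)) + (r : ℂ) * V n y (r • ω) := by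
  rw [radial, singularRep_addParticle, mul_add]
  congr 1
  have h := congrArg (fun x : ℝ => (x : ℂ)) (mul_yukawa_ray (c := c) (l := l) hω hr)
  push_cast at h ⊢
  linear_combination (-(g : ℂ) * (√(n + 1 : ℝ) : ℂ)⁻¹ * singularRep c l g u₀ V n y) * h

/-- The Yukawa potential times r tends to 1/(4πc), which is m/(2πħ²) for this c, while r times the
bounded regular part tends to 0. -/
theorem dirichletIBC_singularRep {ħ m : ℝ} (hħ : 0 < ħ) (hm : 0 < m)
    (hV : ∀ n (y : Config n), ∃ M : ℝ, ∀ z, ‖V n y z‖ ≤ M) :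
    DirichletIBC ħ m g (singularRep (ħ ^ 2 / (2 * m)) l g u₀ V) := by
  intro ω hω n y _
  have hω1 : ‖ω‖ = 1 := by simpa using hω
  obtain ⟨M, hM⟩ := hV n y
  set c := ħ ^ 2 / (2 * m) with hc
  set b := ((-g * (4 * Real.pi * c)⁻¹ : ℝ) : ℂ) *
        ((√(n + 1 : ℝ) : ℂ)⁻¹ * singularRep c l g u₀ V n y) with hb
  have h1 : Tendsto (fun r : ℝ => ((Real.exp (-√(l / c) * r) : ℝ) : ℂ) * b +
      (r : ℂ) * V n y (r • ω)) (𝓝[>] 0) (𝓝 (((Real.exp (-√(l / c) * 0) : ℝ) : ℂ) * b + 0)) := by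
    refine Tendsto.add ?_ ?_
    · have : Continuous fun r : ℝ => ((Real.exp (-√(l / c) * r) : ℝ) : ℂ) * b := by fun_prop
      exact (this.tendsto 0).mono_left nhdsWithin_le_nhds
    · have h2 : Tendsto (fun r : ℝ => |r| * M) (𝓝[>] 0) (𝓝 0) := by
        have : Continuous fun r : ℝ => |r| * M := by fun_prop
        simpa using (this.tendsto 0).mono_left (nhdsWithin_le_nhds (s := Set.Ioi (0 : ℝ)))
      refine squeeze_zero_norm (fun r => ?_) h2
      rw [norm_mul, Complex.norm_real, Real.norm_eq_abs]
      exact mul_le_mul_of_nonneg_left (hM _) (abs_nonneg r)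
  have h3 : ((Real.exp (-√(l / c) * 0) : ℝ) : ℂ) * b + 0 =
      -((g * m / (2 * Real.pi * ħ ^ 2 * √(n + 1 : ℝ)) : ℝ) : ℂ) * singularRep c l g u₀ V n y := by
    rw [mul_zero, Real.exp_zero, Complex.ofReal_one, one_mul, add_zero, hb, ← mul_assoc,
      ← Complex.ofReal_inv, ← Complex.ofReal_mul, ← Complex.ofReal_neg]
    congr 2
    rw [hc]
    have : (0 : ℝ) < √(n + 1 : ℝ) := Real.sqrt_pos.mpr (by positivity)
    field_simp
    ring
  rw [h3] at h1
  refine h1.congr' ?_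
  filter_upwards [self_mem_nhdsWithin] with r hr
  exact (radial_singularRep y hω1 hr).symm

/-- Times r, the singular part is a multiple of e^{-κr} with κ = √(l/c). Its derivative -κ at 0
together with the factor -g gives the positive constant. -/
theorem hasRadialLimit_singularRep (y : Config n) {ω : Space} (hω : ‖ω‖ = 1) {f' : ℝ → ℂ}
    (h1 : ∀ r ∈ Set.Ioo (0 : ℝ) 1, HasDerivAt (fun r : ℝ => (r : ℂ) * V n y (r • ω)) (f' r) r)
    (h2 : Tendsto f' (𝓝[>] 0) (𝓝 (V n y 0))) :
    HasRadialLimit (singularRep c l g u₀ V) y ω ∧ radialLimit (singularRep c l g u₀ V) y ω =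
      ((g * (4 * Real.pi * c)⁻¹ * √(l / c) : ℝ) : ℂ) *
        ((√(n + 1 : ℝ) : ℂ)⁻¹ * singularRep c l g u₀ V n y) + V n y 0 := by
  set b := ((-g * (4 * Real.pi * c)⁻¹ : ℝ) : ℂ) *
        ((√(n + 1 : ℝ) : ℂ)⁻¹ * singularRep c l g u₀ V n y) with hb
  set κ := √(l / c)
  set d : ℝ → ℂ := fun r => ((Real.exp (-κ * r) * (-κ) : ℝ) : ℂ) * b with hd
  have h3 : ∀ r ∈ Set.Ioo (0 : ℝ) 1,
      HasDerivAt (radial (singularRep c l g u₀ V) y ω) (d r + f' r) r := by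
    intro r hr
    have h4 : HasDerivAt (fun r : ℝ => ((Real.exp (-κ * r) : ℝ) : ℂ) * b) (d r) r := by
      have h5 : HasDerivAt (fun r : ℝ => Real.exp (-κ * r)) (Real.exp (-κ * r) * (-κ)) r := by
        simpa using ((hasDerivAt_id r).const_mul (-κ)).exp
      exact h5.ofReal_comp.mul_const b
    refine (h4.fun_add (h1 r hr)).congr_of_eventuallyEq ?_
    filter_upwards [Ioi_mem_nhds hr.1] with s hs
    exact radial_singularRep y hω hs
  have h6 : ∀ᶠ r in 𝓝[>] (0 : ℝ), r ∈ Set.Ioo (0 : ℝ) 1 := Ioo_mem_nhdsGT zero_lt_one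
  have h7 : Tendsto (deriv (radial (singularRep c l g u₀ V) y ω)) (𝓝[>] 0)
      (𝓝 (d 0 + V n y 0)) := by
    have h8 : Tendsto (fun r => d r + f' r) (𝓝[>] 0) (𝓝 (d 0 + V n y 0)) := by
      have : Continuous d := by rw [hd]; fun_prop
      exact ((this.tendsto 0).mono_left nhdsWithin_le_nhds).add h2
    refine h8.congr' ?_
    filter_upwards [h6] with r hr
    exact (h3 r hr).deriv.symm
  refine ⟨⟨?_, _, h7⟩, ?_⟩
  · filter_upwards [h6] with r hr
    exact (h3 r hr).differentiableAt
  · rw [radialLimit, h7.limUnder_eq, hd, hb]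
    simp only [mul_zero, Real.exp_zero, one_mul]
    push_cast
    ring

theorem toSphere_real_univ : (volume : Measure Space).toSphere.real Set.univ = 4 * Real.pi := by
  rw [Measure.toSphere_real_apply_univ, Measure.real, EuclideanSpace.volume_ball_fin_three]
  simp
  rw [ENNReal.toReal_ofReal (by positivity)]
  ring

/-- The radial limit does not depend on the direction, so the surface integral is the area 4π times
it. -/
theorem sphereTerm_singularRep (y : Config n)
    (hV : ∀ᵐ ω : Metric.sphere (0 : Space) 1 ∂(volume : Measure Space).toSphere,
      ∃ f' : ℝ → ℂ, (∀ r ∈ Set.Ioo (0 : ℝ) 1,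
        HasDerivAt (fun r : ℝ => (r : ℂ) * V n y (r • (ω : Space))) (f' r) r) ∧
      Tendsto f' (𝓝[>] 0) (𝓝 (V n y 0))) :
    (∀ᵐ ω : Metric.sphere (0 : Space) 1 ∂(volume : Measure Space).toSphere,
      HasRadialLimit (singularRep c l g u₀ V) y (ω : Space)) ∧
    Integrable (fun ω : Metric.sphere (0 : Space) 1 =>
      radialLimit (singularRep c l g u₀ V) y (ω : Space)) (volume : Measure Space).toSphere ∧
    sphereTerm (singularRep c l g u₀ V) y = ((4 * Real.pi : ℝ) : ℂ) *
      (((g * (4 * Real.pi * c)⁻¹ * √(l / c) : ℝ) : ℂ) *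
        ((√(n + 1 : ℝ) : ℂ)⁻¹ * singularRep c l g u₀ V n y) + V n y 0) := by
  have h1 : ∀ᵐ ω : Metric.sphere (0 : Space) 1 ∂(volume : Measure Space).toSphere,
      HasRadialLimit (singularRep c l g u₀ V) y (ω : Space) ∧
      radialLimit (singularRep c l g u₀ V) y (ω : Space) =
      ((g * (4 * Real.pi * c)⁻¹ * √(l / c) : ℝ) : ℂ) *
        ((√(n + 1 : ℝ) : ℂ)⁻¹ * singularRep c l g u₀ V n y) + V n y 0 := by
    filter_upwards [hV] with ω hω
    obtain ⟨f', h2, h3⟩ := hω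
    exact hasRadialLimit_singularRep y (by simp) h2 h3
  refine ⟨h1.mono fun ω hω => hω.1, ?_, ?_⟩
  · exact (integrable_const _).congr (h1.mono fun ω hω => hω.2.symm)
  · rw [sphereTerm, integral_congr_ae (h1.mono fun ω hω => hω.2), integral_const,
      toSphere_real_univ, Complex.real_smul]

end Representative

/-! ### The momentum-space splitting in position space; identification of the distribution. -/

section PositionSpace

variable {c l g : ℝ} {Ψ : ∀ n, Lp ℂ 2 (volume : Measure (Config n))}
  {F : ∀ n, Lp ℂ 2 (volume : Measure (Config (n + 1)))}

/-- The momentum-space splitting of an `(n + 1)`-particle function into a part that is singular in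
the position of the last particle and a remainder divided by the dispersion relation. -/
def IsSingularSplitting (c l g : ℝ) (Ψ : ∀ n, Lp ℂ 2 (volume : Measure (Config n)))
    (F : ∀ n, Lp ℂ 2 (volume : Measure (Config (n + 1)))) : Prop :=
  ∀ n, ∀ᵐ x, Ψ (n + 1) x = (√(n + 1 : ℝ) : ℂ)⁻¹ *
    (((-g * (symbol c l (x (Fin.last n)))⁻¹ : ℝ) : ℂ) * Ψ n (del (Fin.last n) x)) +
      (((symbol c l (x (Fin.last n)))⁻¹ : ℝ) : ℂ) * F n x

/-- The position-space representative of a momentum-space singular splitting. -/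
def positionRep (c l g : ℝ) (Ψ : ∀ n, Lp ℂ 2 (volume : Measure (Config n)))
    (F : ∀ n, Lp ℂ 2 (volume : Measure (Config (n + 1)))) : WaveFunction :=
  singularRep c l g (fourierL2 (Ψ 0)) fun n => regConv c l (fourierL2 (F n))

theorem IsSingularSplitting.fourierL2_succ (hc : 0 < c) (hl : 0 < l)
    (h : IsSingularSplitting c l g Ψ F) (n : ℕ) :
    fourierL2 (Ψ (n + 1)) =ᵐ[volume] fun x => (√(n + 1 : ℝ) : ℂ)⁻¹ *
      (((-g * yukawa c l (x (Fin.last n)) : ℝ) : ℂ) * fourierL2 (Ψ n) (del (Fin.last n) x)) +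
      lastConv c l (fourierL2 (F n)) x := by
  have hh := isDispersion_symbol hc hl
  have hG := memLp_tensor (Fin.last n) hh.memLp (Lp.memLp (Ψ n))
  have hR : MemLp (fun x => (((symbol c l (x (Fin.last n)))⁻¹ : ℝ) : ℂ) * F n x) 2 := by
    refine ((Lp.memLp (Ψ (n + 1))).sub (hG.const_mul ((√(n + 1 : ℝ) : ℂ)⁻¹ * (-(g : ℂ))))).ae_eq ?_
    filter_upwards [h n] with x hx
    simp only [Pi.sub_apply, hx]
    push_cast
    ring
  have e : Ψ (n + 1) = ((√(n + 1 : ℝ) : ℂ)⁻¹ * (-(g : ℂ))) • hG.toLp + hR.toLp := by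
    refine Lp.ext ?_
    filter_upwards [h n, Lp.coeFn_add (((√(n + 1 : ℝ) : ℂ)⁻¹ * (-(g : ℂ))) • hG.toLp) hR.toLp,
      Lp.coeFn_smul ((√(n + 1 : ℝ) : ℂ)⁻¹ * (-(g : ℂ))) hG.toLp, hG.coeFn_toLp,
      hR.coeFn_toLp] with x h1 h2 h3 h4 h5
    rw [h1, h2, Pi.add_apply, h3, Pi.smul_apply, h4, h5, smul_eq_mul]
    push_cast
    ring
  have e' : fourierL2 (Ψ (n + 1)) = ((√(n + 1 : ℝ) : ℂ)⁻¹ * (-(g : ℂ))) • fourierL2 hG.toLp +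
      fourierL2 hR.toLp := by
    rw [e, map_add, map_smul]
  rw [e']
  filter_upwards [Lp.coeFn_add (((√(n + 1 : ℝ) : ℂ)⁻¹ * (-(g : ℂ))) • fourierL2 hG.toLp)
      (fourierL2 hR.toLp), Lp.coeFn_smul ((√(n + 1 : ℝ) : ℂ)⁻¹ * (-(g : ℂ))) (fourierL2 hG.toLp),
    fourierL2_tensor_inv_symbol hc hl (Ψ n) hG.toLp hG.coeFn_toLp,
    lastConv_fourierL2 hc hl (F n) hR.toLp hR.coeFn_toLp] with x h1 h2 h3 h4
  rw [h1, Pi.add_apply, h2, Pi.smul_apply, h3, h4, smul_eq_mul]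
  push_cast
  ring

/-- The transform of the splitting satisfies, almost everywhere, the recursion that defines
`singularRep`. -/
theorem IsSingularSplitting.positionRep_ae_eq (hc : 0 < c) (hl : 0 < l)
    (h : IsSingularSplitting c l g Ψ F) (n : ℕ) :
    positionRep c l g Ψ F n =ᵐ[volume] fourierL2 (Ψ n) := by
  induction n with
  | zero => rfl
  | succ n ih =>
    filter_upwards [h.fourierL2_succ hc hl n,
      (quasiMeasurePreserving_del (Fin.last n)).ae ih,
      regConv_ae_eq_lastConv (c := c) (l := l) (fourierL2 (F n))] with x h1 h2 h3
    rw [h1, ← h2, ← h3]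
    rfl

theorem dirichletIBC_positionRep {ħ m : ℝ} (hħ : 0 < ħ) (hm : 0 < m) (hl : 0 < l) :
    DirichletIBC ħ m g (positionRep (ħ ^ 2 / (2 * m)) l g Ψ F) :=
  dirichletIBC_singularRep hħ hm fun n y => norm_regConv_le (by positivity) hl _ y

/-- `r V(y, r ω)` has, for almost every `ω`, a derivative which tends to `V(y, 0)` as `r ↘ 0`. -/
def IsRadiallyRegular (V : ∀ n, Config n → Space → ℂ) : Prop :=
  ∀ n (y : Config n), ∀ᵐ ω : Metric.sphere (0 : Space) 1 ∂(volume : Measure Space).toSphere,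
    ∃ f' : ℝ → ℂ, (∀ r ∈ Set.Ioo (0 : ℝ) 1,
      HasDerivAt (fun r : ℝ => (r : ℂ) * V n y (r • (ω : Space))) (f' r) r) ∧
    Tendsto f' (𝓝[>] 0) (𝓝 (V n y 0))

theorem sphereTerm_singularRep_ae_eq {u₀ : Config 0 → ℂ} {V : ∀ n, Config n → Space → ℂ}
    (hV : IsRadiallyRegular V) {n : ℕ} {U T : Config n → ℂ}
    (hU : singularRep c l g u₀ V n =ᵐ[volume] U) (hT : ∀ᵐ y, V n y 0 = T y) :
    ∀ᵐ y : Config n, sphereTerm (singularRep c l g u₀ V) y =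
      ((4 * Real.pi : ℝ) : ℂ) * (((g * (4 * Real.pi * c)⁻¹ * √(l / c) : ℝ) : ℂ) *
        ((√(n + 1 : ℝ) : ℂ)⁻¹ * U y) + T y) := by
  filter_upwards [hU, hT] with y h1 h2
  rw [(sphereTerm_singularRep y (hV n y)).2.2, h1, h2]

theorem boundaryRegular_singularRep {u₀ : Config 0 → ℂ} {V : ∀ n, Config n → Space → ℂ}
    (hV : IsRadiallyRegular V) {U T : ∀ n, Config n → ℂ}
    (hU : ∀ n, singularRep c l g u₀ V n =ᵐ[volume] U n) (hT : ∀ n, ∀ᵐ y, V n y 0 = T n y)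
    (hU2 : ∀ n, MemLp (U n) 2) (hT2 : ∀ n, MemLp (T n) 2) :
    BoundaryRegular (singularRep c l g u₀ V) where
  hasLimit n := .of_forall fun y => (sphereTerm_singularRep y (hV n y)).1
  integrable n := .of_forall fun y => (sphereTerm_singularRep y (hV n y)).2.1
  locallyIntegrable n := by
    have h1 : MemLp (fun y => ((4 * Real.pi : ℝ) : ℂ) *
        (((g * (4 * Real.pi * c)⁻¹ * √(l / c) : ℝ) : ℂ) *
          ((√(n + 1 : ℝ) : ℂ)⁻¹ * U n y) + T n y)) 2 :=
      ((((hU2 n).const_mul _).const_mul _).add (hT2 n)).const_mul _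
    exact (h1.ae_eq ((sphereTerm_singularRep_ae_eq hV (hU n) (hT n)).mono
      fun y hy => hy.symm)).locallyIntegrable (by norm_num)

theorem isRadiallyRegular_regConv (hc : 0 < c) (hl : 0 < l) (F : ∀ n, Config (n + 1) → ℂ) :
    IsRadiallyRegular fun n => regConv c l (F n) :=
  fun n y => ae_hasDerivAt_regConv hc hl (F n) y

theorem IsSingularSplitting.sphereTerm_ae_eq (hc : 0 < c) (hl : 0 < l)
    (h : IsSingularSplitting c l g Ψ F) (n : ℕ) :
    ∀ᵐ y : Config n, sphereTerm (positionRep c l g Ψ F) y =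
      ((4 * Real.pi : ℝ) : ℂ) * (((g * (4 * Real.pi * c)⁻¹ * √(l / c) : ℝ) : ℂ) *
        ((√(n + 1 : ℝ) : ℂ)⁻¹ * fourierL2 (Ψ n) y) + lastTrace c l (fourierL2 (F n)) y) :=
  sphereTerm_singularRep_ae_eq (isRadiallyRegular_regConv hc hl fun n => fourierL2 (F n))
    (h.positionRep_ae_eq hc hl n) (regConv_zero_ae_eq (fourierL2 (F n)))

theorem IsSingularSplitting.boundaryRegular (hc : 0 < c) (hl : 0 < l)
    (h : IsSingularSplitting c l g Ψ F) : BoundaryRegular (positionRep c l g Ψ F) :=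
  boundaryRegular_singularRep (T := fun n => lastTrace c l (fourierL2 (F n)))
    (isRadiallyRegular_regConv hc hl fun n => fourierL2 (F n))
    (h.positionRep_ae_eq hc hl) (fun n => regConv_zero_ae_eq (fourierL2 (F n)))
    (fun _ => Lp.memLp _) fun _ => memLp_lastTrace hc hl (Lp.memLp _)

variable {n : ℕ} {η : Config n → ℂ}

theorem integral_symbol_mul_fourierC (W : Lp ℂ 2 (volume : Measure (Config n)))
    (hη : ContDiff ℝ (⊤ : ℕ∞) η) (hηc : HasCompactSupport η) (j : Fin n) :
    ∫ k, W k * ((symbol c l (k j) : ℂ) * fourierC η k) =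
      -(c : ℂ) * (∫ y, fourierL2 W y * particleLaplacian j η y) +
        (l : ℂ) * ∫ y, fourierL2 W y * η y := by
  have h1 := integrable_particleLaplacian hη hηc j
  have h2 := memLp_particleLaplacian hη hηc j
  have h3 := integrable_test hη hηc
  have h4 := memLp_test hη hηc 2
  rw [integral_fourierL2_mul W h1 h2, integral_fourierL2_mul W h3 h4, ← integral_const_mul,
    ← integral_const_mul, ← integral_add
      ((integrable_mul_of_memLp_two (Lp.memLp W) (memLp_fourierC h1 h2)).const_mul _)
      ((integrable_mul_of_memLp_two (Lp.memLp W) (memLp_fourierC h3 h4)).const_mul _)]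
  refine integral_congr_ae (.of_forall fun k => ?_)
  simp only [fourierC_particleLaplacian hη hηc, symbol]
  push_cast
  ring

theorem integral_createOp_one_mul_fourierC (Ψ : ∀ n, Lp ℂ 2 (volume : Measure (Config n)))
    (g : ℝ) (n : ℕ) {η : Config n → ℂ} (hη : ContDiff ℝ (⊤ : ℕ∞) η) (hηc : HasCompactSupport η) :
    Integrable (fun k => createOp (fun _ => 1) (fun n => Ψ n) n k * fourierC η k) ∧
    (g : ℂ) * ∫ k, createOp (fun _ => 1) (fun n => Ψ n) n k * fourierC η k =
      deltaTerm g (fun n => fourierL2 (Ψ n)) n η := by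
  cases n with
  | zero => simp [createOp_zero, deltaTerm]
  | succ n =>
    have h1 : ∀ k, createOp (fun _ => 1) (fun n => Ψ n) (n + 1) k * fourierC η k =
        (√(n + 1 : ℝ) : ℂ)⁻¹ * ∑ j, Ψ n (del j k) * fourierC η k := by
      intro k
      rw [createOp_succ, createFun, mul_assoc, Finset.sum_mul]
      simp only [one_mul]
    have h2 := fun j => integrable_del_mul_fourierC (Lp.memLp (Ψ n)) hη hηc j
    simp only [h1]
    refine ⟨(integrable_finsetSum _ fun j _ => h2 j).const_mul _, ?_⟩
    rw [integral_const_mul, integral_finsetSum _ fun j _ => h2 j, deltaTerm, ← mul_assoc]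
    simp only [integral_del_mul_fourierC (Ψ n) hη hηc]
    push_cast
    rw [div_eq_mul_inv]

/-- The Hamiltonian in the momentum representation is the one of the position representation. -/
theorem IsSingularSplitting.integral_eq_hamiltonianDistribution {ħ m E₀ : ℝ} (hħ : 0 < ħ)
    (hm : 0 < m) (hl : 0 < l) (h : IsSingularSplitting (ħ ^ 2 / (2 * m)) l g Ψ F)
    {β : Config n → ℂ}
    (hβ : ∀ᵐ k : Config n, ∫ p, (((symbol (ħ ^ 2 / (2 * m)) l p)⁻¹ : ℝ) : ℂ) *
      F n (ins (Fin.last n) p k) = (√(n + 1 : ℝ) : ℂ)⁻¹ * β k)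
    (Φ : Lp ℂ 2 (volume : Measure (Config n)))
    (hΦ : ∀ᵐ k, Φ k = (∑ j, (symbol (ħ ^ 2 / (2 * m)) E₀ (k j) : ℂ)) * Ψ n k +
      g * createOp (fun _ => 1) (fun n => Ψ n) n k +
      ((g * (g * (4 * Real.pi * (ħ ^ 2 / (2 * m)))⁻¹ * √(l / (ħ ^ 2 / (2 * m)))) : ℝ) : ℂ) * Ψ n k
      + g * β k) (hη : ContDiff ℝ (⊤ : ℕ∞) η) (hηc : HasCompactSupport η) :
    ∫ y, fourierL2 Φ y * η y = hamiltonianDistribution ħ m g E₀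
      (positionRep (ħ ^ 2 / (2 * m)) l g Ψ F) n η := by
  have hc : 0 < ħ ^ 2 / (2 * m) := by positivity
  rw [hamiltonianDistribution]
  set c := ħ ^ 2 / (2 * m)
  set s := (√(n + 1 : ℝ) : ℂ) with hs
  have hs0 : s ≠ 0 := sqrt_ne_zero_complex n
  set a := g * (4 * Real.pi * c)⁻¹ * √(l / c)
  have h1 := integrable_test hη hηc
  have h2 := memLp_test hη hηc 2
  have h3 := memLp_fourierC h1 h2
  have hu := fun n => h.positionRep_ae_eq hc hl n
  have e1 : ∀ ζ : Config n → ℂ, ∫ y, positionRep c l g Ψ F n y * ζ y =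
      ∫ y, fourierL2 (Ψ n) y * ζ y := fun ζ =>
    integral_congr_ae ((hu n).mono fun y hy => by simp only [hy])
  have e2 : deltaTerm g (positionRep c l g Ψ F) n η =
      deltaTerm g (fun n => fourierL2 (Ψ n)) n η := by
    cases n with
    | zero => rfl
    | succ n =>
      rw [deltaTerm, deltaTerm]
      congr 1
      refine Finset.sum_congr rfl fun j _ =>
        integral_congr_ae ((hu n).mono fun y hy => by simp only [hy])
  have ht := memLp_lastTrace hc hl (Lp.memLp (fourierL2 (F n)))
  have e3 : ∫ y, sphereTerm (positionRep c l g Ψ F) y * η y = ((4 * Real.pi : ℝ) : ℂ) *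
      ((a : ℂ) * (s⁻¹ * ∫ y, fourierL2 (Ψ n) y * η y) +
        ∫ y, lastTrace c l (fourierL2 (F n)) y * η y) := by
    rw [← integral_const_mul, ← integral_const_mul, ← integral_add
      (((integrable_mul_of_memLp_two (Lp.memLp _) h2).const_mul _).const_mul _)
      (integrable_mul_of_memLp_two ht h2), ← integral_const_mul]
    refine integral_congr_ae ((h.sphereTerm_ae_eq hc hl n).mono fun y hy => ?_)
    simp only [hy]
    ring
  have hβ' : ∀ᵐ k, β k = s * ∫ p, (((symbol c l p)⁻¹ : ℝ) : ℂ) * F n (ins (Fin.last n) p k) := by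
    filter_upwards [hβ] with k hk
    rw [hk, mul_inv_cancel_left₀ hs0]
  -- β is, up to √(n+1), the integral of F against 1/symbol, a kernel that preserves
  -- square-integrability.
  have hβ2 : MemLp β 2 := by
    have h4 := ((memLp_sliceInt (isDispersion_symbol hc hl).memLp
      (isDispersion_symbol hc hl).sliceKernel_inv.measurable
      (isDispersion_symbol hc hl).sliceKernel_inv.le (Lp.memLp (F n))).1).const_mul s
    refine h4.ae_eq (hβ'.mono fun k hk => ?_)
    simp only [hk, sliceInt, ins, Fin.insertNth_apply_same]
  have e4 : ∫ k, β k * fourierC η k = s * ∫ y, lastTrace c l (fourierL2 (F n)) y * η y := by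
    rw [integral_lastTrace_mul hc hl (F n) h1 h2, ← integral_const_mul]
    exact integral_congr_ae (hβ'.mono fun k hk => by simp only [hk, mul_assoc])
  have h5 := fun j => memLp_symbol_mul_fourierC (c := c) (l := E₀) hη hηc j
  obtain ⟨h6, e6⟩ := integral_createOp_one_mul_fourierC Ψ g n hη hηc
  have h7 : Integrable fun k => ∑ j, Ψ n k * ((symbol c E₀ (k j) : ℂ) * fourierC η k) :=
    integrable_finsetSum _ fun j _ => integrable_mul_of_memLp_two (Lp.memLp (Ψ n)) (h5 j)
  have h8 := (integrable_mul_of_memLp_two (Lp.memLp (Ψ n)) h3).const_mul ((g * a : ℝ) : ℂ)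
  have h9 := (integrable_mul_of_memLp_two hβ2 h3).const_mul (g : ℂ)
  have h10 := h6.const_mul (g : ℂ)
  have e7 : ∫ y, fourierL2 Φ y * η y =
      (∑ j, ∫ k, Ψ n k * ((symbol c E₀ (k j) : ℂ) * fourierC η k)) +
      g * (∫ k, createOp (fun _ => 1) (fun n => Ψ n) n k * fourierC η k) +
      ((g * a : ℝ) : ℂ) * (∫ k, Ψ n k * fourierC η k) + g * ∫ k, β k * fourierC η k := by
    rw [integral_fourierL2_mul Φ h1 h2, ← integral_finsetSum _ fun j _ =>
      integrable_mul_of_memLp_two (Lp.memLp (Ψ n)) (h5 j), ← integral_const_mul,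
      ← integral_const_mul, ← integral_const_mul, ← integral_add h7 h10,
      ← integral_add (h7.fun_add h10) h8, ← integral_add ((h7.fun_add h10).fun_add h8) h9]
    refine integral_congr_ae (hΦ.mono fun k hk => ?_)
    simp only [hk]
    rw [← Finset.mul_sum, ← Finset.sum_mul]
    ring
  rw [e7, e4, e6, e2, e3]
  simp only [e1, integral_symbol_mul_fourierC (Ψ n) hη hηc]
  -- The symbol carries E₀ as its constant term, so the sum over the particles produces the
  -- Laplacians together with n E₀.
  rw [Finset.sum_add_distrib, ← Finset.mul_sum, Finset.sum_const, Finset.card_univ, Fintype.card_fin,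
    nsmul_eq_mul, ← integral_fourierL2_mul (Ψ n) h1 h2]
  have hpi : ((Real.pi : ℝ) : ℂ) ≠ 0 := Complex.ofReal_ne_zero.mpr Real.pi_ne_zero
  push_cast
  rw [← hs]
  field_simp
  ring

end PositionSpace

/-! ### Independence of the representative. -/

section Uniqueness

/-- Differentiable functions are continuous, and continuous functions that agree almost everywhere
on an open interval agree everywhere on it. -/
theorem eventually_deriv_eq_of_ae_eq {f f' : ℝ → ℂ}
    (hf : ∀ᶠ r in 𝓝[>] (0 : ℝ), DifferentiableAt ℝ f r)
    (hf' : ∀ᶠ r in 𝓝[>] (0 : ℝ), DifferentiableAt ℝ f' r)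
    (h : ∀ᵐ r : ℝ, 0 < r → f r = f' r) : deriv f =ᶠ[𝓝[>] 0] deriv f' := by
  obtain ⟨ε, hε, hd⟩ := mem_nhdsGT_iff_exists_Ioo_subset.mp (hf.and hf')
  have h1 : f =ᵐ[volume.restrict (Set.Ioo 0 ε)] f' := by
    rw [EventuallyEq, ae_restrict_iff' measurableSet_Ioo]
    exact h.mono fun r hr hr' => hr hr'.1
  have h2 : Set.EqOn f f' (Set.Ioo 0 ε) := Measure.eqOn_open_of_ae_eq h1 isOpen_Ioo
    (fun r hr => (hd hr).1.continuousAt.continuousWithinAt)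
    (fun r hr => (hd hr).2.continuousAt.continuousWithinAt)
  filter_upwards [Ioo_mem_nhdsGT hε] with r hr
  exact (h2.eventuallyEq_of_mem (isOpen_Ioo.mem_nhds hr)).deriv_eq

variable {n : ℕ} {u u' : WaveFunction}

theorem radialLimit_congr {y : Config n} {ω : Space} (hu : HasRadialLimit u y ω)
    (hu' : HasRadialLimit u' y ω)
    (h : ∀ᵐ r : ℝ, 0 < r → u (n + 1) (addParticle y (r • ω)) = u' (n + 1) (addParticle y (r • ω))) :
    radialLimit u y ω = radialLimit u' y ω := by
  have h1 : deriv (radial u y ω) =ᶠ[𝓝[>] 0] deriv (radial u' y ω) := by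
    refine eventually_deriv_eq_of_ae_eq hu.1 hu'.1 (h.mono fun r hr h0 => ?_)
    rw [radial, radial, hr h0]
  rw [radialLimit, radialLimit, limUnder, limUnder, map_congr h1]

/-- By Fubini and polar coordinates, equality almost everywhere passes to almost every ray through
almost every y, and there the radial derivatives coincide. -/
theorem sphereTerm_congr (h : u (n + 1) =ᵐ[volume] u' (n + 1))
    (hu : BoundaryRegular u) (hu' : BoundaryRegular u') :
    ∀ᵐ y : Config n, sphereTerm u y = sphereTerm u' y := by
  filter_upwards [ae_ae_ins (Fin.last n) h, hu.hasLimit n, hu'.hasLimit n] with y h1 h2 h3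
  refine integral_congr_ae ?_
  filter_upwards [ae_ae_polar h1, h2, h3] with ω h4 h5 h6
  refine radialLimit_congr h5 h6 (h4.mono fun r hr h0 => ?_)
  rw [← ins_last]
  exact hr h0

theorem hamiltonianDistribution_congr (ħ m g E₀ : ℝ) (h : ∀ n, u n =ᵐ[volume] u' n)
    (hu : BoundaryRegular u) (hu' : BoundaryRegular u') (η : Config n → ℂ) :
    hamiltonianDistribution ħ m g E₀ u n η = hamiltonianDistribution ħ m g E₀ u' n η := by
  have h1 : ∀ {k : ℕ} (ζ : Config k → ℂ), ∫ y, u k y * ζ y = ∫ y, u' k y * ζ y := fun ζ =>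
    integral_congr_ae ((h _).mono fun y hy => by simp only [hy])
  have h2 : ∫ y, sphereTerm u y * η y = ∫ y, sphereTerm u' y * η y :=
    integral_congr_ae ((sphereTerm_congr (h (n + 1)) hu hu').mono fun y hy => by simp only [hy])
  rw [hamiltonianDistribution, hamiltonianDistribution, h2, h1]
  simp only [h1]
  congr 1
  cases n with
  | zero => rfl
  | succ n =>
    rw [deltaTerm, deltaTerm]
    simp only [h1]

theorem IsHamiltonianValue.satisfiesIBC {ħ m g E₀ : ℝ} {ψ Φ : Fock}
    (h : IsHamiltonianValue ħ m g E₀ ψ Φ) : SatisfiesIBC ħ m g ψ := by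
  obtain ⟨u, hu, hu', -⟩ := h
  exact ⟨u, hu, hu'⟩

theorem IsHamiltonianValue.unique {ħ m g E₀ : ℝ} {ψ Φ Φ' : Fock}
    (h : IsHamiltonianValue ħ m g E₀ ψ Φ) (h' : IsHamiltonianValue ħ m g E₀ ψ Φ') : Φ = Φ' := by
  obtain ⟨u, h1, -, h2, h3⟩ := h
  obtain ⟨u', h1', -, h2', h3'⟩ := h'
  refine lp.ext (funext fun n => Subtype.ext (Lp.ext ?_))
  refine ext_of_forall_test ((Lp.memLp _).locallyIntegrable (by norm_num))
    ((Lp.memLp _).locallyIntegrable (by norm_num)) fun η hη hηc => ?_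
  refine (h3 n η hη hηc).trans (Eq.trans ?_ (h3' n η hη hηc).symm)
  exact hamiltonianDistribution_congr ħ m g E₀ (fun n => (h1 n).trans (h1' n).symm) h2 h2' η

end Uniqueness

/-! ### Exponential vectors over the range of the resolvent have the required Hamiltonian value. -/

section Hamiltonian

variable {c l g μ : ℝ} {R : ∀ n, Sector n →L[ℂ] Sector n}
  {B : ∀ n, Sector (n + 1) →L[ℂ] Sector n} {C : ∀ n, Sector n →L[ℂ] Sector (n + 1)}

theorem symbol_add (c l μ : ℝ) (p : Space) :
    (symbol c l p : ℂ) + μ = (symbol c (l + μ) p : ℂ) := by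
  simp only [symbol]
  push_cast
  ring

theorem symbol_mul_form (hc : 0 < c) (hl : 0 < l) (g : ℝ) (p : Space) :
    (symbol c l p : ℂ) * ((-g * (symbol c l p)⁻¹ : ℝ) : ℂ) = -(g : ℂ) := by
  have h0 : (symbol c l p : ℂ) ≠ 0 :=
    Complex.ofReal_ne_zero.mpr ((isDispersion_symbol hc hl).pos p).ne'
  push_cast
  field_simp

theorem createExp_repr_hamiltonian (hc : 0 < c) (hl : 0 < l) {b a : ℂ} (hb : 1 + b = a)
    (hR : ∀ n ξ, (R n ξ).1 =ᵐ[volume] fun k => (((energy (symbol c l) k)⁻¹ : ℝ) : ℂ) * ξ.1 k)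
    (hB : ∀ n χ, (B n χ).1 =ᵐ[volume] fun k => (√(n + 1 : ℝ) : ℂ) *
      ∫ p, (((energy (symbol c l) (ins (Fin.last n) p k))⁻¹ : ℝ) : ℂ) *
        χ.1 (ins (Fin.last n) p k))
    (θ : ∀ n, Sector n) {Ξ D : ∀ n, Sector n}
    (hD : ∀ n, (D n).1 =ᵐ[volume] createOp (fun p => (((-g * (symbol c l p)⁻¹ : ℝ)) : ℂ))
      (resolved (symbol c l) θ) n)
    (hΞ : ∀ n, Ξ n = θ n + (g : ℂ) • B n (θ (n + 1)) + (μ : ℂ) • ((n : ℂ) • R n (θ n) + D n) +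
      b • R n (θ n)) {Ψ : WaveFunction}
    (hw : ∀ n, Ψ n =ᵐ[volume] createExp (fun p => (((-g * (symbol c l p)⁻¹ : ℝ)) : ℂ))
      (resolved (symbol c l) θ) n) (n : ℕ) :
    ∀ᵐ k, createExp (fun p => (((-g * (symbol c l p)⁻¹ : ℝ)) : ℂ)) (repr Ξ) n k =
      (∑ j, (symbol c (l + μ) (k j) : ℂ)) * Ψ n k + g * createOp (fun _ => 1) Ψ n k + a * Ψ n k +
      g * createExp (fun p => (((-g * (symbol c l p)⁻¹ : ℝ)) : ℂ))
        (marginal (resolvedSlices (symbol c l) θ)) n k := by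
  filter_upwards [createExp_congr (f := fun p => (((-g * (symbol c l p)⁻¹ : ℝ)) : ℂ))
    ((isDispersion_symbol hc hl).repr_hamiltonian θ hR hB hD (g : ℂ) (μ : ℂ) b hΞ) n,
    createOp_congr (f := fun _ => 1) hw n, hw n] with k e1 e2 e3
  rw [e1, createExp_hamiltonian (g : ℂ) (μ : ℂ) b (symbol_mul_form hc hl g), e2, ← e3, hb]
  simp only [symbol_add]

theorem exists_isSingularSplitting (hc : 0 < c) (hl : 0 < l) (θ : ∀ n, Sector n)
    {Ψ : ∀ n, Lp ℂ 2 (volume : Measure (Config n))}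
    (hw : ∀ n, Ψ n =ᵐ[volume] createExp (fun p => (((-g * (symbol c l p)⁻¹ : ℝ)) : ℂ))
      (resolved (symbol c l) θ) n) :
    ∃ F : ∀ n, Lp ℂ 2 (volume : Measure (Config (n + 1))), IsSingularSplitting c l g Ψ F ∧
      ∀ n, ∀ᵐ k : Config n, ∫ p, (((symbol c l p)⁻¹ : ℝ) : ℂ) * F n (ins (Fin.last n) p k) =
        (√(n + 1 : ℝ) : ℂ)⁻¹ * createExp (fun p => (((-g * (symbol c l p)⁻¹ : ℝ)) : ℂ))
          (marginal (resolvedSlices (symbol c l) θ)) n k := by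
  have hh := isDispersion_symbol hc hl
  choose F hF1 hF2 using fun n => hh.exists_remainder θ (hh.memLp_form g) n
  refine ⟨F, fun n => ?_, hF2⟩
  filter_upwards [hw (n + 1), (quasiMeasurePreserving_del (Fin.last n)).ae (hw n), hF1 n]
    with x h1 h2 h3
  rw [h1, h2, h3]

/-- Exponential vectors over the range of the resolvent lie in the domain of the Hamiltonian. -/
theorem isHamiltonianValue_of_createExp {ħ m : ℝ} {b : ℂ} (hħ : 0 < ħ) (hm : 0 < m) (hl : 0 < l)
    (hR : ∀ n ξ, (R n ξ).1 =ᵐ[volume] fun k =>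
      (((energy (symbol (ħ ^ 2 / (2 * m)) l) k)⁻¹ : ℝ) : ℂ) * ξ.1 k)
    (hB : ∀ n χ, (B n χ).1 =ᵐ[volume] fun k => (√(n + 1 : ℝ) : ℂ) *
      ∫ p, (((energy (symbol (ħ ^ 2 / (2 * m)) l) (ins (Fin.last n) p k))⁻¹ : ℝ) : ℂ) *
        χ.1 (ins (Fin.last n) p k))
    (hb : 1 + b = ((g * (g * (4 * Real.pi * (ħ ^ 2 / (2 * m)))⁻¹ *
      √(l / (ħ ^ 2 / (2 * m)))) : ℝ) : ℂ))
    (θ : ∀ n, Sector n) {Ξ D : ∀ n, Sector n}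
    (hD : ∀ n, (D n).1 =ᵐ[volume]
      createOp (fun p => (((-g * (symbol (ħ ^ 2 / (2 * m)) l p)⁻¹ : ℝ)) : ℂ))
        (resolved (symbol (ħ ^ 2 / (2 * m)) l) θ) n)
    (hΞ : ∀ n, Ξ n = θ n + (g : ℂ) • B n (θ (n + 1)) + (μ : ℂ) • ((n : ℂ) • R n (θ n) + D n) +
      b • R n (θ n)) {ψ Φ : Fock}
    (hψ : ∀ n, (ψ n).1 =ᵐ[volume]
      createExp (fun p => (((-g * (symbol (ħ ^ 2 / (2 * m)) l p)⁻¹ : ℝ)) : ℂ))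
        (resolved (symbol (ħ ^ 2 / (2 * m)) l) θ) n)
    (hΦ : ∀ n, (Φ n).1 =ᵐ[volume]
      createExp (fun p => (((-g * (symbol (ħ ^ 2 / (2 * m)) l p)⁻¹ : ℝ)) : ℂ)) (repr Ξ) n) :
    IsHamiltonianValue ħ m g (l + μ) (fourierFock ψ) (fourierFock Φ) := by
  have hc : 0 < ħ ^ 2 / (2 * m) := by positivity
  obtain ⟨F, hF1, hF2⟩ := exists_isSingularSplitting (Ψ := fun n => (ψ n).1) hc hl θ hψ
  refine ⟨positionRep (ħ ^ 2 / (2 * m)) l g (fun n => (ψ n).1) F,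
    fun n => hF1.positionRep_ae_eq hc hl n,
    dirichletIBC_positionRep hħ hm hl, hF1.boundaryRegular hc hl, fun n η hη hηc => ?_⟩
  refine hF1.integral_eq_hamiltonianDistribution hħ hm hl (hF2 n) (Φ n).1 ?_ hη hηc
  filter_upwards [hΦ n, createExp_repr_hamiltonian hc hl hb hR hB θ hD hΞ hψ n] with k e1 e2
  rw [e1, e2]

end Hamiltonian

/-! ### The Weyl operator carries the van Hove domain to such exponential vectors. -/

section Dressing

section Abstract

variable {E : ℕ → Type*} [∀ n, NormedAddCommGroup (E n)] [∀ n, InnerProductSpace ℂ (E n)]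
  [∀ n, CompleteSpace (E n)] {A B : ∀ n, E (n + 1) →L[ℂ] E n} {R : ∀ n, E n →L[ℂ] E n} {γ : ℝ}

theorem IsCCR.weylEquiv_eq_raisingExp_smul (hA : IsCCR A γ) {χ : lp E 2} {ξ : ∀ n, E n}
    (h : loweringExp (fun n => -A n) χ = ξ) (n : ℕ) :
    hA.weylEquiv χ n = raisingExp (adj A) (((Real.exp (-γ ^ 2 / 2) : ℝ) : ℂ) • ξ) n := by
  rw [hA.coe_weylEquiv, h, map_smul]

/-- By linearity the normalization e^{-γ²/2} of the Weyl operator can be absorbed into θ. -/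
theorem smul_hamiltonian (B : ∀ n, E (n + 1) →L[ℂ] E n) (R : ∀ n, E n →L[ℂ] E n)
    (C : ∀ n, E n →L[ℂ] E (n + 1)) (g μ b e : ℂ) (θ : ∀ n, E n) (n : ℕ) :
    (e • (θ + g • lowering B θ + μ • (number (diagonal R θ) + raising C (diagonal R θ)) +
      b • diagonal R θ)) n = (e • θ) n + g • B n ((e • θ) (n + 1)) +
      μ • ((n : ℂ) • R n ((e • θ) n) + raising C (diagonal R (e • θ)) n) +
      b • R n ((e • θ) n) := by
  have h : ∀ x : ∀ n, E n, diagonal R x n = R n (x n) := fun _ => rfl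
  have hn : ∀ x : ∀ n, E n, number x n = (n : ℂ) • x n := fun _ => rfl
  simp only [map_smul, Pi.smul_apply, Pi.add_apply, smul_add, lowering_apply, h, hn]
  simp only [smul_comm e]

theorem IsCCR.exists_raisingExp_vanHove {β g μ d : ℝ} (hA : IsCCR A γ)
    (hB : ∀ n : ℕ, ‖B n‖ ≤ β * √(n + 1))
    (hAR : lowering A * diagonal R = diagonal R * (lowering A + (g : ℂ) • lowering B))
    (hAB : lowering A * lowering B = lowering B * (lowering A + (g : ℂ) • lowering B))
    {χ Θ : lp E 2} (h : (χ, Θ) ∈ vanHove A R μ d) :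
    ∃ θ Ξ : ∀ n, E n, (∀ n, hA.weylEquiv χ n = raisingExp (adj A) (diagonal R θ) n) ∧
      (∀ n, hA.weylEquiv Θ n = raisingExp (adj A) Ξ n) ∧
      ∀ n, Ξ n = θ n + (g : ℂ) • B n (θ (n + 1)) +
        (μ : ℂ) • ((n : ℂ) • R n (θ n) + raising (adj A) (diagonal R θ) n) +
        ((d - μ * γ ^ 2 : ℝ) : ℂ) • R n (θ n) := by
  obtain ⟨θ, h1, h2⟩ := exists_isExp_vanHove hA hB hAR hAB h
  refine ⟨_, _, fun n => ?_, hA.weylEquiv_eq_raisingExp_smul h2, smul_hamiltonian B R _ g μ _ _ θ⟩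
  rw [hA.weylEquiv_eq_raisingExp_smul h1, map_smul (diagonal R)]

end Abstract

variable {l g μ d γ : ℝ} {R : ∀ n, Sector n →L[ℂ] Sector n}
  {B : ∀ n, Sector (n + 1) →L[ℂ] Sector n} {C : ∀ n, Sector n →L[ℂ] Sector (n + 1)}

theorem ae_eq_of_eq {n : ℕ} {φ φ' : Sector n} {v : Config n → ℂ} (h : φ = φ')
    (h' : φ'.1 =ᵐ[volume] v) : φ.1 =ᵐ[volume] v := by
  subst h
  exact h'

theorem isHamiltonianValue_of_raisingExp {ħ m : ℝ} (hħ : 0 < ħ) (hm : 0 < m) (hl : 0 < l)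
    (hC : ∀ n ξ, (C n ξ).1 =ᵐ[volume]
      createFun (fun p => (((-g * (symbol (ħ ^ 2 / (2 * m)) l p)⁻¹ : ℝ)) : ℂ)) ξ.1)
    (hR : ∀ n ξ, (R n ξ).1 =ᵐ[volume] fun k =>
      (((energy (symbol (ħ ^ 2 / (2 * m)) l) k)⁻¹ : ℝ) : ℂ) * ξ.1 k)
    (hB : ∀ n χ, (B n χ).1 =ᵐ[volume] fun k => (√(n + 1 : ℝ) : ℂ) *
      ∫ p, (((energy (symbol (ħ ^ 2 / (2 * m)) l) (ins (Fin.last n) p k))⁻¹ : ℝ) : ℂ) *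
        χ.1 (ins (Fin.last n) p k))
    (hd : 1 + (d - μ * γ ^ 2) = g * (g * (4 * Real.pi * (ħ ^ 2 / (2 * m)))⁻¹ *
      √(l / (ħ ^ 2 / (2 * m))))) {θ Ξ : ∀ n, Sector n} {ψ Φ : Fock}
    (h1 : ∀ n, ψ n =
      raisingExp (E := fun n => Sector n) C (diagonal (E := fun n => Sector n) R θ) n)
    (h2 : ∀ n, Φ n = raisingExp (E := fun n => Sector n) C Ξ n)
    (h3 : ∀ n, Ξ n = θ n + (g : ℂ) • B n (θ (n + 1)) + (μ : ℂ) • ((n : ℂ) • R n (θ n) +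
      raising (E := fun n => Sector n) C (diagonal (E := fun n => Sector n) R θ) n) +
      ((d - μ * γ ^ 2 : ℝ) : ℂ) • R n (θ n)) :
    IsHamiltonianValue ħ m g (l + μ) (fourierFock ψ) (fourierFock Φ) := by
  have hψ := fun n => ae_eq_of_eq (h1 n) (createExp_resolved θ hC hR n)
  have hΦ := fun n => ae_eq_of_eq (h2 n) (repr_raisingExp hC Ξ n)
  have hD := coeFn_raising_resolved θ hC hR
  exact isHamiltonianValue_of_createExp
    (D := raising (E := fun n => Sector n) C (diagonal (E := fun n => Sector n) R θ))
    hħ hm hl hR hB (by rw [← hd]; push_cast; rfl) θ hD h3 hψ hΦ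

/-- The Weyl operator maps the domain of the van Hove operator into the domain of the
Hamiltonian with the interior-boundary condition. -/
theorem IsCCR.isHamiltonianValue {ħ m β : ℝ} (hħ : 0 < ħ) (hm : 0 < m) (hl : 0 < l)
    {A : ∀ n, Sector (n + 1) →L[ℂ] Sector n} (hA : IsCCR (E := fun n => Sector n) A γ)
    (hC : ∀ n ξ, (adj (E := fun n => Sector n) A n ξ).1 =ᵐ[volume]
      createFun (fun p => (((-g * (symbol (ħ ^ 2 / (2 * m)) l p)⁻¹ : ℝ)) : ℂ)) ξ.1)
    (hR : ∀ n ξ, (R n ξ).1 =ᵐ[volume] fun k =>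
      (((energy (symbol (ħ ^ 2 / (2 * m)) l) k)⁻¹ : ℝ) : ℂ) * ξ.1 k)
    (hB : ∀ n χ, (B n χ).1 =ᵐ[volume] fun k => (√(n + 1 : ℝ) : ℂ) *
      ∫ p, (((energy (symbol (ħ ^ 2 / (2 * m)) l) (ins (Fin.last n) p k))⁻¹ : ℝ) : ℂ) *
        χ.1 (ins (Fin.last n) p k))
    (hBn : ∀ n : ℕ, ‖B n‖ ≤ β * √(n + 1))
    (hAR : lowering (E := fun n => Sector n) A * diagonal R =
      diagonal R * (lowering (E := fun n => Sector n) A + (g : ℂ) • lowering B))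
    (hAB : lowering (E := fun n => Sector n) A * lowering B =
      lowering B * (lowering (E := fun n => Sector n) A + (g : ℂ) • lowering B))
    (hd : 1 + (d - μ * γ ^ 2) = g * (g * (4 * Real.pi * (ħ ^ 2 / (2 * m)))⁻¹ *
      √(l / (ħ ^ 2 / (2 * m))))) {χ Θ : Fock}
    (h : (χ, Θ) ∈ vanHove (E := fun n => Sector n) A R μ d) :
    IsHamiltonianValue ħ m g (l + μ) (fourierFock (hA.weylEquiv χ))
      (fourierFock (hA.weylEquiv Θ)) := by
  have t := @IsCCR.exists_raisingExp_vanHove (fun n => Sector n) _ _ _ A B R γ β g μ d hA hBn hAR hAB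
    χ Θ h
  obtain ⟨θ, Ξ, h1, h2, h3⟩ := t
  exact isHamiltonianValue_of_raisingExp hħ hm hl hC hR hB hd h1 h2 h3

end Dressing

/-! ### Self-adjointness, density and positivity for the transported graph. -/

section SelfAdjoint

variable {K : Type*} [NormedAddCommGroup K] [InnerProductSpace ℂ K] [CompleteSpace K]

/-- An operator whose graph is contained in, and contains, the adjoint relation is self-adjoint. -/
theorem isSelfAdjoint_toLinearPMap {G : Submodule ℂ (K × K)}
    (hG : ∀ x ∈ G, x.1 = 0 → x.2 = 0) (hd : Dense (G.toLinearPMap.domain : Set K))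
    (hs : ∀ x ∈ G, ∀ y ∈ G, inner ℂ x.2 y.1 = inner ℂ x.1 y.2)
    (ha : ∀ y : K × K, (∀ x ∈ G, inner ℂ x.2 y.1 = inner ℂ x.1 y.2) → y ∈ G) :
    IsSelfAdjoint G.toLinearPMap := by
  rw [LinearPMap.isSelfAdjoint_def]
  refine LinearPMap.eq_of_eq_graph ?_
  rw [LinearPMap.adjoint_graph_eq_graph_adjoint hd, Submodule.toLinearPMap_graph_eq _ hG]
  ext y
  rw [Submodule.mem_adjoint_iff]
  constructor
  · intro h
    exact ha y fun x hx => sub_eq_zero.mp (h x.1 x.2 hx)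
  · intro h a b hab
    exact sub_eq_zero.mpr (hs (a, b) hab y h)

variable {E : ℕ → Type*} [∀ n, NormedAddCommGroup (E n)] [∀ n, InnerProductSpace ℂ (E n)]
  [∀ n, CompleteSpace (E n)] {A : ∀ n, E (n + 1) →L[ℂ] E n} {R : ∀ n, E n →L[ℂ] E n}
  {μ d γ : ℝ}

/-- Without coupling the levels decouple, and the bound on R says R⁻¹ ≥ 1, so R⁻¹ + d ≥ 1 + d on
each level. -/
theorem vanHove_nonneg (hR : ∀ n x, ‖R n x‖ ^ 2 ≤ (inner ℂ (R n x) x).re) (hd : 0 ≤ 1 + d)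
    {χ Θ : lp E 2} (h : (χ, Θ) ∈ vanHove A R 0 d) : 0 ≤ (inner ℂ χ Θ).re := by
  obtain ⟨ξ, h1, h2⟩ := mem_vanHove.mp h
  refine (Complex.hasSum_re (lp.hasSum_inner χ Θ)).nonneg fun n => ?_
  have e1 : χ n = R n (ξ n) := congrFun h1 n
  have e2 : Θ n = ξ n + (d : ℂ) • χ n := by
    rw [h2, Pi.add_apply, coupling_apply, Complex.ofReal_zero, zero_smul, zero_add]
  rw [e2, inner_add_right, inner_smul_right, e1, inner_self_eq_norm_sq_to_K, Complex.add_re,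
    Complex.re_ofReal_mul]
  have e3 : (((‖R n (ξ n)‖ : ℝ) : ℂ) ^ 2).re = ‖R n (ξ n)‖ ^ 2 := by
    rw [← Complex.ofReal_pow, Complex.ofReal_re]
  have e4 := hR n (ξ n)
  erw [e3]
  nlinarith [sq_nonneg ‖R n (ξ n)‖]

variable (A R μ d)

/-- The image of the van Hove graph under a unitary map. -/
def dressedGraph (U : lp E 2 ≃ₗᵢ[ℂ] lp E 2) : Submodule ℂ (lp E 2 × lp E 2) :=
  (vanHove A R μ d).comap
    ((U.symm.toLinearEquiv : lp E 2 →ₗ[ℂ] lp E 2).prodMap (U.symm.toLinearEquiv : lp E 2 →ₗ[ℂ] lp E 2))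

variable {A R μ d} {U : lp E 2 ≃ₗᵢ[ℂ] lp E 2}

theorem mem_dressedGraph {x : lp E 2 × lp E 2} : x ∈ dressedGraph A R μ d U ↔
    (U.symm x.1, U.symm x.2) ∈ vanHove A R μ d := Iff.rfl

theorem mem_dressedGraph_map {χ Θ : lp E 2} (h : (χ, Θ) ∈ vanHove A R μ d) :
    (U χ, U Θ) ∈ dressedGraph A R μ d U := by
  rw [mem_dressedGraph, U.symm_apply_apply, U.symm_apply_apply]
  exact h

theorem dressedGraph_unique (hR : ∀ n, Function.Injective (R n)) :
    ∀ x ∈ dressedGraph A R μ d U, x.1 = 0 → x.2 = 0 := by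
  intro x hx h0
  rw [mem_dressedGraph, h0, map_zero] at hx
  have h1 := vanHove_unique hR hx (vanHove A R μ d).zero_mem
  exact (map_eq_zero_iff _ U.symm.injective).mp h1

/-- A vector orthogonal to the domain is pulled back by U to one orthogonal to the van Hove domain,
where a symmetric injective R leaves only 0. -/
theorem dense_dressedGraph (hR : ∀ n x y, inner ℂ (R n x) y = inner ℂ x (R n y))
    (hinj : ∀ n, Function.Injective (R n)) :
    Dense ((dressedGraph A R μ d U).toLinearPMap.domain : Set (lp E 2)) := by
  rw [Submodule.dense_iff_topologicalClosure_eq_top, Submodule.topologicalClosure_eq_top_iff,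
    Submodule.eq_bot_iff]
  intro z hz
  rw [Submodule.mem_orthogonal] at hz
  have h1 : U.symm z = 0 := by
    refine vanHove_dense (A := A) (μ := μ) (c := d) hR hinj fun χ Θ h => ?_
    rw [← U.inner_map_map, U.apply_symm_apply]
    exact hz _ ⟨_, mem_dressedGraph_map h, rfl⟩
  exact (map_eq_zero_iff _ U.symm.injective).mp h1

theorem isSelfAdjoint_dressedGraph (hA : ∀ n : ℕ, ‖A n‖ ≤ γ * √(n + 1))
    (hR : ∀ n x y, inner ℂ (R n x) y = inner ℂ x (R n y))
    (hinj : ∀ n, Function.Injective (R n)) :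
    IsSelfAdjoint (dressedGraph A R μ d U).toLinearPMap := by
  refine isSelfAdjoint_toLinearPMap (dressedGraph_unique hinj) (dense_dressedGraph hR hinj)
    (fun x hx y hy => ?_) fun y hy => ?_
  · have h := vanHove_symmetric hA hR (mem_dressedGraph.mp hx) (mem_dressedGraph.mp hy)
    rwa [U.symm.inner_map_map, U.symm.inner_map_map] at h
  · refine mem_dressedGraph.mpr (vanHove_adjoint_le hR fun χ Θ h => ?_)
    have h1 := hy _ (mem_dressedGraph_map h)
    simp only at h1
    rwa [← U.inner_map_map, ← U.inner_map_map χ, U.apply_symm_apply, U.apply_symm_apply]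

end SelfAdjoint

section Resolvent

variable {n : ℕ} {h : Space → ℝ}

theorem IsDispersion.norm_resolvent_sq_le (hh : IsDispersion h) (φ : Sector n) :
    ‖hh.resolvent φ‖ ^ 2 ≤ (inner ℂ (hh.resolvent φ) φ).re := by
  rw [norm_sector_sq, inner_sector]
  have h1 : MemLp (hh.resolvent φ).1 2 := Lp.memLp _
  have h2 : MemLp φ.1 2 := Lp.memLp _
  have h6 : Integrable fun k => (starRingEnd ℂ) ((hh.resolvent φ).1 k) * φ.1 k :=
    integrable_mul_of_memLp_two h1.star h2
  rw [← RCLike.re_eq_complex_re, ← integral_re h6]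
  refine integral_mono_ae ((memLp_two_iff_integrable h1.1).mp h1) h6.re ?_
  filter_upwards [hh.coeFn_resolvent φ] with k hk
  have h3 := hh.one_le_energy k
  have h4 : 0 < (energy h k)⁻¹ := inv_pos.mpr (hh.energy_pos k)
  have h5 : (energy h k)⁻¹ ≤ 1 := inv_le_one_of_one_le₀ h3
  rw [hk, map_mul (starRingEnd ℂ), Complex.conj_ofReal, mul_assoc, Complex.conj_mul', norm_mul, Complex.norm_real,
    Real.norm_of_nonneg h4.le, RCLike.re_eq_complex_re, Complex.re_ofReal_mul, ← Complex.ofReal_pow,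
    Complex.ofReal_re]
  nlinarith [mul_nonneg (mul_nonneg h4.le (sub_nonneg.mpr h5)) (sq_nonneg ‖φ.1 k‖)]

end Resolvent

section Abstract

variable {E : ℕ → Type*} [∀ n, NormedAddCommGroup (E n)] [∀ n, InnerProductSpace ℂ (E n)]
  [∀ n, CompleteSpace (E n)] {A : ∀ n, E (n + 1) →L[ℂ] E n} {R : ∀ n, E n →L[ℂ] E n}

theorem exists_dressed_operator (U : lp E 2 ≃ₗᵢ[ℂ] lp E 2) {γ : ℝ} (μ d : ℝ)
    (hA : ∀ n : ℕ, ‖A n‖ ≤ γ * √(n + 1))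
    (hRs : ∀ n x y, inner ℂ (R n x) y = inner ℂ x (R n y))
    (hRi : ∀ n, Function.Injective (R n))
    (hRn : ∀ n x, ‖R n x‖ ^ 2 ≤ (inner ℂ (R n x) x).re) :
    ∃ (D : Submodule ℂ (lp E 2)) (H : D →ₗ[ℂ] lp E 2), Dense (D : Set (lp E 2)) ∧
      (∀ ψ : D, ∃ χ Θ : lp E 2, (χ, Θ) ∈ vanHove A R μ d ∧ (ψ : lp E 2) = U χ ∧ H ψ = U Θ) ∧
      IsSelfAdjoint (LinearPMap.mk D H) ∧
      (μ = 0 → 0 ≤ 1 + d → ∀ ψ : D, 0 ≤ (inner ℂ (ψ : lp E 2) (H ψ)).re) := by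
  set G := dressedGraph A R μ d U with hG
  have hmem : ∀ ψ : G.toLinearPMap.domain, (U.symm ψ, U.symm (G.toLinearPMap.toFun ψ)) ∈
      vanHove A R μ d := fun ψ =>
    Submodule.mem_graph_toLinearPMap (dressedGraph_unique hRi) ψ
  refine ⟨G.toLinearPMap.domain, G.toLinearPMap.toFun, dense_dressedGraph hRs hRi,
    fun ψ => ⟨_, _, hmem ψ, (U.apply_symm_apply _).symm, (U.apply_symm_apply _).symm⟩,
    isSelfAdjoint_dressedGraph hA hRs hRi, fun hμ hd ψ => ?_⟩
  have h1 := hmem ψ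
  subst hμ
  have h2 := vanHove_nonneg hRn hd h1
  rwa [U.symm.inner_map_map] at h2

end Abstract

/-! ### Choice of the constants and assembly. -/

section Main

variable {ħ m l g γ β : ℝ} {R : ∀ n, Sector n →L[ℂ] Sector n}
  {A B : ∀ n, Sector (n + 1) →L[ℂ] Sector n}

set_option maxHeartbeats 1000000 in
/-- The properties of the Hamiltonian obtained from a dressing transformation. -/
theorem IsCCR.exists_hamiltonian (μ : ℝ) (hħ : 0 < ħ) (hm : 0 < m) (hl : 0 < l)
    (hA : IsCCR (E := fun n => Sector n) A γ)
    (hC : ∀ n ξ, (adj (E := fun n => Sector n) A n ξ).1 =ᵐ[volume]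
      createFun (fun p => (((-g * (symbol (ħ ^ 2 / (2 * m)) l p)⁻¹ : ℝ)) : ℂ)) ξ.1)
    (hR : ∀ n ξ, (R n ξ).1 =ᵐ[volume] fun k =>
      (((energy (symbol (ħ ^ 2 / (2 * m)) l) k)⁻¹ : ℝ) : ℂ) * ξ.1 k)
    (hB : ∀ n χ, (B n χ).1 =ᵐ[volume] fun k => (√(n + 1 : ℝ) : ℂ) *
      ∫ p, (((energy (symbol (ħ ^ 2 / (2 * m)) l) (ins (Fin.last n) p k))⁻¹ : ℝ) : ℂ) *
        χ.1 (ins (Fin.last n) p k))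
    (hBn : ∀ n : ℕ, ‖B n‖ ≤ β * √(n + 1))
    (hAR : lowering (E := fun n => Sector n) A * diagonal R =
      diagonal R * (lowering (E := fun n => Sector n) A + (g : ℂ) • lowering B))
    (hAB : lowering (E := fun n => Sector n) A * lowering B =
      lowering B * (lowering (E := fun n => Sector n) A + (g : ℂ) • lowering B))
    (hRs : ∀ n x y, inner ℂ (R n x) y = inner ℂ x (R n y))
    (hRi : ∀ n, Function.Injective (R n))
    (hRn : ∀ n x, ‖R n x‖ ^ 2 ≤ (inner ℂ (R n x) x).re) :
    ∃ (D : Submodule ℂ Fock) (H : D →ₗ[ℂ] Fock), Dense (D : Set Fock) ∧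
      (∀ ψ : D, IsHamiltonianValue ħ m g (l + μ) (ψ : Fock) (H ψ)) ∧
      IsSelfAdjoint (LinearPMap.mk D H) ∧
      (μ = 0 → ∀ ψ : D, 0 ≤ (inner ℂ (ψ : Fock) (H ψ)).re) := by
  obtain ⟨e, he⟩ : ∃ e : ℝ, e = g * (g * (4 * Real.pi * (ħ ^ 2 / (2 * m)))⁻¹ *
      √(l / (ħ ^ 2 / (2 * m)))) := ⟨_, rfl⟩
  have he0 : 0 ≤ e := by
    rw [he, ← mul_assoc, ← mul_assoc]
    have := mul_self_nonneg g
    positivity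
  -- The -1 removes the 1 in Λ = 1 + dΓ(h), and μγ² completes μ(N + a + a*) to the Weyl conjugate of
  -- μN. What remains is the surface contribution e ≥ 0 of the singular part.
  obtain ⟨d, hd⟩ : ∃ d : ℝ, d = e - 1 + μ * γ ^ 2 := ⟨_, rfl⟩
  have hd1 : 1 + (d - μ * γ ^ 2) = g * (g * (4 * Real.pi * (ħ ^ 2 / (2 * m)))⁻¹ *
      √(l / (ħ ^ 2 / (2 * m)))) := by
    rw [← he, hd]
    ring
  have h := @exists_dressed_operator (fun n => Sector n) _ _ _ A R
    (LinearIsometryEquiv.trans (IsCCR.weylEquiv hA) fourierFock) γ μ d (IsCCR.norm_le hA) hRs hRi hRn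
  obtain ⟨D, H, h1, h2, h3, h4⟩ := h
  refine ⟨D, H, h1, fun ψ => ?_, h3, fun hμ => h4 hμ ?_⟩
  · obtain ⟨χ, Θ, h5, h6, h7⟩ := h2 ψ
    have h8 := IsCCR.isHamiltonianValue hħ hm hl hA hC hR hB hBn hAR hAB hd1 h5
    have e1 : (ψ : Fock) = fourierFock (IsCCR.weylEquiv hA χ) := h6
    have e2 : H ψ = fourierFock (IsCCR.weylEquiv hA Θ) := h7
    rw [e1, e2]
    exact h8
  · rw [hd, hμ]
    linarith

end Main

theorem exists_hamiltonian {ħ m l E₀ μ : ℝ} (g : ℝ) (hħ : 0 < ħ) (hm : 0 < m) (hl : 0 < l)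
    (hE : l + μ = E₀) :
    ∃ (D : Submodule ℂ Fock) (H : D →ₗ[ℂ] Fock), Dense (D : Set Fock) ∧
      (∀ ψ : D, IsHamiltonianValue ħ m g E₀ (ψ : Fock) (H ψ)) ∧
      IsSelfAdjoint (LinearPMap.mk D H) ∧
      (μ = 0 → ∀ ψ : D, 0 ≤ (inner ℂ (ψ : Fock) (H ψ)).re) := by
  have hc : 0 < ħ ^ 2 / (2 * m) := by positivity
  subst hE
  have hh := isDispersion_symbol hc hl
  exact IsCCR.exists_hamiltonian (A := hh.ann g) (B := hh.traceOp) (R := fun _ => hh.resolvent)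
    μ hħ hm hl (hh.isCCR g) (fun n ξ => hh.coeFn_adj_ann g ξ) (fun n ξ => hh.coeFn_resolvent ξ)
    (fun n χ => hh.coeFn_traceOp χ) hh.norm_traceOp_le (hh.lowering_ann_diagonal g)
    (hh.lowering_ann_traceOp g) (fun n => hh.resolvent_symmetric)
    (fun n => hh.resolvent_injective) fun n => hh.norm_resolvent_sq_le

end IBC

end

theorem theorem1 (ħ m g E₀ : ℝ) (hħ : 0 < ħ) (hm : 0 < m) :
    ∃ (D : Submodule ℂ IBC.Fock) (H : D →ₗ[ℂ] IBC.Fock),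
      Dense (D : Set IBC.Fock) ∧
      (∀ ψ ∈ D, IBC.SatisfiesIBC ħ m g ψ) ∧
      (∀ (ψ : D) (Φ : IBC.Fock), IBC.IsHamiltonianValue ħ m g E₀ (ψ : IBC.Fock) Φ ↔ Φ = H ψ) ∧
      IsSelfAdjoint (LinearPMap.mk D H) ∧
      (0 < E₀ → ∀ ψ : D, 0 ≤ (inner ℂ (ψ : IBC.Fock) (H ψ)).re) := by
  -- The Yukawa mass term l must be positive. If E₀ is positive, l = E₀ leaves no coupling μ = E₀ -
  -- l, which is what positivity needs; otherwise any positive l would serve.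
  obtain ⟨l, hl, hlE⟩ : ∃ l : ℝ, 0 < l ∧ (0 < E₀ → E₀ - l = 0) := by
    by_cases h : 0 < E₀
    · exact ⟨E₀, h, fun _ => sub_self E₀⟩
    · exact ⟨1, one_pos, fun h' => absurd h' h⟩
  obtain ⟨D, H, h1, h2, h3, h4⟩ := IBC.exists_hamiltonian g hħ hm hl (add_sub_cancel l E₀)
  refine ⟨D, H, h1, fun ψ hψ => (h2 ⟨ψ, hψ⟩).satisfiesIBC, fun ψ Φ => ⟨fun h => h.unique (h2 ψ), ?_⟩,
    h3, fun hE => h4 (hlE hE)⟩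
  rintro rfl
  exact h2 ψ
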